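/- Let $k$ be a product of finitely many (at least one) fields. Chain complexes are non-negatively graded complexes of $k$-modules, and $\otimes=\otimes_k$ with the usual signs. Let $C$ be a cocommutative differential graded coalgebra over $k$ (coassociative, counital) that is simply connected, i.e. $C_0=k$ and $C_1=0$. A $C$-comodule is a chain complex $X$ with a coassociative and counital chain map $\rho_X:X\to X\otimes C$; a map of comodules is a quasi-isomorphism if it induces an isomorphism on homology. For $C$-comodules $X,Y$ let $\lambda_Y:Y\to C\otimes Y$ be $\rho_Y$ followed by the symmetry, and let $X\square_C Y\subseteq X\otimes Y$ be the equalizer of $\rho_X\otimes \mathrm{id},\ \mathrm{id}\otimes\lambda_Y: X\otimes Y\rightrightarrows X\otimes C\otimes Y$, a $C$-comodule with the coaction restricted from $\mathrm{id}\otimes\rho_Y$. A comodule $Y$ is fibrant if every map of comodules $A\to Y$ extends along every injective quasi-isomorphism of comodules $A\to B$; it is coflat if $Y\square_C-$ is exact. The cosimplicial cobar construction of a comodule $X$ is the cosimplicial comodule $\Omega^\bullet(X,C,C)$ with $\Omega^n(X,C,C)=X\otimes C^{\otimes(n+1)}$ (coaction on the last factor), whose coface $d^0$ applies $\rho_X$,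 whose coface $d^i$ for $1\le i\le n+1$ applies the comultiplication to the $i$-th factor $C$, and whose codegeneracies apply the counit to one of the factors $C$ other than the last one; it is coaugmented by $\rho_X:X\to X\otimes C$. Put $\Omega^\bullet(X,C,Y)=\Omega^\bullet(X,C,C)\square_C Y$. The homotopy limit of a cosimplicial comodule $\Phi$ is the end over $[n]\in\Delta$, in the category of $C$-comodules, of the cotensors $(\Phi^n)^{N(\Delta\downarrow[n])}$; here $N(\Delta\downarrow [n])$ is the nerve of the category of objects of $\Delta$ over $[n]$, and $(-)^{K}$ is right adjoint to $N_*(K;k)\otimes-$, where $N_*(K;k)$ are the normalized chains of the simplicial set $K$. Thus it is the comodule that represents the natural families of maps of comodules $N_*(N(\Delta\downarrow[n]);k)\otimes Z\to\Phi^n$. Let $\Omega(X,C,C)$ and $\Omega(X,C,Y)$ be the homotopy limits of $\Omega^\bullet(X,C,C)$ and $\Omega^\bullet(X,C,Y)$. Then: 1. For all $C$-comodules $X$ and $Y$ the homotopy limits $\Omega(X,C,C)$ and $\Omega(X,C,Y)$ exist. 2. If $X$ is any $C$-comodule and $Y$ is a fibrant (or coflat) $C$-comodule, then the canonical map of $C$-comodules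 $$\Omega(X,C,C)\,\square_C\,Y\longrightarrow \Omega(X,C,Y),$$ induced by applying $-\square_C Y$ to the universal family $N_*(N(\Delta\downarrow[n]);k)\otimes\Omega(X,C,C)\to\Omega^n(X,C,C)$, is a quasi-isomorphism, and it is natural in $X$ and $Y$. 3. Consequently, for $Y$ fibrant (or coflat), $\Omega(X,C,Y)$ computes the derived cotensor product of $X$ and $Y$, which is the cotensor product of fibrant replacements: every comodule $X$ has a quasi-isomorphism to a fibrant comodule, and if $X\to X'$ and $Y\to Y'$ are quasi-isomorphisms of comodules with $X'$ and $Y'$ fibrant, then both maps $$X'\,\square_C\,Y'\longleftarrow X\,\square_C\,Y\longrightarrow\Omega(X,C,Y),$$ the right one being induced by the coaugmentation $X\to\Omega^\bullet(X,C,C)$, are quasi-isomorphisms of $C$-comodules. -/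

import Mathlib

universe u

open TensorProduct

/-- `k` is a product of finitely many (and at least one) fields. -/
class IsFiniteProductOfFields (k : Type u) [CommRing k] : Prop where
  exists_ringEquiv : ∃ (n : ℕ) (K : Fin (n + 1) → Type u) (_ : ∀ i, Field (K i)),
    Nonempty (k ≃+* ∀ i, K i)

instance IsFiniteProductOfFields.isSemisimpleRing (k : Type u) [CommRing k]
    [h : IsFiniteProductOfFields k] : IsSemisimpleRing k := by
  obtain ⟨n, K, _, ⟨e⟩⟩ := h.exists_ringEquiv
  exact e.symm.isSemisimpleRing

theorem IsFiniteProductOfFields.flat (k : Type u) [CommRing k] [IsFiniteProductOfFields k]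
    (M : Type u) [AddCommGroup M] [Module k M] : Module.Flat k M :=
  haveI := Module.projective_of_isSemisimpleRing k M
  inferInstance

/-- A non-negatively graded chain complex of `k`-modules, presented by its total module
`⨁ n, X_n` with the internal grading `gr n = X_n` and the differential `d` of degree `-1`. -/
structure DGModule (k : Type u) [CommRing k] where
  carrier : Type u
  [addCommGroup : AddCommGroup carrier]
  [module : Module k carrier]
  gr : ℕ → Submodule k carrier
  isInternal : DirectSum.IsInternal gr
  d : carrier →ₗ[k] carrier
  d_mem : ∀ (n : ℕ) (x : carrier), x ∈ gr (n + 1) → d x ∈ gr n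
  d_zero : ∀ x : carrier, x ∈ gr 0 → d x = 0
  d_d : d ∘ₗ d = 0

attribute [instance] DGModule.addCommGroup DGModule.module

namespace DGModule

variable {k : Type u} [CommRing k]

instance : CoeSort (DGModule k) (Type u) := ⟨DGModule.carrier⟩

/-- The identification `⨁ n, X_n ≃ X`. -/
noncomputable def sumEquiv (X : DGModule k) : (DirectSum ℕ fun n => X.gr n) ≃ₗ[k] X :=
  LinearEquiv.ofBijective (DirectSum.coeLinearMap X.gr) X.isInternal

theorem sumEquiv_lof (X : DGModule k) (n : ℕ) (x : X.gr n) :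
    X.sumEquiv (DirectSum.lof k ℕ (fun i => X.gr i) n x) = x :=
  DirectSum.coeLinearMap_lof X.gr n x

/-- The endomorphism that multiplies `X_n` by the scalar `a n`. -/
noncomputable def scale (X : DGModule k) (a : ℕ → k) : X →ₗ[k] X :=
  DirectSum.toModule k ℕ X (fun n => a n • (X.gr n).subtype) ∘ₗ
    (X.sumEquiv).symm.toLinearMap

theorem scale_of_mem (X : DGModule k) (a : ℕ → k) {n : ℕ} {x : X} (hx : x ∈ X.gr n) :
    X.scale a x = a n • x := by
  have h : X.sumEquiv.symm x = DirectSum.lof k ℕ (fun i => X.gr i) n ⟨x, hx⟩ := by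
    rw [LinearEquiv.symm_apply_eq, sumEquiv_lof]
  simp [scale, h]

/-- The projection onto `X_n`. -/
noncomputable def proj (X : DGModule k) (n : ℕ) : X →ₗ[k] X := X.scale (Pi.single n 1)

/-- The sign operator `x ↦ (-1)^|x| x`. -/
noncomputable def sgn (X : DGModule k) : X →ₗ[k] X := X.scale (fun n => (-1) ^ n)

/-- The projection onto the odd part. -/
noncomputable def odd (X : DGModule k) : X →ₗ[k] X := X.scale (fun n => if Odd n then 1 else 0)

theorem proj_self (X : DGModule k) {n : ℕ} {x : X} (hx : x ∈ X.gr n) : X.proj n x = x := by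
  simp [proj, X.scale_of_mem _ hx]

theorem proj_ne (X : DGModule k) {m n : ℕ} (h : m ≠ n) {x : X} (hx : x ∈ X.gr n) :
    X.proj m x = 0 := by
  simp [proj, X.scale_of_mem _ hx, Pi.single_eq_of_ne (Ne.symm h)]

theorem sgn_of_mem (X : DGModule k) {n : ℕ} {x : X} (hx : x ∈ X.gr n) :
    X.sgn x = (-1 : k) ^ n • x := X.scale_of_mem _ hx

theorem iSup_gr (X : DGModule k) : ⨆ n, X.gr n = ⊤ := X.isInternal.submodule_iSup_eq_top

theorem induction_homogeneous (X : DGModule k) {P : X → Prop} (x : X)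
    (h : ∀ n, ∀ x ∈ X.gr n, P x) (h0 : P 0) (ha : ∀ x y, P x → P y → P (x + y)) : P x := by
  have hx : x ∈ ⨆ n, X.gr n := by rw [X.iSup_gr]; trivial
  exact Submodule.iSup_induction X.gr (motive := P) hx h h0 ha

theorem proj_mem (X : DGModule k) (n : ℕ) (x : X) : X.proj n x ∈ X.gr n := by
  induction x using X.induction_homogeneous with
  | h m x hx =>
    by_cases h : n = m
    · subst h; rwa [X.proj_self hx]
    · rw [X.proj_ne h hx]; exact zero_mem _
  | h0 => simp
  | ha x y hx hy => rw [map_add]; exact add_mem hx hy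

theorem lin_ext (X : DGModule k) {M : Type u} [AddCommGroup M] [Module k M] {f g : X →ₗ[k] M}
    (h : ∀ n, ∀ x ∈ X.gr n, f x = g x) : f = g := by
  ext x
  induction x using X.induction_homogeneous with
  | h n x hx => exact h n x hx
  | h0 => simp
  | ha x y hx hy => rw [map_add, map_add, hx, hy]

theorem isInternal_of_proj {M : Type u} [AddCommGroup M] [Module k M] (gr : ℕ → Submodule k M)
    (p : ℕ → M →ₗ[k] M) (h₁ : ∀ n, ∀ x ∈ gr n, p n x = x)
    (h₂ : ∀ m n, m ≠ n → ∀ x ∈ gr n, p m x = 0) (h₃ : ⨆ n, gr n = ⊤) :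
    DirectSum.IsInternal gr := by
  refine (DirectSum.isInternal_submodule_iff_iSupIndep_and_iSup_eq_top gr).2 ⟨?_, h₃⟩
  rw [iSupIndep_def]
  intro n
  rw [Submodule.disjoint_def]
  intro x hx hx'
  have : ⨆ j, ⨆ (_ : j ≠ n), gr j ≤ LinearMap.ker (p n) := by
    refine iSup_le fun j => iSup_le fun hj y hy => ?_
    exact h₂ n j (Ne.symm hj) y hy
  rw [← h₁ n x hx]
  exact this hx'

/-- Chain maps. -/
@[ext]
structure Hom (X Y : DGModule k) where
  toLin : X →ₗ[k] Y
  map_mem : ∀ n, ∀ x ∈ X.gr n, toLin x ∈ Y.gr n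
  map_d : toLin ∘ₗ X.d = Y.d ∘ₗ toLin

namespace Hom

variable {X Y Z : DGModule k}

theorem map_d_apply (f : Hom X Y) (x : X) : f.toLin (X.d x) = Y.d (f.toLin x) :=
  LinearMap.congr_fun f.map_d x

/-- The identity chain map. -/
def id (X : DGModule k) : Hom X X := ⟨LinearMap.id, fun _ _ h => h, rfl⟩

/-- Composition of chain maps. -/
def comp (g : Hom Y Z) (f : Hom X Y) : Hom X Z where
  toLin := g.toLin ∘ₗ f.toLin
  map_mem n x hx := g.map_mem n _ (f.map_mem n x hx)
  map_d := by rw [LinearMap.comp_assoc, f.map_d, ← LinearMap.comp_assoc, g.map_d,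
    LinearMap.comp_assoc]

theorem scale_comm (f : Hom X Y) (a : ℕ → k) (x : X) :
    f.toLin (X.scale a x) = Y.scale a (f.toLin x) := by
  have : f.toLin ∘ₗ X.scale a = Y.scale a ∘ₗ f.toLin := by
    refine X.lin_ext fun n x hx => ?_
    simp [X.scale_of_mem a hx, Y.scale_of_mem a (f.map_mem n x hx)]
  exact LinearMap.congr_fun this x

theorem mem_of_injective (f : Hom X Y) (hf : Function.Injective f.toLin) {n : ℕ} {x : X}
    (hx : f.toLin x ∈ Y.gr n) : x ∈ X.gr n := by
  have : X.proj n x = x := hf (by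
    have := f.scale_comm (Pi.single n 1) x
    exact this.trans (Y.proj_self hx))
  rw [← this]
  exact X.proj_mem n x

/-- The difference of two chain maps. -/
def sub (f g : Hom X Y) : Hom X Y where
  toLin := f.toLin - g.toLin
  map_mem n x hx := sub_mem (f.map_mem n x hx) (g.map_mem n x hx)
  map_d := by rw [LinearMap.sub_comp, LinearMap.comp_sub, f.map_d, g.map_d]

end Hom

/-- The homology `H_*(X) = ker d / im d`. -/
abbrev Homology (X : DGModule k) : Type u :=
  LinearMap.ker X.d ⧸ (LinearMap.range X.d).submoduleOf (LinearMap.ker X.d)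

/-- The map induced on homology by a chain map. -/
noncomputable def Hom.homologyMap {X Y : DGModule k} (f : Hom X Y) :
    X.Homology →ₗ[k] Y.Homology :=
  Submodule.mapQ _ _
    (f.toLin.restrict (p := LinearMap.ker X.d) (q := LinearMap.ker Y.d) (fun x hx => by
      rw [LinearMap.mem_ker] at hx ⊢
      rw [← f.map_d_apply, hx, map_zero]))
    (by
      rintro ⟨x, hx⟩ ⟨y, hy⟩
      exact ⟨f.toLin y, by rw [← f.map_d_apply, hy]; rfl⟩)

/-- A chain map is a quasi-isomorphism if it induces an isomorphism on homology. (The map on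
`H_* = ⨁ H_n` preserves the degree, so it is bijective if and only if every `H_n` is.) -/
def Hom.IsQuasiIso {X Y : DGModule k} (f : Hom X Y) : Prop := Function.Bijective f.homologyMap

/-- The degree `n` part of `X ⊗ Y`, spanned by the `x ⊗ y` with `|x| + |y| = n`. -/
def tensorGr (X Y : DGModule k) (n : ℕ) : Submodule k (X ⊗[k] Y) :=
  Submodule.span k {z | ∃ i j : ℕ, i + j = n ∧ ∃ x ∈ X.gr i, ∃ y ∈ Y.gr j, x ⊗ₜ[k] y = z}

/-- `d (x ⊗ y) = dx ⊗ y + (-1)^|x| x ⊗ dy`. -/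
noncomputable def tensorD (X Y : DGModule k) : X ⊗[k] Y →ₗ[k] X ⊗[k] Y :=
  TensorProduct.map X.d LinearMap.id + TensorProduct.map X.sgn Y.d

theorem tensorGr_isInternal (X Y : DGModule k) : DirectSum.IsInternal (tensorGr X Y) := by
  refine isInternal_of_proj _ (fun n => ∑ p ∈ Finset.HasAntidiagonal.antidiagonal n,
    TensorProduct.map (X.proj p.1) (Y.proj p.2)) ?_ ?_ ?_
  · intro n z hz
    induction hz using Submodule.span_induction with
    | mem z hz =>
      obtain ⟨i, j, rfl, x, hx, y, hy, rfl⟩ := hz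
      rw [LinearMap.sum_apply, Finset.sum_eq_single (i, j)]
      · simp [X.proj_self hx, Y.proj_self hy]
      · rintro ⟨a, b⟩ - hab
        by_cases ha : a = i
        · have hb : b ≠ j := fun hb => hab (by rw [ha, hb])
          simp [Y.proj_ne hb hy]
        · simp [X.proj_ne ha hx]
      · intro h; simp at h
    | zero => simp
    | add z w _ _ hz hw => rw [map_add, hz, hw]
    | smul a z _ hz => rw [map_smul, hz]
  · intro m n hmn z hz
    induction hz using Submodule.span_induction with
    | mem z hz =>
      obtain ⟨i, j, rfl, x, hx, y, hy, rfl⟩ := hz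
      rw [LinearMap.sum_apply]
      refine Finset.sum_eq_zero ?_
      rintro ⟨a, b⟩ hab
      rw [Finset.HasAntidiagonal.mem_antidiagonal] at hab
      by_cases ha : a = i
      · have hb : b ≠ j := fun hb => hmn (by rw [← hab]; simp [ha, hb])
        simp [Y.proj_ne hb hy]
      · simp [X.proj_ne ha hx]
    | zero => simp
    | add z w _ _ hz hw => rw [map_add, hz, hw, add_zero]
    | smul a z _ hz => rw [map_smul, hz, smul_zero]
  · rw [eq_top_iff]
    rintro z -
    induction z using TensorProduct.induction_on with
    | zero => exact zero_mem _
    | add z w hz hw => exact add_mem hz hw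
    | tmul x y =>
      induction x using X.induction_homogeneous with
      | h0 => rw [TensorProduct.zero_tmul]; exact zero_mem _
      | ha x x' hx hx' => rw [TensorProduct.add_tmul]; exact add_mem hx hx'
      | h i x hx =>
        induction y using Y.induction_homogeneous with
        | h0 => rw [TensorProduct.tmul_zero]; exact zero_mem _
        | ha x x' hx hx' => rw [TensorProduct.tmul_add]; exact add_mem hx hx'
        | h j y hy =>
          exact Submodule.mem_iSup_of_mem (i + j)
            (Submodule.subset_span ⟨i, j, rfl, x, hx, y, hy, rfl⟩)

theorem tensorD_mem (X Y : DGModule k) (n : ℕ) (z : X ⊗[k] Y) (hz : z ∈ tensorGr X Y (n + 1)) :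
    tensorD X Y z ∈ tensorGr X Y n := by
  unfold tensorD
  induction hz using Submodule.span_induction with
  | mem z hz =>
    obtain ⟨i, j, hij, x, hx, y, hy, rfl⟩ := hz
    simp only [LinearMap.add_apply, TensorProduct.map_tmul, LinearMap.id_apply,
      X.sgn_of_mem hx]
    refine add_mem ?_ ?_
    · cases i with
      | zero => rw [X.d_zero x hx, TensorProduct.zero_tmul]; exact zero_mem _
      | succ i =>
        exact Submodule.subset_span ⟨i, j, by omega, _, X.d_mem i x hx, y, hy, rfl⟩
    · cases j with
      | zero => rw [Y.d_zero y hy, TensorProduct.tmul_zero]; exact zero_mem _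
      | succ j =>
        exact Submodule.subset_span ⟨i, j, by omega, _, Submodule.smul_mem _ _ hx, _,
          Y.d_mem j y hy, rfl⟩
  | zero => simp
  | add z w _ _ hz hw => rw [map_add]; exact add_mem hz hw
  | smul a z _ hz => rw [map_smul]; exact Submodule.smul_mem _ _ hz

theorem tensorD_zero (X Y : DGModule k) (z : X ⊗[k] Y) (hz : z ∈ tensorGr X Y 0) :
    tensorD X Y z = 0 := by
  unfold tensorD
  induction hz using Submodule.span_induction with
  | mem z hz =>
    obtain ⟨i, j, hij, x, hx, y, hy, rfl⟩ := hz
    obtain ⟨rfl, rfl⟩ : i = 0 ∧ j = 0 := by omega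
    simp [X.d_zero x hx, Y.d_zero y hy]
  | zero => simp
  | add z w _ _ hz hw => rw [map_add, hz, hw, add_zero]
  | smul a z _ hz => rw [map_smul, hz, smul_zero]

theorem tensorD_tensorD (X Y : DGModule k) : tensorD X Y ∘ₗ tensorD X Y = 0 := by
  unfold tensorD
  have hsd : X.sgn ∘ₗ X.d = - (X.d ∘ₗ X.sgn) := by
    refine X.lin_ext fun n x hx => ?_
    cases n with
    | zero => simp [X.d_zero x hx, X.sgn_of_mem hx]
    | succ n => simp [X.sgn_of_mem hx, X.sgn_of_mem (X.d_mem n x hx), pow_succ]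
  rw [LinearMap.add_comp, LinearMap.comp_add, LinearMap.comp_add, ← TensorProduct.map_comp,
    ← TensorProduct.map_comp, ← TensorProduct.map_comp, ← TensorProduct.map_comp, X.d_d, Y.d_d,
    hsd]
  ext x y
  simp [TensorProduct.neg_tmul]

/-- The tensor product of complexes: `(X ⊗ Y)_n = ⨁_{i + j = n} X_i ⊗ Y_j`,
`d (x ⊗ y) = dx ⊗ y + (-1)^|x| x ⊗ dy`. -/
noncomputable abbrev tensor (X Y : DGModule k) : DGModule k where
  carrier := X ⊗[k] Y
  gr := tensorGr X Y
  isInternal := tensorGr_isInternal X Y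
  d := tensorD X Y
  d_mem := tensorD_mem X Y
  d_zero := tensorD_zero X Y
  d_d := tensorD_tensorD X Y

section tensor

variable {X Y Z X' Y' Z' : DGModule k}

theorem tmul_mem {i j n : ℕ} (h : i + j = n) {x : X} (hx : x ∈ X.gr i) {y : Y} (hy : y ∈ Y.gr j) :
    x ⊗ₜ[k] y ∈ (tensor X Y).gr n :=
  Submodule.subset_span ⟨i, j, h, x, hx, y, hy, rfl⟩

theorem tensor_d_tmul (x : X) (y : Y) :
    (tensor X Y).d (x ⊗ₜ[k] y) = X.d x ⊗ₜ[k] y + X.sgn x ⊗ₜ[k] Y.d y := rfl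

theorem map_mem_of_tmul {M : Type u} [AddCommGroup M] [Module k M] (S : ℕ → Submodule k M)
    (f : X ⊗[k] Y →ₗ[k] M)
    (h : ∀ i j, ∀ x ∈ X.gr i, ∀ y ∈ Y.gr j, f (x ⊗ₜ[k] y) ∈ S (i + j))
    (n : ℕ) (z : X ⊗[k] Y) (hz : z ∈ (tensor X Y).gr n) : f z ∈ S n := by
  induction hz using Submodule.span_induction with
  | mem z hz =>
    obtain ⟨i, j, rfl, x, hx, y, hy, rfl⟩ := hz
    exact h i j x hx y hy
  | zero => simp
  | add z w _ _ hz hw => rw [map_add]; exact add_mem hz hw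
  | smul a z _ hz => rw [map_smul]; exact Submodule.smul_mem _ _ hz

theorem tensor_ext {M : Type u} [AddCommGroup M] [Module k M] {f g : X ⊗[k] Y →ₗ[k] M}
    (h : ∀ i j, ∀ x ∈ X.gr i, ∀ y ∈ Y.gr j, f (x ⊗ₜ[k] y) = g (x ⊗ₜ[k] y)) : f = g := by
  refine TensorProduct.ext (X.lin_ext fun i x hx => Y.lin_ext fun j y hy => ?_)
  exact h i j x hx y hy

/-- The tensor product of chain maps. -/
noncomputable def tensorHom (f : Hom X X') (g : Hom Y Y') : Hom (tensor X Y) (tensor X' Y') where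
  toLin := TensorProduct.map f.toLin g.toLin
  map_mem := map_mem_of_tmul _ _ fun i j x hx y hy =>
    tmul_mem rfl (f.map_mem i x hx) (g.map_mem j y hy)
  map_d := by
    refine TensorProduct.ext' fun x y => ?_
    change TensorProduct.map f.toLin g.toLin (X.d x ⊗ₜ[k] y + X.sgn x ⊗ₜ[k] Y.d y) =
      X'.d (f.toLin x) ⊗ₜ[k] g.toLin y + X'.sgn (f.toLin x) ⊗ₜ[k] Y'.d (g.toLin y)
    rw [map_add, TensorProduct.map_tmul, TensorProduct.map_tmul, f.map_d_apply, g.map_d_apply]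
    congr 2
    exact f.scale_comm _ x

theorem sgn_tmul (x : X) (y : Y) : (tensor X Y).sgn (x ⊗ₜ[k] y) = X.sgn x ⊗ₜ[k] Y.sgn y := by
  have : (tensor X Y).sgn = TensorProduct.map X.sgn Y.sgn := by
    refine tensor_ext fun i j x hx y hy => ?_
    rw [(tensor X Y).sgn_of_mem (tmul_mem rfl hx hy), TensorProduct.map_tmul, X.sgn_of_mem hx,
      Y.sgn_of_mem hy, TensorProduct.smul_tmul_smul, pow_add]
  exact LinearMap.congr_fun this _

/-- The associativity isomorphism. -/
noncomputable def assocHom (X Y Z : DGModule k) :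
    Hom (tensor (tensor X Y) Z) (tensor X (tensor Y Z)) where
  toLin := (TensorProduct.assoc k X Y Z).toLinearMap
  map_mem := by
    refine map_mem_of_tmul (X := tensor X Y) (Y := Z) _ _ fun i j z hz w hw => ?_
    refine map_mem_of_tmul (X := X) (Y := Y) (fun n => (tensor X (tensor Y Z)).gr (n + j))
      ((TensorProduct.assoc k X Y Z).toLinearMap ∘ₗ (TensorProduct.mk k (tensor X Y) Z).flip w)
      (fun a b x hx y hy => ?_) i z hz
    exact tmul_mem (i := a) (j := b + j) (by omega) hx (tmul_mem rfl hy hw)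
  map_d := by
    refine TensorProduct.ext_threefold fun x y z => ?_
    have h : (tensor (tensor X Y) Z).d ((x ⊗ₜ[k] y) ⊗ₜ[k] z) =
        (X.d x ⊗ₜ[k] y + X.sgn x ⊗ₜ[k] Y.d y) ⊗ₜ[k] z +
          (X.sgn x ⊗ₜ[k] Y.sgn y) ⊗ₜ[k] Z.d z := by
      rw [tensor_d_tmul, tensor_d_tmul, sgn_tmul]
    have h' : (tensor X (tensor Y Z)).d (x ⊗ₜ[k] (y ⊗ₜ[k] z)) =
        X.d x ⊗ₜ[k] (y ⊗ₜ[k] z) + X.sgn x ⊗ₜ[k] (Y.d y ⊗ₜ[k] z + Y.sgn y ⊗ₜ[k] Z.d z) := by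
      rw [tensor_d_tmul, tensor_d_tmul]
    rw [LinearMap.comp_apply, LinearMap.comp_apply, h, LinearEquiv.coe_coe,
      TensorProduct.assoc_tmul, h']
    simp [TensorProduct.add_tmul, TensorProduct.tmul_add, add_assoc]

/-- The inverse of a bijective chain map. -/
noncomputable def Hom.inverse (f : Hom X Y) (e : Y →ₗ[k] X) (h₁ : e ∘ₗ f.toLin = LinearMap.id)
    (h₂ : f.toLin ∘ₗ e = LinearMap.id) : Hom Y X where
  toLin := e
  map_mem n y hy := by
    refine f.mem_of_injective (Function.LeftInverse.injective (g := e) (LinearMap.congr_fun h₁)) ?_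
    rw [show f.toLin (e y) = y from LinearMap.congr_fun h₂ y]
    exact hy
  map_d := by
    have h := congrArg (fun g => (e ∘ₗ g) ∘ₗ e) f.map_d
    simp only [← LinearMap.comp_assoc, h₁, LinearMap.id_comp] at h
    rw [h, LinearMap.comp_assoc, LinearMap.comp_assoc, h₂, LinearMap.comp_id]

/-- The inverse of the associativity isomorphism. -/
noncomputable def assocInvHom (X Y Z : DGModule k) :
    Hom (tensor X (tensor Y Z)) (tensor (tensor X Y) Z) :=
  (assocHom X Y Z).inverse (TensorProduct.assoc k X Y Z).symm.toLinearMap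
    (by ext; simp [assocHom]) (by ext; simp [assocHom])

/-- The symmetry `x ⊗ y ↦ (-1)^(|x||y|) y ⊗ x`; see `braidLin_tmul`. -/
noncomputable def braidLin (X Y : DGModule k) : X ⊗[k] Y →ₗ[k] Y ⊗[k] X :=
  (TensorProduct.comm k X Y).toLinearMap ∘ₗ
    (LinearMap.id - (2 : k) • TensorProduct.map X.odd Y.odd)

theorem braidLin_tmul {i j : ℕ} {x : X} (hx : x ∈ X.gr i) {y : Y} (hy : y ∈ Y.gr j) :
    braidLin X Y (x ⊗ₜ[k] y) = (-1 : k) ^ (i * j) • y ⊗ₜ[k] x := by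
  simp only [braidLin, LinearMap.comp_apply, LinearMap.sub_apply, LinearMap.smul_apply,
    TensorProduct.map_tmul, odd, X.scale_of_mem _ hx, Y.scale_of_mem _ hy, LinearMap.id_apply,
    LinearEquiv.coe_coe, map_sub, map_smul, TensorProduct.comm_tmul]
  by_cases hi : Odd i <;> by_cases hj : Odd j
  · rw [(hi.mul hj).neg_one_pow]
    simp only [hi, hj, if_true, one_smul]
    module
  · have : Even (i * j) := (Nat.not_odd_iff_even.1 hj).mul_left i
    rw [this.neg_one_pow]
    simp [hj]
  · have : Even (i * j) := (Nat.not_odd_iff_even.1 hi).mul_right j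
    rw [this.neg_one_pow]
    simp [hi]
  · have : Even (i * j) := (Nat.not_odd_iff_even.1 hi).mul_right j
    rw [this.neg_one_pow]
    simp [hi]

/-- The symmetry as a chain map. -/
noncomputable def braid (X Y : DGModule k) : Hom (tensor X Y) (tensor Y X) where
  toLin := braidLin X Y
  map_mem := map_mem_of_tmul _ _ fun i j x hx y hy => by
    rw [braidLin_tmul hx hy]
    exact Submodule.smul_mem _ _ (tmul_mem (add_comm j i) hy hx)
  map_d := by
    refine tensor_ext fun i j x hx y hy => ?_
    rw [LinearMap.comp_apply, LinearMap.comp_apply, braidLin_tmul hx hy, tensor_d_tmul, map_smul,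
      tensor_d_tmul, map_add, X.sgn_of_mem hx, Y.sgn_of_mem hy]
    have h₁ : braidLin X Y (X.d x ⊗ₜ[k] y) = ((-1 : k) ^ (i * j) * (-1) ^ j) • y ⊗ₜ[k] X.d x := by
      cases i with
      | zero => simp [X.d_zero x hx]
      | succ i =>
        rw [braidLin_tmul (X.d_mem i x hx) hy, add_mul, one_mul, pow_add, mul_assoc,
          ← mul_pow, neg_one_mul, neg_neg, one_pow, mul_one]
    have h₂ : braidLin X Y (x ⊗ₜ[k] Y.d y) = ((-1 : k) ^ (i * j) * (-1) ^ i) • Y.d y ⊗ₜ[k] x := by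
      cases j with
      | zero => simp [Y.d_zero y hy]
      | succ j =>
        rw [braidLin_tmul hx (Y.d_mem j y hy), mul_add, mul_one, pow_add, mul_assoc,
          ← mul_pow, neg_one_mul, neg_neg, one_pow, mul_one]
    rw [h₁, ← TensorProduct.smul_tmul', map_smul, h₂, smul_smul, smul_add,
      ← TensorProduct.smul_tmul', smul_smul, add_comm]
    congr 2
    rw [mul_comm, mul_assoc, ← mul_pow, neg_one_mul, neg_neg, one_pow, mul_one]

end tensor

end DGModule

namespace DGModule

variable {k : Type u} [CommRing k]

section algebra

variable {X Y Z W X' Y' Z' X'' Y'' : DGModule k}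

theorem Hom.comp_assoc (h : Hom Z W) (g : Hom Y Z) (f : Hom X Y) :
    (h.comp g).comp f = h.comp (g.comp f) := rfl

theorem Hom.comp_id (f : Hom X Y) : f.comp (Hom.id X) = f := rfl

theorem Hom.id_comp (f : Hom X Y) : (Hom.id Y).comp f = f := rfl

theorem tensorHom_comp (f : Hom X X') (f' : Hom X' X'') (g : Hom Y Y') (g' : Hom Y' Y'') :
    (tensorHom f' g').comp (tensorHom f g) = tensorHom (f'.comp f) (g'.comp g) := by
  ext1; exact (TensorProduct.map_comp _ _ _ _).symm

theorem tensorHom_id : tensorHom (Hom.id X) (Hom.id Y) = Hom.id (tensor X Y) := by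
  ext1; exact TensorProduct.map_id

theorem assocInv_assoc : (assocInvHom X Y Z).comp (assocHom X Y Z) = Hom.id _ := by
  ext1; exact (TensorProduct.assoc k X Y Z).symm_comp

theorem assoc_assocInv : (assocHom X Y Z).comp (assocInvHom X Y Z) = Hom.id _ := by
  ext1; exact (TensorProduct.assoc k X Y Z).comp_symm

theorem assoc_naturality (f : Hom X X') (g : Hom Y Y') (h : Hom Z Z') :
    (assocHom X' Y' Z').comp (tensorHom (tensorHom f g) h) =
      (tensorHom f (tensorHom g h)).comp (assocHom X Y Z) := by
  ext1; exact TensorProduct.ext_threefold fun _ _ _ => rfl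

theorem assocInv_naturality (f : Hom X X') (g : Hom Y Y') (h : Hom Z Z') :
    (assocInvHom X' Y' Z').comp (tensorHom f (tensorHom g h)) =
      (tensorHom (tensorHom f g) h).comp (assocInvHom X Y Z) := by
  ext1; exact TensorProduct.ext_threefold' fun _ _ _ => rfl

/-- The pentagon. -/
theorem pentagon :
    (assocInvHom (tensor X Y) Z W).comp (assocInvHom X Y (tensor Z W)) =
      (tensorHom (assocInvHom X Y Z) (Hom.id W)).comp
        ((assocInvHom X (tensor Y Z) W).comp (tensorHom (Hom.id X) (assocInvHom Y Z W))) := by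
  ext1
  refine TensorProduct.ext' fun x t => ?_
  induction t using TensorProduct.induction_on with
  | zero => simp
  | add a b ha hb => rw [TensorProduct.tmul_add, map_add, map_add, ha, hb]
  | tmul y t =>
    induction t using TensorProduct.induction_on with
    | zero => simp
    | add a b ha hb =>
      rw [TensorProduct.tmul_add, TensorProduct.tmul_add, map_add, map_add, ha, hb]
    | tmul z w => rfl

end algebra

end DGModule

namespace DGModule

variable {k : Type u} [CommRing k]

section kernel

variable {X Y : DGModule k}

theorem exists_sum_proj (x : X) :
    ∃ s : Finset ℕ, ∀ t : Finset ℕ, s ⊆ t → ∑ n ∈ t, X.proj n x = x := by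
  induction x using X.induction_homogeneous with
  | h m x hx =>
    refine ⟨{m}, fun t ht => ?_⟩
    rw [Finset.sum_eq_single_of_mem m (ht (Finset.mem_singleton_self m))
      (fun n _ hn => X.proj_ne hn hx), X.proj_self hx]
  | h0 => exact ⟨∅, fun t _ => by simp⟩
  | ha x y hx hy =>
    obtain ⟨s, hs⟩ := hx
    obtain ⟨s', hs'⟩ := hy
    refine ⟨s ∪ s', fun t ht => ?_⟩
    simp only [map_add, Finset.sum_add_distrib]
    rw [hs t (Finset.union_subset_left ht), hs' t (Finset.union_subset_right ht)]

/-- The degree `n` part of the kernel of a chain map. -/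
def kerGr (f : Hom X Y) (n : ℕ) : Submodule k (LinearMap.ker f.toLin) :=
  (X.gr n).comap (LinearMap.ker f.toLin).subtype

theorem kerGr_isInternal (f : Hom X Y) : DirectSum.IsInternal (kerGr f) := by
  have hp : ∀ n, ∀ x ∈ LinearMap.ker f.toLin, X.proj n x ∈ LinearMap.ker f.toLin := by
    intro n x hx
    rw [LinearMap.mem_ker] at hx ⊢
    rw [proj, f.scale_comm, hx, map_zero]
  refine isInternal_of_proj _ (fun n => (X.proj n).restrict (hp n)) ?_ ?_ ?_
  · rintro n ⟨x, hx⟩ h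
    exact Subtype.ext (X.proj_self h)
  · rintro m n hmn ⟨x, hx⟩ h
    exact Subtype.ext (X.proj_ne hmn h)
  · rw [eq_top_iff]
    rintro ⟨x, hx⟩ -
    obtain ⟨s, hs⟩ := exists_sum_proj x
    have : (⟨x, hx⟩ : LinearMap.ker f.toLin) = ∑ n ∈ s, (X.proj n).restrict (hp n) ⟨x, hx⟩ := by
      apply Subtype.ext
      rw [AddSubmonoidClass.coe_finsetSum]
      exact (hs s (Finset.Subset.refl s)).symm
    rw [this]
    exact Submodule.sum_mem _ fun n _ => Submodule.mem_iSup_of_mem n (X.proj_mem n x)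

/-- The kernel of a chain map. -/
abbrev ker (f : Hom X Y) : DGModule k where
  carrier := LinearMap.ker f.toLin
  gr := kerGr f
  isInternal := kerGr_isInternal f
  d := X.d.restrict fun x hx => by
    rw [LinearMap.mem_ker] at hx ⊢
    rw [f.map_d_apply, hx, map_zero]
  d_mem n x hx := X.d_mem n x hx
  d_zero x hx := Subtype.ext (X.d_zero x hx)
  d_d := by
    ext x
    exact LinearMap.congr_fun X.d_d x

/-- The inclusion of the kernel. -/
def kerι (f : Hom X Y) : Hom (ker f) X where
  toLin := (LinearMap.ker f.toLin).subtype
  map_mem _ _ hx := hx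
  map_d := rfl

theorem kerι_injective (f : Hom X Y) : Function.Injective (kerι f).toLin :=
  Subtype.val_injective

/-- The universal property of the kernel. -/
def kerLift {W : DGModule k} (f : Hom X Y) (g : Hom W X) (h : ∀ w, f.toLin (g.toLin w) = 0) :
    Hom W (ker f) where
  toLin := g.toLin.codRestrict _ h
  map_mem n w hw := g.map_mem n w hw
  map_d := by
    ext w
    exact g.map_d_apply w

end kernel

theorem Hom.cancel {X Y Z : DGModule k} (i : Hom Y Z) (hi : Function.Injective i.toLin)
    {f g : Hom X Y} (h : i.comp f = i.comp g) : f = g := by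
  ext x
  exact hi (LinearMap.congr_fun (congrArg Hom.toLin h) x)

section braiding

variable {X Y X' Y' Z : DGModule k}

theorem braid_naturality (f : Hom X X') (g : Hom Y Y') :
    (braid X' Y').comp (tensorHom f g) = (tensorHom g f).comp (braid X Y) := by
  ext1
  refine tensor_ext fun i j x hx y hy => ?_
  change braidLin X' Y' (f.toLin x ⊗ₜ[k] g.toLin y) =
    TensorProduct.map g.toLin f.toLin (braidLin X Y (x ⊗ₜ[k] y))
  rw [braidLin_tmul hx hy, braidLin_tmul (f.map_mem i x hx) (g.map_mem j y hy), map_smul,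
    TensorProduct.map_tmul]

/-- The hexagon. -/
theorem hexagon :
    (assocInvHom Z X Y).comp (braid (tensor X Y) Z) =
      (tensorHom (braid X Z) (Hom.id Y)).comp ((assocInvHom X Z Y).comp
        ((tensorHom (Hom.id X) (braid Y Z)).comp (assocHom X Y Z))) := by
  ext1
  refine tensor_ext (X := tensor X Y) (Y := Z) fun n l t ht z hz => ?_
  induction ht using Submodule.span_induction with
  | zero => rw [TensorProduct.zero_tmul, map_zero, map_zero]
  | add t t' _ _ h h' => rw [TensorProduct.add_tmul, map_add, map_add, h, h']
  | smul a t _ h => rw [← TensorProduct.smul_tmul', map_smul, map_smul, h]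
  | mem t ht =>
    obtain ⟨i, j, rfl, x, hx, y, hy, rfl⟩ := ht
    change (TensorProduct.assoc k Z X Y).symm (braidLin (tensor X Y) Z ((x ⊗ₜ[k] y) ⊗ₜ[k] z)) =
      TensorProduct.map (braidLin X Z) LinearMap.id ((TensorProduct.assoc k X Z Y).symm
        (x ⊗ₜ[k] braidLin Y Z (y ⊗ₜ[k] z)))
    rw [braidLin_tmul (tmul_mem rfl hx hy) hz, braidLin_tmul hy hz, TensorProduct.tmul_smul,
      map_smul, map_smul, map_smul, TensorProduct.assoc_symm_tmul, TensorProduct.assoc_symm_tmul,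
      TensorProduct.map_tmul, braidLin_tmul hx hz, LinearMap.id_apply,
      ← TensorProduct.smul_tmul', smul_smul, add_mul, pow_add, mul_comm]

end braiding

end DGModule

/-- A differential graded coalgebra: a coalgebra whose comultiplication and counit are
chain maps (`k` being concentrated in degree `0`). -/
structure DGCoalgebra (k : Type u) [CommRing k] extends DGModule k where
  [coalgebra : Coalgebra k carrier]
  comul_mem : ∀ n, ∀ x ∈ gr n,
    Coalgebra.comul (R := k) x ∈ (DGModule.tensor toDGModule toDGModule).gr n
  comul_d : Coalgebra.comul (R := k) ∘ₗ d =
    (DGModule.tensor toDGModule toDGModule).d ∘ₗ Coalgebra.comul (R := k)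
  counit_mem : ∀ n, ∀ x ∈ gr (n + 1), Coalgebra.counit (R := k) x = 0
  counit_d : Coalgebra.counit (R := k) ∘ₗ d = 0

attribute [instance] DGCoalgebra.coalgebra

namespace DGCoalgebra

open DGModule

variable {k : Type u} [CommRing k]

/-- The comultiplication as a chain map. -/
noncomputable def comulHom (C : DGCoalgebra k) :
    Hom C.toDGModule (tensor C.toDGModule C.toDGModule) where
  toLin := Coalgebra.comul (R := k)
  map_mem := C.comul_mem
  map_d := C.comul_d

/-- `C` is cocommutative: `τ ∘ Δ = Δ` for the (signed) symmetry `τ`. -/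
class IsCocommutative (C : DGCoalgebra k) : Prop where
  braid_comul : (braid C.toDGModule C.toDGModule).comp C.comulHom = C.comulHom

/-- `C` is simply connected: `C_0 = k` and `C_1 = 0`. -/
class IsSimplyConnected (C : DGCoalgebra k) : Prop where
  gr_zero : Nonempty (C.gr 0 ≃ₗ[k] k)
  gr_one : C.gr 1 = ⊥

variable (C : DGCoalgebra k)

/-- `id ⊗ Δ : M ⊗ C ⟶ (M ⊗ C) ⊗ C`. -/
noncomputable def idComul (M : DGModule k) :
    Hom (tensor M C.toDGModule) (tensor (tensor M C.toDGModule) C.toDGModule) :=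
  (assocInvHom M C.toDGModule C.toDGModule).comp (tensorHom (Hom.id M) C.comulHom)

/-- `id ⊗ ε : M ⊗ C ⟶ M ⊗ k = M`. -/
noncomputable def idCounit (M : DGModule k) : Hom (tensor M C.toDGModule) M where
  toLin := (TensorProduct.rid k M).toLinearMap ∘ₗ
    TensorProduct.map LinearMap.id (Coalgebra.counit (R := k) (A := C.toDGModule))
  map_mem := map_mem_of_tmul _ _ fun i j x hx c hc => by
    rw [LinearMap.comp_apply, TensorProduct.map_tmul, LinearMap.id_apply, LinearEquiv.coe_coe,
      TensorProduct.rid_tmul]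
    cases j with
    | zero => exact Submodule.smul_mem _ _ hx
    | succ j => rw [C.counit_mem j c hc, zero_smul]; exact zero_mem _
  map_d := by
    refine TensorProduct.ext' fun x c => ?_
    have h : Coalgebra.counit (R := k) (C.d c) = 0 := LinearMap.congr_fun C.counit_d c
    simp only [LinearMap.comp_apply]
    rw [tensor_d_tmul]
    simp [h]

variable {C} {M N : DGModule k}

theorem idComul_naturality (f : Hom M N) :
    (C.idComul N).comp (tensorHom f (Hom.id _)) =
      (tensorHom (tensorHom f (Hom.id _)) (Hom.id _)).comp (C.idComul M) := by
  rw [idComul, idComul, Hom.comp_assoc, tensorHom_comp, ← Hom.comp_assoc, ← assocInv_naturality,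
    Hom.comp_assoc, tensorHom_comp, tensorHom_id]
  rfl

theorem idCounit_naturality (f : Hom M N) :
    (C.idCounit N).comp (tensorHom f (Hom.id _)) = f.comp (C.idCounit M) := by
  ext1
  refine TensorProduct.ext' fun x c => ?_
  exact (map_smul f.toLin (Coalgebra.counit (R := k) (A := C.toDGModule) c) x).symm

theorem comul_comul : (tensorHom C.comulHom (Hom.id _)).comp C.comulHom =
    (C.idComul C.toDGModule).comp C.comulHom := by
  apply (assocHom _ _ _).cancel
    (TensorProduct.assoc k C.toDGModule C.toDGModule C.toDGModule).injective
  rw [idComul, ← Hom.comp_assoc, ← Hom.comp_assoc, ← Hom.comp_assoc, assoc_assocInv]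
  ext1
  exact Coalgebra.coassoc (R := k) (A := C.toDGModule)

theorem idCounit_comul : (C.idCounit C.toDGModule).comp C.comulHom = Hom.id _ := by
  ext c
  have h := Coalgebra.lTensor_counit_comul (R := k) (A := C.toDGModule) c
  change TensorProduct.rid k C.toDGModule
    ((Coalgebra.counit (R := k) (A := C.toDGModule)).lTensor C.toDGModule
      (Coalgebra.comul (R := k) (A := C.toDGModule) c)) = c
  rw [h, TensorProduct.rid_tmul, one_smul]

/-- `id ⊗ ρ` is coassociative if `ρ` is. -/
theorem tensor_coassoc (M : DGModule k) {Y : DGModule k} (ρ : Hom Y (tensor Y C.toDGModule))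
    (h : (tensorHom ρ (Hom.id _)).comp ρ = (C.idComul Y).comp ρ) :
    (tensorHom ((assocInvHom M Y _).comp (tensorHom (Hom.id M) ρ)) (Hom.id _)).comp
        ((assocInvHom M Y _).comp (tensorHom (Hom.id M) ρ)) =
      (C.idComul (tensor M Y)).comp ((assocInvHom M Y _).comp (tensorHom (Hom.id M) ρ)) := by
  calc _ = (tensorHom (assocInvHom M Y C.toDGModule) (Hom.id C.toDGModule)).comp
        (((tensorHom (tensorHom (Hom.id M) ρ) (Hom.id C.toDGModule)).comp
          (assocInvHom M Y C.toDGModule)).comp (tensorHom (Hom.id M) ρ)) := by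
        rw [← Hom.comp_assoc, ← Hom.comp_assoc, ← Hom.comp_assoc, tensorHom_comp, Hom.id_comp]
    _ = (tensorHom (assocInvHom M Y C.toDGModule) (Hom.id C.toDGModule)).comp
        ((assocInvHom M (tensor Y C.toDGModule) C.toDGModule).comp
          (tensorHom (Hom.id M) ((tensorHom ρ (Hom.id C.toDGModule)).comp ρ))) := by
        rw [← assocInv_naturality, Hom.comp_assoc, tensorHom_comp, Hom.comp_id]
    _ = ((tensorHom (assocInvHom M Y C.toDGModule) (Hom.id C.toDGModule)).comp
        ((assocInvHom M (tensor Y C.toDGModule) C.toDGModule).comp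
          (tensorHom (Hom.id M) (assocInvHom Y C.toDGModule C.toDGModule)))).comp
          ((tensorHom (Hom.id M) (tensorHom (Hom.id Y) C.comulHom)).comp
            (tensorHom (Hom.id M) ρ)) := by
        rw [h, idComul, tensorHom_comp, Hom.comp_assoc, Hom.comp_assoc, Hom.comp_assoc,
          tensorHom_comp]
        rfl
    _ = _ := by
        rw [← pentagon, Hom.comp_assoc, ← Hom.comp_assoc _ _ (tensorHom (Hom.id M) ρ),
          assocInv_naturality, tensorHom_id, idComul]
        rfl

/-- `id ⊗ ρ` is counital if `ρ` is. -/
theorem tensor_counit (M : DGModule k) {Y : DGModule k} (ρ : Hom Y (tensor Y C.toDGModule))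
    (h : (C.idCounit Y).comp ρ = Hom.id Y) :
    (C.idCounit (tensor M Y)).comp ((assocInvHom M Y _).comp (tensorHom (Hom.id M) ρ)) =
      Hom.id _ := by
  have h' : (C.idCounit (tensor M Y)).comp (assocInvHom M Y C.toDGModule) =
      tensorHom (Hom.id M) (C.idCounit Y) := by
    ext1
    refine TensorProduct.ext_threefold' fun x y c => ?_
    exact (TensorProduct.tmul_smul (Coalgebra.counit (R := k) (A := C.toDGModule) c) x y).symm
  rw [← Hom.comp_assoc, h', tensorHom_comp, h, Hom.id_comp, tensorHom_id]

theorem idComul_idComul (M : DGModule k) :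
    (tensorHom (C.idComul M) (Hom.id _)).comp (C.idComul M) =
      (C.idComul (tensor M C.toDGModule)).comp (C.idComul M) :=
  tensor_coassoc M C.comulHom comul_comul

theorem idCounit_idComul (M : DGModule k) :
    (C.idCounit (tensor M C.toDGModule)).comp (C.idComul M) = Hom.id _ :=
  tensor_counit M C.comulHom idCounit_comul

theorem idCounit_tensor_idComul (M : DGModule k) :
    (tensorHom (C.idCounit M) (Hom.id _)).comp (C.idComul M) = Hom.id _ := by
  ext1
  refine TensorProduct.ext' fun x c => ?_
  have h : ∀ w : C.toDGModule ⊗[k] C.toDGModule,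
      ((tensorHom (C.idCounit M) (Hom.id C.toDGModule)).comp
        (assocInvHom M C.toDGModule C.toDGModule)).toLin (x ⊗ₜ[k] w) =
      x ⊗ₜ[k] TensorProduct.lid k C.toDGModule
        ((Coalgebra.counit (R := k) (A := C.toDGModule)).rTensor C.toDGModule w) := by
    intro w
    induction w using TensorProduct.induction_on with
    | zero => simp
    | add a b ha hb => rw [TensorProduct.tmul_add, map_add, ha, hb, map_add, map_add,
        TensorProduct.tmul_add]
    | tmul a b =>
      exact TensorProduct.smul_tmul (Coalgebra.counit (R := k) (A := C.toDGModule) a) x b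
  refine (h (Coalgebra.comul (R := k) (A := C.toDGModule) c)).trans ?_
  rw [Coalgebra.rTensor_counit_comul, TensorProduct.lid_tmul, one_smul]
  rfl

end DGCoalgebra

open DGModule in
/-- A (right) comodule over the differential graded coalgebra `C`. -/
structure DGComodule {k : Type u} [CommRing k] (C : DGCoalgebra k) extends DGModule k where
  coact : Hom toDGModule (tensor toDGModule C.toDGModule)
  coassoc : (tensorHom coact (Hom.id C.toDGModule)).comp coact =
    (C.idComul toDGModule).comp coact
  counit : (C.idCounit toDGModule).comp coact = Hom.id toDGModule

namespace DGComodule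

open DGModule

variable {k : Type u} [CommRing k] {C : DGCoalgebra k}

/-- Maps of comodules. -/
@[ext]
structure Hom (X Y : DGComodule C) extends DGModule.Hom X.toDGModule Y.toDGModule where
  colinear : Y.coact.comp toHom = (tensorHom toHom (Hom.id C.toDGModule)).comp X.coact

namespace Hom

variable {X Y Z : DGComodule C}

/-- The identity of a comodule. -/
def id (X : DGComodule C) : Hom X X where
  toHom := DGModule.Hom.id X.toDGModule
  colinear := by rw [tensorHom_id]; rfl

/-- Composition of maps of comodules. -/
def comp (g : Hom Y Z) (f : Hom X Y) : Hom X Z where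
  toHom := g.toHom.comp f.toHom
  colinear := by
    rw [← DGModule.Hom.comp_assoc, g.colinear, DGModule.Hom.comp_assoc, f.colinear,
      ← DGModule.Hom.comp_assoc, tensorHom_comp]
    rfl

/-- The difference of two maps of comodules. -/
def sub (f g : Hom X Y) : Hom X Y where
  toHom := f.toHom.sub g.toHom
  colinear := by
    ext x
    have hf := LinearMap.congr_fun (congrArg DGModule.Hom.toLin f.colinear) x
    have hg := LinearMap.congr_fun (congrArg DGModule.Hom.toLin g.colinear) x
    change Y.coact.toLin (f.toLin x) =
      TensorProduct.map f.toLin LinearMap.id (X.coact.toLin x) at hf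
    change Y.coact.toLin (g.toLin x) =
      TensorProduct.map g.toLin LinearMap.id (X.coact.toLin x) at hg
    change Y.coact.toLin (f.toLin x - g.toLin x) =
      TensorProduct.map (f.toLin - g.toLin) LinearMap.id (X.coact.toLin x)
    rw [map_sub, hf, hg]
    exact (LinearMap.congr_fun (LinearMap.rTensor_sub f.toLin g.toLin)
      (X.coact.toLin x)).symm

/-- A map of comodules is a quasi-isomorphism if the underlying chain map is. -/
def IsQuasiIso (f : Hom X Y) : Prop := f.toHom.IsQuasiIso

end Hom

/-- `Y` is fibrant: it has the extension property for the acyclic cofibrations, which are the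
injective quasi-isomorphisms of comodules. -/
def IsFibrant (Y : DGComodule C) : Prop :=
  ∀ (A B : DGComodule C) (i : Hom A B), Function.Injective i.toLin → i.IsQuasiIso →
    ∀ f : Hom A Y, ∃ g : Hom B Y, g.comp i = f

/-- `C` as a comodule over itself. -/
noncomputable def regular (C : DGCoalgebra k) : DGComodule C where
  toDGModule := C.toDGModule
  coact := C.comulHom
  coassoc := DGCoalgebra.comul_comul
  counit := DGCoalgebra.idCounit_comul

/-- The comodule `M ⊗ Y`, for a complex `M` and a comodule `Y`, with coaction `id ⊗ ρ_Y`. -/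
noncomputable abbrev tensorLeft (M : DGModule k) (Y : DGComodule C) : DGComodule C where
  toDGModule := tensor M Y.toDGModule
  coact := (assocInvHom M Y.toDGModule C.toDGModule).comp
    (tensorHom (DGModule.Hom.id M) Y.coact)
  coassoc := DGCoalgebra.tensor_coassoc M Y.coact Y.coassoc
  counit := DGCoalgebra.tensor_counit M Y.coact Y.counit

/-- Functoriality of `M ⊗ Y`. -/
noncomputable def tensorLeftMap {M N : DGModule k} {Y Z : DGComodule C} (f : DGModule.Hom M N)
    (g : Hom Y Z) : Hom (tensorLeft M Y) (tensorLeft N Z) where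
  toHom := tensorHom f g.toHom
  colinear := by
    rw [DGModule.Hom.comp_assoc, tensorHom_comp, g.colinear, ← DGModule.Hom.comp_assoc,
      ← assocInv_naturality, DGModule.Hom.comp_assoc, tensorHom_comp]
    rfl

/-- `(M ⊗ N) ⊗ Y ≅ M ⊗ (N ⊗ Y)`. -/
noncomputable def tensorLeftAssoc (M N : DGModule k) (Y : DGComodule C) :
    Hom (tensorLeft (tensor M N) Y) (tensorLeft M (tensorLeft N Y)) where
  toHom := assocHom M N Y.toDGModule
  colinear := by
    ext1
    refine TensorProduct.ext_threefold fun m n y => ?_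
    change (assocInvHom M (tensor N Y.toDGModule) C.toDGModule).toLin
      (m ⊗ₜ[k] (assocInvHom N Y.toDGModule C.toDGModule).toLin (n ⊗ₜ[k] Y.coact.toLin y)) =
      (tensorHom (assocHom M N Y.toDGModule) (DGModule.Hom.id C.toDGModule)).toLin
        ((assocInvHom (tensor M N) Y.toDGModule C.toDGModule).toLin
          ((m ⊗ₜ[k] n) ⊗ₜ[k] Y.coact.toLin y))
    induction Y.coact.toLin y using TensorProduct.induction_on with
    | zero => simp
    | add a b ha hb => simp only [TensorProduct.tmul_add, map_add, ha, hb]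
    | tmul a b => rfl

/-- `M ⊗ (N ⊗ Y) ≅ (M ⊗ N) ⊗ Y`. -/
noncomputable def tensorLeftAssocInv (M N : DGModule k) (Y : DGComodule C) :
    Hom (tensorLeft M (tensorLeft N Y)) (tensorLeft (tensor M N) Y) where
  toHom := assocInvHom M N Y.toDGModule
  colinear := by
    ext1
    refine TensorProduct.ext_threefold' fun m n y => ?_
    change (assocInvHom (tensor M N) Y.toDGModule C.toDGModule).toLin
          ((m ⊗ₜ[k] n) ⊗ₜ[k] Y.coact.toLin y) =
      (tensorHom (assocInvHom M N Y.toDGModule) (DGModule.Hom.id C.toDGModule)).toLin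
        ((assocInvHom M (tensor N Y.toDGModule) C.toDGModule).toLin
      (m ⊗ₜ[k] (assocInvHom N Y.toDGModule C.toDGModule).toLin (n ⊗ₜ[k] Y.coact.toLin y)))
    induction Y.coact.toLin y using TensorProduct.induction_on with
    | zero => simp
    | add a b ha hb => simp only [TensorProduct.tmul_add, map_add, ha, hb]
    | tmul a b => rfl

/-- The left coaction `Y ⟶ Y ⊗ C ≅ C ⊗ Y` of a comodule over a cocommutative coalgebra; it is a
map of right comodules. -/
noncomputable def leftCoact [h : C.IsCocommutative] (Y : DGComodule C) :
    Hom Y (tensorLeft C.toDGModule Y) where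
  toHom := (braid Y.toDGModule C.toDGModule).comp Y.coact
  colinear := by
    calc _ = (assocInvHom C.toDGModule Y.toDGModule C.toDGModule).comp
          (((tensorHom (DGModule.Hom.id C.toDGModule) Y.coact).comp
            (braid Y.toDGModule C.toDGModule)).comp Y.coact) := rfl
      _ = ((assocInvHom C.toDGModule Y.toDGModule C.toDGModule).comp
            (braid (tensor Y.toDGModule C.toDGModule) C.toDGModule)).comp
            ((tensorHom Y.coact (DGModule.Hom.id C.toDGModule)).comp Y.coact) := by
          rw [← braid_naturality]; rfl
      _ = ((tensorHom (braid Y.toDGModule C.toDGModule) (DGModule.Hom.id C.toDGModule)).comp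
            ((assocInvHom Y.toDGModule C.toDGModule C.toDGModule).comp
            (tensorHom (DGModule.Hom.id Y.toDGModule) (braid C.toDGModule C.toDGModule)))).comp
            (((assocHom Y.toDGModule C.toDGModule C.toDGModule).comp
              (assocInvHom Y.toDGModule C.toDGModule C.toDGModule)).comp
              ((tensorHom (DGModule.Hom.id Y.toDGModule) C.comulHom).comp Y.coact)) := by
          rw [hexagon, Y.coassoc]; rfl
      _ = (tensorHom (braid Y.toDGModule C.toDGModule) (DGModule.Hom.id C.toDGModule)).comp
            ((assocInvHom Y.toDGModule C.toDGModule C.toDGModule).comp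
            ((tensorHom (DGModule.Hom.id Y.toDGModule) C.comulHom).comp Y.coact)) := by
          rw [assoc_assocInv, DGModule.Hom.id_comp, DGModule.Hom.comp_assoc,
            DGModule.Hom.comp_assoc, ← DGModule.Hom.comp_assoc _ _ Y.coact, tensorHom_comp,
            h.braid_comul, DGModule.Hom.comp_id]
      _ = (tensorHom (braid Y.toDGModule C.toDGModule) (DGModule.Hom.id C.toDGModule)).comp
            ((C.idComul Y.toDGModule).comp Y.coact) := rfl
      _ = _ := by
          rw [← Y.coassoc, ← DGModule.Hom.comp_assoc, tensorHom_comp]; rfl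

section kernel

variable [IsFiniteProductOfFields k] {X Y : DGComodule C}

theorem tensorHom_injective {M N : DGModule k} (f : DGModule.Hom M N)
    (hf : Function.Injective f.toLin) (P : DGModule k) :
    Function.Injective (tensorHom f (DGModule.Hom.id P)).toLin :=
  have := IsFiniteProductOfFields.flat k P
  Module.Flat.rTensor_preserves_injective_linearMap f.toLin hf

theorem exists_kerCoact (f : Hom X Y) :
    ∃ ρ : DGModule.Hom (DGModule.ker f.toHom) (tensor (DGModule.ker f.toHom) C.toDGModule),
      (tensorHom (kerι f.toHom) (DGModule.Hom.id C.toDGModule)).comp ρ =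
        X.coact.comp (kerι f.toHom) := by
  have := IsFiniteProductOfFields.flat k C.toDGModule
  have hinj := tensorHom_injective (kerι f.toHom) (kerι_injective f.toHom) C.toDGModule
  have hex : Function.Exact (tensorHom (kerι f.toHom) (DGModule.Hom.id C.toDGModule)).toLin
      (tensorHom f.toHom (DGModule.Hom.id C.toDGModule)).toLin :=
    Module.Flat.rTensor_exact C.toDGModule (f := (LinearMap.ker f.toLin).subtype) (g := f.toLin)
      (LinearMap.exact_subtype_ker_map f.toLin)
  have hmem : ∀ x : DGModule.ker f.toHom, X.coact.toLin x.1 ∈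
      LinearMap.range (tensorHom (kerι f.toHom) (DGModule.Hom.id C.toDGModule)).toLin := by
    intro x
    refine (hex _).1 ?_
    have h := LinearMap.congr_fun (congrArg DGModule.Hom.toLin f.colinear) x.1
    refine h.symm.trans ?_
    change Y.coact.toLin (f.toLin x.1) = 0
    rw [show f.toLin x.1 = 0 from x.2, map_zero]
  let e := LinearEquiv.ofInjective _ hinj
  have he : ∀ z, (tensorHom (kerι f.toHom) (DGModule.Hom.id C.toDGModule)).toLin (e.symm z) = z.1 :=
    fun z => congrArg Subtype.val (e.apply_symm_apply z)
  obtain ⟨r, hr⟩ : ∃ r : DGModule.ker f.toHom →ₗ[k] tensor (DGModule.ker f.toHom) C.toDGModule,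
      ∀ x, (tensorHom (kerι f.toHom) (DGModule.Hom.id C.toDGModule)).toLin (r x) =
        X.coact.toLin x.1 :=
    ⟨e.symm.toLinearMap ∘ₗ ((X.coact.toLin ∘ₗ (kerι f.toHom).toLin).codRestrict _ hmem),
      fun x => he _⟩
  refine ⟨⟨r, fun n x hx => ?_, ?_⟩, ?_⟩
  · refine DGModule.Hom.mem_of_injective _ hinj ?_
    rw [hr]
    exact X.coact.map_mem n _ hx
  · ext1 x
    apply hinj
    rw [LinearMap.comp_apply, LinearMap.comp_apply, hr, DGModule.Hom.map_d_apply, hr]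
    exact X.coact.map_d_apply x.1
  · ext1
    exact LinearMap.ext hr

/-- The coaction on the kernel of a map of comodules, restricted from `X`; it exists because
`- ⊗ C` preserves kernels. -/
noncomputable def kerCoact (f : Hom X Y) :
    DGModule.Hom (DGModule.ker f.toHom) (tensor (DGModule.ker f.toHom) C.toDGModule) :=
  (exists_kerCoact f).choose

theorem kerCoact_spec (f : Hom X Y) :
    (tensorHom (kerι f.toHom) (DGModule.Hom.id C.toDGModule)).comp (kerCoact f) =
      X.coact.comp (kerι f.toHom) :=
  (exists_kerCoact f).choose_spec

/-- The kernel of a map of comodules. -/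
noncomputable abbrev ker (f : Hom X Y) : DGComodule C where
  toDGModule := DGModule.ker f.toHom
  coact := kerCoact f
  coassoc := by
    have h := kerCoact_spec f
    apply DGModule.Hom.cancel _ (tensorHom_injective _
      (tensorHom_injective (kerι f.toHom) (kerι_injective f.toHom) C.toDGModule) C.toDGModule)
    rw [← DGModule.Hom.comp_assoc, tensorHom_comp, h, ← DGModule.Hom.comp_assoc,
      ← DGCoalgebra.idComul_naturality, DGModule.Hom.comp_assoc, h, ← DGModule.Hom.comp_assoc,
      ← X.coassoc, DGModule.Hom.comp_assoc, ← h, ← DGModule.Hom.comp_assoc, tensorHom_comp, h]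
  counit := by
    have h := kerCoact_spec f
    apply DGModule.Hom.cancel _ (kerι_injective f.toHom)
    rw [← DGModule.Hom.comp_assoc, ← DGCoalgebra.idCounit_naturality, DGModule.Hom.comp_assoc, h,
      ← DGModule.Hom.comp_assoc, X.counit]
    rfl

/-- The inclusion of the kernel. -/
noncomputable def kerIncl (f : Hom X Y) : Hom (ker f) X where
  toHom := kerι f.toHom
  colinear := (kerCoact_spec f).symm

/-- The universal property of the kernel. -/
noncomputable def kerDesc {W : DGComodule C} (f : Hom X Y) (g : Hom W X)
    (h : ∀ w, f.toLin (g.toLin w) = 0) : Hom W (ker f) where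
  toHom := kerLift f.toHom g.toHom h
  colinear := by
    apply DGModule.Hom.cancel _
      (tensorHom_injective (kerι f.toHom) (kerι_injective f.toHom) C.toDGModule)
    rw [← DGModule.Hom.comp_assoc, kerCoact_spec, ← DGModule.Hom.comp_assoc, tensorHom_comp]
    exact g.colinear

end kernel

end DGComodule

namespace DGComodule

open DGModule

variable {k : Type u} [CommRing k] {C : DGCoalgebra k}

section cotensor

/-- `ρ_X ⊗ id : X ⊗ Y ⟶ X ⊗ C ⊗ Y`. -/
noncomputable def coactLeft (X Y : DGComodule C) :
    Hom (tensorLeft X.toDGModule Y) (tensorLeft X.toDGModule (tensorLeft C.toDGModule Y)) :=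
  (tensorLeftAssoc X.toDGModule C.toDGModule Y).comp (tensorLeftMap X.coact (Hom.id Y))

/-- `id ⊗ λ_Y : X ⊗ Y ⟶ X ⊗ C ⊗ Y`, for the left coaction `λ_Y`. -/
noncomputable def coactRight [C.IsCocommutative] (X Y : DGComodule C) :
    Hom (tensorLeft X.toDGModule Y) (tensorLeft X.toDGModule (tensorLeft C.toDGModule Y)) :=
  tensorLeftMap (DGModule.Hom.id X.toDGModule) Y.leftCoact

theorem coactLeft_naturality {X X' Y Y' : DGComodule C} (f : Hom X X') (g : Hom Y Y') :
    (coactLeft X' Y').comp (tensorLeftMap f.toHom g) =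
      (tensorLeftMap f.toHom (tensorLeftMap (DGModule.Hom.id _) g)).comp (coactLeft X Y) := by
  have h : (coactLeft X' Y').toHom.comp (tensorLeftMap f.toHom g).toHom =
      (tensorLeftMap f.toHom (tensorLeftMap (DGModule.Hom.id _) g)).toHom.comp
        (coactLeft X Y).toHom := by
    change ((assocHom _ _ _).comp (tensorHom X'.coact (DGModule.Hom.id _))).comp
        (tensorHom f.toHom g.toHom) =
      (tensorHom f.toHom (tensorHom (DGModule.Hom.id _) g.toHom)).comp
        ((assocHom _ _ _).comp (tensorHom X.coact (DGModule.Hom.id _)))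
    rw [DGModule.Hom.comp_assoc, tensorHom_comp, f.colinear, ← DGModule.Hom.comp_assoc,
      ← assoc_naturality, DGModule.Hom.comp_assoc, tensorHom_comp]
    rfl
  exact Hom.ext (congrArg DGModule.Hom.toLin h)

theorem leftCoact_naturality [C.IsCocommutative] {Y Y' : DGComodule C} (g : Hom Y Y') :
    Y'.leftCoact.toHom.comp g.toHom =
      (tensorHom (DGModule.Hom.id C.toDGModule) g.toHom).comp Y.leftCoact.toHom := by
  change ((braid _ _).comp Y'.coact).comp g.toHom =
    (tensorHom (DGModule.Hom.id C.toDGModule) g.toHom).comp ((braid _ _).comp Y.coact)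
  rw [DGModule.Hom.comp_assoc, g.colinear, ← DGModule.Hom.comp_assoc, braid_naturality]
  rfl

theorem coactRight_naturality [C.IsCocommutative] {X X' Y Y' : DGComodule C}
    (f : DGModule.Hom X.toDGModule X'.toDGModule) (g : Hom Y Y') :
    (coactRight X' Y').comp (tensorLeftMap f g) =
      (tensorLeftMap f (tensorLeftMap (DGModule.Hom.id _) g)).comp (coactRight X Y) := by
  have h : (coactRight X' Y').toHom.comp (tensorLeftMap f g).toHom =
      (tensorLeftMap f (tensorLeftMap (DGModule.Hom.id _) g)).toHom.comp
        (coactRight X Y).toHom := by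
    change (tensorHom (DGModule.Hom.id _) Y'.leftCoact.toHom).comp (tensorHom f g.toHom) =
      (tensorHom f (tensorHom (DGModule.Hom.id _) g.toHom)).comp
        (tensorHom (DGModule.Hom.id _) Y.leftCoact.toHom)
    rw [tensorHom_comp, tensorHom_comp, leftCoact_naturality]
    rfl
  exact Hom.ext (congrArg DGModule.Hom.toLin h)

theorem coactLeft_tensor (K : DGModule k) (T Y : DGComodule C) (κ : K)
    (z : T.toDGModule ⊗[k] Y.toDGModule) :
    (coactLeft (tensorLeft K T) Y).toLin
        ((assocInvHom K T.toDGModule Y.toDGModule).toLin (κ ⊗ₜ[k] z)) =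
      (assocInvHom K T.toDGModule (tensor C.toDGModule Y.toDGModule)).toLin
        (κ ⊗ₜ[k] (coactLeft T Y).toLin z) := by
  induction z using TensorProduct.induction_on with
  | zero => simp
  | add a b ha hb => simp only [TensorProduct.tmul_add, map_add, ha, hb]
  | tmul t y =>
    change (assocHom (tensor K T.toDGModule) C.toDGModule Y.toDGModule).toLin
        ((assocInvHom K T.toDGModule C.toDGModule).toLin (κ ⊗ₜ[k] T.coact.toLin t) ⊗ₜ[k] y) =
      (assocInvHom K T.toDGModule (tensor C.toDGModule Y.toDGModule)).toLin
        (κ ⊗ₜ[k] (assocHom T.toDGModule C.toDGModule Y.toDGModule).toLin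
          (T.coact.toLin t ⊗ₜ[k] y))
    induction T.coact.toLin t using TensorProduct.induction_on with
    | zero => simp
    | add a b ha hb =>
      simp only [TensorProduct.tmul_add, TensorProduct.add_tmul, map_add, ha, hb]
    | tmul a b => rfl

theorem coactRight_tensor [C.IsCocommutative] (K : DGModule k) (T Y : DGComodule C) (κ : K)
    (z : T.toDGModule ⊗[k] Y.toDGModule) :
    (coactRight (tensorLeft K T) Y).toLin
        ((assocInvHom K T.toDGModule Y.toDGModule).toLin (κ ⊗ₜ[k] z)) =
      (assocInvHom K T.toDGModule (tensor C.toDGModule Y.toDGModule)).toLin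
        (κ ⊗ₜ[k] (coactRight T Y).toLin z) := by
  induction z using TensorProduct.induction_on with
  | zero => simp
  | add a b ha hb => simp only [TensorProduct.tmul_add, map_add, ha, hb]
  | tmul t y => rfl

variable [C.IsCocommutative] [IsFiniteProductOfFields k]

/-- The cotensor product `X □_C Y`: the equalizer of `ρ_X ⊗ id` and `id ⊗ λ_Y` on `X ⊗ Y`, with
the coaction restricted from `id ⊗ ρ_Y`. -/
noncomputable abbrev cotensor (X Y : DGComodule C) : DGComodule C :=
  ker ((coactLeft X Y).sub (coactRight X Y))

/-- The inclusion `X □_C Y ⟶ X ⊗ Y`. -/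
noncomputable def cotensorIncl (X Y : DGComodule C) :
    Hom (cotensor X Y) (tensorLeft X.toDGModule Y) :=
  kerIncl _

theorem cotensor_condition {X Y : DGComodule C} (z : (cotensor X Y).toDGModule) :
    (coactLeft X Y).toLin ((cotensorIncl X Y).toLin z) =
      (coactRight X Y).toLin ((cotensorIncl X Y).toLin z) :=
  sub_eq_zero.1 z.2

/-- A map into `X ⊗ Y` that equalizes the coactions factors through `X □_C Y`. -/
noncomputable def cotensorLift {W X Y : DGComodule C} (g : Hom W (tensorLeft X.toDGModule Y))
    (h : ∀ w, (coactLeft X Y).toLin (g.toLin w) = (coactRight X Y).toLin (g.toLin w)) :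
    Hom W (cotensor X Y) :=
  kerDesc _ g fun w => sub_eq_zero.2 (h w)

/-- Functoriality of the cotensor product: the restriction of `f ⊗ g`. -/
noncomputable def cotensorMap {X X' Y Y' : DGComodule C} (f : Hom X X') (g : Hom Y Y') :
    Hom (cotensor X Y) (cotensor X' Y') :=
  cotensorLift ((tensorLeftMap f.toHom g).comp (cotensorIncl X Y)) fun z => by
    have h₁ := LinearMap.congr_fun (congrArg (fun h => h.toLin) (coactLeft_naturality f g))
      ((cotensorIncl X Y).toLin z)
    have h₂ := LinearMap.congr_fun (congrArg (fun h => h.toLin)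
      (coactRight_naturality (X := X) (X' := X') f.toHom g)) ((cotensorIncl X Y).toLin z)
    refine h₁.trans (Eq.trans ?_ h₂.symm)
    exact congrArg _ (cotensor_condition z)

theorem cotensorMap_comp {X X' X'' Y Y' Y'' : DGComodule C} (f : Hom X X') (f' : Hom X' X'')
    (g : Hom Y Y') (g' : Hom Y' Y'') :
    (cotensorMap f' g').comp (cotensorMap f g) = cotensorMap (f'.comp f) (g'.comp g) := by
  ext z
  exact LinearMap.congr_fun (congrArg DGModule.Hom.toLin
    (tensorHom_comp f.toHom f'.toHom g.toHom g'.toHom)) z.1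

theorem cotensorMap_id (X Y : DGComodule C) :
    cotensorMap (Hom.id X) (Hom.id Y) = Hom.id (cotensor X Y) := by
  ext z
  exact LinearMap.congr_fun (congrArg DGModule.Hom.toLin tensorHom_id) z.1

/-- `Y` is coflat: `Y □_C -` is exact. -/
def IsCoflat (Y : DGComodule C) : Prop :=
  ∀ (Z' Z Z'' : DGComodule C) (f : Hom Z' Z) (g : Hom Z Z''), Function.Injective f.toLin →
    Function.Exact f.toLin g.toLin → Function.Surjective g.toLin →
      Function.Injective (cotensorMap (Hom.id Y) f).toLin ∧
      Function.Exact (cotensorMap (Hom.id Y) f).toLin (cotensorMap (Hom.id Y) g).toLin ∧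
      Function.Surjective (cotensorMap (Hom.id Y) g).toLin

/-- The identification of `K ⊗ (T □_C Y)` with a part of `(K ⊗ T) □_C Y`, followed by `θ □_C Y`
for a map of comodules `θ : K ⊗ T ⟶ Z`. -/
noncomputable def tensorCotensorMap {K : DGModule k} {T Z : DGComodule C}
    (θ : Hom (tensorLeft K T) Z) (Y : DGComodule C) :
    Hom (tensorLeft K (cotensor T Y)) (cotensor Z Y) :=
  cotensorLift ((tensorLeftMap θ.toHom (Hom.id Y)).comp
    ((tensorLeftAssocInv K T.toDGModule Y).comp
      (tensorLeftMap (DGModule.Hom.id K) (cotensorIncl T Y)))) (by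
    intro w
    have h₁ := LinearMap.congr_fun (congrArg (fun h => h.toLin)
      (coactLeft_naturality θ (Hom.id Y)))
    have h₂ := LinearMap.congr_fun (congrArg (fun h => h.toLin)
      (coactRight_naturality (X := tensorLeft K T) (X' := Z) θ.toHom (Hom.id Y)))
    refine (h₁ _).trans (Eq.trans ?_ (h₂ _).symm)
    have h : ∀ w : K ⊗[k] (cotensor T Y).toDGModule,
        (coactLeft (tensorLeft K T) Y).toLin ((assocInvHom K T.toDGModule Y.toDGModule).toLin
          (TensorProduct.map LinearMap.id (cotensorIncl T Y).toLin w)) =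
        (coactRight (tensorLeft K T) Y).toLin ((assocInvHom K T.toDGModule Y.toDGModule).toLin
          (TensorProduct.map LinearMap.id (cotensorIncl T Y).toLin w)) := by
      intro w
      induction w using TensorProduct.induction_on with
      | zero => simp
      | add a b ha hb => simp only [map_add, ha, hb]
      | tmul κ z =>
        rw [TensorProduct.map_tmul, LinearMap.id_apply, coactLeft_tensor, coactRight_tensor,
          cotensor_condition]
    exact congrArg (tensorLeftMap θ.toHom
      (tensorLeftMap (DGModule.Hom.id C.toDGModule) (Hom.id Y))).toLin (h w))

theorem tensorCotensorMap_precomp {K K' : DGModule k} {T Z : DGComodule C}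
    (θ : Hom (tensorLeft K' T) Z) (a : DGModule.Hom K K') (Y : DGComodule C) :
    tensorCotensorMap (θ.comp (tensorLeftMap a (Hom.id T))) Y =
      (tensorCotensorMap θ Y).comp (tensorLeftMap a (Hom.id (cotensor T Y))) := by
  ext1
  refine TensorProduct.ext' fun κ z => Subtype.ext ?_
  change TensorProduct.map (θ.toLin ∘ₗ TensorProduct.map a.toLin LinearMap.id) LinearMap.id
      ((assocInvHom K T.toDGModule Y.toDGModule).toLin (κ ⊗ₜ[k] z.1)) =
    TensorProduct.map θ.toLin LinearMap.id
      ((assocInvHom K' T.toDGModule Y.toDGModule).toLin (a.toLin κ ⊗ₜ[k] z.1))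
  induction z.1 using TensorProduct.induction_on with
  | zero => simp
  | add x y hx hy => simp only [TensorProduct.tmul_add, map_add, hx, hy]
  | tmul x y => rfl

theorem tensorCotensorMap_postcomp {K : DGModule k} {T Z Z' : DGComodule C}
    (θ : Hom (tensorLeft K T) Z) (f : Hom Z Z') (Y : DGComodule C) :
    tensorCotensorMap (f.comp θ) Y =
      (cotensorMap f (Hom.id Y)).comp (tensorCotensorMap θ Y) := by
  ext1
  refine TensorProduct.ext' fun κ z => Subtype.ext ?_
  change TensorProduct.map (f.toLin ∘ₗ θ.toLin) LinearMap.id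
      ((assocInvHom K T.toDGModule Y.toDGModule).toLin (κ ⊗ₜ[k] z.1)) =
    TensorProduct.map f.toLin LinearMap.id (TensorProduct.map θ.toLin LinearMap.id
      ((assocInvHom K T.toDGModule Y.toDGModule).toLin (κ ⊗ₜ[k] z.1)))
  exact LinearMap.congr_fun (TensorProduct.map_comp f.toLin LinearMap.id θ.toLin LinearMap.id) _

end cotensor

end DGComodule

open DGComodule in
/-- A cosimplicial object in the category of `C`-comodules, given by cofaces and codegeneracies
satisfying the cosimplicial identities. -/
structure CosimplicialComodule {k : Type u} [CommRing k] (C : DGCoalgebra k) where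
  obj : ℕ → DGComodule C
  δ : ∀ {n : ℕ} (_ : Fin (n + 2)), Hom (obj n) (obj (n + 1))
  σ : ∀ {n : ℕ} (_ : Fin (n + 1)), Hom (obj (n + 1)) (obj n)
  δ_comp_δ : ∀ {n : ℕ} {i j : Fin (n + 2)}, i ≤ j →
    (δ j.succ).comp (δ i) = (δ i.castSucc).comp (δ j)
  δ_comp_σ_of_le : ∀ {n : ℕ} {i : Fin (n + 2)} {j : Fin (n + 1)}, i ≤ j.castSucc →
    (σ j.succ).comp (δ i.castSucc) = (δ i).comp (σ j)
  δ_comp_σ_self : ∀ {n : ℕ} {i : Fin (n + 1)}, (σ i).comp (δ i.castSucc) = Hom.id (obj n)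
  δ_comp_σ_succ : ∀ {n : ℕ} {i : Fin (n + 1)}, (σ i).comp (δ i.succ) = Hom.id (obj n)
  δ_comp_σ_of_gt : ∀ {n : ℕ} {i : Fin (n + 2)} {j : Fin (n + 1)}, j.castSucc < i →
    (σ j.castSucc).comp (δ i.succ) = (δ i).comp (σ j)
  σ_comp_σ : ∀ {n : ℕ} {i j : Fin (n + 1)}, i ≤ j →
    (σ j).comp (σ i.castSucc) = (σ i).comp (σ j.succ)

open DGComodule in
/-- Maps of cosimplicial comodules. -/
structure CosimplicialComodule.Hom {k : Type u} [CommRing k] {C : DGCoalgebra k}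
    (Φ Ψ : CosimplicialComodule C) where
  app : ∀ n, DGComodule.Hom (Φ.obj n) (Ψ.obj n)
  app_δ : ∀ {n : ℕ} (i : Fin (n + 2)), (app (n + 1)).comp (Φ.δ i) = (Ψ.δ i).comp (app n)
  app_σ : ∀ {n : ℕ} (i : Fin (n + 1)), (app n).comp (Φ.σ i) = (Ψ.σ i).comp (app (n + 1))

namespace DGComodule

open DGModule

variable {k : Type u} [CommRing k] {C : DGCoalgebra k}

section cobar

/-- `X ⊗ C^{⊗ n}`. -/
noncomputable def pow (X : DGComodule C) : ℕ → DGModule k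
  | 0 => X.toDGModule
  | n + 1 => tensor (X.pow n) C.toDGModule

/-- For `i ≤ n`, the map `X ⊗ C^{⊗ n} ⟶ X ⊗ C^{⊗ (n + 1)}` given by the coaction of `X` if
`i = 0` and by the comultiplication of the `i`-th factor `C` if `i ≥ 1`. -/
noncomputable def coface (X : DGComodule C) :
    ∀ n : ℕ, ℕ → DGModule.Hom (X.pow n) (X.pow (n + 1))
  | 0, _ => X.coact
  | n + 1, i =>
    if i ≤ n then tensorHom (X.coface n i) (DGModule.Hom.id C.toDGModule) else C.idComul (X.pow n)

/-- For `j ≤ n`, the map `X ⊗ C^{⊗ (n + 1)} ⟶ X ⊗ C^{⊗ n}` given by the counit of the factor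
`C` that has `j` factors `C` to its left. -/
noncomputable def codegeneracy (X : DGComodule C) :
    ∀ n : ℕ, ℕ → DGModule.Hom (X.pow (n + 1)) (X.pow n)
  | 0, _ => C.idCounit X.toDGModule
  | n + 1, j =>
    if j ≤ n then tensorHom (X.codegeneracy n j) (DGModule.Hom.id C.toDGModule)
    else C.idCounit (X.pow (n + 1))

variable (X : DGComodule C)

theorem coface_succ_of_le {n i : ℕ} (h : i ≤ n) :
    X.coface (n + 1) i = tensorHom (X.coface n i) (DGModule.Hom.id C.toDGModule) :=
  if_pos h

theorem coface_succ_self (n : ℕ) : X.coface (n + 1) (n + 1) = C.idComul (X.pow n) :=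
  if_neg (by omega)

theorem codegeneracy_succ_of_le {n i : ℕ} (h : i ≤ n) :
    X.codegeneracy (n + 1) i = tensorHom (X.codegeneracy n i) (DGModule.Hom.id C.toDGModule) :=
  if_pos h

theorem codegeneracy_self (n : ℕ) : X.codegeneracy n n = C.idCounit (X.pow n) := by
  cases n with
  | zero => rfl
  | succ n => exact if_neg (by omega)

theorem coface_coface {n i j : ℕ} (hij : i ≤ j) (hj : j ≤ n) :
    (X.coface (n + 1) (j + 1)).comp (X.coface n i) =
      (X.coface (n + 1) i).comp (X.coface n j) := by
  induction n with
  | zero =>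
    obtain rfl : j = 0 := by omega
    obtain rfl : i = 0 := by omega
    rw [X.coface_succ_self, X.coface_succ_of_le le_rfl]
    exact X.coassoc.symm
  | succ n ih =>
    rcases Nat.lt_or_ge n j with hj' | hj'
    · obtain rfl : j = n + 1 := by omega
      rw [X.coface_succ_self, X.coface_succ_of_le (n := n + 1) hij, X.coface_succ_self]
      rcases Nat.lt_or_ge n i with hi | hi
      · obtain rfl : i = n + 1 := by omega
        rw [X.coface_succ_self]
        exact (DGCoalgebra.idComul_idComul _).symm
      · rw [X.coface_succ_of_le hi]
        exact DGCoalgebra.idComul_naturality _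
    · rw [X.coface_succ_of_le (n := n + 1) (i := j + 1) (by omega),
        X.coface_succ_of_le (n := n) (i := i) (by omega),
        X.coface_succ_of_le (n := n + 1) (i := i) (by omega),
        X.coface_succ_of_le (n := n) (i := j) hj']
      refine (tensorHom_comp _ _ _ _).trans (Eq.trans ?_ (tensorHom_comp _ _ _ _).symm)
      rw [ih hj']

theorem codegeneracy_coface_of_le {n i j : ℕ} (hij : i ≤ j) (hj : j ≤ n) :
    (X.codegeneracy (n + 1) (j + 1)).comp (X.coface (n + 1) i) =
      (X.coface n i).comp (X.codegeneracy n j) := by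
  induction n with
  | zero =>
    obtain rfl : j = 0 := by omega
    obtain rfl : i = 0 := by omega
    rw [X.codegeneracy_self, X.coface_succ_of_le le_rfl]
    exact DGCoalgebra.idCounit_naturality _
  | succ n ih =>
    rcases Nat.lt_or_ge n j with hj' | hj'
    · obtain rfl : j = n + 1 := by omega
      rw [X.codegeneracy_self, X.codegeneracy_self, X.coface_succ_of_le (n := n + 1) hij]
      exact DGCoalgebra.idCounit_naturality _
    · rw [X.coface_succ_of_le (n := n) (i := i) (by omega),
        X.codegeneracy_succ_of_le (n := n) (i := j) hj',
        X.codegeneracy_succ_of_le (n := n + 1) (i := j + 1) (by omega),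
        X.coface_succ_of_le (n := n + 1) (i := i) (by omega)]
      refine (tensorHom_comp _ _ _ _).trans (Eq.trans ?_ (tensorHom_comp _ _ _ _).symm)
      rw [ih hj']

theorem codegeneracy_coface_self {n i : ℕ} (hi : i ≤ n) :
    (X.codegeneracy n i).comp (X.coface n i) = DGModule.Hom.id _ := by
  induction n with
  | zero => exact X.counit
  | succ n ih =>
    rcases Nat.lt_or_ge n i with hi' | hi'
    · obtain rfl : i = n + 1 := by omega
      rw [X.codegeneracy_self, X.coface_succ_self]
      exact DGCoalgebra.idCounit_idComul _
    · rw [X.codegeneracy_succ_of_le hi', X.coface_succ_of_le hi']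
      refine (tensorHom_comp _ _ _ _).trans ?_
      rw [ih hi']
      exact tensorHom_id

theorem codegeneracy_coface_succ {n i : ℕ} (hi : i ≤ n) :
    (X.codegeneracy (n + 1) i).comp (X.coface (n + 1) (i + 1)) = DGModule.Hom.id _ := by
  induction n with
  | zero =>
    obtain rfl : i = 0 := by omega
    rw [X.coface_succ_self, X.codegeneracy_succ_of_le le_rfl]
    exact DGCoalgebra.idCounit_tensor_idComul _
  | succ n ih =>
    rcases Nat.lt_or_ge n i with hi' | hi'
    · obtain rfl : i = n + 1 := by omega
      rw [X.coface_succ_self, X.codegeneracy_succ_of_le le_rfl, X.codegeneracy_self]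
      exact DGCoalgebra.idCounit_tensor_idComul _
    · rw [X.codegeneracy_succ_of_le (n := n + 1) (by omega),
        X.coface_succ_of_le (n := n + 1) (by omega)]
      refine (tensorHom_comp _ _ _ _).trans ?_
      rw [ih hi']
      exact tensorHom_id

theorem codegeneracy_coface_of_gt {n i j : ℕ} (hij : j < i) (hi : i ≤ n) :
    (X.codegeneracy (n + 1) j).comp (X.coface (n + 1) (i + 1)) =
      (X.coface n i).comp (X.codegeneracy n j) := by
  induction n with
  | zero => omega
  | succ n ih =>
    rcases Nat.lt_or_ge n i with hi' | hi'
    · obtain rfl : i = n + 1 := by omega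
      rw [X.coface_succ_self, X.coface_succ_self,
        X.codegeneracy_succ_of_le (n := n + 1) (i := j) (by omega),
        X.codegeneracy_succ_of_le (n := n) (i := j) (by omega)]
      exact (DGCoalgebra.idComul_naturality _).symm
    · rw [X.coface_succ_of_le (n := n) (i := i) hi',
        X.codegeneracy_succ_of_le (n := n) (i := j) (by omega),
        X.coface_succ_of_le (n := n + 1) (i := i + 1) (by omega),
        X.codegeneracy_succ_of_le (n := n + 1) (i := j) (by omega)]
      refine (tensorHom_comp _ _ _ _).trans (Eq.trans ?_ (tensorHom_comp _ _ _ _).symm)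
      rw [ih hi']

theorem codegeneracy_codegeneracy {n i j : ℕ} (hij : i ≤ j) (hj : j ≤ n) :
    (X.codegeneracy n j).comp (X.codegeneracy (n + 1) i) =
      (X.codegeneracy n i).comp (X.codegeneracy (n + 1) (j + 1)) := by
  induction n with
  | zero =>
    obtain rfl : j = 0 := by omega
    obtain rfl : i = 0 := by omega
    rw [X.codegeneracy_self 1, X.codegeneracy_succ_of_le le_rfl]
    exact DGCoalgebra.idCounit_naturality _
  | succ n ih =>
    rcases Nat.lt_or_ge n j with hj' | hj'
    · obtain rfl : j = n + 1 := by omega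
      rw [X.codegeneracy_self (n + 1), X.codegeneracy_self (n + 1 + 1),
        X.codegeneracy_succ_of_le (n := n + 1) hij]
      exact DGCoalgebra.idCounit_naturality _
    · rw [X.codegeneracy_succ_of_le (n := n) (i := j) hj',
        X.codegeneracy_succ_of_le (n := n) (i := i) (by omega),
        X.codegeneracy_succ_of_le (n := n + 1) (i := i) (by omega),
        X.codegeneracy_succ_of_le (n := n + 1) (i := j + 1) (by omega)]
      refine (tensorHom_comp _ _ _ _).trans (Eq.trans ?_ (tensorHom_comp _ _ _ _).symm)
      rw [ih hj']

theorem Hom.ext_toHom {X Y : DGComodule C} {f g : Hom X Y} (h : f.toHom = g.toHom) : f = g :=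
  Hom.ext (congrArg DGModule.Hom.toLin h)

/-- The comodule `Ω^n(X, C, C) = X ⊗ C^{⊗ (n + 1)}`, with the coaction given by the
comultiplication of the last factor. -/
noncomputable def cobarObj (n : ℕ) : DGComodule C := tensorLeft (X.pow n) (regular C)

/-- The coface `d^i : Ω^n(X, C, C) ⟶ Ω^{n+1}(X, C, C)`. -/
noncomputable def cobarδ {n : ℕ} (i : Fin (n + 2)) : Hom (X.cobarObj n) (X.cobarObj (n + 1)) where
  toHom := X.coface (n + 1) i
  colinear := by
    obtain ⟨i, hi⟩ := i
    rcases Nat.lt_or_ge n i with hi' | hi'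
    · obtain rfl : i = n + 1 := by omega
      dsimp only
      rw [X.coface_succ_self]
      exact (DGCoalgebra.idComul_idComul _).symm
    · dsimp only
      rw [X.coface_succ_of_le hi']
      exact DGCoalgebra.idComul_naturality _

/-- The codegeneracy `s^j : Ω^{n+1}(X, C, C) ⟶ Ω^n(X, C, C)`. -/
noncomputable def cobarσ {n : ℕ} (j : Fin (n + 1)) : Hom (X.cobarObj (n + 1)) (X.cobarObj n) where
  toHom := X.codegeneracy (n + 1) j
  colinear := by
    obtain ⟨j, hj⟩ := j
    dsimp only
    rw [X.codegeneracy_succ_of_le (by omega)]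
    exact DGCoalgebra.idComul_naturality _

/-- The two-sided cosimplicial cobar construction `Ω^•(X, C, C)`. -/
noncomputable def cobar : CosimplicialComodule C where
  obj := X.cobarObj
  δ := X.cobarδ
  σ := X.cobarσ
  δ_comp_δ {n i j} h := Hom.ext_toHom (X.coface_coface h (by omega))
  δ_comp_σ_of_le {n i j} h := Hom.ext_toHom (X.codegeneracy_coface_of_le h (by omega))
  δ_comp_σ_self {n i} := Hom.ext_toHom (X.codegeneracy_coface_self (n := n + 1) (i := i) (by omega))
  δ_comp_σ_succ {n i} := Hom.ext_toHom (X.codegeneracy_coface_succ (n := n) (i := i) (by omega))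
  δ_comp_σ_of_gt {n i j} h := Hom.ext_toHom (X.codegeneracy_coface_of_gt h (by omega))
  σ_comp_σ {n i j} h := Hom.ext_toHom (X.codegeneracy_codegeneracy (n := n + 1) h (by omega))

/-- The coaugmentation `X ⟶ X ⊗ C = Ω^0(X, C, C)`, the coaction of `X`. -/
noncomputable def cobarCoaugZero : Hom X (X.cobar.obj 0) where
  toHom := X.coact
  colinear := X.coassoc.symm

/-- The coaugmentation `X ⟶ Ω^n(X, C, C)`. -/
noncomputable def cobarCoaug (X : DGComodule C) : ∀ n : ℕ, Hom X (X.cobar.obj n)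
  | 0 => X.cobarCoaugZero
  | n + 1 => (X.cobar.δ 0).comp (X.cobarCoaug n)

variable {X} {X' : DGComodule C}

/-- `f ⊗ id : X ⊗ C^{⊗ n} ⟶ X' ⊗ C^{⊗ n}`. -/
noncomputable def powMap (f : Hom X X') : ∀ n : ℕ, DGModule.Hom (X.pow n) (X'.pow n)
  | 0 => f.toHom
  | n + 1 => tensorHom (powMap f n) (DGModule.Hom.id C.toDGModule)

theorem powMap_coface (f : Hom X X') (n i : ℕ) :
    (powMap f (n + 1)).comp (X.coface n i) = (X'.coface n i).comp (powMap f n) := by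
  induction n with
  | zero => exact f.colinear.symm
  | succ n ih =>
    by_cases h : i ≤ n
    · rw [X.coface_succ_of_le h, X'.coface_succ_of_le h]
      refine (tensorHom_comp _ _ _ _).trans (Eq.trans ?_ (tensorHom_comp _ _ _ _).symm)
      rw [ih]
    · rw [show X.coface (n + 1) i = C.idComul (X.pow n) from if_neg h,
        show X'.coface (n + 1) i = C.idComul (X'.pow n) from if_neg h]
      exact (DGCoalgebra.idComul_naturality _).symm

theorem powMap_codegeneracy (f : Hom X X') (n i : ℕ) :
    (powMap f n).comp (X.codegeneracy n i) = (X'.codegeneracy n i).comp (powMap f (n + 1)) := by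
  induction n with
  | zero => exact (DGCoalgebra.idCounit_naturality _).symm
  | succ n ih =>
    by_cases h : i ≤ n
    · rw [X.codegeneracy_succ_of_le h, X'.codegeneracy_succ_of_le h]
      refine (tensorHom_comp _ _ _ _).trans (Eq.trans ?_ (tensorHom_comp _ _ _ _).symm)
      rw [ih]
    · rw [show X.codegeneracy (n + 1) i = C.idCounit (X.pow (n + 1)) from if_neg h,
        show X'.codegeneracy (n + 1) i = C.idCounit (X'.pow (n + 1)) from if_neg h]
      exact (DGCoalgebra.idCounit_naturality _).symm

/-- Functoriality of `Ω^•(X, C, C)` in `X`. -/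
noncomputable def cobarMap (f : Hom X X') : CosimplicialComodule.Hom X.cobar X'.cobar where
  app n := tensorLeftMap (powMap f n) (Hom.id (regular C))
  app_δ {n} i := Hom.ext_toHom (powMap_coface f (n + 1) i)
  app_σ {n} i := Hom.ext_toHom (powMap_codegeneracy f (n + 1) i)

end cobar

end DGComodule

namespace CosimplicialComodule

open DGComodule

variable {k : Type u} [CommRing k] {C : DGCoalgebra k} [C.IsCocommutative]
  [IsFiniteProductOfFields k]

/-- The cosimplicial comodule `Φ □_C Y`. -/
noncomputable def cotensor (Φ : CosimplicialComodule C) (Y : DGComodule C) :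
    CosimplicialComodule C where
  obj n := DGComodule.cotensor (Φ.obj n) Y
  δ i := cotensorMap (Φ.δ i) (DGComodule.Hom.id Y)
  σ i := cotensorMap (Φ.σ i) (DGComodule.Hom.id Y)
  δ_comp_δ h := by rw [cotensorMap_comp, cotensorMap_comp, Φ.δ_comp_δ h]
  δ_comp_σ_of_le h := by rw [cotensorMap_comp, cotensorMap_comp, Φ.δ_comp_σ_of_le h]
  δ_comp_σ_self := by
    intros
    rw [cotensorMap_comp, Φ.δ_comp_σ_self]
    exact cotensorMap_id _ _
  δ_comp_σ_succ := by
    intros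
    rw [cotensorMap_comp, Φ.δ_comp_σ_succ]
    exact cotensorMap_id _ _
  δ_comp_σ_of_gt h := by rw [cotensorMap_comp, cotensorMap_comp, Φ.δ_comp_σ_of_gt h]
  σ_comp_σ h := by rw [cotensorMap_comp, cotensorMap_comp, Φ.σ_comp_σ h]

/-- Functoriality of `Φ □_C Y`. -/
noncomputable def cotensorHom {Φ Ψ : CosimplicialComodule C} {Y Y' : DGComodule C}
    (f : Hom Φ Ψ) (g : DGComodule.Hom Y Y') : Hom (Φ.cotensor Y) (Ψ.cotensor Y') where
  app n := cotensorMap (f.app n) g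
  app_δ i := by
    refine (cotensorMap_comp _ _ _ _).trans (Eq.trans ?_ (cotensorMap_comp _ _ _ _).symm)
    rw [f.app_δ i]
    rfl
  app_σ i := by
    refine (cotensorMap_comp _ _ _ _).trans (Eq.trans ?_ (cotensorMap_comp _ _ _ _).symm)
    rw [f.app_σ i]
    rfl

end CosimplicialComodule

namespace DGModule

open CategoryTheory

variable {k : Type u} [CommRing k]

section chainComplex

/-- The degree `n` part of `⨁ n, K_n`. -/
def ofChainComplexGr (K : ChainComplex (ModuleCat.{u} k) ℕ) (n : ℕ) :
    Submodule k (DirectSum ℕ fun n => K.X n) :=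
  LinearMap.range (DirectSum.lof k ℕ (fun n => K.X n) n)

theorem ofChainComplexGr_isInternal (K : ChainComplex (ModuleCat.{u} k) ℕ) :
    DirectSum.IsInternal (ofChainComplexGr K) := by
  refine isInternal_of_proj _ (fun n => DirectSum.lof k ℕ (fun n => K.X n) n ∘ₗ
    DirectSum.component k ℕ (fun n => K.X n) n) ?_ ?_ ?_
  · rintro n _ ⟨x, rfl⟩
    rw [LinearMap.comp_apply, DirectSum.component.lof_self]
  · rintro m n hmn _ ⟨x, rfl⟩
    rw [LinearMap.comp_apply, DirectSum.component.of, dif_neg (Ne.symm hmn), map_zero]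
  · rw [eq_top_iff]
    rintro x -
    induction x using DirectSum.induction_on with
    | zero => exact zero_mem _
    | of n x => exact Submodule.mem_iSup_of_mem n ⟨x, rfl⟩
    | add x y hx hy => exact add_mem hx hy

/-- The differential of `⨁ n, K_n`. -/
noncomputable def ofChainComplexD (K : ChainComplex (ModuleCat.{u} k) ℕ) :
    (DirectSum ℕ fun n => K.X n) →ₗ[k] DirectSum ℕ fun n => K.X n :=
  DirectSum.toModule k ℕ _ fun n =>
    DirectSum.lof k ℕ (fun n => K.X n) (n - 1) ∘ₗ (K.d n (n - 1)).hom

theorem ofChainComplexD_lof (K : ChainComplex (ModuleCat.{u} k) ℕ) (n : ℕ) (x : K.X n) :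
    ofChainComplexD K (DirectSum.lof k ℕ (fun n => K.X n) n x) =
      DirectSum.lof k ℕ (fun n => K.X n) (n - 1) ((K.d n (n - 1)).hom x) := by
  rw [ofChainComplexD, DirectSum.toModule_lof, LinearMap.comp_apply]

/-- The total module `⨁ n, K_n` of a chain complex. -/
noncomputable abbrev ofChainComplex (K : ChainComplex (ModuleCat.{u} k) ℕ) : DGModule k where
  carrier := DirectSum ℕ fun n => K.X n
  gr := ofChainComplexGr K
  isInternal := ofChainComplexGr_isInternal K
  d := ofChainComplexD K
  d_mem := by
    rintro n _ ⟨x, rfl⟩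
    rw [ofChainComplexD_lof]
    exact ⟨_, rfl⟩
  d_zero := by
    rintro _ ⟨x, rfl⟩
    rw [ofChainComplexD_lof, K.shape 0 (0 - 1) (by simp)]
    simp
  d_d := by
    refine DirectSum.linearMap_ext k fun n => LinearMap.ext fun x => ?_
    rw [LinearMap.comp_apply, LinearMap.comp_apply, ofChainComplexD_lof, ofChainComplexD_lof]
    have h : (K.d (n - 1) (n - 1 - 1)).hom ((K.d n (n - 1)).hom x) = 0 := by
      rw [← ModuleCat.comp_apply, K.d_comp_d]
      rfl
    rw [h, map_zero]
    rfl

/-- The linear map `⨁ n, K_n ⟶ ⨁ n, L_n` induced by a chain map. -/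
noncomputable def ofChainComplexMapLin {K L : ChainComplex (ModuleCat.{u} k) ℕ} (f : K ⟶ L) :
    (DirectSum ℕ fun n => K.X n) →ₗ[k] DirectSum ℕ fun n => L.X n :=
  DirectSum.toModule k ℕ _ fun n => DirectSum.lof k ℕ (fun n => L.X n) n ∘ₗ (f.f n).hom

theorem ofChainComplexMapLin_lof {K L : ChainComplex (ModuleCat.{u} k) ℕ} (f : K ⟶ L) (n : ℕ)
    (x : K.X n) : ofChainComplexMapLin f (DirectSum.lof k ℕ (fun n => K.X n) n x) =
      DirectSum.lof k ℕ (fun n => L.X n) n ((f.f n).hom x) := by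
  rw [ofChainComplexMapLin, DirectSum.toModule_lof, LinearMap.comp_apply]

/-- The chain map `⨁ n, K_n ⟶ ⨁ n, L_n` induced by a chain map. -/
noncomputable def ofChainComplexMap {K L : ChainComplex (ModuleCat.{u} k) ℕ} (f : K ⟶ L) :
    Hom (ofChainComplex K) (ofChainComplex L) where
  toLin := ofChainComplexMapLin f
  map_mem := by
    rintro n _ ⟨x, rfl⟩
    exact ⟨(f.f n).hom x, (ofChainComplexMapLin_lof f n x).symm⟩
  map_d := by
    refine DirectSum.linearMap_ext k fun n => LinearMap.ext fun x => ?_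
    rw [LinearMap.comp_apply, LinearMap.comp_apply, LinearMap.comp_apply, LinearMap.comp_apply,
      ofChainComplexD_lof, ofChainComplexMapLin_lof, ofChainComplexMapLin_lof,
      ofChainComplexD_lof, ← ModuleCat.comp_apply, ← ModuleCat.comp_apply, f.comm]

end chainComplex

/-- The functor `[n] ↦ k[N(Δ ↓ [n])]`: the free simplicial module on the nerve of the
category of objects over `[n]` in the simplex category. -/
noncomputable def overNerveModule (k : Type u) [CommRing k] :
    SimplexCategory ⥤ SimplicialObject (ModuleCat.{u} k) :=
  Over.mapFunctor SimplexCategory ⋙ nerveFunctor ⋙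
    (SimplicialObject.whiskering _ _).obj (uliftFunctor.{u, 0} ⋙ ModuleCat.free k)

/-- The functor `[n] ↦ N_*(N(Δ ↓ [n]); k)`, the normalized chains on the nerve of `Δ ↓ [n]`. -/
noncomputable def overChains (k : Type u) [CommRing k] :
    SimplexCategory ⥤ ChainComplex (ModuleCat.{u} k) ℕ :=
  overNerveModule k ⋙ AlgebraicTopology.normalizedMooreComplex (ModuleCat.{u} k)

/-- The complex `N_*(N(Δ ↓ [n]); k)`. -/
noncomputable abbrev weight (k : Type u) [CommRing k] (n : ℕ) : DGModule k :=
  ofChainComplex ((overChains k).obj (SimplexCategory.mk n))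

/-- The chain map induced by the `i`-th coface `[n] ⟶ [n + 1]`. -/
noncomputable def weightδ (k : Type u) [CommRing k] {n : ℕ} (i : Fin (n + 2)) :
    Hom (weight k n) (weight k (n + 1)) :=
  ofChainComplexMap ((overChains k).map (SimplexCategory.δ i))

/-- The chain map induced by the `i`-th codegeneracy `[n + 1] ⟶ [n]`. -/
noncomputable def weightσ (k : Type u) [CommRing k] {n : ℕ} (i : Fin (n + 1)) :
    Hom (weight k (n + 1)) (weight k n) :=
  ofChainComplexMap ((overChains k).map (SimplexCategory.σ i))

/-- The augmentation `N_*(N(Δ ↓ [n]); k) ⟶ k`, which sends every vertex to `1`. -/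
noncomputable def weightAug (k : Type u) [CommRing k] (n : ℕ) : weight k n →ₗ[k] k :=
  DirectSum.toModule k ℕ k fun p => match p with
    | 0 => Finsupp.linearCombination k (fun _ => (1 : k)) ∘ₗ
        (((AlgebraicTopology.inclusionOfMooreComplex (ModuleCat.{u} k)).app
          ((overNerveModule k).obj (SimplexCategory.mk n))).f 0).hom
    | _ + 1 => 0

end DGModule

section homotopyLimit

open DGModule DGComodule

/-- A comodule `pt` with a natural family of maps `N_*(N(Δ ↓ [n]); k) ⊗ pt ⟶ Φ^n`; equivalently, a
compatible family of maps from `pt` to the cotensors `(Φ^n)^{N(Δ ↓ [n])}`. -/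
structure HolimCone {k : Type u} [CommRing k] {C : DGCoalgebra k} (Φ : CosimplicialComodule C) where
  pt : DGComodule C
  θ : ∀ n, DGComodule.Hom (tensorLeft (weight k n) pt) (Φ.obj n)
  θ_δ : ∀ {n : ℕ} (i : Fin (n + 2)),
    (θ (n + 1)).comp (tensorLeftMap (weightδ k i) (DGComodule.Hom.id pt)) = (Φ.δ i).comp (θ n)
  θ_σ : ∀ {n : ℕ} (i : Fin (n + 1)),
    (θ n).comp (tensorLeftMap (weightσ k i) (DGComodule.Hom.id pt)) = (Φ.σ i).comp (θ (n + 1))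

namespace HolimCone

variable {k : Type u} [CommRing k] {C : DGCoalgebra k} {Φ Ψ : CosimplicialComodule C}

/-- The homotopy limit of `Φ` in comodules is the end of the cotensors
`(Φ^n)^{N(Δ ↓ [n])}`, that is, a universal cone. -/
def IsHolim (T : HolimCone Φ) : Prop :=
  ∀ S : HolimCone Φ, ∃! f : DGComodule.Hom S.pt T.pt,
    ∀ n, (T.θ n).comp (tensorLeftMap (DGModule.Hom.id (weight k n)) f) = S.θ n

/-- The map to a homotopy limit induced by a cone. -/
noncomputable def IsHolim.lift {T : HolimCone Φ} (hT : T.IsHolim) (S : HolimCone Φ) :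
    DGComodule.Hom S.pt T.pt :=
  (hT S).choose

/-- The composition of a cone with a map of cosimplicial comodules. -/
noncomputable def postcomp (T : HolimCone Φ) (f : CosimplicialComodule.Hom Φ Ψ) :
    HolimCone Ψ where
  pt := T.pt
  θ n := (f.app n).comp (T.θ n)
  θ_δ i := (congrArg ((f.app _).comp ·) (T.θ_δ i)).trans
    (congrArg (DGComodule.Hom.comp · (T.θ _)) (f.app_δ i))
  θ_σ i := (congrArg ((f.app _).comp ·) (T.θ_σ i)).trans
    (congrArg (DGComodule.Hom.comp · (T.θ _)) (f.app_σ i))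

/-- The map induced on homotopy limits by a map of cosimplicial comodules. -/
noncomputable def holimMap (T : HolimCone Φ) {T' : HolimCone Ψ} (hT' : T'.IsHolim)
    (f : CosimplicialComodule.Hom Φ Ψ) : DGComodule.Hom T.pt T'.pt :=
  hT'.lift (T.postcomp f)

section cotensor

variable [C.IsCocommutative] [IsFiniteProductOfFields k]

/-- The cone `T □_C Y` over `Φ □_C Y`. -/
noncomputable def cotensor (T : HolimCone Φ) (Y : DGComodule C) : HolimCone (Φ.cotensor Y) where
  pt := DGComodule.cotensor T.pt Y
  θ n := tensorCotensorMap (T.θ n) Y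
  θ_δ i := by
    refine (tensorCotensorMap_precomp _ _ _).symm.trans ?_
    rw [T.θ_δ i]
    exact tensorCotensorMap_postcomp _ _ _
  θ_σ i := by
    refine (tensorCotensorMap_precomp _ _ _).symm.trans ?_
    rw [T.θ_σ i]
    exact tensorCotensorMap_postcomp _ _ _

/-- The canonical map `(holim Φ) □_C Y ⟶ holim (Φ □_C Y)`. -/
noncomputable def comparison (T : HolimCone Φ) {Y : DGComodule C} {S : HolimCone (Φ.cotensor Y)}
    (hS : S.IsHolim) : DGComodule.Hom (DGComodule.cotensor T.pt Y) S.pt :=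
  hS.lift (T.cotensor Y)

end cotensor

end HolimCone

end homotopyLimit

/-! Since `k` is semisimple, every module is flat and projective, acyclic complexes are
contractible, and quasi-isomorphisms of complexes are homotopy equivalences. Hence tensor products
preserve injections, exactness and quasi-isomorphisms.

Existence of homotopy limits. The natural families `N_*(N(Δ ↓ [n]); k) ⟶ Φ^n` form a complex `lim
Φ`, but not a comodule in an evident way, because `- ⊗ C` does not commute with infinite products.
The cofree comodule `V ⊗ C` is right adjoint to the forgetful functor, so the end in comodules is
the equalizer of two maps of cofree comodules `lim Φ ⊗ C ⇉ lim (Φ ⊗ C) ⊗ C` (`holimCone_isHolim`).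

The total comodule. As `C_0 = k` and `C_1 = 0`, the normalized part of `Ω^q(X, C, Y)` vanishes below
degree `2 q` (`cobar_isConnective`, `cobar_cotensor_isConnective`). So the normalized total complex
has only finitely many nonzero columns in each degree: it is a direct sum, it is a comodule, and
both column filtrations can be used without convergence problems. Fundamental chains `ι_q` in the
weights (`exists_fundamental`) give a comparison `toTot` from a homotopy limit to this total
comodule. Conversely the total comodule is itself a cone, on which a simplex of `N(Δ ↓ [n])` acts
through its last-vertex map `[q] ⟶ [n]`. The composite from the homotopy limit to itself is the
action of the last-vertex map on the weights, which is naturally homotopic to the identity by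
acyclic models (`weightHomotopy_spec`). Therefore `toTot` is injective on homology. This one-sided
statement suffices: if a coaugmentation `Z ⟶ holim` becomes a quasi-isomorphism after composition
with `toTot`, it is one already (`IsHolim.isQuasiIso_of_coaug`).

Resolutions. The counit of the last factor is an extra codegeneracy that contracts `X ⟶ Ω^•(X, C,
C)` (`cobar_isResolution`). If `Y` is coflat, `- □_C Y` preserves this exactness, so `X □_C Y ⟶ Ω(X,
C, Y)` is a quasi-isomorphism. As `(M ⊗ C) □_C Y ≅ M ⊗ Y`, each level of `Ω^•(X, C, Y)` is homotopy
invariant, hence so is its total complex, and hence so is `X □_C Y` for coflat `Y`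
(`cotensorMap_isQuasiIso`). In `X □_C Y ⟶ Ω(X, C, C) □_C Y ⟶ Ω(X, C, Y)` the first map and the
composite are now quasi-isomorphisms, so the second is too (`comparison_isQuasiIso`).

Fibrant comodules. Call `Y` relatively injective if its coaction has a retraction of graded
comodules. Total comodules of cobar constructions have this property. Relatively injective comodules
are fibrant, by correcting a graded extension degree by degree (`IsRelInjective.isFibrant`), and
they are coflat (`IsRelInjective.isCoflat`). So every comodule has a fibrant replacement; a fibrant
comodule is a retract of its replacement, hence relatively injective and coflat. -/

set_option linter.unusedSectionVars false

namespace DGModule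

variable {k : Type u} [CommRing k]

/-! ### Homogeneous components and signs. -/

section graded

variable {X Y Z : DGModule k}

/-- The linear map that is `φ n` on `X_n`. -/
noncomputable def glue (X : DGModule k) {M : Type u} [AddCommGroup M] [Module k M]
    (φ : ℕ → X →ₗ[k] M) : X →ₗ[k] M :=
  DirectSum.toModule k ℕ M (fun n => φ n ∘ₗ (X.gr n).subtype) ∘ₗ (X.sumEquiv).symm.toLinearMap

theorem glue_of_mem {M : Type u} [AddCommGroup M] [Module k M] (φ : ℕ → X →ₗ[k] M) {n : ℕ}
    {x : X} (hx : x ∈ X.gr n) : X.glue φ x = φ n x := by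
  have h : X.sumEquiv.symm x = DirectSum.lof k ℕ (fun i => X.gr i) n ⟨x, hx⟩ := by
    rw [LinearEquiv.symm_apply_eq, sumEquiv_lof]
  simp [glue, h]

theorem d_proj (n : ℕ) (x : X) : X.d (X.proj (n + 1) x) = X.proj n (X.d x) := by
  induction x using X.induction_homogeneous with
  | h m x hx =>
    by_cases h : n + 1 = m
    · subst h; rw [X.proj_self hx, X.proj_self (X.d_mem n x hx)]
    · rw [X.proj_ne h hx, map_zero]
      cases m with
      | zero => rw [X.d_zero x hx, map_zero]
      | succ m => rw [X.proj_ne (by omega) (X.d_mem m x hx)]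
  | h0 => simp
  | ha x y hx hy => simp only [map_add, hx, hy]

theorem d_d_apply (x : X) : X.d (X.d x) = 0 := LinearMap.congr_fun X.d_d x

theorem sgn_sgn (x : X) : X.sgn (X.sgn x) = x := by
  induction x using X.induction_homogeneous with
  | h m x hx =>
    rw [X.sgn_of_mem hx, map_smul, X.sgn_of_mem hx, smul_smul, ← mul_pow]
    simp
  | h0 => simp
  | ha x y hx hy => simp only [map_add, hx, hy]

theorem sgn_of_raises (h : X →ₗ[k] Y) (hh : ∀ n, ∀ x ∈ X.gr n, h x ∈ Y.gr (n + 1)) (x : X) :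
    Y.sgn (h x) = - h (X.sgn x) := by
  induction x using X.induction_homogeneous with
  | h m x hx =>
    rw [X.sgn_of_mem hx, Y.sgn_of_mem (hh m x hx), map_smul, pow_succ]
    simp
  | h0 => simp
  | ha x y hx hy => simp only [map_add, hx, hy, neg_add]

theorem sgn_d (x : X) : X.sgn (X.d x) = - X.d (X.sgn x) := by
  induction x using X.induction_homogeneous with
  | h m x hx =>
    cases m with
    | zero => rw [X.sgn_of_mem hx, map_smul, X.d_zero x hx]; simp
    | succ m =>
      rw [X.sgn_of_mem hx, X.sgn_of_mem (X.d_mem m x hx), map_smul, pow_succ]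
      simp
  | h0 => simp
  | ha x y hx hy => simp only [map_add, hx, hy, neg_add]

end graded

/-! ### Quasi-isomorphisms of complexes. -/

section quasiIso

variable {X Y Z X' Y' : DGModule k}

/-- This removes the quotients: later arguments only handle cycles and primitives. The first clause
is injectivity on homology, the second surjectivity. -/
theorem Hom.isQuasiIso_iff (f : Hom X Y) : f.IsQuasiIso ↔
    (∀ x y, X.d x = 0 → Y.d y = f.toLin x → ∃ w, X.d w = x) ∧
      ∀ y, Y.d y = 0 → ∃ x w, X.d x = 0 ∧ f.toLin x + Y.d w = y := by
  have hmk : ∀ x : LinearMap.ker X.d, f.homologyMap (Submodule.Quotient.mk x) =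
      Submodule.Quotient.mk ⟨f.toLin x.1, by
        rw [LinearMap.mem_ker, ← f.map_d_apply, LinearMap.mem_ker.1 x.2, map_zero]⟩ :=
    fun _ => rfl
  constructor
  · rintro ⟨hi, hs⟩
    refine ⟨fun x y hx hy => ?_, fun y hy => ?_⟩
    · have h0 : f.homologyMap (Submodule.Quotient.mk ⟨x, hx⟩) = f.homologyMap 0 := by
        refine (hmk _).trans (Eq.trans ?_ (map_zero _).symm)
        exact (Submodule.Quotient.mk_eq_zero _).2 ⟨y, hy⟩
      have h1 := hi h0
      rw [Submodule.Quotient.mk_eq_zero] at h1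
      exact h1
    · obtain ⟨q, hq⟩ := hs (Submodule.Quotient.mk ⟨y, hy⟩)
      obtain ⟨x, rfl⟩ := Submodule.Quotient.mk_surjective _ q
      rw [hmk, eq_comm, Submodule.Quotient.eq] at hq
      obtain ⟨w, hw⟩ := hq
      refine ⟨x.1, w, x.2, ?_⟩
      rw [hw]
      simp
  · rintro ⟨hi, hs⟩
    refine ⟨(injective_iff_map_eq_zero _).2 fun q hq => ?_, fun q => ?_⟩
    · obtain ⟨x, rfl⟩ := Submodule.Quotient.mk_surjective _ q
      rw [hmk, Submodule.Quotient.mk_eq_zero] at hq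
      obtain ⟨y, hy⟩ := hq
      rw [Submodule.Quotient.mk_eq_zero]
      exact hi x.1 y x.2 hy
    · obtain ⟨y, rfl⟩ := Submodule.Quotient.mk_surjective _ q
      obtain ⟨x, w, hx, hw⟩ := hs y.1 y.2
      refine ⟨Submodule.Quotient.mk ⟨x, hx⟩, ?_⟩
      rw [hmk, eq_comm, Submodule.Quotient.eq]
      refine ⟨w, ?_⟩
      simp [← hw]

theorem Hom.homologyMap_comp (g : Hom Y Z) (f : Hom X Y) :
    (g.comp f).homologyMap = g.homologyMap ∘ₗ f.homologyMap := by
  refine LinearMap.ext fun q => ?_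
  obtain ⟨x, rfl⟩ := Submodule.Quotient.mk_surjective _ q
  rfl

theorem Hom.IsQuasiIso.comp {g : Hom Y Z} {f : Hom X Y} (hg : g.IsQuasiIso) (hf : f.IsQuasiIso) :
    (g.comp f).IsQuasiIso := by
  unfold IsQuasiIso
  rw [homologyMap_comp]
  rw [LinearMap.coe_comp]
  exact Function.Bijective.comp hg hf

theorem Hom.IsQuasiIso.of_comp_left {g : Hom Y Z} {f : Hom X Y} (hg : g.IsQuasiIso)
    (h : (g.comp f).IsQuasiIso) : f.IsQuasiIso := by
  unfold IsQuasiIso at h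
  rw [homologyMap_comp, LinearMap.coe_comp] at h
  exact (Function.Bijective.of_comp_iff' hg _).1 h

theorem Hom.IsQuasiIso.of_comp_right {g : Hom Y Z} {f : Hom X Y} (hf : f.IsQuasiIso)
    (h : (g.comp f).IsQuasiIso) : g.IsQuasiIso := by
  unfold IsQuasiIso at h
  rw [homologyMap_comp, LinearMap.coe_comp] at h
  exact (Function.Bijective.of_comp_iff _ hf).1 h

theorem Hom.isQuasiIso_of_bijective (f : Hom X Y) (hf : Function.Bijective f.toLin) :
    f.IsQuasiIso := by
  rw [f.isQuasiIso_iff]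
  refine ⟨fun x y hx hy => ?_, fun y hy => ?_⟩
  · obtain ⟨w, rfl⟩ := hf.2 y
    exact ⟨w, hf.1 (by rw [f.map_d_apply, hy])⟩
  · obtain ⟨x, rfl⟩ := hf.2 y
    exact ⟨x, 0, hf.1 (by rw [f.map_d_apply, hy, map_zero]), by simp⟩

theorem Hom.isQuasiIso_of_homotopy (f : Hom X Y) (g : Hom Y X) (s : X →ₗ[k] X) (t : Y →ₗ[k] Y)
    (hs : ∀ x, X.d (s x) + s (X.d x) = x - g.toLin (f.toLin x))
    (ht : ∀ y, Y.d (t y) + t (Y.d y) = y - f.toLin (g.toLin y)) : f.IsQuasiIso := by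
  rw [f.isQuasiIso_iff]
  refine ⟨fun x y hx hy => ⟨s x + g.toLin y, ?_⟩, fun y hy => ⟨g.toLin y, t y, ?_, ?_⟩⟩
  · have := hs x
    rw [hx, map_zero, add_zero] at this
    rw [map_add, this, ← g.map_d_apply, hy, sub_add_cancel]
  · rw [← g.map_d_apply, hy, map_zero]
  · have := ht y
    rw [hy, map_zero, add_zero] at this
    rw [this, add_sub_cancel]

/-- A retract of a quasi-isomorphism is a quasi-isomorphism. -/
theorem Hom.IsQuasiIso.of_retract {f : Hom X Y} {f' : Hom X' Y'} (hf : f.IsQuasiIso)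
    (i : Hom X' X) (r : Hom X X') (j : Hom Y' Y) (p : Hom Y Y') (hri : r.comp i = Hom.id X')
    (hpj : p.comp j = Hom.id Y') (h₁ : f.comp i = j.comp f') (h₂ : f'.comp r = p.comp f) :
    f'.IsQuasiIso := by
  have e₁ : ∀ x, r.toLin (i.toLin x) = x := fun x =>
    LinearMap.congr_fun (congrArg Hom.toLin hri) x
  have e₂ : ∀ x, p.toLin (j.toLin x) = x := fun x =>
    LinearMap.congr_fun (congrArg Hom.toLin hpj) x
  have e₃ : ∀ x, f.toLin (i.toLin x) = j.toLin (f'.toLin x) := fun x =>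
    LinearMap.congr_fun (congrArg Hom.toLin h₁) x
  have e₄ : ∀ x, f'.toLin (r.toLin x) = p.toLin (f.toLin x) := fun x =>
    LinearMap.congr_fun (congrArg Hom.toLin h₂) x
  rw [isQuasiIso_iff] at hf ⊢
  refine ⟨fun x y hx hy => ?_, fun y hy => ?_⟩
  · obtain ⟨w, hw⟩ := hf.1 (i.toLin x) (j.toLin y) (by rw [← i.map_d_apply, hx, map_zero])
      (by rw [← j.map_d_apply, hy, e₃])
    exact ⟨r.toLin w, by rw [← r.map_d_apply, hw, e₁]⟩
  · obtain ⟨x, w, hx, hw⟩ := hf.2 (j.toLin y) (by rw [← j.map_d_apply, hy, map_zero])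
    refine ⟨r.toLin x, p.toLin w, by rw [← r.map_d_apply, hx, map_zero], ?_⟩
    rw [e₄, ← p.map_d_apply, ← map_add, hw, e₂]

end quasiIso

/-! ### Homotopy theory of complexes over a semisimple ring. -/

section contraction

variable {X Y : DGModule k}

/-- A graded splitting of an injective chain map. -/
theorem Hom.exists_graded_retraction [IsSemisimpleRing k] (f : Hom X Y)
    (hf : Function.Injective f.toLin) : ∃ r : Y →ₗ[k] X, (∀ n, ∀ y ∈ Y.gr n, r y ∈ X.gr n) ∧
      ∀ x, r (f.toLin x) = x := by
  obtain ⟨r, hr⟩ := IsSemisimpleModule.extension_property f.toLin hf LinearMap.id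
  refine ⟨Y.glue fun n => X.proj n ∘ₗ r, fun n y hy => ?_, fun x => ?_⟩
  · rw [glue_of_mem _ hy]
    exact X.proj_mem n _
  · induction x using X.induction_homogeneous with
    | h m x hx =>
      rw [glue_of_mem _ (f.map_mem m x hx), LinearMap.comp_apply,
        show r (f.toLin x) = x from LinearMap.congr_fun hr x, X.proj_self hx]
    | h0 => simp
    | ha x y hx hy => simp only [map_add, hx, hy]

/-- The surjection of `X` onto the boundaries splits by semisimplicity. A section `s` of it,
extended to all of `X`, yields the contraction `s (1 - s d)`. -/
theorem exists_contraction [IsSemisimpleRing k] (X : DGModule k)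
    (hX : ∀ x, X.d x = 0 → ∃ w, X.d w = x) :
    ∃ h : X →ₗ[k] X, (∀ n, ∀ x ∈ X.gr n, h x ∈ X.gr (n + 1)) ∧
      ∀ x, X.d (h x) + h (X.d x) = x := by
  have := Module.projective_of_isSemisimpleRing k (LinearMap.range X.d)
  obtain ⟨s₁, hs₁⟩ := Module.projective_lifting_property X.d.rangeRestrict LinearMap.id
    X.d.surjective_rangeRestrict
  obtain ⟨s₀, hs₀'⟩ := IsSemisimpleModule.extension_property (LinearMap.range X.d).subtype
    (Submodule.injective_subtype _) s₁
  have hs₀ : ∀ x, X.d (s₀ (X.d x)) = X.d x := by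
    intro x
    have h1 : s₀ (X.d x) = s₁ ⟨X.d x, ⟨x, rfl⟩⟩ := LinearMap.congr_fun hs₀' ⟨X.d x, ⟨x, rfl⟩⟩
    have h2 := congrArg Subtype.val (LinearMap.congr_fun hs₁ ⟨X.d x, ⟨x, rfl⟩⟩)
    rw [h1]
    exact h2
  -- The splitting need not respect degrees. Its component of degree `+1` still satisfies `d s d =
  -- d`, because `d` is homogeneous.
  let s : X →ₗ[k] X := X.glue fun n => X.proj (n + 1) ∘ₗ s₀
  have hs : ∀ n, ∀ x ∈ X.gr n, s x ∈ X.gr (n + 1) := fun n x hx => by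
    rw [show s x = _ from glue_of_mem _ hx]
    exact X.proj_mem _ _
  have hds : ∀ x, X.d (s (X.d x)) = X.d x := by
    intro x
    induction x using X.induction_homogeneous with
    | h m x hx =>
      cases m with
      | zero => simp [X.d_zero x hx]
      | succ m =>
        rw [show s (X.d x) = _ from glue_of_mem _ (X.d_mem m x hx), LinearMap.comp_apply, d_proj,
          hs₀, X.proj_self (X.d_mem m x hx)]
    | h0 => simp
    | ha x y hx hy => simp only [map_add, hx, hy]
  -- The element `x - s d x` is a cycle, hence a boundary, and `d s` fixes boundaries. So `d h x = x
  -- - s d x`, while `h d x = s d x`.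
  refine ⟨s ∘ₗ (LinearMap.id - s ∘ₗ X.d), fun n x hx => hs n _ (sub_mem hx ?_), fun x => ?_⟩
  · change s (X.d x) ∈ _
    cases n with
    | zero => rw [X.d_zero x hx, map_zero]; exact zero_mem _
    | succ n => exact hs n _ (X.d_mem n x hx)
  · obtain ⟨w, hw⟩ := hX (x - s (X.d x)) (by rw [map_sub, hds, sub_self])
    change X.d (s (x - s (X.d x))) + s (X.d x - s (X.d (X.d x))) = x
    rw [← hw, hds, hw, d_d_apply, map_zero, sub_zero, sub_add_cancel]

/-- The degree `n` part of the mapping cone. -/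
def coneGr (_f : Hom X Y) : ℕ → Submodule k (Y × X)
  | 0 => (Y.gr 0).prod ⊥
  | n + 1 => (Y.gr (n + 1)).prod (X.gr n)

theorem coneGr_isInternal (f : Hom X Y) : DirectSum.IsInternal (coneGr f) := by
  refine isInternal_of_proj _ (fun n => match n with
    | 0 => (Y.proj 0).prodMap 0
    | n + 1 => (Y.proj (n + 1)).prodMap (X.proj n)) ?_ ?_ ?_
  · rintro (_ | n) ⟨y, x⟩ ⟨hy, hx⟩
    · rw [SetLike.mem_coe, Submodule.mem_bot] at hx
      exact Prod.ext (Y.proj_self hy) hx.symm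
    · exact Prod.ext (Y.proj_self hy) (X.proj_self hx)
  · rintro (_ | m) (_ | n) hmn ⟨y, x⟩ ⟨hy, hx⟩
    · exact absurd rfl hmn
    · exact Prod.ext (Y.proj_ne hmn hy) rfl
    · rw [SetLike.mem_coe, Submodule.mem_bot] at hx
      refine Prod.ext (Y.proj_ne hmn hy) ?_
      change X.proj m x = 0
      rw [show x = 0 from hx, map_zero]
    · exact Prod.ext (Y.proj_ne hmn hy) (X.proj_ne (by omega) hx)
  · rw [eq_top_iff]
    rintro ⟨y, x⟩ -
    have h1 : ((y, 0) : Y × X) ∈ ⨆ n, coneGr f n := by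
      induction y using Y.induction_homogeneous with
      | h m y hy =>
        refine Submodule.mem_iSup_of_mem m ?_
        cases m with
        | zero => exact ⟨hy, zero_mem _⟩
        | succ m => exact ⟨hy, zero_mem _⟩
      | h0 => exact zero_mem _
      | ha y y' hy hy' =>
        have := add_mem hy hy'
        rwa [Prod.mk_add_mk, add_zero] at this
    have h2 : ((0, x) : Y × X) ∈ ⨆ n, coneGr f n := by
      induction x using X.induction_homogeneous with
      | h m y hy => exact Submodule.mem_iSup_of_mem (m + 1) ⟨zero_mem _, hy⟩
      | h0 => exact zero_mem _
      | ha y y' hy hy' =>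
        have := add_mem hy hy'
        rwa [Prod.mk_add_mk, add_zero] at this
    have := add_mem h1 h2
    rwa [Prod.mk_add_mk, add_zero, zero_add] at this

/-- The mapping cone of a chain map. -/
def cone (f : Hom X Y) : DGModule k where
  carrier := Y × X
  gr := coneGr f
  isInternal := coneGr_isInternal f
  d := (Y.d ∘ₗ LinearMap.fst k Y X + f.toLin ∘ₗ LinearMap.snd k Y X).prod
    (-(X.d ∘ₗ LinearMap.snd k Y X))
  d_mem := by
    rintro (_ | n) ⟨y, x⟩ ⟨hy, hx⟩
    · refine ⟨add_mem (Y.d_mem 0 y hy) (f.map_mem 0 x hx), ?_⟩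
      change -(X.d x) ∈ (⊥ : Submodule k X)
      rw [X.d_zero x hx, neg_zero]
      exact zero_mem _
    · exact ⟨add_mem (Y.d_mem (n + 1) y hy) (f.map_mem (n + 1) x hx), neg_mem (X.d_mem n x hx)⟩
  d_zero := by
    rintro ⟨y, x⟩ ⟨hy, hx⟩
    obtain rfl : x = 0 := hx
    refine Prod.ext ?_ ?_
    · change Y.d y + f.toLin 0 = 0
      rw [Y.d_zero y hy, map_zero, add_zero]
    · change -(X.d 0) = 0
      rw [map_zero, neg_zero]
  d_d := by
    refine LinearMap.ext fun ⟨y, x⟩ => Prod.ext ?_ ?_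
    · change Y.d (Y.d y + f.toLin x) + f.toLin (-(X.d x)) = 0
      rw [map_add, d_d_apply, map_neg, f.map_d_apply, zero_add, add_neg_cancel]
    · change -(X.d (-(X.d x))) = 0
      rw [map_neg, d_d_apply, neg_zero, neg_zero]

/-- For a cycle `(y, x)` injectivity on homology gives a primitive of `-x`; what remains is a cycle
of `Y`, which surjectivity removes. -/
theorem cone_acyclic (f : Hom X Y) (hf : f.IsQuasiIso) (z : cone f) (hz : (cone f).d z = 0) :
    ∃ w, (cone f).d w = z := by
  obtain ⟨y, x⟩ := z
  have h1 : Y.d y + f.toLin x = 0 := congrArg Prod.fst hz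
  have h2 : -(X.d x) = 0 := congrArg Prod.snd hz
  rw [f.isQuasiIso_iff] at hf
  obtain ⟨w, hw⟩ := hf.1 (-x) y (by rw [map_neg, h2]) (by rw [map_neg]; exact eq_neg_of_add_eq_zero_left h1)
  obtain ⟨x', y', hx', hy'⟩ := hf.2 (y - f.toLin w)
    (by rw [map_sub, ← f.map_d_apply, hw, map_neg, sub_neg_eq_add, h1])
  refine ⟨(y', x' + w), Prod.ext ?_ ?_⟩
  · change Y.d y' + f.toLin (x' + w) = y
    rw [map_add, ← add_assoc, add_comm (Y.d y'), hy', sub_add_cancel]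
  · change -(X.d (x' + w)) = x
    rw [map_add, hx', hw, zero_add, neg_neg]

/-- Over a semisimple ring, quasi-isomorphisms are chain homotopy equivalences. -/
theorem Hom.IsQuasiIso.exists_homotopyInverse [IsSemisimpleRing k] {f : Hom X Y}
    (hf : f.IsQuasiIso) :
    ∃ (g : Hom Y X) (s : X →ₗ[k] X) (t : Y →ₗ[k] Y), (∀ n, ∀ x ∈ X.gr n, s x ∈ X.gr (n + 1)) ∧
      (∀ n, ∀ y ∈ Y.gr n, t y ∈ Y.gr (n + 1)) ∧
      (∀ x, X.d (s x) + s (X.d x) = x - g.toLin (f.toLin x)) ∧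
      (∀ y, Y.d (t y) + t (Y.d y) = y - f.toLin (g.toLin y)) := by
  obtain ⟨h, hdeg, hh⟩ := exists_contraction (cone f) (cone_acyclic f hf)
  -- A contraction of the cone is a `2 × 2` matrix. The entry from `Y` to `X` is the homotopy
  -- inverse and the diagonal entries are the homotopies. The one on `X` is negated at the end,
  -- since the cone carries `-d` on `X`.
  let iY : Y →ₗ[k] Y × X := LinearMap.inl k Y X
  let iX : X →ₗ[k] Y × X := LinearMap.inr k Y X
  let h' : Y × X →ₗ[k] Y × X := h
  let g : Y →ₗ[k] X := LinearMap.snd k Y X ∘ₗ h' ∘ₗ iY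
  let t : Y →ₗ[k] Y := LinearMap.fst k Y X ∘ₗ h' ∘ₗ iY
  let s : X →ₗ[k] X := LinearMap.snd k Y X ∘ₗ h' ∘ₗ iX
  let m : X →ₗ[k] Y := LinearMap.fst k Y X ∘ₗ h' ∘ₗ iX
  have hY : ∀ n, ∀ y ∈ Y.gr n, ((y, 0) : Y × X) ∈ coneGr f n := by
    rintro (_ | n) y hy
    · exact ⟨hy, zero_mem _⟩
    · exact ⟨hy, zero_mem _⟩
  have e1 : ∀ y, Y.d (t y) + f.toLin (g y) + t (Y.d y) = y ∧ -(X.d (g y)) + g (Y.d y) = 0 := by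
    intro y
    have h1 := hh (y, 0)
    have h2 : (cone f).d (y, 0) = (Y.d y, (0 : X)) := by
      refine Prod.ext ?_ ?_
      · change Y.d y + f.toLin 0 = _
        rw [map_zero, add_zero]
      · change -(X.d 0) = _
        rw [map_zero, neg_zero]
    rw [h2] at h1
    exact ⟨congrArg Prod.fst h1, congrArg Prod.snd h1⟩
  have e2 : ∀ x, -(X.d (s x)) + (g (f.toLin x) - s (X.d x)) = x := by
    intro x
    have h1 := hh ((0 : Y), x)
    have h2 : (cone f).d ((0 : Y), x) = iY (f.toLin x) - iX (X.d x) := by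
      refine Prod.ext ?_ ?_
      · change Y.d 0 + f.toLin x = f.toLin x - 0
        rw [map_zero, zero_add, sub_zero]
      · change -(X.d x) = 0 - X.d x
        rw [zero_sub]
    rw [h2] at h1
    have h3 := congrArg Prod.snd h1
    have h4 : h (iY (f.toLin x) - iX (X.d x)) = h' (iY (f.toLin x)) - h' (iX (X.d x)) :=
      map_sub h' _ _
    rw [h4] at h3
    exact h3
  refine ⟨⟨g, fun n y hy => (hdeg n _ (hY n y hy)).2, ?_⟩, -s, t, fun n x hx => neg_mem ?_,
    fun n y hy => (hdeg n _ (hY n y hy)).1, fun x => ?_, fun y => ?_⟩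
  · ext y
    have := (e1 y).2
    rw [neg_add_eq_zero] at this
    exact this.symm
  · exact (hdeg (n + 1) ((0 : Y), x) ⟨zero_mem _, hx⟩).2
  · have := e2 x
    simp only [LinearMap.neg_apply, map_neg]
    change _ = x - g (f.toLin x)
    rw [eq_sub_iff_add_eq]
    refine Eq.trans ?_ this
    abel
  · have := (e1 y).1
    change _ = y - f.toLin (g y)
    rw [eq_sub_iff_add_eq]
    refine Eq.trans ?_ this
    abel

/-- Homotopy equivalences are preserved by tensoring, whereas an arbitrary quasi-isomorphism would
require a Künneth argument. -/
theorem Hom.IsQuasiIso.tensor_right [IsSemisimpleRing k] {f : Hom X Y} (hf : f.IsQuasiIso)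
    (M : DGModule k) : (tensorHom f (Hom.id M)).IsQuasiIso := by
  obtain ⟨g, s, t, hs, ht, es, et⟩ := hf.exists_homotopyInverse
  -- If `a` is a homotopy from `1` to `e`, then `a ⊗ 1` is one from `1` to `e ⊗ 1`: since `a`
  -- anticommutes with the sign operator, the two terms containing `d` of the second factor cancel.
  have key : ∀ (Z : DGModule k) (a : Z →ₗ[k] Z) (e : Hom Z Z)
      (_ : ∀ n, ∀ x ∈ Z.gr n, a x ∈ Z.gr (n + 1))
      (_ : ∀ x, Z.d (a x) + a (Z.d x) = x - e.toLin x) (w : Z ⊗[k] M),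
      (tensor Z M).d (TensorProduct.map a LinearMap.id w) +
        TensorProduct.map a LinearMap.id ((tensor Z M).d w) =
        w - TensorProduct.map e.toLin LinearMap.id w := by
    intro Z a e ha hae w
    induction w using TensorProduct.induction_on with
    | zero => simp
    | add x y hx hy =>
      have := congrArg₂ (· + ·) hx hy
      simp only [map_add]
      refine Eq.trans ?_ (this.trans ?_) <;> abel
    | tmul x y =>
      rw [TensorProduct.map_tmul, tensor_d_tmul, tensor_d_tmul, map_add, TensorProduct.map_tmul,
        TensorProduct.map_tmul, TensorProduct.map_tmul, sgn_of_raises a ha, LinearMap.id_apply,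
        LinearMap.id_apply, TensorProduct.neg_tmul, ← TensorProduct.sub_tmul, ← hae x,
        TensorProduct.add_tmul]
      abel
  refine isQuasiIso_of_homotopy _ (tensorHom g (Hom.id M)) (TensorProduct.map s LinearMap.id)
    (TensorProduct.map t LinearMap.id) (fun x => ?_) (fun y => ?_)
  · refine (key X s (g.comp f) hs es x).trans ?_
    congr 1
    exact (LinearMap.congr_fun (congrArg Hom.toLin (tensorHom_comp f g (Hom.id M) (Hom.id M))) x).symm
  · refine (key Y t (f.comp g) ht et y).trans ?_
    congr 1
    exact (LinearMap.congr_fun (congrArg Hom.toLin (tensorHom_comp g f (Hom.id M) (Hom.id M))) y).symm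

theorem braid_braid : (braid Y X).comp (braid X Y) = Hom.id (tensor X Y) := by
  ext1
  refine tensor_ext fun i j x hx y hy => ?_
  change braidLin Y X (braidLin X Y (x ⊗ₜ[k] y)) = x ⊗ₜ[k] y
  rw [braidLin_tmul hx hy, map_smul, braidLin_tmul hy hx, smul_smul, mul_comm j i, ← mul_pow]
  simp

theorem braid_bijective (X Y : DGModule k) : Function.Bijective (braid X Y).toLin :=
  Function.bijective_iff_has_inverse.2 ⟨(braid Y X).toLin,
    fun z => LinearMap.congr_fun (congrArg Hom.toLin (braid_braid (X := X) (Y := Y))) z,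
    fun z => LinearMap.congr_fun (congrArg Hom.toLin (braid_braid (X := Y) (Y := X))) z⟩

theorem Hom.IsQuasiIso.tensor_left [IsSemisimpleRing k] {f : Hom X Y} (hf : f.IsQuasiIso)
    (M : DGModule k) : (tensorHom (Hom.id M) f).IsQuasiIso := by
  refine IsQuasiIso.of_comp_left (isQuasiIso_of_bijective _ (braid_bijective M Y)) ?_
  rw [braid_naturality]
  exact (hf.tensor_right M).comp (isQuasiIso_of_bijective _ (braid_bijective M X))

theorem Hom.IsQuasiIso.tensor [IsSemisimpleRing k] {X' Y' : DGModule k} {f : Hom X Y}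
    {g : Hom X' Y'} (hf : f.IsQuasiIso) (hg : g.IsQuasiIso) : (tensorHom f g).IsQuasiIso := by
  have := (hg.tensor_left Y).comp (hf.tensor_right X')
  rwa [tensorHom_comp] at this

end contraction

end DGModule

/-! ### Further identities for the symmetry, and flatness. -/

namespace DGModule

variable {k : Type u} [CommRing k] {X Y Z : DGModule k}

theorem Hom.congr_toLin {f g : Hom X Y} (h : f = g) (x : X) : f.toLin x = g.toLin x := by
  rw [h]

theorem tensor_ext_right {M : Type u} [AddCommGroup M] [Module k M]
    {f g : X ⊗[k] (Y ⊗[k] Z) →ₗ[k] M}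
    (h : ∀ i j l, ∀ x ∈ X.gr i, ∀ y ∈ Y.gr j, ∀ z ∈ Z.gr l,
      f (x ⊗ₜ[k] (y ⊗ₜ[k] z)) = g (x ⊗ₜ[k] (y ⊗ₜ[k] z))) : f = g := by
  refine TensorProduct.ext (X.lin_ext fun i x hx => ?_)
  exact tensor_ext fun j l y hy z hz => h i j l x hx y hy z hz

/-- The second hexagon. -/
theorem hexagon_right :
    (assocHom Y Z X).comp (braid X (tensor Y Z)) =
      (tensorHom (Hom.id Y) (braid X Z)).comp ((assocHom Y X Z).comp
        ((tensorHom (braid X Y) (Hom.id Z)).comp (assocInvHom X Y Z))) := by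
  ext1
  refine tensor_ext_right fun i j l x hx y hy z hz => ?_
  change TensorProduct.assoc k Y Z X (braidLin X (tensor Y Z) (x ⊗ₜ[k] (y ⊗ₜ[k] z))) =
    TensorProduct.map LinearMap.id (braidLin X Z) (TensorProduct.assoc k Y X Z
      (braidLin X Y (x ⊗ₜ[k] y) ⊗ₜ[k] z))
  rw [braidLin_tmul hx (tmul_mem rfl hy hz), braidLin_tmul hx hy, ← TensorProduct.smul_tmul',
    map_smul, map_smul, map_smul, TensorProduct.assoc_tmul, TensorProduct.assoc_tmul,
    TensorProduct.map_tmul, braidLin_tmul hx hz, LinearMap.id_apply, TensorProduct.tmul_smul,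
    smul_smul, mul_add, pow_add]

/-- Both sides reverse the order of three factors, starting from `X ⊗ (Z ⊗ Y)`. This coherence is
what the coassociativity of the left coaction needs. -/
theorem braid_tensor_braid :
    (tensorHom (Hom.id Z) (braid X Y)).comp ((braid (tensor X Y) Z).comp
      ((assocInvHom X Y Z).comp (tensorHom (Hom.id X) (braid Z Y)))) =
    (assocHom Z Y X).comp (braid X (tensor Z Y)) := by
  have h : (braid (tensor X Y) Z).comp
      ((assocInvHom X Y Z).comp (tensorHom (Hom.id X) (braid Z Y))) =
      (assocHom Z X Y).comp ((tensorHom (braid X Z) (Hom.id Y)).comp (assocInvHom X Z Y)) := by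
    calc _ = ((assocHom Z X Y).comp (assocInvHom Z X Y)).comp ((braid (tensor X Y) Z).comp
          ((assocInvHom X Y Z).comp (tensorHom (Hom.id X) (braid Z Y)))) := by
            rw [assoc_assocInv, Hom.id_comp]
      _ = (assocHom Z X Y).comp (((assocInvHom Z X Y).comp (braid (tensor X Y) Z)).comp
          ((assocInvHom X Y Z).comp (tensorHom (Hom.id X) (braid Z Y)))) := rfl
      _ = (assocHom Z X Y).comp ((tensorHom (braid X Z) (Hom.id Y)).comp ((assocInvHom X Z Y).comp
        ((tensorHom (Hom.id X) (braid Y Z)).comp (((assocHom X Y Z).comp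
          (assocInvHom X Y Z)).comp (tensorHom (Hom.id X) (braid Z Y)))))) := by
            rw [hexagon]; rfl
      _ = _ := by
        rw [assoc_assocInv, Hom.id_comp, tensorHom_comp, braid_braid, Hom.id_comp, tensorHom_id,
          Hom.comp_id]
  rw [h, hexagon_right]

section injective

variable [IsFiniteProductOfFields k] {X' Y' : DGModule k}

theorem map_injective {M N P Q : Type u} [AddCommGroup M] [Module k M] [AddCommGroup N]
    [Module k N] [AddCommGroup P] [Module k P] [AddCommGroup Q] [Module k Q] (f : M →ₗ[k] N)
    (g : P →ₗ[k] Q) (hf : Function.Injective f) (hg : Function.Injective g) :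
    Function.Injective (TensorProduct.map f g) := by
  have := IsFiniteProductOfFields.flat k P
  have := IsFiniteProductOfFields.flat k N
  have h : TensorProduct.map f g = g.lTensor N ∘ₗ f.rTensor P := by
    rw [LinearMap.lTensor, LinearMap.rTensor, ← TensorProduct.map_comp]
    rfl
  rw [h, LinearMap.coe_comp]
  exact (Module.Flat.lTensor_preserves_injective_linearMap g hg).comp
    (Module.Flat.rTensor_preserves_injective_linearMap f hf)

end injective

end DGModule

namespace DGComodule

open DGModule

variable {k : Type u} [CommRing k] {C : DGCoalgebra k}

/-! ### Cofree comodules as a right adjoint. -/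

section cofree

variable {Z : DGComodule C} {V : DGModule k}

theorem coact_coact (Y : DGComodule C) (y : Y.toDGModule) :
    TensorProduct.map Y.coact.toLin LinearMap.id (Y.coact.toLin y) =
      (C.idComul Y.toDGModule).toLin (Y.coact.toLin y) :=
  DGModule.Hom.congr_toLin Y.coassoc y

theorem counit_coact (Y : DGComodule C) (y : Y.toDGModule) :
    (C.idCounit Y.toDGModule).toLin (Y.coact.toLin y) = y :=
  DGModule.Hom.congr_toLin Y.counit y

theorem Hom.coact_apply {X Y : DGComodule C} (f : Hom X Y) (x : X.toDGModule) :
    Y.coact.toLin (f.toLin x) = TensorProduct.map f.toLin LinearMap.id (X.coact.toLin x) :=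
  DGModule.Hom.congr_toLin f.colinear x

theorem coact_injective (Y : DGComodule C) : Function.Injective Y.coact.toLin :=
  Function.LeftInverse.injective (counit_coact Y)

/-- The map to the cofree comodule `V ⊗ C` induced by a chain map to `V`. -/
noncomputable def cofreeLift (g : DGModule.Hom Z.toDGModule V) :
    Hom Z (tensorLeft V (regular C)) where
  toHom := (tensorHom g (DGModule.Hom.id C.toDGModule)).comp Z.coact
  colinear := by
    change (C.idComul V).comp ((tensorHom g (DGModule.Hom.id C.toDGModule)).comp Z.coact) = _
    rw [← DGModule.Hom.comp_assoc, DGCoalgebra.idComul_naturality, DGModule.Hom.comp_assoc,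
      ← Z.coassoc, ← DGModule.Hom.comp_assoc, tensorHom_comp]
    rfl

theorem idCounit_cofreeLift (g : DGModule.Hom Z.toDGModule V) :
    (C.idCounit V).comp (cofreeLift g).toHom = g := by
  change (C.idCounit V).comp ((tensorHom g (DGModule.Hom.id C.toDGModule)).comp Z.coact) = _
  rw [← DGModule.Hom.comp_assoc, DGCoalgebra.idCounit_naturality, DGModule.Hom.comp_assoc,
    Z.counit, DGModule.Hom.comp_id]

/-- The adjunction between the forgetful functor and `V ↦ V ⊗ C`: as `(ε ⊗ id) Δ = id`, a colinear
map is recovered from its composite with `id ⊗ ε`. -/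
theorem cofree_eq_aux (f : DGModule.Hom Z.toDGModule (tensor V C.toDGModule))
    (h : (C.idComul V).comp f =
      (tensorHom f (DGModule.Hom.id C.toDGModule)).comp Z.coact) :
    f = (tensorHom ((C.idCounit V).comp f) (DGModule.Hom.id C.toDGModule)).comp Z.coact := by
  have h' : f = ((tensorHom (C.idCounit V) (DGModule.Hom.id C.toDGModule)).comp
      (C.idComul V)).comp f := by
    rw [DGCoalgebra.idCounit_tensor_idComul]
    rfl
  refine h'.trans ?_
  rw [DGModule.Hom.comp_assoc, h, ← DGModule.Hom.comp_assoc, tensorHom_comp]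
  rfl

theorem cofree_eq (f : Hom Z (tensorLeft V (regular C))) :
    f = cofreeLift ((C.idCounit V).comp f.toHom) :=
  Hom.ext_toHom (cofree_eq_aux f.toHom f.colinear)

theorem cofree_hom_ext {f g : Hom Z (tensorLeft V (regular C))}
    (h : (C.idCounit V).comp f.toHom = (C.idCounit V).comp g.toHom) : f = g := by
  rw [cofree_eq f, cofree_eq g, h]

end cofree

/-! ### The left coaction over a cocommutative coalgebra. -/

section leftCoaction

variable [h : C.IsCocommutative]

/-- The left coaction is coassociative. -/
theorem leftCoact_coassoc (Y : DGComodule C) :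
    (tensorHom (DGModule.Hom.id C.toDGModule) Y.leftCoact.toHom).comp Y.leftCoact.toHom =
      (assocHom C.toDGModule C.toDGModule Y.toDGModule).comp
        ((tensorHom C.comulHom (DGModule.Hom.id Y.toDGModule)).comp Y.leftCoact.toHom) := by
  change (tensorHom (DGModule.Hom.id C.toDGModule) ((braid _ _).comp Y.coact)).comp
    ((braid _ _).comp Y.coact) = (assocHom _ _ _).comp
      ((tensorHom C.comulHom (DGModule.Hom.id Y.toDGModule)).comp ((braid _ _).comp Y.coact))
  have e0 : tensorHom (DGModule.Hom.id C.toDGModule) ((braid Y.toDGModule C.toDGModule).comp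
      Y.coact) = (tensorHom (DGModule.Hom.id C.toDGModule) (braid Y.toDGModule C.toDGModule)).comp
      (tensorHom (DGModule.Hom.id C.toDGModule) Y.coact) := by
    rw [tensorHom_comp, DGModule.Hom.comp_id]
  have e1 : (tensorHom (DGModule.Hom.id C.toDGModule) ((braid Y.toDGModule C.toDGModule).comp
      Y.coact)).comp ((braid Y.toDGModule C.toDGModule).comp Y.coact) =
      (tensorHom (DGModule.Hom.id C.toDGModule) (braid Y.toDGModule C.toDGModule)).comp
        ((braid (tensor Y.toDGModule C.toDGModule) C.toDGModule).comp
          ((tensorHom Y.coact (DGModule.Hom.id C.toDGModule)).comp Y.coact)) := by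
    rw [e0, ← DGModule.Hom.comp_assoc (braid (tensor Y.toDGModule C.toDGModule) C.toDGModule),
      braid_naturality, DGModule.Hom.comp_assoc, DGModule.Hom.comp_assoc]
  have e2 : (tensorHom C.comulHom (DGModule.Hom.id Y.toDGModule)).comp
      ((braid Y.toDGModule C.toDGModule).comp Y.coact) =
      (braid Y.toDGModule (tensor C.toDGModule C.toDGModule)).comp
        ((tensorHom (DGModule.Hom.id Y.toDGModule) C.comulHom).comp Y.coact) := by
    rw [← DGModule.Hom.comp_assoc, ← braid_naturality, DGModule.Hom.comp_assoc]
  rw [e1, e2, Y.coassoc, DGCoalgebra.idComul]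
  -- Cocommutativity enters here: an interchange of the two factors `C` is inserted for free, and it
  -- is the one that `braid_tensor_braid` absorbs.
  have e3 : tensorHom (DGModule.Hom.id Y.toDGModule) C.comulHom =
      (tensorHom (DGModule.Hom.id Y.toDGModule) (braid C.toDGModule C.toDGModule)).comp
        (tensorHom (DGModule.Hom.id Y.toDGModule) C.comulHom) := by
    rw [tensorHom_comp, h.braid_comul, DGModule.Hom.comp_id]
  have e4 := congrArg (fun f => f.comp ((tensorHom (DGModule.Hom.id Y.toDGModule)
    C.comulHom).comp Y.coact)) (braid_tensor_braid (X := Y.toDGModule) (Y := C.toDGModule)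
      (Z := C.toDGModule))
  refine Eq.trans ?_ e4
  conv_lhs => rw [e3]
  rfl

/-- `ε ⊗ id : C ⊗ Y ⟶ Y`. -/
noncomputable def counitLeft (C : DGCoalgebra k) (Y : DGModule k) :
    C.toDGModule ⊗[k] Y →ₗ[k] Y :=
  (TensorProduct.lid k Y).toLinearMap ∘ₗ
    TensorProduct.map (Coalgebra.counit (R := k) (A := C.toDGModule)) LinearMap.id

theorem counitLeft_tmul (Y : DGModule k) (c : C.toDGModule) (y : Y) :
    counitLeft C Y (c ⊗ₜ[k] y) = Coalgebra.counit (R := k) (A := C.toDGModule) c • y := rfl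

theorem counit_eq_zero {n : ℕ} (hn : n ≠ 0) {c : C.toDGModule} (hc : c ∈ C.gr n) :
    Coalgebra.counit (R := k) (A := C.toDGModule) c = 0 := by
  obtain ⟨m, rfl⟩ := Nat.exists_eq_succ_of_ne_zero hn
  exact C.counit_mem m c hc

/-- The sign of the symmetry is invisible to the counit, which vanishes outside degree `0`. -/
theorem counitLeft_braid (Y : DGModule k) (z : Y ⊗[k] C.toDGModule) :
    counitLeft C Y ((braid Y C.toDGModule).toLin z) = (C.idCounit Y).toLin z := by
  have : counitLeft C Y ∘ₗ (braid Y C.toDGModule).toLin = (C.idCounit Y).toLin := by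
    refine tensor_ext fun i j y hy c hc => ?_
    change counitLeft C Y (braidLin Y C.toDGModule (y ⊗ₜ[k] c)) =
      Coalgebra.counit (R := k) (A := C.toDGModule) c • y
    rw [braidLin_tmul hy hc, map_smul, counitLeft_tmul]
    by_cases hj : j = 0
    · subst hj; simp
    · rw [counit_eq_zero hj hc, zero_smul, smul_zero]
  exact LinearMap.congr_fun this z

theorem counitLeft_leftCoact (Y : DGComodule C) (y : Y.toDGModule) :
    counitLeft C Y.toDGModule (Y.leftCoact.toLin y) = y :=
  (counitLeft_braid Y.toDGModule (Y.coact.toLin y)).trans (counit_coact Y y)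

end leftCoaction

/-! ### Exactness, symmetry and cofree case of the cotensor product. -/

section cotensor

variable [C.IsCocommutative] [IsFiniteProductOfFields k]

theorem mem_cotensor_iff {X Y : DGComodule C} (z : X.toDGModule ⊗[k] Y.toDGModule) :
    z ∈ LinearMap.ker ((coactLeft X Y).sub (coactRight X Y)).toLin ↔
      (coactLeft X Y).toLin z = (coactRight X Y).toLin z := by
  rw [LinearMap.mem_ker]
  exact sub_eq_zero

theorem coactLeft_map {X X' Y Y' : DGComodule C} (f : Hom X X') (g : Hom Y Y')
    (z : X.toDGModule ⊗[k] Y.toDGModule) :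
    (coactLeft X' Y').toLin (TensorProduct.map f.toLin g.toLin z) =
      TensorProduct.map f.toLin (TensorProduct.map LinearMap.id g.toLin)
        ((coactLeft X Y).toLin z) :=
  LinearMap.congr_fun (congrArg (fun h => h.toLin) (coactLeft_naturality f g)) z

theorem coactRight_map {X X' Y Y' : DGComodule C} (f : Hom X X') (g : Hom Y Y')
    (z : X.toDGModule ⊗[k] Y.toDGModule) :
    (coactRight X' Y').toLin (TensorProduct.map f.toLin g.toLin z) =
      TensorProduct.map f.toLin (TensorProduct.map LinearMap.id g.toLin)
        ((coactRight X Y).toLin z) :=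
  LinearMap.congr_fun (congrArg (fun h => h.toLin)
    (coactRight_naturality (X := X) (X' := X') f.toHom g)) z

/-- Injective maps reflect the cotensor condition. -/
theorem mem_cotensor_of_map {X X' Y Y' : DGComodule C} (f : Hom X X') (g : Hom Y Y')
    (hf : Function.Injective f.toLin) (hg : Function.Injective g.toLin)
    (z : X.toDGModule ⊗[k] Y.toDGModule)
    (h : (coactLeft X' Y').toLin (TensorProduct.map f.toLin g.toLin z) =
      (coactRight X' Y').toLin (TensorProduct.map f.toLin g.toLin z)) :
    (coactLeft X Y).toLin z = (coactRight X Y).toLin z := by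
  rw [coactLeft_map, coactRight_map] at h
  exact map_injective _ _ hf (map_injective _ _ Function.injective_id hg) h

theorem cotensorMap_injective {X X' Y Y' : DGComodule C} (f : Hom X X') (g : Hom Y Y')
    (hf : Function.Injective f.toLin) (hg : Function.Injective g.toLin) :
    Function.Injective (cotensorMap f g).toLin := fun _ _ h =>
  Subtype.ext (map_injective _ _ hf hg (congrArg Subtype.val h))

/-- Left exactness of the cotensor product in the first variable. -/
theorem exists_of_cotensorMap_left_eq_zero {X X' Y : DGComodule C} (f : Hom X X')
    (z : (cotensor X Y).toDGModule) (hz : (cotensorMap f (Hom.id Y)).toLin z = 0) :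
    ∃ w : (cotensor (ker f) Y).toDGModule,
      (cotensorMap (kerIncl f) (Hom.id Y)).toLin w = z := by
  have := IsFiniteProductOfFields.flat k Y.toDGModule
  have hex : Function.Exact ((kerIncl f).toLin.rTensor Y.toDGModule)
      (f.toLin.rTensor Y.toDGModule) :=
    Module.Flat.rTensor_exact Y.toDGModule (f := (LinearMap.ker f.toLin).subtype) (g := f.toLin)
      (LinearMap.exact_subtype_ker_map f.toLin)
  obtain ⟨w, hw⟩ := (hex z.1).1 (congrArg Subtype.val hz)
  have hw' : TensorProduct.map (kerIncl f).toLin (Hom.id Y).toLin w = z.1 := hw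
  refine ⟨⟨w, (mem_cotensor_iff w).2 (mem_cotensor_of_map (kerIncl f) (Hom.id Y)
    (kerι_injective f.toHom) Function.injective_id w ?_)⟩, Subtype.ext hw'⟩
  rw [hw']
  exact cotensor_condition z

/-- Left exactness of the cotensor product in the second variable. -/
theorem cotensorMap_right_exact {X Z' Z Z'' : DGComodule C} (f : Hom Z' Z) (g : Hom Z Z'')
    (hf : Function.Injective f.toLin) (hfg : Function.Exact f.toLin g.toLin) :
    Function.Exact (cotensorMap (Hom.id X) f).toLin (cotensorMap (Hom.id X) g).toLin := by
  have := IsFiniteProductOfFields.flat k X.toDGModule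
  have hex : Function.Exact (f.toLin.lTensor X.toDGModule) (g.toLin.lTensor X.toDGModule) :=
    Module.Flat.lTensor_exact X.toDGModule hfg
  intro z
  constructor
  · intro hz
    obtain ⟨w, hw⟩ := (hex z.1).1 (congrArg Subtype.val hz)
    have hw' : TensorProduct.map (Hom.id X).toLin f.toLin w = z.1 := hw
    refine ⟨⟨w, (mem_cotensor_iff w).2 (mem_cotensor_of_map (Hom.id X) f
      Function.injective_id hf w ?_)⟩, Subtype.ext hw'⟩
    rw [hw']
    exact cotensor_condition z
  · rintro ⟨w, rfl⟩
    exact Subtype.ext ((hex (TensorProduct.map LinearMap.id f.toLin w.1)).2 ⟨w.1, rfl⟩)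

/-- `X ⊗ (C ⊗ Y) ≅ Y ⊗ (C ⊗ X)`, the reversal of the three factors. -/
noncomputable def reversal (X Y Z : DGModule k) :
    DGModule.Hom (tensor X (tensor Z Y)) (tensor Y (tensor Z X)) :=
  (tensorHom (DGModule.Hom.id Y) (braid X Z)).comp ((assocHom Y X Z).comp
    ((tensorHom (braid X Y) (DGModule.Hom.id Z)).comp ((assocInvHom X Y Z).comp
      (tensorHom (DGModule.Hom.id X) (braid Z Y)))))

/-- Together with `reversal_coactRight` this makes the cotensor product symmetric: reversing `X ⊗ C
⊗ Y` exchanges the two maps whose equalizer is taken. -/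
theorem reversal_coactLeft (X Y : DGComodule C) :
    (reversal X.toDGModule Y.toDGModule C.toDGModule).comp (coactLeft X Y).toHom =
      (coactRight Y X).toHom.comp (braid X.toDGModule Y.toDGModule) := by
  change (reversal _ _ _).comp ((assocHom X.toDGModule C.toDGModule Y.toDGModule).comp
      (tensorHom X.coact (DGModule.Hom.id _))) =
    (tensorHom (DGModule.Hom.id _) ((braid X.toDGModule C.toDGModule).comp X.coact)).comp
      (braid X.toDGModule Y.toDGModule)
  have e1 : (tensorHom (DGModule.Hom.id Y.toDGModule)
      ((braid X.toDGModule C.toDGModule).comp X.coact)).comp (braid X.toDGModule Y.toDGModule) =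
      (tensorHom (DGModule.Hom.id Y.toDGModule) (braid X.toDGModule C.toDGModule)).comp
      ((braid (tensor X.toDGModule C.toDGModule) Y.toDGModule).comp
        (tensorHom X.coact (DGModule.Hom.id Y.toDGModule))) := by
    rw [braid_naturality, ← DGModule.Hom.comp_assoc, tensorHom_comp, DGModule.Hom.comp_id]
  rw [e1]
  have e2 : (assocHom Y.toDGModule X.toDGModule C.toDGModule).comp
      ((tensorHom (braid X.toDGModule Y.toDGModule) (DGModule.Hom.id C.toDGModule)).comp
      ((assocInvHom X.toDGModule Y.toDGModule C.toDGModule).comp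
      ((tensorHom (DGModule.Hom.id X.toDGModule) (braid C.toDGModule Y.toDGModule)).comp
        (assocHom X.toDGModule C.toDGModule Y.toDGModule)))) =
      braid (tensor X.toDGModule C.toDGModule) Y.toDGModule := by
    rw [← hexagon, ← DGModule.Hom.comp_assoc, assoc_assocInv, DGModule.Hom.id_comp]
  rw [← e2]
  rfl

theorem reversal_coactRight (X Y : DGComodule C) :
    (reversal X.toDGModule Y.toDGModule C.toDGModule).comp (coactRight X Y).toHom =
      (coactLeft Y X).toHom.comp (braid X.toDGModule Y.toDGModule) := by
  change (reversal _ _ _).comp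
      (tensorHom (DGModule.Hom.id _) ((braid Y.toDGModule C.toDGModule).comp Y.coact)) =
    ((assocHom Y.toDGModule C.toDGModule X.toDGModule).comp
      (tensorHom Y.coact (DGModule.Hom.id _))).comp (braid X.toDGModule Y.toDGModule)
  rw [DGModule.Hom.comp_assoc, ← braid_naturality, ← DGModule.Hom.comp_assoc, hexagon_right]
  have e : (tensorHom (DGModule.Hom.id X.toDGModule) (braid C.toDGModule Y.toDGModule)).comp
      (tensorHom (DGModule.Hom.id X.toDGModule)
        ((braid Y.toDGModule C.toDGModule).comp Y.coact)) =
      tensorHom (DGModule.Hom.id X.toDGModule) Y.coact := by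
    rw [tensorHom_comp, ← DGModule.Hom.comp_assoc, braid_braid]
    rfl
  rw [← e]
  rfl

/-- The symmetry `X □_C Y ⟶ Y □_C X`. -/
noncomputable def cotensorSwap (X Y : DGComodule C) (z : (cotensor X Y).toDGModule) :
    (cotensor Y X).toDGModule :=
  ⟨(braid X.toDGModule Y.toDGModule).toLin z.1, by
    have h₁ : (reversal X.toDGModule Y.toDGModule C.toDGModule).toLin
        ((coactLeft X Y).toLin z.1) = (coactRight Y X).toLin ((braid _ _).toLin z.1) :=
      DGModule.Hom.congr_toLin (reversal_coactLeft X Y) z.1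
    have h₂ : (reversal X.toDGModule Y.toDGModule C.toDGModule).toLin
        ((coactRight X Y).toLin z.1) = (coactLeft Y X).toLin ((braid _ _).toLin z.1) :=
      DGModule.Hom.congr_toLin (reversal_coactRight X Y) z.1
    have h₃ : (coactLeft X Y).toLin z.1 = (coactRight X Y).toLin z.1 := cotensor_condition z
    rw [mem_cotensor_iff, ← h₁, ← h₂, h₃]⟩

theorem cotensorSwap_swap (X Y : DGComodule C) (z : (cotensor X Y).toDGModule) :
    cotensorSwap Y X (cotensorSwap X Y z) = z :=
  Subtype.ext (DGModule.Hom.congr_toLin braid_braid z.1)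

theorem cotensorSwap_cotensorMap {X X' Y Y' : DGComodule C} (f : Hom X X') (g : Hom Y Y')
    (z : (cotensor X Y).toDGModule) :
    cotensorSwap X' Y' ((cotensorMap f g).toLin z) =
      (cotensorMap g f).toLin (cotensorSwap X Y z) :=
  Subtype.ext (DGModule.Hom.congr_toLin (braid_naturality f.toHom g.toHom) z.1)

/-- If `Y` is coflat, then `- □_C Y` preserves surjections. -/
theorem IsCoflat.cotensorMap_surjective {Y : DGComodule C} (hY : Y.IsCoflat) {Z Z' : DGComodule C}
    (g : Hom Z Z') (hg : Function.Surjective g.toLin) :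
    Function.Surjective (cotensorMap g (Hom.id Y)).toLin := by
  have h := (hY (ker g) Z Z' (kerIncl g) g (kerι_injective g.toHom)
    (LinearMap.exact_subtype_ker_map g.toLin) hg).2.2
  intro z
  obtain ⟨w, hw⟩ := h (cotensorSwap Z' Y z)
  refine ⟨cotensorSwap Y Z w, ?_⟩
  rw [← cotensorSwap_cotensorMap, hw, cotensorSwap_swap]

/-- The isomorphism `(M ⊗ C) □_C Y ⟶ M ⊗ Y`. -/
noncomputable def cofreeCotensor (M : DGModule k) (Y : DGComodule C) :
    DGModule.Hom (cotensor (tensorLeft M (regular C)) Y).toDGModule (tensor M Y.toDGModule) :=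
  (tensorHom (C.idCounit M) (DGModule.Hom.id Y.toDGModule)).comp
    (cotensorIncl (tensorLeft M (regular C)) Y).toHom

theorem idCounit_tensor_eq (M : DGModule k) (Y : DGModule k) (w : C.toDGModule ⊗[k] Y) (m : M) :
    TensorProduct.map (C.idCounit M).toLin LinearMap.id
      ((TensorProduct.assoc k M C.toDGModule Y).symm (m ⊗ₜ[k] w)) =
      m ⊗ₜ[k] counitLeft C Y w := by
  induction w using TensorProduct.induction_on with
  | zero => simp
  | add a b ha hb => simp only [TensorProduct.tmul_add, map_add, ha, hb]
  | tmul c y => exact TensorProduct.smul_tmul (Coalgebra.counit (R := k) (A := C.toDGModule) c) m y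

theorem coactLeft_cofree (M : DGModule k) (Y : DGComodule C) (m : M)
    (w : C.toDGModule ⊗[k] Y.toDGModule) :
    (coactLeft (tensorLeft M (regular C)) Y).toLin
        ((TensorProduct.assoc k M C.toDGModule Y.toDGModule).symm (m ⊗ₜ[k] w)) =
      (TensorProduct.assoc k M C.toDGModule (C.toDGModule ⊗[k] Y.toDGModule)).symm
        (m ⊗ₜ[k] TensorProduct.assoc k C.toDGModule C.toDGModule Y.toDGModule
          (TensorProduct.map C.comulHom.toLin LinearMap.id w)) :=
  coactLeft_tensor M (regular C) Y m w

/-- The inverse sends `m ⊗ y` to `m ⊗ λ(y)`, where `λ` is the left coaction of `Y`. -/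
theorem cofreeCotensor_bijective (M : DGModule k) (Y : DGComodule C) :
    Function.Bijective (cofreeCotensor M Y).toLin := by
  let v : M ⊗[k] Y.toDGModule →ₗ[k] (M ⊗[k] C.toDGModule) ⊗[k] Y.toDGModule :=
    (TensorProduct.assoc k M C.toDGModule Y.toDGModule).symm.toLinearMap ∘ₗ
      TensorProduct.map LinearMap.id Y.leftCoact.toLin
  let L : (M ⊗[k] C.toDGModule) ⊗[k] Y.toDGModule →ₗ[k]
      (M ⊗[k] C.toDGModule) ⊗[k] (C.toDGModule ⊗[k] Y.toDGModule) :=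
    (coactLeft (tensorLeft M (regular C)) Y).toLin
  let R : (M ⊗[k] C.toDGModule) ⊗[k] Y.toDGModule →ₗ[k]
      (M ⊗[k] C.toDGModule) ⊗[k] (C.toDGModule ⊗[k] Y.toDGModule) :=
    (coactRight (tensorLeft M (regular C)) Y).toLin
  -- The candidate inverse takes values in the equalizer by coassociativity of the left coaction.
  have hv : ∀ w, L (v w) = R (v w) := by
    intro w
    induction w using TensorProduct.induction_on with
    | zero => simp
    | add a b ha hb => simp only [map_add, ha, hb]
    | tmul m y =>
      refine (coactLeft_cofree M Y m (Y.leftCoact.toLin y)).trans ?_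
      have h := DGModule.Hom.congr_toLin (leftCoact_coassoc Y) y
      refine (congrArg (fun t => (TensorProduct.assoc k M C.toDGModule
        (C.toDGModule ⊗[k] Y.toDGModule)).symm (m ⊗ₜ[k] t)) h.symm).trans ?_
      change _ = TensorProduct.map LinearMap.id Y.leftCoact.toLin
        ((TensorProduct.assoc k M C.toDGModule Y.toDGModule).symm (m ⊗ₜ[k] Y.leftCoact.toLin y))
      change (TensorProduct.assoc k M C.toDGModule (C.toDGModule ⊗[k] Y.toDGModule)).symm
        (m ⊗ₜ[k] TensorProduct.map LinearMap.id Y.leftCoact.toLin (Y.leftCoact.toLin y)) = _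
      induction Y.leftCoact.toLin y using TensorProduct.induction_on with
      | zero => simp
      | add a b ha hb => simp only [TensorProduct.tmul_add, map_add, ha, hb]
      | tmul a b => rfl
  have huv : ∀ w, (cofreeCotensor M Y).toLin ⟨v w, (mem_cotensor_iff _).2 (hv w)⟩ = w := by
    intro w
    change TensorProduct.map (C.idCounit M).toLin LinearMap.id (v w) = w
    induction w using TensorProduct.induction_on with
    | zero => simp
    | add a b ha hb => simp only [map_add, ha, hb]
    | tmul m y =>
      change TensorProduct.map (C.idCounit M).toLin LinearMap.id
        ((TensorProduct.assoc k M C.toDGModule Y.toDGModule).symm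
          (m ⊗ₜ[k] Y.leftCoact.toLin y)) = _
      rw [idCounit_tensor_eq, counitLeft_leftCoact]
  -- Apply `id ⊗ ε` of the first two factors to the equation that defines the cotensor product. The
  -- left side becomes `z` itself up to reassociation by the counit axiom, the right side becomes
  -- `λ` applied after `cofreeCotensor`.
  have hvu : ∀ z : (cotensor (tensorLeft M (regular C)) Y).toDGModule,
      v ((cofreeCotensor M Y).toLin z) = z.1 := by
    intro z
    have h₀ : L z.1 = R z.1 := cotensor_condition z
    have h₁ : ∀ w : (M ⊗[k] C.toDGModule) ⊗[k] Y.toDGModule,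
        TensorProduct.map (C.idCounit M).toLin
          (LinearMap.id (M := C.toDGModule ⊗[k] Y.toDGModule))
          (L w) =
        TensorProduct.assoc k M C.toDGModule Y.toDGModule w := by
      intro w
      induction w using TensorProduct.induction_on with
      | zero => simp
      | add a b ha hb => simp only [map_add, ha, hb]
      | tmul t y =>
        have e := DGModule.Hom.congr_toLin
          (DGCoalgebra.idCounit_tensor_idComul (C := C) M) t
        have e' : TensorProduct.map (C.idCounit M).toLin LinearMap.id
          ((C.idComul M).toLin t) = t := e
        change TensorProduct.map (C.idCounit M).toLin LinearMap.id
          (TensorProduct.assoc k (M ⊗[k] C.toDGModule) C.toDGModule Y.toDGModule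
            ((C.idComul M).toLin t ⊗ₜ[k] y)) = _
        conv_rhs => rw [← e']
        induction (C.idComul M).toLin t using TensorProduct.induction_on with
        | zero => simp
        | add a b ha hb => simp only [TensorProduct.add_tmul, map_add, ha, hb]
        | tmul a b => rfl
    have h₂ : ∀ w : (M ⊗[k] C.toDGModule) ⊗[k] Y.toDGModule,
        TensorProduct.map (C.idCounit M).toLin
          (LinearMap.id (M := C.toDGModule ⊗[k] Y.toDGModule))
          (R w) =
        TensorProduct.map LinearMap.id Y.leftCoact.toLin
          (TensorProduct.map (C.idCounit M).toLin LinearMap.id w) := by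
      intro w
      induction w using TensorProduct.induction_on with
      | zero => simp
      | add a b ha hb => simp only [map_add, ha, hb]
      | tmul t y => rfl
    have h := (h₁ z.1).symm.trans ((congrArg _ h₀).trans (h₂ z.1))
    exact (LinearEquiv.symm_apply_eq _).2 h.symm
  refine ⟨fun z w h => Subtype.ext ?_, fun w => ⟨_, huv w⟩⟩
  rw [← hvu z, ← hvu w, h]

/-- Cotensor products with cofree comodules preserve quasi-isomorphisms. -/
theorem cotensorMap_cofree_isQuasiIso {M M' : DGModule k} {Y Y' : DGComodule C}
    {a : DGModule.Hom M M'} {g : Hom Y Y'} (ha : a.IsQuasiIso) (hg : g.IsQuasiIso) :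
    (cotensorMap (tensorLeftMap a (Hom.id (regular C))) g).IsQuasiIso := by
  have h : (cofreeCotensor M' Y').comp
      (cotensorMap (tensorLeftMap a (Hom.id (regular C))) g).toHom =
      (tensorHom a g.toHom).comp (cofreeCotensor M Y) := by
    have : ∀ w : (M ⊗[k] C.toDGModule) ⊗[k] Y.toDGModule,
        TensorProduct.map (C.idCounit M').toLin LinearMap.id
          (TensorProduct.map (TensorProduct.map a.toLin LinearMap.id) g.toLin w) =
        TensorProduct.map a.toLin g.toLin
          (TensorProduct.map (C.idCounit M).toLin LinearMap.id w) := by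
      intro w
      induction w using TensorProduct.induction_on with
      | zero => simp
      | add a b ha hb => simp only [map_add, ha, hb]
      | tmul t y =>
        have := DGModule.Hom.congr_toLin (DGCoalgebra.idCounit_naturality (C := C) a) t
        exact congrArg (· ⊗ₜ[k] g.toLin y) this
    ext z
    exact this z.1
  refine DGModule.Hom.IsQuasiIso.of_comp_left
    (DGModule.Hom.isQuasiIso_of_bijective _ (cofreeCotensor_bijective M' Y')) ?_
  rw [h]
  exact (DGModule.Hom.IsQuasiIso.tensor ha hg).comp
    (DGModule.Hom.isQuasiIso_of_bijective _ (cofreeCotensor_bijective M Y))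

end cotensor

end DGComodule

/-! ### The complex of natural families, which is the end in chain complexes. -/

namespace DGModule

variable {k : Type u} [CommRing k]

section graded

variable (A : ℕ → Type u) [∀ n, AddCommGroup (A n)] [∀ n, Module k (A n)]
  (D : ∀ n, A (n + 1) →ₗ[k] A n)

/-- The internal grading of an external direct sum. -/
theorem isInternal_range_lof :
    DirectSum.IsInternal fun n => LinearMap.range (DirectSum.lof k ℕ A n) := by
  refine isInternal_of_proj _ (fun n => DirectSum.lof k ℕ A n ∘ₗ
    DirectSum.component k ℕ A n) ?_ ?_ ?_
  · rintro n _ ⟨x, rfl⟩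
    rw [LinearMap.comp_apply, DirectSum.component.lof_self]
  · rintro m n hmn _ ⟨x, rfl⟩
    rw [LinearMap.comp_apply, DirectSum.component.of, dif_neg (Ne.symm hmn), map_zero]
  · rw [eq_top_iff]
    rintro x -
    induction x using DirectSum.induction_on with
    | zero => exact zero_mem _
    | of n x => exact Submodule.mem_iSup_of_mem n ⟨x, rfl⟩
    | add x y hx hy => exact add_mem hx hy

/-- The differential on an external direct sum given by its components. -/
noncomputable def gradedD : DirectSum ℕ A →ₗ[k] DirectSum ℕ A :=
  DirectSum.toModule k ℕ _ fun j => match j with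
    | 0 => 0
    | j + 1 => DirectSum.lof k ℕ A j ∘ₗ D j

theorem gradedD_lof_zero (x : A 0) : gradedD A D (DirectSum.lof k ℕ A 0 x) = 0 := by
  rw [gradedD, DirectSum.toModule_lof]
  rfl

theorem gradedD_lof_succ (j : ℕ) (x : A (j + 1)) :
    gradedD A D (DirectSum.lof k ℕ A (j + 1) x) = DirectSum.lof k ℕ A j (D j x) := by
  rw [gradedD, DirectSum.toModule_lof]
  rfl

/-- The complex with prescribed homogeneous parts. -/
noncomputable abbrev ofGraded (hD : ∀ n x, D n (D (n + 1) x) = 0) : DGModule k where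
  carrier := DirectSum ℕ A
  gr j := LinearMap.range (DirectSum.lof k ℕ A j)
  isInternal := isInternal_range_lof A
  d := gradedD A D
  d_mem := by
    rintro n _ ⟨φ, rfl⟩
    rw [gradedD_lof_succ]
    exact ⟨_, rfl⟩
  d_zero := by
    rintro _ ⟨φ, rfl⟩
    exact gradedD_lof_zero A D φ
  d_d := by
    refine DirectSum.linearMap_ext k fun n => LinearMap.ext fun φ => ?_
    rw [LinearMap.comp_apply, LinearMap.comp_apply]
    rcases n with _ | _ | n
    · rw [gradedD_lof_zero, map_zero]; rfl
    · rw [gradedD_lof_succ, gradedD_lof_zero]; rfl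
    · rw [gradedD_lof_succ, gradedD_lof_succ, hD, map_zero]; rfl

end graded

/-- A family of complexes with operators in the shape of cofaces and codegeneracies. -/
structure CosimplicialFamily (k : Type u) [CommRing k] where
  obj : ℕ → DGModule k
  δ : ∀ {n : ℕ} (_ : Fin (n + 2)), Hom (obj n) (obj (n + 1))
  σ : ∀ {n : ℕ} (_ : Fin (n + 1)), Hom (obj (n + 1)) (obj n)

namespace CosimplicialFamily

variable (M : CosimplicialFamily k)

/-- The natural families of linear maps `N_*(N(Δ ↓ [n]); k) ⟶ M^n`. -/
def families : Submodule k (∀ n, weight k n →ₗ[k] M.obj n) where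
  carrier := {φ | (∀ (n : ℕ) (i : Fin (n + 2)) (κ : weight k n),
      φ (n + 1) ((weightδ k i).toLin κ) = (M.δ i).toLin (φ n κ)) ∧
    ∀ (n : ℕ) (i : Fin (n + 1)) (κ : weight k (n + 1)),
      φ n ((weightσ k i).toLin κ) = (M.σ i).toLin (φ (n + 1) κ)}
  zero_mem' := ⟨fun n i κ => by simp, fun n i κ => by simp⟩
  add_mem' := fun {φ ψ} hφ hψ => ⟨fun n i κ => by simp [hφ.1 n i κ, hψ.1 n i κ],
    fun n i κ => by simp [hφ.2 n i κ, hψ.2 n i κ]⟩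
  smul_mem' := fun a φ hφ => ⟨fun n i κ => by simp [hφ.1 n i κ], fun n i κ => by simp [hφ.2 n i κ]⟩

/-- The differential on families. -/
noncomputable def familyD :
    (∀ n, weight k n →ₗ[k] M.obj n) →ₗ[k] (∀ n, weight k n →ₗ[k] M.obj n) where
  -- The weight is the first tensor factor, so the sign in `d (κ ⊗ φ)` depends on the degree of `κ`.
  -- Composition with `sgn` is what makes the evaluation `κ ⊗ φ ↦ φ κ` a chain map.
  toFun φ n := ((M.obj n).d ∘ₗ φ n - φ n ∘ₗ (weight k n).d) ∘ₗ (weight k n).sgn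
  map_add' φ ψ := by
    ext n : 1
    refine LinearMap.ext fun κ => ?_
    simp only [Pi.add_apply, LinearMap.comp_apply, LinearMap.sub_apply, LinearMap.add_apply,
      map_add]
    abel
  map_smul' a φ := by
    ext n : 1
    refine LinearMap.ext fun κ => ?_
    simp only [Pi.smul_apply, LinearMap.comp_apply, LinearMap.sub_apply, LinearMap.smul_apply,
      map_smul, RingHom.id_apply, smul_sub]

theorem familyD_apply (φ : ∀ n, weight k n →ₗ[k] M.obj n) (n : ℕ) (κ : weight k n) :
    M.familyD φ n κ = (M.obj n).d (φ n ((weight k n).sgn κ)) -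
      φ n ((weight k n).d ((weight k n).sgn κ)) := rfl

theorem familyD_familyD (φ : ∀ n, weight k n →ₗ[k] M.obj n) : M.familyD (M.familyD φ) = 0 := by
  ext n : 1
  refine LinearMap.ext fun κ => ?_
  rw [familyD_apply, familyD_apply, familyD_apply, sgn_sgn, map_sub, d_d_apply, sgn_d, sgn_sgn,
    map_neg, map_neg, map_neg, d_d_apply]
  simp

/-- The natural families of degree `j` (which are chain maps if `j = 0`). -/
def familyGr (j : ℕ) : Submodule k (∀ n, weight k n →ₗ[k] M.obj n) where
  -- The last condition truncates the mapping complex: complexes here are non-negatively graded, so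
  -- in degree `0` only the cycles may be kept. Elements of degree `0` of a test complex are cycles,
  -- so nothing is lost for the universal property.
  carrier := {φ | φ ∈ M.families ∧ (∀ n p, ∀ κ ∈ (weight k n).gr p, φ n κ ∈ (M.obj n).gr (p + j)) ∧
    (j = 0 → M.familyD φ = 0)}
  zero_mem' := ⟨zero_mem _, fun n p κ _ => zero_mem _, fun _ => map_zero _⟩
  add_mem' := fun {φ ψ} hφ hψ => ⟨add_mem hφ.1 hψ.1,
    fun n p κ h => add_mem (hφ.2.1 n p κ h) (hψ.2.1 n p κ h),
    fun h => by rw [map_add, hφ.2.2 h, hψ.2.2 h, add_zero]⟩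
  smul_mem' := fun a φ hφ => ⟨Submodule.smul_mem _ _ hφ.1,
    fun n p κ h => Submodule.smul_mem _ _ (hφ.2.1 n p κ h),
    fun h => by rw [map_smul, hφ.2.2 h, smul_zero]⟩

theorem familyD_mem (j : ℕ) (φ : ∀ n, weight k n →ₗ[k] M.obj n) (hφ : φ ∈ M.familyGr (j + 1)) :
    M.familyD φ ∈ M.familyGr j := by
  refine ⟨⟨fun n i κ => ?_, fun n i κ => ?_⟩, fun n p κ hκ => ?_, fun _ => M.familyD_familyD φ⟩
  · have h := (weightδ k i).scale_comm (fun n => (-1) ^ n) κ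
    rw [familyD_apply, familyD_apply, map_sub, ← hφ.1.1, (M.δ i).map_d_apply, ← hφ.1.1]
    change _ = (M.obj (n + 1)).d (φ (n + 1) ((weightδ k i).toLin ((weight k n).scale _ κ))) -
      φ (n + 1) ((weightδ k i).toLin ((weight k n).d ((weight k n).scale _ κ)))
    rw [(weightδ k i).map_d_apply, h]
    rfl
  · have h := (weightσ k i).scale_comm (fun n => (-1) ^ n) κ
    rw [familyD_apply, familyD_apply, map_sub, ← hφ.1.2, (M.σ i).map_d_apply, ← hφ.1.2]
    change _ = (M.obj n).d (φ n ((weightσ k i).toLin ((weight k (n + 1)).scale _ κ))) -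
      φ n ((weightσ k i).toLin ((weight k (n + 1)).d ((weight k (n + 1)).scale _ κ)))
    rw [(weightσ k i).map_d_apply, h]
    rfl
  · rw [familyD_apply, sgn_of_mem _ hκ, map_smul, map_smul, map_smul, map_smul]
    refine sub_mem (Submodule.smul_mem _ _ ((M.obj n).d_mem _ _ (hφ.2.1 n p κ hκ)))
      (Submodule.smul_mem _ _ ?_)
    cases p with
    | zero => rw [(weight k n).d_zero κ hκ, map_zero]; exact zero_mem _
    | succ p =>
      have := hφ.2.1 n p _ ((weight k n).d_mem p κ hκ)
      rwa [show p + 1 + j = p + (j + 1) by omega]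

/-- The differential on natural families of positive degree. -/
noncomputable def limitD (j : ℕ) : M.familyGr (j + 1) →ₗ[k] M.familyGr j :=
  M.familyD.restrict (M.familyD_mem j)

theorem limitD_limitD (j : ℕ) (φ : M.familyGr (j + 2)) : M.limitD j (M.limitD (j + 1) φ) = 0 :=
  Subtype.ext (M.familyD_familyD φ.1)

/-- The complex of natural families `N_*(N(Δ ↓ [n]); k) ⟶ M^n`. -/
noncomputable abbrev limit : DGModule k :=
  ofGraded (fun j => ↥(M.familyGr j)) M.limitD M.limitD_limitD

theorem limitD_lof_zero (φ : M.familyGr 0) :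
    M.limit.d (DirectSum.lof k ℕ (fun j => M.familyGr j) 0 φ) = 0 :=
  gradedD_lof_zero (k := k) (fun j => M.familyGr j) M.limitD φ

theorem limitD_lof_succ (j : ℕ) (φ : M.familyGr (j + 1)) :
    M.limit.d (DirectSum.lof k ℕ (fun j => M.familyGr j) (j + 1) φ) =
      DirectSum.lof k ℕ (fun j => M.familyGr j) j (M.limitD j φ) :=
  gradedD_lof_succ (k := k) (fun j => M.familyGr j) M.limitD j φ

/-- The family underlying an element of the limit. -/
noncomputable def toFamily : M.limit →ₗ[k] (∀ n, weight k n →ₗ[k] M.obj n) :=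
  DirectSum.toModule k ℕ _ fun j => (M.familyGr j).subtype

theorem toFamily_lof (j : ℕ) (φ : M.familyGr j) :
    M.toFamily (DirectSum.lof k ℕ (fun j => M.familyGr j) j φ) = φ.1 := by
  rw [toFamily, DirectSum.toModule_lof]
  rfl

theorem toFamily_d (x : M.limit) : M.toFamily (M.limit.d x) = M.familyD (M.toFamily x) := by
  have : M.toFamily ∘ₗ M.limit.d = M.familyD ∘ₗ M.toFamily := by
    refine DirectSum.linearMap_ext k fun j => LinearMap.ext fun φ => ?_
    change M.toFamily (M.limit.d (DirectSum.lof k ℕ (fun j => M.familyGr j) j φ)) =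
      M.familyD (M.toFamily (DirectSum.lof k ℕ (fun j => M.familyGr j) j φ))
    rw [toFamily_lof]
    cases j with
    | zero => rw [limitD_lof_zero, map_zero, φ.2.2.2 rfl]
    | succ j => rw [limitD_lof_succ, toFamily_lof]; rfl
  exact LinearMap.congr_fun this x

theorem toFamily_mem (x : M.limit) : M.toFamily x ∈ M.families := by
  induction x using M.limit.induction_homogeneous with
  | h n x hx =>
    obtain ⟨φ, rfl⟩ := hx
    rw [toFamily_lof]
    exact φ.2.1
  | h0 => rw [map_zero]; exact zero_mem _
  | ha x y hx hy => rw [map_add]; exact add_mem hx hy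

theorem toFamily_degree {j : ℕ} {x : M.limit} (hx : x ∈ M.limit.gr j) (n p : ℕ) (κ : weight k n)
    (hκ : κ ∈ (weight k n).gr p) : M.toFamily x n κ ∈ (M.obj n).gr (p + j) := by
  obtain ⟨φ, rfl⟩ := hx
  rw [toFamily_lof]
  exact φ.2.2.1 n p κ hκ

theorem eq_of_toFamily_eq {j : ℕ} {x y : M.limit} (hx : x ∈ M.limit.gr j) (hy : y ∈ M.limit.gr j)
    (h : M.toFamily x = M.toFamily y) : x = y := by
  obtain ⟨φ, rfl⟩ := hx
  obtain ⟨ψ, rfl⟩ := hy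
  rw [toFamily_lof, toFamily_lof] at h
  rw [Subtype.ext h]

/-- The evaluation `N_*(N(Δ ↓ [n]); k) ⊗ lim M ⟶ M^n`. -/
noncomputable def eval (n : ℕ) : Hom (tensor (weight k n) M.limit) (M.obj n) where
  toLin := TensorProduct.lift ((LinearMap.proj n ∘ₗ M.toFamily).flip)
  map_mem := map_mem_of_tmul _ _ fun i j κ hκ x hx => M.toFamily_degree hx n i κ hκ
  map_d := by
    refine TensorProduct.ext' fun κ x => ?_
    rw [LinearMap.comp_apply, LinearMap.comp_apply, tensor_d_tmul, map_add]
    change M.toFamily x n ((weight k n).d κ) + M.toFamily (M.limit.d x) n ((weight k n).sgn κ) =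
      (M.obj n).d (M.toFamily x n κ)
    rw [toFamily_d, familyD_apply, sgn_sgn, add_sub_cancel]

theorem eval_δ {n : ℕ} (i : Fin (n + 2)) :
    (M.eval (n + 1)).comp (tensorHom (weightδ k i) (Hom.id _)) = (M.δ i).comp (M.eval n) := by
  ext1
  exact TensorProduct.ext' fun κ x => (M.toFamily_mem x).1 n i κ

theorem eval_σ {n : ℕ} (i : Fin (n + 1)) :
    (M.eval n).comp (tensorHom (weightσ k i) (Hom.id _)) = (M.σ i).comp (M.eval (n + 1)) := by
  ext1
  exact TensorProduct.ext' fun κ x => (M.toFamily_mem x).2 n i κ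

variable {M} {Z : DGModule k}

/-- Maps to the limit are determined by the induced families. -/
theorem limit_hom_ext {f g : Hom Z M.limit}
    (h : ∀ n, (M.eval n).comp (tensorHom (Hom.id _) f) = (M.eval n).comp (tensorHom (Hom.id _) g)) :
    f = g := by
  ext1
  refine Z.lin_ext fun j z hz => M.eq_of_toFamily_eq (f.map_mem j z hz) (g.map_mem j z hz) ?_
  ext n : 1
  refine LinearMap.ext fun κ => ?_
  exact Hom.congr_toLin (h n) (κ ⊗ₜ[k] z)

section lift

variable (θ : ∀ n, Hom (tensor (weight k n) Z) (M.obj n))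
  (hδ : ∀ {n : ℕ} (i : Fin (n + 2)),
    (θ (n + 1)).comp (tensorHom (weightδ k i) (Hom.id Z)) = (M.δ i).comp (θ n))
  (hσ : ∀ {n : ℕ} (i : Fin (n + 1)),
    (θ n).comp (tensorHom (weightσ k i) (Hom.id Z)) = (M.σ i).comp (θ (n + 1)))

/-- The family of linear maps `κ ↦ θ (κ ⊗ z)`. -/
noncomputable def partialEval : Z →ₗ[k] (∀ n, weight k n →ₗ[k] M.obj n) :=
  LinearMap.pi fun n => (TensorProduct.curry (θ n).toLin).flip

theorem familyD_partialEval (z : Z) : M.familyD (partialEval θ z) = partialEval θ (Z.d z) := by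
  ext n : 1
  refine LinearMap.ext fun κ => ?_
  rw [familyD_apply]
  change (M.obj n).d ((θ n).toLin ((weight k n).sgn κ ⊗ₜ[k] z)) -
    (θ n).toLin ((weight k n).d ((weight k n).sgn κ) ⊗ₜ[k] z) = (θ n).toLin (κ ⊗ₜ[k] Z.d z)
  rw [← (θ n).map_d_apply, tensor_d_tmul, map_add, sgn_sgn, add_sub_cancel_left]

theorem partialEval_mem (hδ : ∀ {n : ℕ} (i : Fin (n + 2)),
      (θ (n + 1)).comp (tensorHom (weightδ k i) (Hom.id Z)) = (M.δ i).comp (θ n))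
    (hσ : ∀ {n : ℕ} (i : Fin (n + 1)),
      (θ n).comp (tensorHom (weightσ k i) (Hom.id Z)) = (M.σ i).comp (θ (n + 1))) {j : ℕ} {z : Z} (hz : z ∈ Z.gr j) : partialEval θ z ∈ M.familyGr j := by
  refine ⟨⟨fun n i κ => Hom.congr_toLin (hδ i) (κ ⊗ₜ[k] z),
    fun n i κ => Hom.congr_toLin (hσ i) (κ ⊗ₜ[k] z)⟩,
    fun n p κ hκ => (θ n).map_mem _ _ (tmul_mem rfl hκ hz), fun h => ?_⟩
  subst h
  rw [familyD_partialEval, Z.d_zero z hz, map_zero]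

/-- The linear map to the limit induced by a natural family. -/
noncomputable def limitLiftLin : Z →ₗ[k] M.limit :=
  DirectSum.toModule k ℕ (DirectSum ℕ fun j => M.familyGr j) (fun j =>
    DirectSum.lof k ℕ (fun j => M.familyGr j) j ∘ₗ
      (partialEval θ).restrict (p := Z.gr j) (q := M.familyGr j)
        (fun _ hz => partialEval_mem θ hδ hσ hz)) ∘ₗ Z.sumEquiv.symm.toLinearMap

theorem limitLiftLin_of_mem {j : ℕ} {z : Z} (hz : z ∈ Z.gr j) :
    limitLiftLin θ hδ hσ z = DirectSum.lof k ℕ (fun j => M.familyGr j) j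
      ⟨partialEval θ z, partialEval_mem θ hδ hσ hz⟩ := by
  have h : Z.sumEquiv.symm z = DirectSum.lof k ℕ (fun i => Z.gr i) j ⟨z, hz⟩ := by
    rw [LinearEquiv.symm_apply_eq, sumEquiv_lof]
  rw [limitLiftLin, LinearMap.comp_apply, LinearEquiv.coe_coe, h, DirectSum.toModule_lof]
  rfl

theorem toFamily_limitLiftLin (z : Z) :
    M.toFamily (limitLiftLin θ hδ hσ z) = partialEval θ z := by
  induction z using Z.induction_homogeneous with
  | h n z hz => rw [limitLiftLin_of_mem θ hδ hσ hz, toFamily_lof]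
  | h0 => rw [map_zero, map_zero, map_zero]
  | ha x y hx hy => rw [map_add, map_add, map_add, hx, hy]

theorem limitLiftLin_mem (j : ℕ) (z : Z) (hz : z ∈ Z.gr j) :
    limitLiftLin θ hδ hσ z ∈ M.limit.gr j := by
  rw [limitLiftLin_of_mem θ hδ hσ hz]
  exact ⟨_, rfl⟩

/-- The chain map to the limit induced by a natural family. -/
noncomputable def limitLift : Hom Z M.limit where
  toLin := limitLiftLin θ hδ hσ
  map_mem := limitLiftLin_mem θ hδ hσ
  map_d := by
    refine Z.lin_ext fun j z hz => ?_
    rw [LinearMap.comp_apply, LinearMap.comp_apply]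
    cases j with
    | zero =>
      rw [Z.d_zero z hz, map_zero, M.limit.d_zero _ (limitLiftLin_mem θ hδ hσ 0 z hz)]
    | succ j =>
      refine M.eq_of_toFamily_eq (limitLiftLin_mem θ hδ hσ j _ (Z.d_mem j z hz))
        (M.limit.d_mem j _ (limitLiftLin_mem θ hδ hσ (j + 1) z hz)) ?_
      rw [toFamily_d, toFamily_limitLiftLin, toFamily_limitLiftLin, familyD_partialEval]

theorem eval_limitLift (n : ℕ) :
    (M.eval n).comp (tensorHom (Hom.id _) (limitLift θ hδ hσ)) = θ n := by
  ext1
  refine TensorProduct.ext' fun κ z => ?_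
  change M.toFamily (limitLiftLin θ hδ hσ z) n κ = _
  rw [toFamily_limitLiftLin]
  rfl

end lift

end CosimplicialFamily

end DGModule

/-! ### Existence of homotopy limits of cosimplicial comodules. -/

namespace CosimplicialComodule

open DGModule DGComodule

variable {k : Type u} [CommRing k] {C : DGCoalgebra k} (Φ : CosimplicialComodule C)

/-- The complexes underlying a cosimplicial comodule. -/
abbrev family : CosimplicialFamily k where
  obj n := (Φ.obj n).toDGModule
  δ i := (Φ.δ i).toHom
  σ i := (Φ.σ i).toHom

/-- The complexes `Φ^n ⊗ C`. -/
noncomputable abbrev tensorFamily : CosimplicialFamily k where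
  obj n := tensor (Φ.obj n).toDGModule C.toDGModule
  δ i := tensorHom (Φ.δ i).toHom (DGModule.Hom.id _)
  σ i := tensorHom (Φ.σ i).toHom (DGModule.Hom.id _)

/-- The family `κ ⊗ (p ⊗ c) ↦ ε(c) ρ(p(κ))`. -/
noncomputable def coactFamily (n : ℕ) :
    DGModule.Hom (tensor (weight k n) (tensor Φ.family.limit C.toDGModule))
      (tensor (Φ.obj n).toDGModule C.toDGModule) :=
  (Φ.obj n).coact.comp ((Φ.family.eval n).comp
    (tensorHom (DGModule.Hom.id _) (C.idCounit Φ.family.limit)))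

/-- The family `κ ⊗ (p ⊗ c) ↦ p(κ) ⊗ c`. -/
noncomputable def evalFamily (n : ℕ) :
    DGModule.Hom (tensor (weight k n) (tensor Φ.family.limit C.toDGModule))
      (tensor (Φ.obj n).toDGModule C.toDGModule) :=
  (tensorHom (Φ.family.eval n) (DGModule.Hom.id _)).comp
    (assocInvHom (weight k n) Φ.family.limit C.toDGModule)

theorem coactFamily_δ {n : ℕ} (i : Fin (n + 2)) :
    (Φ.coactFamily (n + 1)).comp (tensorHom (weightδ k i) (DGModule.Hom.id _)) =
      (tensorHom (Φ.δ i).toHom (DGModule.Hom.id _)).comp (Φ.coactFamily n) := by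
  have h := congrArg (fun f => (Φ.obj (n + 1)).coact.comp (f.comp
    (tensorHom (DGModule.Hom.id _) (C.idCounit Φ.family.limit)))) (Φ.family.eval_δ i)
  refine Eq.trans ?_ (h.trans ?_)
  · change (Φ.obj (n + 1)).coact.comp ((Φ.family.eval (n + 1)).comp
      ((tensorHom _ _).comp (tensorHom _ _))) = (Φ.obj (n + 1)).coact.comp
      ((Φ.family.eval (n + 1)).comp ((tensorHom _ _).comp (tensorHom _ _)))
    rw [tensorHom_comp, tensorHom_comp]
    rfl
  · exact congrArg (fun f => f.comp ((Φ.family.eval n).comp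
      (tensorHom (DGModule.Hom.id _) (C.idCounit Φ.family.limit)))) (Φ.δ i).colinear

theorem coactFamily_σ {n : ℕ} (i : Fin (n + 1)) :
    (Φ.coactFamily n).comp (tensorHom (weightσ k i) (DGModule.Hom.id _)) =
      (tensorHom (Φ.σ i).toHom (DGModule.Hom.id _)).comp (Φ.coactFamily (n + 1)) := by
  have h := congrArg (fun f => (Φ.obj n).coact.comp (f.comp
    (tensorHom (DGModule.Hom.id _) (C.idCounit Φ.family.limit)))) (Φ.family.eval_σ i)
  refine Eq.trans ?_ (h.trans ?_)
  · change (Φ.obj n).coact.comp ((Φ.family.eval n).comp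
      ((tensorHom _ _).comp (tensorHom _ _))) = (Φ.obj n).coact.comp
      ((Φ.family.eval n).comp ((tensorHom _ _).comp (tensorHom _ _)))
    rw [tensorHom_comp, tensorHom_comp]
    rfl
  · exact congrArg (fun f => f.comp ((Φ.family.eval (n + 1)).comp
      (tensorHom (DGModule.Hom.id _) (C.idCounit Φ.family.limit)))) (Φ.σ i).colinear

theorem evalFamily_δ {n : ℕ} (i : Fin (n + 2)) :
    (Φ.evalFamily (n + 1)).comp (tensorHom (weightδ k i) (DGModule.Hom.id _)) =
      (tensorHom (Φ.δ i).toHom (DGModule.Hom.id _)).comp (Φ.evalFamily n) := by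
  ext1
  exact TensorProduct.ext_threefold' fun κ x c =>
    congrArg (· ⊗ₜ[k] c) (DGModule.Hom.congr_toLin (Φ.family.eval_δ i) (κ ⊗ₜ[k] x))

theorem evalFamily_σ {n : ℕ} (i : Fin (n + 1)) :
    (Φ.evalFamily n).comp (tensorHom (weightσ k i) (DGModule.Hom.id _)) =
      (tensorHom (Φ.σ i).toHom (DGModule.Hom.id _)).comp (Φ.evalFamily (n + 1)) := by
  ext1
  exact TensorProduct.ext_threefold' fun κ x c =>
    congrArg (· ⊗ₜ[k] c) (DGModule.Hom.congr_toLin (Φ.family.eval_σ i) (κ ⊗ₜ[k] x))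

/-- The chain map `lim Φ ⊗ C ⟶ lim (Φ ⊗ C)` given by the coactions. -/
noncomputable def limitCoact :
    DGModule.Hom (tensor Φ.family.limit C.toDGModule) Φ.tensorFamily.limit :=
  CosimplicialFamily.limitLift (M := Φ.tensorFamily) Φ.coactFamily Φ.coactFamily_δ Φ.coactFamily_σ

/-- The canonical chain map `lim Φ ⊗ C ⟶ lim (Φ ⊗ C)`. -/
noncomputable def limitTensor :
    DGModule.Hom (tensor Φ.family.limit C.toDGModule) Φ.tensorFamily.limit :=
  CosimplicialFamily.limitLift (M := Φ.tensorFamily) Φ.evalFamily Φ.evalFamily_δ Φ.evalFamily_σ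

theorem eval_limitCoact (n : ℕ) : (Φ.tensorFamily.eval n).comp
    (tensorHom (DGModule.Hom.id _) Φ.limitCoact) = Φ.coactFamily n :=
  CosimplicialFamily.eval_limitLift _ _ _ n

theorem eval_limitTensor (n : ℕ) : (Φ.tensorFamily.eval n).comp
    (tensorHom (DGModule.Hom.id _) Φ.limitTensor) = Φ.evalFamily n :=
  CosimplicialFamily.eval_limitLift _ _ _ n

variable [IsFiniteProductOfFields k]

/-- The map whose kernel is the homotopy limit. -/
noncomputable def holimDiff : DGComodule.Hom (tensorLeft Φ.family.limit (regular C))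
    (tensorLeft Φ.tensorFamily.limit (regular C)) :=
  (cofreeLift (Z := tensorLeft Φ.family.limit (regular C)) Φ.limitCoact).sub
    (cofreeLift (Z := tensorLeft Φ.family.limit (regular C)) Φ.limitTensor)

theorem holimDiff_ker (t : (DGComodule.ker Φ.holimDiff).toDGModule) :
    Φ.limitCoact.toLin t.1 = Φ.limitTensor.toLin t.1 := by
  have h : (cofreeLift (Z := tensorLeft Φ.family.limit (regular C)) Φ.limitCoact).toLin t.1 =
    (cofreeLift (Z := tensorLeft Φ.family.limit (regular C)) Φ.limitTensor).toLin t.1 :=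
      sub_eq_zero.1 t.2
  have h₁ := DGModule.Hom.congr_toLin (idCounit_cofreeLift
    (Z := tensorLeft Φ.family.limit (regular C)) Φ.limitCoact) t.1
  have h₂ := DGModule.Hom.congr_toLin (idCounit_cofreeLift
    (Z := tensorLeft Φ.family.limit (regular C)) Φ.limitTensor) t.1
  exact h₁.symm.trans ((congrArg (C.idCounit _).toLin h).trans h₂)

/-- The homotopy limit as a comodule. -/
noncomputable def holimObj : DGComodule C := DGComodule.ker Φ.holimDiff

/-- The inclusion of the homotopy limit in `lim Φ ⊗ C`. -/
noncomputable def holimIncl :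
    DGModule.Hom Φ.holimObj.toDGModule (tensor Φ.family.limit C.toDGModule) :=
  (kerIncl Φ.holimDiff).toHom

theorem holimIncl_coact : (tensorHom Φ.holimIncl (DGModule.Hom.id _)).comp Φ.holimObj.coact =
    (C.idComul Φ.family.limit).comp Φ.holimIncl :=
  kerCoact_spec Φ.holimDiff

theorem holimIncl_eq : Φ.limitCoact.comp Φ.holimIncl = Φ.limitTensor.comp Φ.holimIncl := by
  apply DGModule.Hom.ext
  refine LinearMap.ext fun t => ?_
  exact Φ.holimDiff_ker t

/-- The evaluation of the homotopy limit. -/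
noncomputable def holimθ (n : ℕ) :
    DGModule.Hom (tensor (weight k n) Φ.holimObj.toDGModule) (Φ.obj n).toDGModule :=
  (Φ.family.eval n).comp (tensorHom (DGModule.Hom.id _)
    ((C.idCounit Φ.family.limit).comp Φ.holimIncl))

/-- Membership in the kernel says that applying the coaction of `Φ^n` to a value agrees with
evaluating on the first factor of `lim Φ ⊗ C`. The counit axiom identifies the latter with the
coaction of the homotopy limit followed by evaluation. -/
theorem holimθ_colinear (n : ℕ) : (Φ.obj n).coact.comp (Φ.holimθ n) =
    (tensorHom (Φ.holimθ n) (DGModule.Hom.id _)).comp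
      ((assocInvHom (weight k n) Φ.holimObj.toDGModule C.toDGModule).comp
        (tensorHom (DGModule.Hom.id _) Φ.holimObj.coact)) := by
  have e₁ : (Φ.obj n).coact.comp (Φ.holimθ n) =
      (Φ.coactFamily n).comp (tensorHom (DGModule.Hom.id _) Φ.holimIncl) := by
    change (Φ.obj n).coact.comp ((Φ.family.eval n).comp _) = (Φ.obj n).coact.comp
      ((Φ.family.eval n).comp ((tensorHom _ _).comp (tensorHom _ _)))
    rw [tensorHom_comp]
    rfl
  have e₂ : (Φ.coactFamily n).comp (tensorHom (DGModule.Hom.id _) Φ.holimIncl) =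
      (Φ.evalFamily n).comp (tensorHom (DGModule.Hom.id _) Φ.holimIncl) := by
    rw [← eval_limitCoact, ← eval_limitTensor, DGModule.Hom.comp_assoc, DGModule.Hom.comp_assoc,
      tensorHom_comp, tensorHom_comp, holimIncl_eq]
  have e₃ : tensorHom (Φ.holimθ n) (DGModule.Hom.id C.toDGModule) =
      (tensorHom (Φ.family.eval n) (DGModule.Hom.id _)).comp
        (tensorHom (tensorHom (DGModule.Hom.id _)
          ((C.idCounit Φ.family.limit).comp Φ.holimIncl)) (DGModule.Hom.id _)) := by
    rw [tensorHom_comp]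
    rfl
  -- The coaction on the kernel is the restriction of `id ⊗ Δ`, so applying `ε` to the first factor
  -- of `Δ` gives the inclusion back.
  have e₄ : (tensorHom ((C.idCounit Φ.family.limit).comp Φ.holimIncl)
      (DGModule.Hom.id C.toDGModule)).comp Φ.holimObj.coact = Φ.holimIncl := by
    have : tensorHom ((C.idCounit Φ.family.limit).comp Φ.holimIncl)
        (DGModule.Hom.id C.toDGModule) = (tensorHom (C.idCounit Φ.family.limit)
          (DGModule.Hom.id C.toDGModule)).comp
            (tensorHom Φ.holimIncl (DGModule.Hom.id C.toDGModule)) := by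
      rw [tensorHom_comp]
      rfl
    rw [this, DGModule.Hom.comp_assoc, holimIncl_coact, ← DGModule.Hom.comp_assoc,
      DGCoalgebra.idCounit_tensor_idComul, DGModule.Hom.id_comp]
  have e₅ := congrArg (fun f => (tensorHom (Φ.family.eval n) (DGModule.Hom.id C.toDGModule)).comp
    (f.comp (tensorHom (DGModule.Hom.id _) Φ.holimObj.coact)))
    (assocInv_naturality (DGModule.Hom.id (weight k n))
      ((C.idCounit Φ.family.limit).comp Φ.holimIncl) (DGModule.Hom.id C.toDGModule))
  rw [e₁, e₂, e₃]
  refine Eq.trans ?_ e₅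
  have e₆ : (tensorHom (DGModule.Hom.id (weight k n))
      (tensorHom ((C.idCounit Φ.family.limit).comp Φ.holimIncl) (DGModule.Hom.id C.toDGModule))).comp
        (tensorHom (DGModule.Hom.id _) Φ.holimObj.coact) =
      tensorHom (DGModule.Hom.id (weight k n)) Φ.holimIncl := by
    rw [tensorHom_comp, e₄]
    rfl
  exact congrArg (fun f => (tensorHom (Φ.family.eval n) (DGModule.Hom.id C.toDGModule)).comp
    ((assocInvHom (weight k n) Φ.family.limit C.toDGModule).comp f)) e₆.symm

/-- The cone of the homotopy limit. -/
noncomputable def holimCone : HolimCone Φ where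
  pt := Φ.holimObj
  θ n := ⟨Φ.holimθ n, Φ.holimθ_colinear n⟩
  θ_δ {n} i := by
    apply DGComodule.Hom.ext_toHom
    have h := congrArg (fun f => f.comp (tensorHom (DGModule.Hom.id _)
      ((C.idCounit Φ.family.limit).comp Φ.holimIncl))) (Φ.family.eval_δ i)
    refine Eq.trans ?_ h
    change (Φ.family.eval (n + 1)).comp ((tensorHom _ _).comp (tensorHom _ _)) =
      (Φ.family.eval (n + 1)).comp ((tensorHom _ _).comp (tensorHom _ _))
    rw [tensorHom_comp, tensorHom_comp]
    rfl
  θ_σ {n} i := by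
    apply DGComodule.Hom.ext_toHom
    have h := congrArg (fun f => f.comp (tensorHom (DGModule.Hom.id _)
      ((C.idCounit Φ.family.limit).comp Φ.holimIncl))) (Φ.family.eval_σ i)
    refine Eq.trans ?_ h
    change (Φ.family.eval n).comp ((tensorHom _ _).comp (tensorHom _ _)) =
      (Φ.family.eval n).comp ((tensorHom _ _).comp (tensorHom _ _))
    rw [tensorHom_comp, tensorHom_comp]
    rfl

section universal

variable {Φ} (S : HolimCone Φ)

/-- The chain map from a cone to `lim Φ`. -/
noncomputable def coneToLimit : DGModule.Hom S.pt.toDGModule Φ.family.limit :=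
  CosimplicialFamily.limitLift (M := Φ.family) (fun n => (S.θ n).toHom)
    (fun i => congrArg DGComodule.Hom.toHom (S.θ_δ i))
    (fun i => congrArg DGComodule.Hom.toHom (S.θ_σ i))

theorem eval_coneToLimit (n : ℕ) : (Φ.family.eval n).comp
    (tensorHom (DGModule.Hom.id _) (coneToLimit S)) = (S.θ n).toHom :=
  CosimplicialFamily.eval_limitLift (M := Φ.family) (fun n => (S.θ n).toHom)
    (fun i => congrArg DGComodule.Hom.toHom (S.θ_δ i))
    (fun i => congrArg DGComodule.Hom.toHom (S.θ_σ i)) n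

/-- After evaluation at each `n` the two sides are the two sides of the colinearity of the structure
map `S.θ n`. -/
theorem coneToLimit_equalizes :
    Φ.limitCoact.comp (cofreeLift (coneToLimit S)).toHom =
      Φ.limitTensor.comp (cofreeLift (coneToLimit S)).toHom := by
  have h₀ : (cofreeLift (coneToLimit S)).toHom =
    (tensorHom (coneToLimit S) (DGModule.Hom.id C.toDGModule)).comp S.pt.coact := rfl
  have h₁ : (C.idCounit Φ.family.limit).comp ((tensorHom (coneToLimit S)
      (DGModule.Hom.id C.toDGModule)).comp S.pt.coact) = coneToLimit S :=
    idCounit_cofreeLift (coneToLimit S)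
  change Φ.limitCoact.comp ((tensorHom (coneToLimit S)
      (DGModule.Hom.id C.toDGModule)).comp S.pt.coact) = Φ.limitTensor.comp
      ((tensorHom (coneToLimit S) (DGModule.Hom.id C.toDGModule)).comp S.pt.coact)
  apply CosimplicialFamily.limit_hom_ext
  intro n
  set G := (tensorHom (coneToLimit S) (DGModule.Hom.id C.toDGModule)).comp S.pt.coact with hG
  have e : ∀ f : DGModule.Hom (tensor Φ.family.limit C.toDGModule) Φ.tensorFamily.limit,
      (Φ.tensorFamily.eval n).comp (tensorHom (DGModule.Hom.id _) (f.comp G)) =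
      ((Φ.tensorFamily.eval n).comp (tensorHom (DGModule.Hom.id _) f)).comp
        (tensorHom (DGModule.Hom.id _) G) := by
    intro f
    rw [DGModule.Hom.comp_assoc, tensorHom_comp]
    rfl
  rw [e, e, eval_limitCoact, eval_limitTensor]
  have e₁ : (Φ.coactFamily n).comp (tensorHom (DGModule.Hom.id _) G) =
      (Φ.obj n).coact.comp (S.θ n).toHom := by
    change (Φ.obj n).coact.comp ((Φ.family.eval n).comp ((tensorHom _ _).comp (tensorHom _ _))) = _
    rw [tensorHom_comp, h₁, ← eval_coneToLimit S n]
    rfl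
  have e₂ : (Φ.evalFamily n).comp (tensorHom (DGModule.Hom.id _) G) =
      (tensorHom (S.θ n).toHom (DGModule.Hom.id _)).comp
        ((assocInvHom (weight k n) S.pt.toDGModule C.toDGModule).comp
          (tensorHom (DGModule.Hom.id _) S.pt.coact)) := by
    have hG' : tensorHom (DGModule.Hom.id (weight k n)) G =
        (tensorHom (DGModule.Hom.id (weight k n)) (tensorHom (coneToLimit S)
          (DGModule.Hom.id C.toDGModule))).comp (tensorHom (DGModule.Hom.id _) S.pt.coact) := by
      rw [tensorHom_comp]
      rfl
    have hθ : tensorHom (S.θ n).toHom (DGModule.Hom.id C.toDGModule) =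
        (tensorHom (Φ.family.eval n) (DGModule.Hom.id _)).comp (tensorHom
          (tensorHom (DGModule.Hom.id _) (coneToLimit S)) (DGModule.Hom.id C.toDGModule)) := by
      rw [tensorHom_comp, eval_coneToLimit]
      rfl
    rw [hG', hθ]
    have := congrArg (fun f => (tensorHom (Φ.family.eval n) (DGModule.Hom.id C.toDGModule)).comp
      (f.comp (tensorHom (DGModule.Hom.id _) S.pt.coact)))
      (assocInv_naturality (DGModule.Hom.id (weight k n)) (coneToLimit S)
        (DGModule.Hom.id C.toDGModule))
    exact this
  rw [e₁, e₂]
  exact (S.θ n).colinear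

/-- The map from a cone to the homotopy limit. -/
noncomputable def holimLift : DGComodule.Hom S.pt Φ.holimObj :=
  kerDesc Φ.holimDiff (cofreeLift (coneToLimit S)) (by
    have h : (cofreeLift (Z := tensorLeft Φ.family.limit (regular C)) Φ.limitCoact).comp
        (cofreeLift (coneToLimit S)) =
        (cofreeLift (Z := tensorLeft Φ.family.limit (regular C)) Φ.limitTensor).comp
          (cofreeLift (coneToLimit S)) := by
      apply cofree_hom_ext
      have h₁ := idCounit_cofreeLift (Z := tensorLeft Φ.family.limit (regular C)) Φ.limitCoact
      have h₂ := idCounit_cofreeLift (Z := tensorLeft Φ.family.limit (regular C)) Φ.limitTensor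
      refine (congrArg (fun f => DGModule.Hom.comp f (cofreeLift (coneToLimit S)).toHom) h₁).trans
        (Eq.trans ?_
        (congrArg (fun f => DGModule.Hom.comp f (cofreeLift (coneToLimit S)).toHom) h₂).symm)
      exact coneToLimit_equalizes S
    intro w
    exact sub_eq_zero.2 (LinearMap.congr_fun (congrArg (fun f => f.toLin) h) w))

theorem holimIncl_holimLift : Φ.holimIncl.comp (holimLift S).toHom =
    (cofreeLift (coneToLimit S)).toHom := rfl

end universal

/-- A cone gives a chain map to `lim Φ`, hence a map to the cofree comodule on it, and this map
lands in the kernel. For uniqueness, a map into the kernel is determined by its image in the cofree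
comodule, that by its chain map to `lim Φ`, and that by the induced families. -/
theorem holimCone_isHolim : Φ.holimCone.IsHolim := by
  intro S
  refine ⟨holimLift S, fun n => ?_, fun f hf => ?_⟩
  · apply DGComodule.Hom.ext_toHom
    change ((Φ.family.eval n).comp (tensorHom (DGModule.Hom.id _)
      ((C.idCounit Φ.family.limit).comp Φ.holimIncl))).comp
        (tensorHom (DGModule.Hom.id _) (holimLift S).toHom) = (S.θ n).toHom
    rw [DGModule.Hom.comp_assoc, tensorHom_comp, DGModule.Hom.comp_assoc, holimIncl_holimLift,
      ← eval_coneToLimit]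
    congr 2
    exact idCounit_cofreeLift (coneToLimit S)
  · have h : ∀ g : DGComodule.Hom S.pt Φ.holimObj,
        (∀ n, (Φ.holimCone.θ n).comp (tensorLeftMap (DGModule.Hom.id (weight k n)) g) = S.θ n) →
        (kerIncl Φ.holimDiff).comp g = cofreeLift (coneToLimit S) := by
      intro g hg
      apply cofree_hom_ext
      refine Eq.trans ?_ (idCounit_cofreeLift (coneToLimit S)).symm
      apply CosimplicialFamily.limit_hom_ext
      intro n
      rw [eval_coneToLimit, ← hg n]
      change _ = ((Φ.family.eval n).comp (tensorHom (DGModule.Hom.id _)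
        ((C.idCounit Φ.family.limit).comp Φ.holimIncl))).comp
          (tensorHom (DGModule.Hom.id _) g.toHom)
      rw [DGModule.Hom.comp_assoc, tensorHom_comp]
      rfl
    have h' := h f hf
    apply DGComodule.Hom.ext
    refine LinearMap.ext fun z => Subtype.ext ?_
    exact LinearMap.congr_fun (congrArg (fun f => f.toLin) h') z

end CosimplicialComodule

/-- A cosimplicial `k`-module, presented by its cofaces and codegeneracies. -/
structure CosimplicialModule (k : Type u) [CommRing k] where
  obj : ℕ → Type u
  [addCommGroup : ∀ n, AddCommGroup (obj n)]
  [module : ∀ n, Module k (obj n)]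
  δ : ∀ {n : ℕ} (_ : Fin (n + 2)), obj n →ₗ[k] obj (n + 1)
  σ : ∀ {n : ℕ} (_ : Fin (n + 1)), obj (n + 1) →ₗ[k] obj n
  δ_δ : ∀ {n : ℕ} {i j : Fin (n + 2)}, i ≤ j → ∀ x, δ j.succ (δ i x) = δ i.castSucc (δ j x)
  σ_δ_of_le : ∀ {n : ℕ} {i : Fin (n + 2)} {j : Fin (n + 1)}, i ≤ j.castSucc →
    ∀ x, σ j.succ (δ i.castSucc x) = δ i (σ j x)
  σ_δ_self : ∀ {n : ℕ} {i : Fin (n + 1)} (x : obj n), σ i (δ i.castSucc x) = x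
  σ_δ_succ : ∀ {n : ℕ} {i : Fin (n + 1)} (x : obj n), σ i (δ i.succ x) = x
  σ_δ_of_gt : ∀ {n : ℕ} {i : Fin (n + 2)} {j : Fin (n + 1)}, j.castSucc < i →
    ∀ x, σ j.castSucc (δ i.succ x) = δ i (σ j x)
  σ_σ : ∀ {n : ℕ} {i j : Fin (n + 1)}, i ≤ j → ∀ x, σ j (σ i.castSucc x) = σ i (σ j.succ x)

attribute [instance] CosimplicialModule.addCommGroup CosimplicialModule.module

/-! ### Normalized cochains of a cosimplicial module. -/

namespace CosimplicialModule

open CategoryTheory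

variable {k : Type u} [CommRing k] (M : CosimplicialModule k)

/-- The alternating sum of the cofaces. -/
def alt (q : ℕ) : M.obj q →ₗ[k] M.obj (q + 1) := ∑ i : Fin (q + 2), (-1 : k) ^ (i : ℕ) • M.δ i

theorem alt_apply {q : ℕ} (x : M.obj q) :
    M.alt q x = ∑ i : Fin (q + 2), (-1 : k) ^ (i : ℕ) • M.δ i x := by
  simp [alt]

/-- The usual cancellation in pairs, by the cosimplicial identity for two cofaces. -/
theorem alt_alt {q : ℕ} (x : M.obj q) : M.alt (q + 1) (M.alt q x) = 0 := by
  rw [alt_apply, alt_apply]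
  simp only [map_sum, map_smul, Finset.smul_sum, smul_smul]
  rw [Finset.sum_comm]
  simp only [← Finset.sum_product']
  let P := Fin (q + 2) × Fin (q + 3)
  let S : Finset P := {ij : P | (ij.2 : ℕ) ≤ (ij.1 : ℕ)}
  rw [Finset.univ_product_univ, ← Finset.sum_add_sum_compl S, ← eq_neg_iff_add_eq_zero,
    ← Finset.sum_neg_distrib]
  -- The term `(i, j)` with `j ≤ i` is matched with the term `(j, i + 1)` of opposite sign.
  let φ : ∀ ij : P, ij ∈ S → P := fun ij hij =>
    (Fin.castLT ij.2 (lt_of_le_of_lt (Finset.mem_filter.mp hij).right (Fin.is_lt ij.1)), ij.1.succ)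
  apply Finset.sum_bij φ
  · intro ij hij
    simp_rw [S, φ, Finset.compl_filter, Finset.mem_filter_univ, Fin.val_succ,
      Fin.val_castLT] at hij ⊢
    lia
  · rintro ⟨i, j⟩ hij ⟨i', j'⟩ hij' h
    rw [Prod.mk_inj]
    exact ⟨by simpa [φ] using congr_arg Prod.snd h,
      by simpa [φ, Fin.castSucc_castLT] using congr_arg Fin.castSucc (congr_arg Prod.fst h)⟩
  · rintro ⟨i', j'⟩ hij'
    simp_rw [S, Finset.compl_filter, Finset.mem_filter_univ, not_le] at hij'
    refine ⟨(j'.pred <| ?_, Fin.castSucc i'), ?_, ?_⟩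
    · rintro rfl
      simp only [Fin.val_zero, not_lt_zero] at hij'
    · simpa [S] using Nat.le_sub_one_of_lt hij'
    · simp only [φ, Fin.castLT_castSucc, Fin.succ_pred]
  · rintro ⟨i, j⟩ hij
    have hij' : (j : ℕ) ≤ i := (Finset.mem_filter.mp hij).right
    have hj : (j : ℕ) < q + 2 := lt_of_le_of_lt hij' i.isLt
    have h := M.δ_δ (i := Fin.castLT j hj) (j := i) hij' x
    rw [Fin.castSucc_castLT] at h
    simp only [φ, Fin.val_succ, Fin.val_castLT, h, ← neg_smul]
    congr 1
    ring

/-- The normalized cochains: the elements that are killed by all codegeneracies. -/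
def normal : ∀ q : ℕ, Submodule k (M.obj q)
  | 0 => ⊤
  | _ + 1 => ⨅ j, LinearMap.ker (M.σ j)

theorem mem_normal_succ {q : ℕ} {x : M.obj (q + 1)} :
    x ∈ M.normal (q + 1) ↔ ∀ j, M.σ j x = 0 := by
  simp [normal]

/-- Subtracting `δ_{j+1} σ_j x` in order to kill `σ_j` does not spoil the vanishing of an earlier
`σ_i`, because `σ_i δ_{j+1} σ_j = δ_j σ_i σ_j = δ_j σ_{j-1} σ_i`. -/
theorem sub_mem_normal {q : ℕ} (j : Fin (q + 1)) (x : M.obj (q + 1)) (i : Fin (q + 1))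
    (hi : i < j) (h : M.σ i x = 0) : M.σ i (M.δ j.succ (M.σ j x)) = 0 := by
  obtain ⟨q, rfl⟩ : ∃ p, q = p + 1 := ⟨q - 1, by have := j.isLt; omega⟩
  obtain ⟨j, rfl⟩ := Fin.eq_succ_of_ne_zero (Fin.ne_zero_of_lt hi)
  have hi' : (i : ℕ) < q + 1 := by
    have := j.isLt
    have : (i : ℕ) < j + 1 := hi
    omega
  have hij : Fin.castLT i hi' ≤ j := Nat.lt_succ_iff.1 hi
  have e₁ := M.σ_δ_of_gt (i := j.succ) (j := Fin.castLT i hi') (by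
    rw [Fin.castSucc_castLT]; exact hi) (M.σ j.succ x)
  have e₂ := M.σ_σ hij x
  rw [Fin.castSucc_castLT] at e₁ e₂
  rw [e₁, ← e₂, h, map_zero, map_zero]

/-- The partial normalizations. -/
def normalizeAux (q : ℕ) : ℕ → M.obj (q + 1) →ₗ[k] M.obj (q + 1)
  | 0 => LinearMap.id
  | m + 1 => if h : m < q + 1 then
      (LinearMap.id - M.δ (Fin.succ ⟨m, h⟩) ∘ₗ M.σ ⟨m, h⟩) ∘ₗ normalizeAux q m
    else normalizeAux q m

theorem normalizeAux_succ {q m : ℕ} (h : m < q + 1) (x : M.obj (q + 1)) :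
    M.normalizeAux q (m + 1) x = M.normalizeAux q m x -
      M.δ (Fin.succ ⟨m, h⟩) (M.σ ⟨m, h⟩ (M.normalizeAux q m x)) := by
  rw [normalizeAux, dif_pos h]
  rfl

theorem σ_normalizeAux {q : ℕ} (x : M.obj (q + 1)) : ∀ m ≤ q + 1, ∀ j : Fin (q + 1), (j : ℕ) < m →
    M.σ j (M.normalizeAux q m x) = 0 := by
  intro m
  induction m with
  | zero => intro _ j hj; omega
  | succ m ih =>
    intro hm j hj
    rw [M.normalizeAux_succ hm, map_sub]
    by_cases h : (j : ℕ) < m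
    · rw [ih (by omega) j h, zero_sub, neg_eq_zero]
      exact M.sub_mem_normal ⟨m, hm⟩ _ j h (ih (by omega) j h)
    · obtain rfl : j = ⟨m, hm⟩ := Fin.ext (by dsimp; omega)
      rw [M.σ_δ_succ, sub_self]

theorem normalizeAux_of_mem {q : ℕ} {x : M.obj (q + 1)} (hx : x ∈ M.normal (q + 1)) (m : ℕ) :
    M.normalizeAux q m x = x := by
  rw [mem_normal_succ] at hx
  induction m with
  | zero => rfl
  | succ m ih =>
    by_cases h : m < q + 1
    · rw [M.normalizeAux_succ h, ih, hx, map_zero, sub_zero]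
    · rw [normalizeAux, dif_neg h, ih]

/-- The projection onto the normalized cochains along the images of the positive cofaces. -/
def normalize : ∀ q : ℕ, M.obj q →ₗ[k] M.obj q
  | 0 => LinearMap.id
  | q + 1 => M.normalizeAux q (q + 1)

theorem normalize_mem {q : ℕ} (x : M.obj q) : M.normalize q x ∈ M.normal q := by
  cases q with
  | zero => trivial
  | succ q => exact M.mem_normal_succ.2 fun j => M.σ_normalizeAux x _ le_rfl j j.isLt

theorem normalize_of_mem {q : ℕ} {x : M.obj q} (hx : x ∈ M.normal q) : M.normalize q x = x := by
  cases q with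
  | zero => rfl
  | succ q => exact M.normalizeAux_of_mem hx _

/-- In `σ_j` of the alternating sum only the cofaces `j` and `j + 1` survive, and these contribute
`x` with opposite signs. In every other term a codegeneracy reaches `x`. -/
theorem alt_mem_normal {q : ℕ} {x : M.obj q} (hx : x ∈ M.normal q) :
    M.alt q x ∈ M.normal (q + 1) := by
  rw [mem_normal_succ]
  intro j
  rw [alt_apply, map_sum]
  rw [Finset.sum_eq_add j.castSucc j.succ (by simp [Fin.ext_iff])]
  · rw [map_smul, map_smul, M.σ_δ_self, M.σ_δ_succ, Fin.val_succ, Fin.val_castSucc, pow_succ]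
    simp
  · rintro i - ⟨h₁, h₂⟩
    rw [map_smul]
    cases q with
    | zero =>
      have h1 : (i : ℕ) ≠ j := fun h => h₁ (Fin.ext h)
      have h2 : (i : ℕ) ≠ j + 1 := fun h => h₂ (Fin.ext h)
      omega
    | succ q =>
      rw [mem_normal_succ] at hx
      have h1 : (i : ℕ) ≠ j := fun h => h₁ (Fin.ext h)
      have h2 : (i : ℕ) ≠ j + 1 := fun h => h₂ (Fin.ext h)
      have hj := j.isLt
      have hi := i.isLt
      rcases lt_or_gt_of_ne h1 with h | h
      · obtain ⟨i, rfl⟩ : ∃ i' : Fin (q + 2), i = i'.castSucc := ⟨⟨i, by omega⟩, rfl⟩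
        obtain ⟨j, rfl⟩ : ∃ j' : Fin (q + 1), j = j'.succ :=
          ⟨⟨j - 1, by omega⟩, Fin.ext (by simp; omega)⟩
        rw [M.σ_δ_of_le (Fin.le_def.2 (by simp at h ⊢; omega)), hx, map_zero, smul_zero]
      · obtain ⟨i, rfl⟩ : ∃ i' : Fin (q + 2), i = i'.succ :=
          ⟨⟨i - 1, by omega⟩, Fin.ext (by simp; omega)⟩
        obtain ⟨j, rfl⟩ : ∃ j' : Fin (q + 1), j = j'.castSucc :=
          ⟨⟨j, by simp at h h2; omega⟩, rfl⟩
        rw [M.σ_δ_of_gt (Fin.lt_def.2 (by simp at h h2 ⊢; omega)), hx, map_zero, smul_zero]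
  · simp
  · simp

section maps

variable {M} {M' : CosimplicialModule k} (F : ∀ n, M.obj n →ₗ[k] M'.obj n)
  (hδ : ∀ {n : ℕ} (i : Fin (n + 2)) (x : M.obj n), F (n + 1) (M.δ i x) = M'.δ i (F n x))
  (hσ : ∀ {n : ℕ} (i : Fin (n + 1)) (x : M.obj (n + 1)), F n (M.σ i x) = M'.σ i (F (n + 1) x))

theorem map_alt (hδ : ∀ {n : ℕ} (i : Fin (n + 2)) (x : M.obj n),
    F (n + 1) (M.δ i x) = M'.δ i (F n x)) {q : ℕ} (x : M.obj q) :
    F (q + 1) (M.alt q x) = M'.alt q (F q x) := by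
  simp [alt_apply, hδ]

theorem map_mem_normal (hσ : ∀ {n : ℕ} (i : Fin (n + 1)) (x : M.obj (n + 1)),
    F n (M.σ i x) = M'.σ i (F (n + 1) x)) {q : ℕ} {x : M.obj q} (hx : x ∈ M.normal q) :
    F q x ∈ M'.normal q := by
  cases q with
  | zero => trivial
  | succ q =>
    rw [mem_normal_succ] at hx ⊢
    intro j
    rw [← hσ, hx, map_zero]

end maps

/-- The maps `M^q ⟶ M^n` that are composites of cofaces, with the corresponding maps in the
simplex category. -/
inductive IsCofaceWord {q : ℕ} :
    ∀ {n : ℕ}, (SimplexCategory.mk q ⟶ SimplexCategory.mk n) → (M.obj q →ₗ[k] M.obj n) → Prop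
  | id : IsCofaceWord (𝟙 (SimplexCategory.mk q)) LinearMap.id
  | δ {n : ℕ} {α : SimplexCategory.mk q ⟶ SimplexCategory.mk n} {g : M.obj q →ₗ[k] M.obj n}
      (i : Fin (n + 2)) : IsCofaceWord α g →
      IsCofaceWord (α ≫ SimplexCategory.δ i) (M.δ i ∘ₗ g)

/-! ### Injective monotone maps as composites of cofaces. -/

namespace IsCofaceWord

variable {M} {q n : ℕ} {α : SimplexCategory.mk q ⟶ SimplexCategory.mk n}
  {g : M.obj q →ₗ[k] M.obj n}

theorem mono (h : M.IsCofaceWord α g) : Mono α := by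
  induction h with
  | id => infer_instance
  | δ i _ ih => exact mono_comp _ _

theorem le (h : M.IsCofaceWord α g) : q ≤ n :=
  have := h.mono
  SimplexCategory.le_of_mono α

theorem eq_id_aux (h : M.IsCofaceWord α g) (e : n = q) (x : M.obj q) : HEq (g x) x := by
  induction h with
  | id => rfl
  | δ i h _ => exact absurd h.le (by omega)

/-- Inversion of the inductive predicate. The target index has to stay a variable for the case
analysis, so its value enters through an equation and the conclusions are heterogeneous. -/
theorem exists_eq_comp_aux (h : M.IsCofaceWord α g) (m : ℕ) (e : n = m + 1) (hm : q ≤ m) :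
    ∃ (j : Fin (m + 2)) (β : SimplexCategory.mk q ⟶ SimplexCategory.mk m)
      (g' : M.obj q →ₗ[k] M.obj m), M.IsCofaceWord β g' ∧ HEq α (β ≫ SimplexCategory.δ j) ∧
        HEq g (M.δ j ∘ₗ g') := by
  induction h with
  | id => omega
  | δ i h _ =>
    obtain rfl := Nat.succ.inj e
    exact ⟨i, _, _, h, HEq.rfl, HEq.rfl⟩

/-- A map that misses a value factors through the corresponding coface, and a bijective monotone map
is the identity. -/
theorem exists_of_mono (α : SimplexCategory.mk q ⟶ SimplexCategory.mk n) [Mono α] :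
    ∃ g, M.IsCofaceWord α g := by
  induction n with
  | zero =>
    have := SimplexCategory.le_of_mono α
    obtain rfl : q = 0 := by omega
    rw [SimplexCategory.eq_id_of_mono α]
    exact ⟨_, id⟩
  | succ n ih =>
    by_cases hα : Function.Surjective α.toOrderHom
    · have := SimplexCategory.epi_iff_surjective.2 hα
      have h₁ := SimplexCategory.le_of_mono α
      have h₂ := SimplexCategory.len_le_of_epi α
      obtain rfl : q = n + 1 := le_antisymm h₁ h₂
      rw [SimplexCategory.eq_id_of_mono α]
      exact ⟨_, id⟩
    · obtain ⟨i, β, rfl⟩ := SimplexCategory.eq_comp_δ_of_not_surjective α hα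
      have : Mono β := mono_of_mono β (SimplexCategory.δ i)
      obtain ⟨g, hg⟩ := ih β
      exact ⟨_, hg.δ i⟩

/-- A monotone map that factors through two cofaces factors through their composite. -/
theorem exists_common_factor {α β : SimplexCategory.mk q ⟶ SimplexCategory.mk n} {i j : Fin (n + 2)}
    (hij : i < j) (h : α ≫ SimplexCategory.δ i = β ≫ SimplexCategory.δ j) :
    ∃ (m : ℕ) (_ : n = m + 1) (i' j' : Fin (m + 2))
      (γ : SimplexCategory.mk q ⟶ SimplexCategory.mk m), i' ≤ j' ∧ (i : ℕ) = i' ∧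
      (j : ℕ) = j' + 1 ∧ HEq α (γ ≫ SimplexCategory.δ j') ∧
        HEq β (γ ≫ SimplexCategory.δ i') := by
  have hx : ∀ x, i.succAbove (α.toOrderHom x) = j.succAbove (β.toOrderHom x) := fun x =>
    DFunLike.congr_fun (congrArg SimplexCategory.Hom.toOrderHom h) x
  have hji : (i : ℕ) < j := hij
  have hj := j.isLt
  cases n with
  | zero =>
    have h₀ := congrArg Fin.val (hx 0)
    have hi : i = 0 := Fin.ext (by simp; omega)
    have hj' : j = 1 := Fin.ext (by simp; omega)
    rw [Subsingleton.elim (α := Fin 1) (α.toOrderHom 0) 0,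
      Subsingleton.elim (α := Fin 1) (β.toOrderHom 0) 0, hi, hj'] at h₀
    simp [Fin.succAbove] at h₀
  | succ m =>
    obtain ⟨i, rfl⟩ : ∃ i' : Fin (m + 2), i = i'.castSucc := ⟨⟨i, by omega⟩, rfl⟩
    obtain ⟨j, rfl⟩ : ∃ j' : Fin (m + 2), j = j'.succ :=
      ⟨⟨j - 1, by omega⟩, Fin.ext (by simp; omega)⟩
    have hle : i ≤ j := Fin.le_def.2 (by simp at hji; omega)
    -- If `α` took the value `j`, its composite with the coface `i ≤ j` would take the value `j +
    -- 1`, which the other composite omits.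
    obtain ⟨γ, hγ⟩ := SimplexCategory.eq_comp_δ_of_not_surjective' α j (by
      intro x hαx
      have := hx x
      rw [hαx] at this
      refine Fin.succAbove_ne j.succ (β.toOrderHom x) (this.symm.trans ?_)
      rw [Fin.succAbove_of_le_castSucc _ _ (Fin.castSucc_le_castSucc_iff.2 hle)])
    refine ⟨m, rfl, i, j, γ, hle, rfl, rfl, heq_of_eq hγ, heq_of_eq ?_⟩
    rw [← cancel_mono (SimplexCategory.δ j.succ), ← h, hγ, Category.assoc, Category.assoc,
      SimplexCategory.δ_comp_δ hle]

/-- This makes the action of an injective map independent of its factorization. If two words end in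
different cofaces, the map factors through both. By induction the shorter words may be rewritten
through the common factor, and one cosimplicial identity compares the results. -/
theorem unique {g' : M.obj q →ₗ[k] M.obj n} (h : M.IsCofaceWord α g) (h' : M.IsCofaceWord α g') :
    g = g' := by
  induction n using Nat.strong_induction_on with
  | _ n ih =>
    rcases Nat.eq_or_lt_of_le h.le with e | e
    · subst e
      exact LinearMap.ext fun x =>
        (eq_of_heq (h.eq_id_aux rfl x)).trans (eq_of_heq (h'.eq_id_aux rfl x)).symm
    · obtain ⟨m, rfl⟩ : ∃ m, n = m + 1 := ⟨n - 1, by omega⟩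
      obtain ⟨i, β, f, hf, hα, hg⟩ := h.exists_eq_comp_aux m rfl (by omega)
      obtain ⟨i', β', f', hf', hα', hg'⟩ := h'.exists_eq_comp_aux m rfl (by omega)
      rw [eq_of_heq hg, eq_of_heq hg']
      have key : ∀ {i i' : Fin (m + 2)} {β β' : SimplexCategory.mk q ⟶ SimplexCategory.mk m}
          {f f' : M.obj q →ₗ[k] M.obj m}, i < i' → M.IsCofaceWord β f → M.IsCofaceWord β' f' →
          β ≫ SimplexCategory.δ i = β' ≫ SimplexCategory.δ i' → M.δ i ∘ₗ f = M.δ i' ∘ₗ f' := by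
        intro i i' β β' f f' hi hf hf' hβ
        have := hf.mono
        obtain ⟨p, rfl, a, b, γ, hab, ha, hb, h₁, h₂⟩ := exists_common_factor hi hβ
        have h₁ := eq_of_heq h₁
        have h₂ := eq_of_heq h₂
        subst h₁ h₂
        have : Mono γ := mono_of_mono γ (SimplexCategory.δ b)
        obtain ⟨w, hw⟩ := exists_of_mono (M := M) γ
        rw [ih (p + 1) (by omega) hf (hw.δ b), ih (p + 1) (by omega) hf' (hw.δ a)]
        refine LinearMap.ext fun x => ?_
        rw [show i = a.castSucc from Fin.ext ha, show i' = b.succ from Fin.ext (by simpa using hb)]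
        exact (M.δ_δ hab (w x)).symm
      have hβ := (eq_of_heq hα).symm.trans (eq_of_heq hα')
      rcases lt_trichotomy i i' with hi | hi | hi
      · exact key hi hf hf' hβ
      · subst hi
        have := (cancel_mono _).1 hβ
        subst this
        rw [ih m (by omega) hf hf']
      · exact (key hi hf' hf hβ.symm).symm

theorem comp {p : ℕ} {β : SimplexCategory.mk p ⟶ SimplexCategory.mk q}
    {f : M.obj p →ₗ[k] M.obj q} (h : M.IsCofaceWord α g) (h' : M.IsCofaceWord β f) :
    M.IsCofaceWord (β ≫ α) (g ∘ₗ f) := by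
  induction h with
  | id => rw [Category.comp_id]; exact h'
  | δ i _ ih => rw [← Category.assoc]; exact ih.δ i

end IsCofaceWord

/-! ### The action of the simplex category on normalized cochains. -/

open Classical in
/-- The action on `M` of an injective monotone map, extended by zero to all monotone maps; this is
the action of the simplex category on normalized cochains. -/
noncomputable def act {q n : ℕ} (α : SimplexCategory.mk q ⟶ SimplexCategory.mk n) :
    M.obj q →ₗ[k] M.obj n :=
  if h : ∃ g, M.IsCofaceWord α g then h.choose else 0

variable {M} {q n : ℕ}

theorem act_of_word {α : SimplexCategory.mk q ⟶ SimplexCategory.mk n} {g : M.obj q →ₗ[k] M.obj n}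
    (h : M.IsCofaceWord α g) : M.act α = g := by
  have h' : ∃ g, M.IsCofaceWord α g := ⟨g, h⟩
  rw [act, dif_pos h']
  exact h'.choose_spec.unique h

theorem act_of_not_mono {α : SimplexCategory.mk q ⟶ SimplexCategory.mk n} (h : ¬ Mono α) :
    M.act α = 0 :=
  dif_neg fun ⟨_, hg⟩ => h hg.mono

theorem isCofaceWord_act (α : SimplexCategory.mk q ⟶ SimplexCategory.mk n) [Mono α] :
    M.IsCofaceWord α (M.act α) := by
  obtain ⟨g, hg⟩ := IsCofaceWord.exists_of_mono (M := M) α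
  rwa [act_of_word hg]

theorem δ_act (α : SimplexCategory.mk q ⟶ SimplexCategory.mk n) (i : Fin (n + 2)) (x : M.obj q) :
    M.δ i (M.act α x) = M.act (α ≫ SimplexCategory.δ i) x := by
  by_cases h : Mono α
  · rw [act_of_word ((isCofaceWord_act (M := M) α).δ i)]
    rfl
  · rw [act_of_not_mono h, act_of_not_mono fun h' => h (mono_of_mono α (SimplexCategory.δ i))]
    simp

theorem not_mono_σ_comp (j : Fin (q + 1)) (α : SimplexCategory.mk q ⟶ SimplexCategory.mk n) :
    ¬ Mono (SimplexCategory.σ j ≫ α) := by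
  intro h
  have := mono_of_mono (SimplexCategory.σ j) α
  have := SimplexCategory.le_of_mono (SimplexCategory.σ j)
  omega

/-- Move the codegeneracy through a coface word. Either it cancels a coface, or it reaches `x` and
gives `0` because `x` is normalized; in the second case the composite is not injective, so it acts
by `0` as well. -/
theorem σ_act (α : SimplexCategory.mk q ⟶ SimplexCategory.mk (n + 1)) (j : Fin (n + 1))
    {x : M.obj q} (hx : x ∈ M.normal q) :
    M.σ j (M.act α x) = M.act (α ≫ SimplexCategory.σ j) x := by
  by_cases h : Mono α
  · have key : ∀ {m : ℕ} {α : SimplexCategory.mk q ⟶ SimplexCategory.mk m}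
        {g : M.obj q →ₗ[k] M.obj m}, M.IsCofaceWord α g → ∀ (n : ℕ) (e : m = n + 1)
        (j : Fin (n + 1)), M.σ j (e ▸ g x) = M.act ((e ▸ α) ≫ SimplexCategory.σ j) x := by
      intro m α g hg
      induction hg with
      | id =>
        intro n e j
        subst e
        change M.σ j x = _
        rw [Category.id_comp, act_of_not_mono, (M.mem_normal_succ.1 hx), LinearMap.zero_apply]
        have := not_mono_σ_comp j (𝟙 _)
        rwa [Category.comp_id] at this
      | @δ m α g i hg ih =>
        intro n e j
        obtain rfl := Nat.succ.inj e
        change M.σ j (M.δ i (g x)) = M.act ((α ≫ SimplexCategory.δ i) ≫ SimplexCategory.σ j) x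
        have hj := j.isLt
        have hi := i.isLt
        rw [Category.assoc]
        by_cases h₁ : i = j.castSucc
        · rw [h₁, M.σ_δ_self, SimplexCategory.δ_comp_σ_self, Category.comp_id, act_of_word hg]
        by_cases h₂ : i = j.succ
        · rw [h₂, M.σ_δ_succ, SimplexCategory.δ_comp_σ_succ, Category.comp_id, act_of_word hg]
        have h1 : (i : ℕ) ≠ j := fun h => h₁ (Fin.ext h)
        have h2 : (i : ℕ) ≠ j + 1 := fun h => h₂ (Fin.ext (by simpa using h))
        cases m with
        | zero => omega
        | succ m =>
          have ih' := fun j => ih m rfl j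
          rcases lt_or_gt_of_ne h1 with h | h
          · obtain ⟨i, rfl⟩ : ∃ i' : Fin (m + 2), i = i'.castSucc := ⟨⟨i, by omega⟩, rfl⟩
            obtain ⟨j, rfl⟩ : ∃ j' : Fin (m + 1), j = j'.succ :=
              ⟨⟨j - 1, by omega⟩, Fin.ext (by simp; omega)⟩
            have hle : i ≤ j.castSucc := Fin.le_def.2 (by simp at h ⊢; omega)
            rw [M.σ_δ_of_le hle, SimplexCategory.δ_comp_σ_of_le hle, ← Category.assoc, ← δ_act,
              ← ih']
          · obtain ⟨i, rfl⟩ : ∃ i' : Fin (m + 2), i = i'.succ :=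
              ⟨⟨i - 1, by omega⟩, Fin.ext (by simp; omega)⟩
            obtain ⟨j, rfl⟩ : ∃ j' : Fin (m + 1), j = j'.castSucc :=
              ⟨⟨j, by simp at h h2; omega⟩, rfl⟩
            have hlt : j.castSucc < i := Fin.lt_def.2 (by simp at h h2 ⊢; omega)
            rw [M.σ_δ_of_gt hlt, SimplexCategory.δ_comp_σ_of_gt hlt, ← Category.assoc, ← δ_act,
              ← ih']
    exact key (isCofaceWord_act α) n rfl j
  · rw [act_of_not_mono h, LinearMap.zero_apply, map_zero, act_of_not_mono, LinearMap.zero_apply]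
    intro h'
    exact h (mono_of_mono α (SimplexCategory.σ j))

/-- This turns faces of simplices into the cochain differential. For injective `α` it is
functoriality. If `α` collapses `j` and `j + 1`, the left side vanishes, and on the right the faces
`j` and `j + 1` cancel while all others still collapse two points. -/
theorem act_alt (α : SimplexCategory.mk (q + 1) ⟶ SimplexCategory.mk n) (x : M.obj q) :
    M.act α (M.alt q x) =
      ∑ i : Fin (q + 2), (-1 : k) ^ (i : ℕ) • M.act (SimplexCategory.δ i ≫ α) x := by
  by_cases h : Mono α
  · rw [alt_apply, map_sum]
    refine Finset.sum_congr rfl fun i _ => ?_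
    rw [map_smul]
    have h₁ : M.IsCofaceWord (SimplexCategory.δ i) (M.δ i) := by
      have := (IsCofaceWord.id (M := M) (q := q)).δ i
      rwa [Category.id_comp] at this
    rw [act_of_word ((isCofaceWord_act (M := M) α).comp h₁)]
    rfl
  · rw [act_of_not_mono h, LinearMap.zero_apply]
    rw [SimplexCategory.mono_iff_injective] at h
    obtain ⟨j, β, rfl⟩ := SimplexCategory.eq_σ_comp_of_not_injective α h
    symm
    rw [Finset.sum_eq_add j.castSucc j.succ (by simp [Fin.ext_iff])]
    · have e₁ := SimplexCategory.δ_comp_σ_self (i := j)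
      have e₂ := SimplexCategory.δ_comp_σ_succ (i := j)
      rw [← Category.assoc, ← Category.assoc, e₁, e₂, Fin.val_succ, Fin.val_castSucc, pow_succ]
      simp
    · rintro i - ⟨h₁, h₂⟩
      rw [act_of_not_mono, LinearMap.zero_apply, smul_zero]
      rw [SimplexCategory.mono_iff_injective]
      intro hinj
      obtain ⟨a, ha⟩ := Fin.exists_succAbove_eq (Ne.symm h₁)
      obtain ⟨b, hb⟩ := Fin.exists_succAbove_eq (Ne.symm h₂)
      have hab : a = b := by
        apply hinj
        change β.toOrderHom (j.predAbove (i.succAbove a)) =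
          β.toOrderHom (j.predAbove (i.succAbove b))
        rw [ha, hb]
        simp
      rw [hab, hb] at ha
      exact absurd (congrArg Fin.val ha) (by simp)
    · simp
    · simp

end CosimplicialModule

/-! ### Chains on the nerve of `Δ ↓ a`, normalized and unnormalized. -/

namespace DGModule

open CategoryTheory AlgebraicTopology

variable {k : Type u} [CommRing k]

section chainComplex

variable {K L N : ChainComplex (ModuleCat.{u} k) ℕ}

theorem ofChainComplexMap_id (K : ChainComplex (ModuleCat.{u} k) ℕ) :
    ofChainComplexMap (𝟙 K) = Hom.id (ofChainComplex K) := by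
  apply Hom.ext
  refine DirectSum.linearMap_ext k fun n => LinearMap.ext fun x => ?_
  exact ofChainComplexMapLin_lof (𝟙 K) n x

theorem ofChainComplexMap_comp (f : K ⟶ L) (g : L ⟶ N) :
    ofChainComplexMap (f ≫ g) = (ofChainComplexMap g).comp (ofChainComplexMap f) := by
  apply Hom.ext
  refine DirectSum.linearMap_ext k fun n => LinearMap.ext fun x => ?_
  change ofChainComplexMapLin (f ≫ g) (DirectSum.lof k ℕ (fun n => K.X n) n x) =
    ofChainComplexMapLin g (ofChainComplexMapLin f (DirectSum.lof k ℕ (fun n => K.X n) n x))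
  rw [ofChainComplexMapLin_lof, ofChainComplexMapLin_lof, ofChainComplexMapLin_lof]
  rfl

end chainComplex

section overChains

variable (k) {a b c : SimplexCategory}

/-- The normalized chains on the nerve of the category of objects over `a`. -/
noncomputable abbrev overWeight (a : SimplexCategory) : DGModule k :=
  ofChainComplex ((overChains k).obj a)

/-- The unnormalized chains on the nerve of the category of objects over `a`. -/
noncomputable abbrev overMoore (a : SimplexCategory) : DGModule k :=
  ofChainComplex ((alternatingFaceMapComplex (ModuleCat.{u} k)).obj ((overNerveModule k).obj a))

/-- Functoriality of the normalized chains. -/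
noncomputable def overWeightMap (α : a ⟶ b) : Hom (overWeight k a) (overWeight k b) :=
  ofChainComplexMap ((overChains k).map α)

/-- Functoriality of the unnormalized chains. -/
noncomputable def overMooreMap (α : a ⟶ b) : Hom (overMoore k a) (overMoore k b) :=
  ofChainComplexMap ((alternatingFaceMapComplex (ModuleCat.{u} k)).map ((overNerveModule k).map α))

/-- The inclusion of the normalized chains. -/
noncomputable def overIncl (a : SimplexCategory) : Hom (overWeight k a) (overMoore k a) :=
  ofChainComplexMap (inclusionOfMooreComplexMap ((overNerveModule k).obj a))

/-- The projection onto the normalized chains. -/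
noncomputable def overProj (a : SimplexCategory) : Hom (overMoore k a) (overWeight k a) :=
  ofChainComplexMap (DoldKan.PInftyToNormalizedMooreComplex ((overNerveModule k).obj a))

theorem overProj_comp_overIncl (a : SimplexCategory) :
    (overProj k a).comp (overIncl k a) = Hom.id (overWeight k a) := by
  refine (ofChainComplexMap_comp _ _).symm.trans (Eq.trans ?_ (ofChainComplexMap_id _))
  exact congrArg ofChainComplexMap
    (DoldKan.splitMonoInclusionOfMooreComplexMap ((overNerveModule k).obj a)).id

theorem overWeightMap_id (a : SimplexCategory) :
    overWeightMap k (𝟙 a) = Hom.id (overWeight k a) := by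
  refine Eq.trans ?_ (ofChainComplexMap_id _)
  exact congrArg ofChainComplexMap ((overChains k).map_id a)

theorem overWeightMap_comp (α : a ⟶ b) (β : b ⟶ c) :
    overWeightMap k (α ≫ β) = (overWeightMap k β).comp (overWeightMap k α) := by
  refine Eq.trans ?_ (ofChainComplexMap_comp _ _)
  exact congrArg ofChainComplexMap ((overChains k).map_comp α β)

theorem overIncl_naturality (α : a ⟶ b) : (overIncl k b).comp (overWeightMap k α) =
    (overMooreMap k α).comp (overIncl k a) := by
  refine (ofChainComplexMap_comp _ _).symm.trans (Eq.trans ?_ (ofChainComplexMap_comp _ _))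
  exact congrArg ofChainComplexMap
    ((inclusionOfMooreComplex (ModuleCat.{u} k)).naturality ((overNerveModule k).map α))

theorem overProj_naturality (α : a ⟶ b) : (overProj k b).comp (overMooreMap k α) =
    (overWeightMap k α).comp (overProj k a) := by
  refine (ofChainComplexMap_comp _ _).symm.trans (Eq.trans ?_ (ofChainComplexMap_comp _ _))
  exact congrArg ofChainComplexMap
    (DoldKan.PInftyToNormalizedMooreComplex_naturality ((overNerveModule k).map α))

/-- The simplices of the nerve of the category of objects over `a`. -/
abbrev OverSimplex (a : SimplexCategory) (q : ℕ) := ComposableArrows (Over a) q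

/-- The faces of a simplex. -/
def OverSimplex.face {q : ℕ} (i : Fin (q + 2)) (x : OverSimplex a (q + 1)) : OverSimplex a q :=
  (nerve (Over a)).δ i x

/-- The image of a simplex. -/
def OverSimplex.push (α : a ⟶ b) {q : ℕ} (x : OverSimplex a q) : OverSimplex b q :=
  x ⋙ Over.map α

/-- The generator given by a simplex, in its degree. -/
noncomputable def simplexGen {q : ℕ} (x : OverSimplex a q) :
    ((alternatingFaceMapComplex (ModuleCat.{u} k)).obj ((overNerveModule k).obj a)).X q :=
  (Finsupp.single (ULift.up x) (1 : k) : ULift.{u} (OverSimplex a q) →₀ k)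

/-- The unnormalized chain given by a simplex. -/
noncomputable def simplex {q : ℕ} (x : OverSimplex a q) : overMoore k a :=
  DirectSum.lof k ℕ (fun n =>
    ((alternatingFaceMapComplex (ModuleCat.{u} k)).obj ((overNerveModule k).obj a)).X n) q
      (simplexGen k x)

theorem simplex_mem {q : ℕ} (x : OverSimplex a q) : simplex k x ∈ (overMoore k a).gr q :=
  ⟨_, rfl⟩

theorem simplex_map (α : a ⟶ b) {q : ℕ} (x : OverSimplex a q) :
    (overMooreMap k α).toLin (simplex k x) = simplex k (x.push α) := by
  refine (ofChainComplexMapLin_lof _ q _).trans ?_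
  refine congrArg (DirectSum.lof k ℕ _ q) ?_
  exact Finsupp.mapDomain_single

theorem d_simplex {q : ℕ} (x : OverSimplex a (q + 1)) :
    (overMoore k a).d (simplex k x) =
      ∑ i : Fin (q + 2), (-1 : k) ^ (i : ℕ) • simplex k (x.face i) := by
  refine (ofChainComplexD_lof _ (q + 1) _).trans ?_
  have : ∀ i : Fin (q + 2), (-1 : k) ^ (i : ℕ) • simplex k (x.face i) =
      DirectSum.lof k ℕ (fun n => ((alternatingFaceMapComplex (ModuleCat.{u} k)).obj
        ((overNerveModule k).obj a)).X n) q ((-1 : k) ^ (i : ℕ) • simplexGen k (x.face i)) :=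
    fun i => (map_smul _ _ _).symm
  rw [Finset.sum_congr rfl fun i _ => this i, ← map_sum]
  refine congrArg (DirectSum.lof k ℕ _ q) ?_
  have e : ((alternatingFaceMapComplex (ModuleCat.{u} k)).obj ((overNerveModule k).obj a)).d
      (q + 1) q = AlternatingFaceMapComplex.objD ((overNerveModule k).obj a) q :=
    alternatingFaceMapComplex_obj_d _ _
  have h : ∀ i : Fin (q + 2), (((overNerveModule k).obj a).δ i).hom (simplexGen k x) =
      simplexGen k (x.face i) := fun i => Finsupp.mapDomain_single
  have e' : (((alternatingFaceMapComplex (ModuleCat.{u} k)).obj ((overNerveModule k).obj a)).d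
      (q + 1) q).hom = ∑ i : Fin (q + 2), (-1 : ℤ) ^ (i : ℕ) •
        (((overNerveModule k).obj a).δ i).hom := by
    rw [e, AlternatingFaceMapComplex.objD, ModuleCat.hom_sum]
    rfl
  refine (LinearMap.congr_fun e' (simplexGen k x)).trans ?_
  rw [LinearMap.sum_apply]
  refine Finset.sum_congr rfl fun i _ => ?_
  rw [LinearMap.smul_apply]
  refine (congrArg ((-1 : ℤ) ^ (i : ℕ) • ·) (h i)).trans ?_
  -- The alternating face map complex has signs in `ℤ`, whereas here they are scalars of `k`.
  rcases neg_one_pow_eq_or ℤ (i : ℕ) with h' | h' <;>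
    rcases Nat.even_or_odd (i : ℕ) with h'' | h'' <;> simp [h''.neg_one_pow]

theorem overMoore_ext {M : Type u} [AddCommGroup M] [Module k M] {f g : overMoore k a →ₗ[k] M}
    (h : ∀ (q : ℕ) (x : OverSimplex a q), f (simplex k x) = g (simplex k x)) : f = g := by
  refine DirectSum.linearMap_ext k fun q => ?_
  refine Finsupp.lhom_ext' fun ⟨x⟩ => LinearMap.ext_ring ?_
  exact h q x

/-- The linear map with prescribed values on simplices. -/
noncomputable def overMooreLift {M : Type u} [AddCommGroup M] [Module k M]
    (v : ∀ q, OverSimplex a q → M) : overMoore k a →ₗ[k] M :=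
  DirectSum.toModule k ℕ M fun q => Finsupp.linearCombination k
    (fun x : ULift.{u} (OverSimplex a q) => v q x.down)

theorem overMooreLift_simplex {M : Type u} [AddCommGroup M] [Module k M]
    (v : ∀ q, OverSimplex a q → M) {q : ℕ} (x : OverSimplex a q) :
    overMooreLift k v (simplex k x) = v q x := by
  refine (DirectSum.toModule_lof k (φ := fun q => Finsupp.linearCombination k
    (fun x : ULift.{u} (OverSimplex a q) => v q x.down)) q (simplexGen k x)).trans ?_
  exact (Finsupp.linearCombination_single k (1 : k) (ULift.up x)).trans (one_smul k _)

/-- The augmentation of the unnormalized chains. -/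
noncomputable def overMooreAug (a : SimplexCategory) : overMoore k a →ₗ[k] k :=
  overMooreLift k fun q _ => if q = 0 then 1 else 0

theorem overMooreAug_simplex {q : ℕ} (x : OverSimplex a q) :
    overMooreAug k a (simplex k x) = if q = 0 then 1 else 0 :=
  overMooreLift_simplex k (fun q _ => if q = 0 then (1 : k) else 0) x

theorem overMooreAug_map (α : a ⟶ b) (x : overMoore k a) :
    overMooreAug k b ((overMooreMap k α).toLin x) = overMooreAug k a x := by
  refine LinearMap.congr_fun (f := overMooreAug k b ∘ₗ (overMooreMap k α).toLin) ?_ x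
  refine overMoore_ext k fun q x => ?_
  rw [LinearMap.comp_apply, simplex_map, overMooreAug, overMooreAug, overMooreLift_simplex,
    overMooreLift_simplex]

theorem overMooreAug_d (x : overMoore k a) : overMooreAug k a ((overMoore k a).d x) = 0 := by
  refine LinearMap.congr_fun (f := overMooreAug k a ∘ₗ (overMoore k a).d) (g := 0) ?_ x
  refine overMoore_ext k fun q x => ?_
  rw [LinearMap.comp_apply]
  cases q with
  | zero => rw [(overMoore k a).d_zero _ (simplex_mem k x), map_zero]; rfl
  | succ q =>
    rw [d_simplex, map_sum, LinearMap.zero_apply,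
      Finset.sum_congr rfl fun (i : Fin (q + 2)) _ => (map_smul _ _ _).trans
        (congrArg ((-1 : k) ^ (i : ℕ) • ·) (overMooreAug_simplex k (x.face i)))]
    cases q with
    | zero => simp [Fin.sum_univ_two]
    | succ q => simp

/-- The augmentation of the normalized chains. -/
noncomputable def overWeightAug (a : SimplexCategory) : overWeight k a →ₗ[k] k :=
  overMooreAug k a ∘ₗ (overIncl k a).toLin

theorem weightAug_eq (n : ℕ) : weightAug k n = overWeightAug k (SimplexCategory.mk n) := by
  refine DirectSum.linearMap_ext k fun q => LinearMap.ext fun x => ?_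
  have h : (overIncl k (SimplexCategory.mk n)).toLin (DirectSum.lof k ℕ _ q x) = _ :=
    ofChainComplexMapLin_lof _ q x
  change weightAug k n (DirectSum.lof k ℕ _ q x) = overMooreAug k _
    ((overIncl k (SimplexCategory.mk n)).toLin (DirectSum.lof k ℕ _ q x))
  rw [h]
  rw [weightAug, DirectSum.toModule_lof]
  refine Eq.symm ((DirectSum.toModule_lof k (φ := fun q => Finsupp.linearCombination k
    (fun _ : ULift.{u} (OverSimplex (SimplexCategory.mk n) q) => if q = 0 then (1 : k) else 0))
      q _).trans ?_)
  cases q with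
  | zero => rfl
  | succ q =>
    have : Finsupp.linearCombination k (fun _ : ULift.{u} (OverSimplex (SimplexCategory.mk n)
      (q + 1)) => (0 : k)) = 0 := by
        refine Finsupp.lhom_ext' fun x => LinearMap.ext_ring ?_
        simp
    exact LinearMap.congr_fun this _

theorem overWeightAug_map (α : a ⟶ b) (x : overWeight k a) :
    overWeightAug k b ((overWeightMap k α).toLin x) = overWeightAug k a x := by
  have h : (overIncl k b).toLin ((overWeightMap k α).toLin x) =
    (overMooreMap k α).toLin ((overIncl k a).toLin x) :=
      Hom.congr_toLin (overIncl_naturality k α) x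
  change overMooreAug k b ((overIncl k b).toLin ((overWeightMap k α).toLin x)) = _
  rw [h, overMooreAug_map]
  rfl

theorem overWeightAug_d (x : overWeight k a) :
    overWeightAug k a ((overWeight k a).d x) = 0 := by
  change overMooreAug k a ((overIncl k a).toLin ((overWeight k a).d x)) = 0
  rw [(overIncl k a).map_d_apply, overMooreAug_d]

end overChains

end DGModule

/-! ### Cones over simplices, universal simplices and last vertices. -/

namespace DGModule

open CategoryTheory AlgebraicTopology

section cone

instance {m : ℕ} (X Y : WithTerminal (Fin m)) : Subsingleton (X ⟶ Y) := by
  rcases X with X | _ <;> rcases Y with Y | _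
  · exact inferInstanceAs (Subsingleton (X ⟶ Y))
  · exact inferInstanceAs (Subsingleton PUnit)
  · exact inferInstanceAs (Subsingleton PEmpty)
  · exact inferInstanceAs (Subsingleton PUnit)

/-- The chain `0 → ⋯ → q + 1`, viewed as `0 → ⋯ → q` with a terminal object added. -/
def withTopObj (q : ℕ) (i : Fin (q + 2)) : WithTerminal (Fin (q + 1)) :=
  if h : (i : ℕ) < q + 1 then WithTerminal.of ⟨i, h⟩ else WithTerminal.star

theorem withTopObj_hom {q : ℕ} {i j : Fin (q + 2)} (h : i ≤ j) :
    Nonempty (withTopObj q i ⟶ withTopObj q j) := by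
  unfold withTopObj
  by_cases hj : (j : ℕ) < q + 1
  · have hi : (i : ℕ) < q + 1 := lt_of_le_of_lt h hj
    rw [dif_pos hj, dif_pos hi]
    exact ⟨WithTerminal.incl.map (homOfLE (show (⟨i, hi⟩ : Fin (q + 1)) ≤ ⟨j, hj⟩ from h))⟩
  · rw [dif_neg hj]
    exact ⟨WithTerminal.starTerminal.from _⟩

/-- The functor form of `withTopObj`. -/
noncomputable def withTop (q : ℕ) : Fin (q + 2) ⥤ WithTerminal (Fin (q + 1)) where
  obj := withTopObj q
  map f := Classical.choice (withTopObj_hom (leOfHom f))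
  map_id _ := Subsingleton.elim _ _
  map_comp _ _ := Subsingleton.elim _ _

variable {D : Type*} [Category D] {T : D} (hT : Limits.IsTerminal T)

theorem map_comp_liftToTerminal {J J' : Type*} [Category J] [Category J'] (F : J ⥤ J') (x : J' ⥤ D) :
    WithTerminal.map F ⋙ WithTerminal.liftToTerminal x hT =
      WithTerminal.liftToTerminal (F ⋙ x) hT := by
  refine CategoryTheory.Functor.hext ?_ ?_
  · rintro (_ | _) <;> rfl
  · rintro (X | _) (Y | _) f
    · rfl
    · rfl
    · exact f.elim
    · rfl

end cone

variable {k : Type u} [CommRing k] {a b c : SimplexCategory}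

namespace OverSimplex

/-- The simplex with the terminal object `id : a ⟶ a` added at the end. -/
noncomputable def cone {q : ℕ} (x : OverSimplex a q) : OverSimplex a (q + 1) :=
  withTop q ⋙ WithTerminal.liftToTerminal x Over.mkIdTerminal

/-- The vertex `id : a ⟶ a`. -/
noncomputable def top (a : SimplexCategory) : OverSimplex a 0 :=
  (Functor.const _).obj (Over.mk (𝟙 a))

/-- The `i`-th coface as a functor. -/
def faceFunctor {q : ℕ} (i : Fin (q + 2)) : Fin (q + 1) ⥤ Fin (q + 2) :=
  (SimplexCategory.toCat.map (SimplexCategory.δ i)).toFunctor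

/-- Both sides are restrictions of lifts of `x` to a category with a terminal object added. The
equality therefore reduces to one of functors into a thin category, which is checked on objects. -/
theorem face_cone {q : ℕ} (x : OverSimplex a (q + 1)) (i : Fin (q + 2)) :
    x.cone.face i.castSucc = (x.face i).cone := by
  have h : faceFunctor i.castSucc ⋙ withTop (q + 1) =
      withTop q ⋙ WithTerminal.map (faceFunctor i) := by
    refine CategoryTheory.Functor.ext (fun j => ?_) (fun _ _ _ => Subsingleton.elim _ _)
    change withTopObj (q + 1) (i.castSucc.succAbove j) =
      (WithTerminal.map (faceFunctor i)).obj
        (withTopObj q j)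
    have hj := j.isLt
    have hi := i.isLt
    by_cases h : (j : ℕ) < q + 1
    · have h' : ((i.castSucc.succAbove j : Fin (q + 3)) : ℕ) < q + 2 := by
        unfold Fin.succAbove
        split_ifs <;> simp only [Fin.val_castSucc, Fin.val_succ] <;> omega
      unfold withTopObj
      rw [dif_pos h, dif_pos h']
      refine congrArg WithTerminal.of (Fin.ext ?_)
      change ((i.castSucc.succAbove j : Fin (q + 3)) : ℕ) =
        ((i.succAbove ⟨j, h⟩ : Fin (q + 2)) : ℕ)
      unfold Fin.succAbove
      simp only [Fin.lt_def, Fin.val_castSucc]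
      split_ifs <;> rfl
    · have h' : ¬ ((i.castSucc.succAbove j : Fin (q + 3)) : ℕ) < q + 2 := by
        unfold Fin.succAbove
        simp only [Fin.lt_def, Fin.val_castSucc]
        rw [if_neg (by omega)]
        simp; omega
      unfold withTopObj
      rw [dif_neg h, dif_neg h']
      rfl
  change faceFunctor i.castSucc ⋙ (withTop (q + 1) ⋙
    WithTerminal.liftToTerminal x Over.mkIdTerminal) = withTop q ⋙ WithTerminal.liftToTerminal
      ((faceFunctor i) ⋙ x) Over.mkIdTerminal
  rw [← map_comp_liftToTerminal, ← Functor.assoc, ← Functor.assoc, h]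

theorem face_last_cone {q : ℕ} (x : OverSimplex a q) : x.cone.face (Fin.last (q + 1)) = x := by
  have h : faceFunctor (Fin.last (q + 1)) ⋙ withTop q =
      WithTerminal.incl := by
    refine CategoryTheory.Functor.ext (fun j => ?_) (fun _ _ _ => Subsingleton.elim _ _)
    change withTopObj q ((Fin.last (q + 1)).succAbove j) = WithTerminal.of j
    rw [Fin.succAbove_last]
    exact dif_pos j.isLt
  change (faceFunctor (Fin.last (q + 1)) ⋙ withTop q) ⋙
    WithTerminal.liftToTerminal x Over.mkIdTerminal = x
  rw [h]
  rfl

theorem face_zero_cone (x : OverSimplex a 0) : x.cone.face 0 = top a := by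
  have h : faceFunctor 0 ⋙ withTop 0 = (Functor.const _).obj WithTerminal.star := by
    refine CategoryTheory.Functor.ext (fun j => ?_) (fun _ _ _ => Subsingleton.elim _ _)
    change withTopObj 0 ((0 : Fin 2).succAbove j) = WithTerminal.star
    exact dif_neg (by simp)
  change (faceFunctor 0 ⋙ withTop 0) ⋙ WithTerminal.liftToTerminal x Over.mkIdTerminal = top a
  rw [h]
  refine CategoryTheory.Functor.hext (fun i => rfl) (fun i j f => ?_)
  change HEq ((WithTerminal.liftToTerminal x Over.mkIdTerminal).map (𝟙 WithTerminal.star))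
    (𝟙 (Over.mk (𝟙 a)))
  rfl

/-- The universal simplex of which `x` is the image. -/
def hat {q : ℕ} (x : OverSimplex a q) : OverSimplex (x.obj (Fin.last q)).left q :=
  Functor.toOver (x ⋙ Over.forget a) _ (fun i => (x.map (homOfLE (Fin.le_last i))).left) (by
    intro i j f
    change (x.map f).left ≫ (x.map _).left = _
    rw [← Over.comp_left, ← x.map_comp]
    rfl)

/-- Representability for the method of acyclic models: a chain `x_0 ⟶ ⋯ ⟶ x_q ⟶ a` is the image,
under `x_q ⟶ a`, of the same chain viewed over `x_q`. -/
theorem push_hat {q : ℕ} (x : OverSimplex a q) : x.hat.push (x.obj (Fin.last q)).hom = x := by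
  have h : ∀ i, (x.hat.push (x.obj (Fin.last q)).hom).obj i = x.obj i := by
    intro i
    change Over.mk ((x.map (homOfLE (Fin.le_last i))).left ≫ (x.obj (Fin.last q)).hom) = x.obj i
    rw [Over.w]
    rfl
  refine CategoryTheory.Functor.ext h (fun i j f => ?_)
  apply Over.OverMorphism.ext
  rw [Over.comp_left, Over.comp_left, Over.eqToHom_left, Over.eqToHom_left]
  change (x.map f).left = 𝟙 _ ≫ (x.map f).left ≫ 𝟙 _
  rw [Category.id_comp, Category.comp_id]

/-- The last-vertex map. -/
def lastVertex {q : ℕ} (x : OverSimplex a q) : SimplexCategory.mk q ⟶ a :=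
  SimplexCategory.Hom.mk ⟨fun i => (x.obj i).hom.toOrderHom (Fin.last _), by
    intro i j h
    have e := Over.w (x.map (homOfLE h))
    dsimp only
    rw [← e]
    exact (x.obj j).hom.toOrderHom.monotone (Fin.le_last _)⟩

theorem lastVertex_push {q : ℕ} (α : a ⟶ b) (x : OverSimplex a q) :
    (x.push α).lastVertex = x.lastVertex ≫ α := rfl

theorem lastVertex_face {q : ℕ} (x : OverSimplex a (q + 1)) (i : Fin (q + 2)) :
    (x.face i).lastVertex = SimplexCategory.δ i ≫ x.lastVertex := rfl

theorem push_face {q : ℕ} (α : a ⟶ b) (x : OverSimplex a (q + 1)) (i : Fin (q + 2)) :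
    (x.push α).face i = (x.face i).push α := rfl

end OverSimplex

end DGModule

/-! ### Acyclicity of the weights. -/

namespace DGModule

open CategoryTheory AlgebraicTopology

variable (k : Type u) [CommRing k] {a b c : SimplexCategory}

/-- The contraction of the unnormalized chains that adds the terminal object to a simplex. -/
noncomputable def overContraction (a : SimplexCategory) : overMoore k a →ₗ[k] overMoore k a :=
  overMooreLift k fun q x => (-1 : k) ^ (q + 1) • simplex k x.cone

theorem overContraction_simplex {q : ℕ} (x : OverSimplex a q) :
    overContraction k a (simplex k x) = (-1 : k) ^ (q + 1) • simplex k x.cone :=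
  overMooreLift_simplex k (fun q (x : OverSimplex a q) => (-1 : k) ^ (q + 1) • simplex k x.cone) x

theorem overMoore_induction {P : overMoore k a → Prop} {q : ℕ} {z : overMoore k a}
    (hz : z ∈ (overMoore k a).gr q) (h : ∀ x : OverSimplex a q, P (simplex k x)) (h0 : P 0)
    (hadd : ∀ x y, P x → P y → P (x + y)) (hsmul : ∀ (r : k) x, P x → P (r • x)) : P z := by
  obtain ⟨y, rfl⟩ := hz
  refine Finsupp.induction_linear (motive := fun y => P (DirectSum.lof k ℕ
    (fun n => ((alternatingFaceMapComplex (ModuleCat.{u} k)).obj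
      ((overNerveModule k).obj a)).X n) q y)) y ?_ ?_ ?_
  · exact (map_zero (DirectSum.lof k ℕ (fun n => ((alternatingFaceMapComplex (ModuleCat.{u} k)).obj
      ((overNerveModule k).obj a)).X n) q)).symm ▸ h0
  · intro f g hf hg
    exact (map_add (DirectSum.lof k ℕ (fun n => ((alternatingFaceMapComplex (ModuleCat.{u} k)).obj
      ((overNerveModule k).obj a)).X n) q) f g).symm ▸ hadd _ _ hf hg
  · rintro ⟨x⟩ r
    have e : DirectSum.lof k ℕ (fun n => ((alternatingFaceMapComplex (ModuleCat.{u} k)).obj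
      ((overNerveModule k).obj a)).X n) q (Finsupp.single (ULift.up x) r) = r • simplex k x := by
      refine Eq.trans ?_ (map_smul _ _ _)
      refine congrArg (DirectSum.lof k ℕ _ q) ?_
      exact ((Finsupp.smul_single r (ULift.up x) (1 : k)).trans
        (congrArg (Finsupp.single (ULift.up x)) (mul_one r))).symm
    exact e.symm ▸ hsmul r _ (h x)

theorem overMooreLift_mem {M : DGModule k} {j : ℕ} (v : ∀ q, OverSimplex a q → M)
    (hv : ∀ q x, v q x ∈ M.gr (q + j)) (q : ℕ) (z : overMoore k a)
    (hz : z ∈ (overMoore k a).gr q) : overMooreLift k v z ∈ M.gr (q + j) := by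
  refine overMoore_induction k (P := fun z => overMooreLift k v z ∈ M.gr (q + j)) hz
    (fun x => ?_) ?_ ?_ ?_
  · rw [overMooreLift_simplex]; exact hv q x
  · rw [map_zero]; exact zero_mem _
  · intro x y hx hy; rw [map_add]; exact add_mem hx hy
  · intro r x hx; rw [map_smul]; exact Submodule.smul_mem _ _ hx

theorem overContraction_mem (q : ℕ) (z : overMoore k a) (hz : z ∈ (overMoore k a).gr q) :
    overContraction k a z ∈ (overMoore k a).gr (q + 1) :=
  overMooreLift_mem k _ (fun _ _ => Submodule.smul_mem _ _ (simplex_mem k _)) q z hz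

/-- The identity of `a` is terminal in `Δ ↓ a`. Coning commutes with every face except the last,
which returns the simplex, and the sign `(-1)^(q+1)` of the contraction cancels the sign of that
face. On a vertex the other face is the cone point, which gives the augmentation term. -/
theorem overContraction_spec (z : overMoore k a) :
    (overMoore k a).d (overContraction k a z) + overContraction k a ((overMoore k a).d z) =
      z - overMooreAug k a z • simplex k (OverSimplex.top a) := by
  refine LinearMap.congr_fun (f := (overMoore k a).d ∘ₗ overContraction k a +
    overContraction k a ∘ₗ (overMoore k a).d) (g := LinearMap.id -
      (overMooreAug k a).smulRight (simplex k (OverSimplex.top a))) ?_ z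
  refine overMoore_ext k fun q x => ?_
  rw [LinearMap.add_apply, LinearMap.comp_apply, LinearMap.comp_apply, LinearMap.sub_apply,
    LinearMap.smulRight_apply, LinearMap.id_apply, overContraction_simplex, map_smul, d_simplex,
    overMooreAug_simplex]
  cases q with
  | zero =>
    rw [(overMoore k a).d_zero _ (simplex_mem k x), map_zero, Fin.sum_univ_two,
      OverSimplex.face_zero_cone, show (1 : Fin 2) = Fin.last 1 from rfl,
      OverSimplex.face_last_cone]
    simp only [Fin.val_zero, Fin.val_last, pow_one, zero_add, pow_zero, one_smul, neg_smul, if_true,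
      add_zero]
    abel
  | succ q =>
    rw [Fin.sum_univ_castSucc, OverSimplex.face_last_cone, d_simplex, map_sum,
      Finset.sum_congr rfl fun (i : Fin (q + 2)) _ =>
        congrArg (fun y => (-1 : k) ^ (i.castSucc : ℕ) • simplex k y) (x.face_cone i),
      Finset.sum_congr rfl fun (i : Fin (q + 2)) _ => (map_smul _ _ _).trans
        (congrArg ((-1 : k) ^ (i : ℕ) • ·) (overContraction_simplex k (x.face i))),
      smul_add, smul_smul, Fin.val_last, ← pow_add, Even.neg_one_pow ⟨_, rfl⟩, one_smul,
      Finset.smul_sum, add_right_comm, ← Finset.sum_add_distrib, Finset.sum_eq_zero]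
    · simp
    · intro i _
      rw [smul_smul, smul_smul, ← add_smul, Fin.val_castSucc, pow_succ (-1 : k) (q + 1)]
      ring_nf
      simp

/-- The contraction of the unnormalized chains is transported along the retraction onto normalized
chains. -/
theorem overWeight_acyclic {q : ℕ} {z : overWeight k a} (hz : z ∈ (overWeight k a).gr q)
    (hd : (overWeight k a).d z = 0) (haug : overWeightAug k a z = 0) :
    ∃ y ∈ (overWeight k a).gr (q + 1), (overWeight k a).d y = z := by
  have h := overContraction_spec k ((overIncl k a).toLin z)
  rw [← (overIncl k a).map_d_apply, hd, map_zero, map_zero, add_zero,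
    show overMooreAug k a ((overIncl k a).toLin z) = 0 from haug, zero_smul, sub_zero] at h
  refine ⟨(overProj k a).toLin (overContraction k a ((overIncl k a).toLin z)),
    (overProj k a).map_mem _ _ (overContraction_mem k q _ ((overIncl k a).map_mem q z hz)), ?_⟩
  rw [← (overProj k a).map_d_apply, h]
  exact Hom.congr_toLin (overProj_comp_overIncl k a) z

theorem overMooreAug_of_pos {q : ℕ} {z : overMoore k a} (hz : z ∈ (overMoore k a).gr (q + 1)) :
    overMooreAug k a z = 0 := by
  refine overMoore_induction k (P := fun z => overMooreAug k a z = 0) hz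
    (fun x => by rw [overMooreAug_simplex, if_neg (by omega)]) (map_zero _) ?_ ?_
  · intro x y hx hy; rw [map_add, hx, hy, add_zero]
  · intro r x hx; rw [map_smul, hx, smul_zero]

theorem overWeightAug_of_pos {q : ℕ} {z : overWeight k a} (hz : z ∈ (overWeight k a).gr (q + 1)) :
    overWeightAug k a z = 0 :=
  overMooreAug_of_pos k ((overIncl k a).map_mem _ _ hz)

/-- In degree `0` the Dold-Kan projector is the identity; in positive degrees both augmentations
vanish. -/
theorem overWeightAug_overProj (z : overMoore k a) :
    overWeightAug k a ((overProj k a).toLin z) = overMooreAug k a z := by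
  refine LinearMap.congr_fun (f := overWeightAug k a ∘ₗ (overProj k a).toLin) ?_ z
  refine overMoore_ext k fun q x => ?_
  rw [LinearMap.comp_apply]
  cases q with
  | zero =>
    have h : (overIncl k a).comp (overProj k a) = ofChainComplexMap DoldKan.PInfty := by
      refine (ofChainComplexMap_comp _ _).symm.trans ?_
      exact congrArg ofChainComplexMap
        (DoldKan.PInftyToNormalizedMooreComplex_comp_inclusionOfMooreComplexMap _)
    refine congrArg (overMooreAug k a) ((Hom.congr_toLin h (simplex k x)).trans ?_)
    refine (ofChainComplexMapLin_lof _ 0 _).trans ?_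
    refine congrArg (DirectSum.lof k ℕ _ 0) ?_
    rw [DoldKan.PInfty_f_0]
    rfl
  | succ q =>
    rw [overMooreAug_of_pos k (simplex_mem k x),
      overWeightAug_of_pos k ((overProj k a).map_mem _ _ (simplex_mem k x))]

/-! ### Acyclic models: natural maps of augmentation zero are naturally null homotopic. -/

section acyclicModels

variable {k}
variable (φ : ∀ a, Hom (overMoore k a) (overWeight k a))

/-- The values on simplices of a natural null homotopy. -/
noncomputable def homotopyValue : ∀ (q : ℕ) (a : SimplexCategory), OverSimplex a q → overWeight k a
  -- The primitive is chosen only for the universal simplex and then transported to `x`. As the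
  -- choice depends on nothing but the universal simplex, the result is natural. That the chosen
  -- element has the required property is shown afterwards.
  | 0, _, x => (overWeightMap k (x.obj (Fin.last 0)).hom).toLin
      (Classical.epsilon fun y => y ∈ (overWeight k _).gr 1 ∧
        (overWeight k _).d y = (φ _).toLin (simplex k x.hat))
  | q + 1, _, x => (overWeightMap k (x.obj (Fin.last (q + 1))).hom).toLin
      (Classical.epsilon fun y => y ∈ (overWeight k _).gr (q + 2) ∧
        (overWeight k _).d y = (φ _).toLin (simplex k x.hat) -
          ∑ i : Fin (q + 2), (-1 : k) ^ (i : ℕ) • homotopyValue q _ (x.hat.face i))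

/-- A simplex and its image have definitionally the same universal simplex, hence the same chosen
primitive. -/
theorem homotopyValue_push (α : a ⟶ b) {q : ℕ} (x : OverSimplex a q) :
    homotopyValue φ q b (x.push α) = (overWeightMap k α).toLin (homotopyValue φ q a x) := by
  have h : ∀ y, (overWeightMap k ((x.obj (Fin.last q)).hom ≫ α)).toLin y =
      (overWeightMap k α).toLin ((overWeightMap k (x.obj (Fin.last q)).hom).toLin y) := fun y =>
    Hom.congr_toLin (overWeightMap_comp k _ _) y
  cases q with
  | zero => exact h _
  | succ q => exact h _

variable (hnat : ∀ {a b : SimplexCategory} (α : a ⟶ b) (z : overMoore k a),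
    (φ b).toLin ((overMooreMap k α).toLin z) = (overWeightMap k α).toLin ((φ a).toLin z))
  (haug : ∀ (a : SimplexCategory) (z : overMoore k a), overWeightAug k a ((φ a).toLin z) = 0)

theorem homotopyValue_zero (hnat : ∀ {a b : SimplexCategory} (α : a ⟶ b) (z : overMoore k a),
      (φ b).toLin ((overMooreMap k α).toLin z) = (overWeightMap k α).toLin ((φ a).toLin z))
    (haug : ∀ (a : SimplexCategory) (z : overMoore k a), overWeightAug k a ((φ a).toLin z) = 0)
    (x : OverSimplex a 0) : homotopyValue φ 0 a x ∈ (overWeight k a).gr 1 ∧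
      (overWeight k a).d (homotopyValue φ 0 a x) = (φ a).toLin (simplex k x) := by
  have hm := (φ _).map_mem _ _ (simplex_mem k x.hat)
  obtain ⟨h₁, h₂⟩ := Classical.epsilon_spec
    (p := fun y => y ∈ (overWeight k _).gr 1 ∧
        (overWeight k _).d y = (φ _).toLin (simplex k x.hat))
    (overWeight_acyclic k hm ((overWeight k _).d_zero _ hm) (haug _ _))
  refine ⟨(overWeightMap k _).map_mem _ _ h₁, ?_⟩
  have e : (overWeight k a).d (homotopyValue φ 0 a x) =
    (overWeightMap k (x.obj (Fin.last 0)).hom).toLin ((φ _).toLin (simplex k x.hat)) :=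
    ((overWeightMap k _).map_d_apply _).symm.trans (congrArg (overWeightMap k _).toLin h₂)
  rw [e, ← hnat, simplex_map, OverSimplex.push_hat]

/-- The condition `hc` is the cycle condition that a primitive requires; in positive degrees the
augmentation imposes nothing further. -/
theorem homotopyValue_succ (hnat : ∀ {a b : SimplexCategory} (α : a ⟶ b) (z : overMoore k a),
      (φ b).toLin ((overMooreMap k α).toLin z) = (overWeightMap k α).toLin ((φ a).toLin z))
    (q : ℕ)
    (hc : ∀ (a : SimplexCategory) (x : OverSimplex a (q + 1)),
      (overWeight k a).d ((φ a).toLin (simplex k x) -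
        ∑ i : Fin (q + 2), (-1 : k) ^ (i : ℕ) • homotopyValue φ q a (x.face i)) = 0)
    (hg : ∀ (a : SimplexCategory) (x : OverSimplex a q),
      homotopyValue φ q a x ∈ (overWeight k a).gr (q + 1))
    (x : OverSimplex a (q + 1)) : homotopyValue φ (q + 1) a x ∈ (overWeight k a).gr (q + 2) ∧
      (overWeight k a).d (homotopyValue φ (q + 1) a x) = (φ a).toLin (simplex k x) -
        ∑ i : Fin (q + 2), (-1 : k) ^ (i : ℕ) • homotopyValue φ q a (x.face i) := by
  have hm : (φ _).toLin (simplex k x.hat) - ∑ i : Fin (q + 2), (-1 : k) ^ (i : ℕ) •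
      homotopyValue φ q _ (x.hat.face i) ∈ (overWeight k _).gr (q + 1) :=
    sub_mem ((φ _).map_mem _ _ (simplex_mem k x.hat))
      (sum_mem fun i _ => Submodule.smul_mem _ _ (hg _ _))
  obtain ⟨h₁, h₂⟩ := Classical.epsilon_spec
    (p := fun y => y ∈ (overWeight k _).gr (q + 2) ∧
        (overWeight k _).d y = (φ _).toLin (simplex k x.hat) -
          ∑ i : Fin (q + 2), (-1 : k) ^ (i : ℕ) • homotopyValue φ q _ (x.hat.face i))
    (overWeight_acyclic k hm (hc _ _) (overWeightAug_of_pos k hm))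
  refine ⟨(overWeightMap k _).map_mem _ _ h₁, ?_⟩
  have e : (overWeight k a).d (homotopyValue φ (q + 1) a x) =
    (overWeightMap k (x.obj (Fin.last (q + 1))).hom).toLin ((φ _).toLin (simplex k x.hat) -
      ∑ i : Fin (q + 2), (-1 : k) ^ (i : ℕ) • homotopyValue φ q _ (x.hat.face i)) :=
    ((overWeightMap k _).map_d_apply _).symm.trans (congrArg (overWeightMap k _).toLin h₂)
  rw [e, map_sub, ← hnat, simplex_map, OverSimplex.push_hat, map_sum]
  refine congrArg _ (Finset.sum_congr rfl fun i _ => ?_)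
  rw [map_smul, ← homotopyValue_push, ← OverSimplex.push_face, OverSimplex.push_hat]

/-- The natural null homotopy. -/
noncomputable def naturalHomotopy (a : SimplexCategory) : overMoore k a →ₗ[k] overWeight k a :=
  overMooreLift k fun q x => homotopyValue φ q a x

theorem naturalHomotopy_simplex {q : ℕ} (x : OverSimplex a q) :
    naturalHomotopy φ a (simplex k x) = homotopyValue φ q a x :=
  overMooreLift_simplex k (fun q (x : OverSimplex a q) => homotopyValue φ q a x) x

theorem naturalHomotopy_naturality (α : a ⟶ b) (z : overMoore k a) :
    naturalHomotopy φ b ((overMooreMap k α).toLin z) =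
      (overWeightMap k α).toLin (naturalHomotopy φ a z) := by
  refine LinearMap.congr_fun (f := naturalHomotopy φ b ∘ₗ (overMooreMap k α).toLin)
    (g := (overWeightMap k α).toLin ∘ₗ naturalHomotopy φ a) ?_ z
  refine overMoore_ext k fun q x => ?_
  rw [LinearMap.comp_apply, LinearMap.comp_apply, simplex_map, naturalHomotopy_simplex,
    naturalHomotopy_simplex, homotopyValue_push]

/-- Induction on the dimension. The obstruction `φ x - h (d x)` is a cycle because `d h = φ - h d`
is already known one degree lower, and the weights are acyclic. -/
theorem homotopyValue_spec (hnat : ∀ {a b : SimplexCategory} (α : a ⟶ b) (z : overMoore k a),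
      (φ b).toLin ((overMooreMap k α).toLin z) = (overWeightMap k α).toLin ((φ a).toLin z))
    (haug : ∀ (a : SimplexCategory) (z : overMoore k a), overWeightAug k a ((φ a).toLin z) = 0)
    (q : ℕ) : ∀ (a : SimplexCategory) (x : OverSimplex a q),
      homotopyValue φ q a x ∈ (overWeight k a).gr (q + 1) ∧
        (overWeight k a).d (homotopyValue φ q a x) = (φ a).toLin (simplex k x) -
          naturalHomotopy φ a ((overMoore k a).d (simplex k x)) := by
  induction q with
  | zero =>
    intro a x
    rw [(overMoore k a).d_zero _ (simplex_mem k x), map_zero, sub_zero]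
    exact homotopyValue_zero φ hnat haug x
  | succ q ih =>
    intro a x
    have hs : ∀ (a : SimplexCategory) (x : OverSimplex a (q + 1)),
        naturalHomotopy φ a ((overMoore k a).d (simplex k x)) =
        ∑ i : Fin (q + 2), (-1 : k) ^ (i : ℕ) • homotopyValue φ q a (x.face i) := by
      intro a x
      rw [d_simplex, map_sum]
      exact Finset.sum_congr rfl fun i _ => (map_smul _ _ _).trans
        (congrArg ((-1 : k) ^ (i : ℕ) • ·) (naturalHomotopy_simplex φ (x.face i)))
    rw [hs]
    refine homotopyValue_succ φ hnat q (fun a x => ?_) (fun a x => (ih a x).1) x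
    rw [← hs]
    have key : ∀ z ∈ (overMoore k a).gr q, (overWeight k a).d (naturalHomotopy φ a z) =
        (φ a).toLin z - naturalHomotopy φ a ((overMoore k a).d z) := by
      intro z hz
      refine overMoore_induction k (P := fun z => (overWeight k a).d (naturalHomotopy φ a z) =
        (φ a).toLin z - naturalHomotopy φ a ((overMoore k a).d z)) hz
        (fun x => ?_) (by simp) ?_ ?_
      · rw [naturalHomotopy_simplex]; exact (ih a x).2
      · intro x y hx hy
        simp only [map_add, hx, hy]
        abel
      · intro r x hx
        simp only [map_smul, hx, smul_sub]
    rw [map_sub, key _ ((overMoore k a).d_mem _ _ (simplex_mem k x)), d_d_apply, map_zero,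
      sub_zero, (φ a).map_d_apply, sub_self]

theorem naturalHomotopy_spec (hnat : ∀ {a b : SimplexCategory} (α : a ⟶ b) (z : overMoore k a),
      (φ b).toLin ((overMooreMap k α).toLin z) = (overWeightMap k α).toLin ((φ a).toLin z))
    (haug : ∀ (a : SimplexCategory) (z : overMoore k a), overWeightAug k a ((φ a).toLin z) = 0)
    (z : overMoore k a) : (overWeight k a).d (naturalHomotopy φ a z) +
      naturalHomotopy φ a ((overMoore k a).d z) = (φ a).toLin z := by
  refine LinearMap.congr_fun (f := (overWeight k a).d ∘ₗ naturalHomotopy φ a +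
    naturalHomotopy φ a ∘ₗ (overMoore k a).d) ?_ z
  refine overMoore_ext k fun q x => ?_
  rw [LinearMap.add_apply, LinearMap.comp_apply, LinearMap.comp_apply, naturalHomotopy_simplex,
    (homotopyValue_spec φ hnat haug q a x).2, sub_add_cancel]

theorem naturalHomotopy_mem (hnat : ∀ {a b : SimplexCategory} (α : a ⟶ b) (z : overMoore k a),
      (φ b).toLin ((overMooreMap k α).toLin z) = (overWeightMap k α).toLin ((φ a).toLin z))
    (haug : ∀ (a : SimplexCategory) (z : overMoore k a), overWeightAug k a ((φ a).toLin z) = 0)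
    (q : ℕ) (z : overMoore k a) (hz : z ∈ (overMoore k a).gr q) :
    naturalHomotopy φ a z ∈ (overWeight k a).gr (q + 1) :=
  overMooreLift_mem k _ (fun q x => (homotopyValue_spec φ hnat haug q a x).1) q z hz

end acyclicModels

end DGModule

/-! ### Fundamental chains and the last-vertex map. -/

namespace DGModule

open CategoryTheory

variable (k : Type u) [CommRing k] {a b c : SimplexCategory}

theorem overWeightMap_comp_apply (α : a ⟶ b) (β : b ⟶ c) (x : overWeight k a) :
    (overWeightMap k (α ≫ β)).toLin x = (overWeightMap k β).toLin ((overWeightMap k α).toLin x) :=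
  Hom.congr_toLin (overWeightMap_comp k α β) x

theorem overWeightMap_congr {α α' : a ⟶ b} (h : α = α') (x : overWeight k a) :
    (overWeightMap k α).toLin x = (overWeightMap k α').toLin x := by rw [h]

/-- The cosimplicial module of the weights. -/
noncomputable abbrev weightCosimplicial : CosimplicialModule k where
  obj n := weight k n
  δ i := (weightδ k i).toLin
  σ i := (weightσ k i).toLin
  δ_δ h x := (overWeightMap_comp_apply k _ _ x).symm.trans
    ((overWeightMap_congr k (SimplexCategory.δ_comp_δ h) x).trans (overWeightMap_comp_apply k _ _ x))
  σ_δ_of_le h x := (overWeightMap_comp_apply k _ _ x).symm.trans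
    ((overWeightMap_congr k (SimplexCategory.δ_comp_σ_of_le h) x).trans
      (overWeightMap_comp_apply k _ _ x))
  σ_δ_self x := (overWeightMap_comp_apply k _ _ x).symm.trans
    ((overWeightMap_congr k SimplexCategory.δ_comp_σ_self x).trans
      (Hom.congr_toLin (overWeightMap_id k _) x))
  σ_δ_succ x := (overWeightMap_comp_apply k _ _ x).symm.trans
    ((overWeightMap_congr k SimplexCategory.δ_comp_σ_succ x).trans
      (Hom.congr_toLin (overWeightMap_id k _) x))
  σ_δ_of_gt h x := (overWeightMap_comp_apply k _ _ x).symm.trans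
    ((overWeightMap_congr k (SimplexCategory.δ_comp_σ_of_gt h) x).trans
      (overWeightMap_comp_apply k _ _ x))
  σ_σ h x := (overWeightMap_comp_apply k _ _ x).symm.trans
    ((overWeightMap_congr k (SimplexCategory.σ_comp_σ h) x).trans (overWeightMap_comp_apply k _ _ x))

theorem weightCosimplicial_alt {q : ℕ} (x : weight k q) : (weightCosimplicial k).alt q x =
    ∑ i : Fin (q + 2), (-1 : k) ^ (i : ℕ) • (weightδ k i).toLin x :=
  CosimplicialModule.alt_apply (weightCosimplicial k) x

theorem weight_d_alt {q : ℕ} (x : weight k q) :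
    (weight k (q + 1)).d ((weightCosimplicial k).alt q x) =
      (weightCosimplicial k).alt q ((weight k q).d x) := by
  rw [weightCosimplicial_alt, weightCosimplicial_alt, map_sum]
  refine Finset.sum_congr rfl fun i _ => ?_
  rw [map_smul, (weightδ k i).map_d_apply]

theorem weight_alt_mem {q j : ℕ} {x : weight k q} (hx : x ∈ (weight k q).gr j) :
    (weightCosimplicial k).alt q x ∈ (weight k (q + 1)).gr j := by
  rw [weightCosimplicial_alt]
  exact sum_mem fun i _ => Submodule.smul_mem _ _ ((weightδ k i).map_mem _ _ hx)

/-- Only `q = 0` has content: there the two cofaces have equal augmentations and opposite signs. -/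
theorem weightAug_alt {q : ℕ} {x : weight k q} (hx : x ∈ (weight k q).gr q) :
    overWeightAug k (SimplexCategory.mk (q + 1)) ((weightCosimplicial k).alt q x) = 0 := by
  cases q with
  | zero =>
    rw [weightCosimplicial_alt, Fin.sum_univ_two, map_add, map_smul, map_smul]
    have h := fun i => overWeightAug_map k (SimplexCategory.δ (n := 0) i) x
    rw [show overWeightAug k _ ((weightδ k 0).toLin x) = _ from h 0,
      show overWeightAug k _ ((weightδ k 1).toLin x) = _ from h 1]
    simp
  | succ q => exact overWeightAug_of_pos k (weight_alt_mem k hx)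

/-- The partial normalizations preserve boundaries with a given normalized value. -/
theorem weight_normalizeAux {q j : ℕ} {x : weight k (q + 1)} (hx : x ∈ (weight k (q + 1)).gr j)
    (hd : (weight k (q + 1)).d x ∈ (weightCosimplicial k).normal (q + 1)) (m : ℕ) :
    (weightCosimplicial k).normalizeAux q m x ∈ (weight k (q + 1)).gr j ∧
      (weight k (q + 1)).d ((weightCosimplicial k).normalizeAux q m x) =
        (weight k (q + 1)).d x := by
  induction m with
  | zero => exact ⟨hx, rfl⟩
  | succ m ih =>
    by_cases h : m < q + 1
    · rw [(weightCosimplicial k).normalizeAux_succ h]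
      refine ⟨sub_mem ih.1 ((weightδ k _).map_mem _ _ ((weightσ k _).map_mem _ _ ih.1)), ?_⟩
      rw [map_sub, ih.2, sub_eq_self]
      have h₁ : (weightσ k ⟨m, h⟩).toLin ((weight k (q + 1)).d x) = 0 :=
        (weightCosimplicial k).mem_normal_succ.1 hd ⟨m, h⟩
      have e₁ := (weightδ k (Fin.succ ⟨m, h⟩)).map_d_apply ((weightσ k ⟨m, h⟩).toLin
        ((weightCosimplicial k).normalizeAux q m x))
      refine e₁.symm.trans ?_
      have e₂ := (weightσ k ⟨m, h⟩).map_d_apply ((weightCosimplicial k).normalizeAux q m x)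
      rw [← e₂, ih.2, h₁, map_zero]
    · rw [CosimplicialModule.normalizeAux, dif_neg h]
      exact ih

/-- The properties of a compatible system of fundamental chains. -/
structure IsFundamental (ι : ∀ q, weight k q) : Prop where
  mem (q : ℕ) : ι q ∈ (weight k q).gr q
  normal (q : ℕ) : ι q ∈ (weightCosimplicial k).normal q
  d_succ (q : ℕ) : (weight k (q + 1)).d (ι (q + 1)) = (weightCosimplicial k).alt q (ι q)
  aug : overWeightAug k (SimplexCategory.mk 0) (ι 0) = 1

/-- The alternating sum of the cofaces of `ι_q` is a cycle of augmentation zero, so it has a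
primitive in the acyclic weight of `[q + 1]`. This primitive can be normalized without changing its
boundary, which is normalized already. -/
theorem exists_fundamental : ∃ ι, IsFundamental k ι := by
  -- The invariant for the recursion; its last clause says that the next primitive can be found.
  let P (q : ℕ) (x : weight k q) : Prop := x ∈ (weight k q).gr q ∧
    x ∈ (weightCosimplicial k).normal q ∧
      (weight k (q + 1)).d ((weightCosimplicial k).alt q x) = 0
  have step : ∀ q (x : {x // P q x}), ∃ y : {y // P (q + 1) y},
      (weight k (q + 1)).d y.1 = (weightCosimplicial k).alt q x.1 := by
    rintro q ⟨x, h₁, h₂, h₃⟩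
    obtain ⟨y, hy, hd⟩ := overWeight_acyclic k (weight_alt_mem k h₁) h₃ (weightAug_alt k h₁)
    have hn : (weight k (q + 1)).d y ∈ (weightCosimplicial k).normal (q + 1) := by
      have := (weightCosimplicial k).alt_mem_normal h₂
      exact hd ▸ this
    obtain ⟨h₄, h₅⟩ := weight_normalizeAux k hy hn (q + 1)
    have h₆ := h₅.trans hd
    refine ⟨⟨_, h₄, (weightCosimplicial k).normalize_mem (q := q + 1) y, ?_⟩, h₆⟩
    rw [weight_d_alt, h₆]
    exact (weightCosimplicial k).alt_alt x
  have base : P 0 ((overProj k (SimplexCategory.mk 0)).toLin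
      (simplex k (OverSimplex.top (SimplexCategory.mk 0)))) := by
    have h := (overProj k (SimplexCategory.mk 0)).map_mem _ _ (simplex_mem k (OverSimplex.top _))
    exact ⟨h, trivial, (weight k 1).d_zero _ (weight_alt_mem k h)⟩
  choose f hf using step
  let ι : ∀ q, {x // P q x} := fun q => Nat.rec ⟨_, base⟩ (fun q x => f q x) q
  refine ⟨fun q => (ι q).1, fun q => (ι q).2.1, fun q => (ι q).2.2.1, fun q => hf q (ι q), ?_⟩
  refine (overWeightAug_overProj k _).trans ?_
  rw [overMooreAug_simplex, if_pos rfl]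

variable {k} {ι : ∀ q, weight k q}

theorem IsFundamental.map_eq_zero (hι : IsFundamental k ι) {q : ℕ} {α : SimplexCategory.mk q ⟶ a}
    (hα : ¬ Mono α) : (overWeightMap k α).toLin (ι q) = 0 := by
  rw [SimplexCategory.mono_iff_injective] at hα
  cases q with
  | zero => exact absurd (Function.injective_of_subsingleton (α := Fin 1) _) hα
  | succ q =>
    obtain ⟨j, β, rfl⟩ := SimplexCategory.eq_σ_comp_of_not_injective α hα
    rw [overWeightMap_comp_apply]
    have h := (weightCosimplicial k).mem_normal_succ.1 (hι.normal (q + 1)) j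
    exact (congrArg _ h).trans (map_zero _)

/-- The chain map from unnormalized to normalized chains given by last vertices. -/
noncomputable def lastVertexLin (ι : ∀ q, weight k q) (a : SimplexCategory) :
    overMoore k a →ₗ[k] overWeight k a :=
  overMooreLift k fun q x => (overWeightMap k x.lastVertex).toLin (ι q)

theorem lastVertexLin_simplex {q : ℕ} (x : OverSimplex a q) :
    lastVertexLin ι a (simplex k x) = (overWeightMap k x.lastVertex).toLin (ι q) :=
  overMooreLift_simplex k
    (fun q (x : OverSimplex a q) => (overWeightMap k x.lastVertex).toLin (ι q)) x

/-- The last-vertex map of the `i`-th face is the restriction along the `i`-th coface, so this is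
the relation between `d ι_{q+1}` and the cofaces of `ι_q`. -/
theorem lastVertexLin_d (hι : IsFundamental k ι) (z : overMoore k a) :
    lastVertexLin ι a ((overMoore k a).d z) = (overWeight k a).d (lastVertexLin ι a z) := by
  refine LinearMap.congr_fun (f := lastVertexLin ι a ∘ₗ (overMoore k a).d)
    (g := (overWeight k a).d ∘ₗ lastVertexLin ι a) ?_ z
  refine overMoore_ext k fun q x => ?_
  rw [LinearMap.comp_apply, LinearMap.comp_apply, lastVertexLin_simplex,
    ← (overWeightMap k _).map_d_apply]
  cases q with
  | zero =>
    rw [(overMoore k a).d_zero _ (simplex_mem k x), map_zero,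
      (overWeight k _).d_zero _ (hι.mem 0), map_zero]
  | succ q =>
    rw [hι.d_succ, weightCosimplicial_alt, d_simplex, map_sum, map_sum]
    refine Finset.sum_congr rfl fun i _ => ?_
    rw [map_smul, map_smul, lastVertexLin_simplex, OverSimplex.lastVertex_face,
      overWeightMap_comp_apply]
    rfl

/-- The chain map from unnormalized to normalized chains given by last vertices. -/
noncomputable def lastVertexHom (hι : IsFundamental k ι) (a : SimplexCategory) :
    Hom (overMoore k a) (overWeight k a) where
  toLin := lastVertexLin ι a
  map_mem := overMooreLift_mem (j := 0) k _ fun q _ => (overWeightMap k _).map_mem _ _ (hι.mem q)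
  map_d := LinearMap.ext fun z => lastVertexLin_d hι z

theorem lastVertexLin_naturality (α : a ⟶ b) (z : overMoore k a) :
    lastVertexLin ι b ((overMooreMap k α).toLin z) =
      (overWeightMap k α).toLin (lastVertexLin ι a z) := by
  refine LinearMap.congr_fun (f := lastVertexLin ι b ∘ₗ (overMooreMap k α).toLin)
    (g := (overWeightMap k α).toLin ∘ₗ lastVertexLin ι a) ?_ z
  refine overMoore_ext k fun q x => ?_
  rw [LinearMap.comp_apply, LinearMap.comp_apply, lastVertexLin_simplex, simplex_map,
    lastVertexLin_simplex, OverSimplex.lastVertex_push, overWeightMap_comp_apply]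

theorem lastVertexLin_aug (hι : IsFundamental k ι) (z : overMoore k a) :
    overWeightAug k a (lastVertexLin ι a z) = overMooreAug k a z := by
  refine LinearMap.congr_fun (f := overWeightAug k a ∘ₗ lastVertexLin ι a) ?_ z
  refine overMoore_ext k fun q x => ?_
  rw [LinearMap.comp_apply, lastVertexLin_simplex, overWeightAug_map, overMooreAug_simplex]
  cases q with
  | zero => rw [hι.aug, if_pos rfl]
  | succ q => rw [overWeightAug_of_pos k (hι.mem (q + 1)), if_neg (by omega)]

/-- The difference of the last-vertex map and the projection. -/
noncomputable def lastVertexDiff (hι : IsFundamental k ι) (a : SimplexCategory) :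
    Hom (overMoore k a) (overWeight k a) :=
  (lastVertexHom hι a).sub (overProj k a)

theorem lastVertexDiff_naturality (hι : IsFundamental k ι) {a b : SimplexCategory} (α : a ⟶ b)
    (z : overMoore k a) : (lastVertexDiff hι b).toLin ((overMooreMap k α).toLin z) =
      (overWeightMap k α).toLin ((lastVertexDiff hι a).toLin z) := by
  change lastVertexLin ι b _ - (overProj k b).toLin _ =
    (overWeightMap k α).toLin (lastVertexLin ι a z - (overProj k a).toLin z)
  rw [lastVertexLin_naturality, map_sub]
  exact congrArg _ (Hom.congr_toLin (overProj_naturality k α) z)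

theorem lastVertexDiff_aug (hι : IsFundamental k ι) (a : SimplexCategory) (z : overMoore k a) :
    overWeightAug k a ((lastVertexDiff hι a).toLin z) = 0 := by
  change overWeightAug k a (lastVertexLin ι a z - (overProj k a).toLin z) = 0
  rw [map_sub, lastVertexLin_aug hι, overWeightAug_overProj, sub_self]

/-- The natural homotopy from the identity of the weights to the last-vertex map. -/
noncomputable def weightHomotopy (hι : IsFundamental k ι) (a : SimplexCategory) :
    overWeight k a →ₗ[k] overWeight k a :=
  naturalHomotopy (lastVertexDiff hι) a ∘ₗ (overIncl k a).toLin

theorem weightHomotopy_mem (hι : IsFundamental k ι) (q : ℕ) (κ : overWeight k a)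
    (hκ : κ ∈ (overWeight k a).gr q) : weightHomotopy hι a κ ∈ (overWeight k a).gr (q + 1) :=
  naturalHomotopy_mem _ (lastVertexDiff_naturality hι) (lastVertexDiff_aug hι) q _
    ((overIncl k a).map_mem q κ hκ)

/-- The last-vertex map and the Dold-Kan projection are natural and preserve the augmentation, so
acyclic models connects them. Restricted to normalized chains the projection is the identity. -/
theorem weightHomotopy_spec (hι : IsFundamental k ι) (κ : overWeight k a) :
    (overWeight k a).d (weightHomotopy hι a κ) + weightHomotopy hι a ((overWeight k a).d κ) =
      lastVertexLin ι a ((overIncl k a).toLin κ) - κ := by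
  have h := naturalHomotopy_spec (lastVertexDiff hι) (lastVertexDiff_naturality hι)
    (lastVertexDiff_aug hι) ((overIncl k a).toLin κ)
  rw [← (overIncl k a).map_d_apply] at h
  refine h.trans ?_
  exact congrArg (lastVertexLin ι a ((overIncl k a).toLin κ) - ·)
    (Hom.congr_toLin (overProj_comp_overIncl k a) κ)

theorem weightHomotopy_naturality (hι : IsFundamental k ι) (α : a ⟶ b) (κ : overWeight k a) :
    weightHomotopy hι b ((overWeightMap k α).toLin κ) =
      (overWeightMap k α).toLin (weightHomotopy hι a κ) := by
  refine Eq.trans ?_ (naturalHomotopy_naturality (lastVertexDiff hι) α ((overIncl k a).toLin κ))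
  exact congrArg (naturalHomotopy (lastVertexDiff hι) b)
    (Hom.congr_toLin (overIncl_naturality k α) κ)

end DGModule

/-! ### Truncations and degree bounds for primitives. -/

namespace DGModule

variable {k : Type u} [CommRing k] {X Y Z : DGModule k}

/-- The projection onto the part of degree at most `m`. -/
noncomputable def trunc (X : DGModule k) (m : ℕ) : X →ₗ[k] X :=
  X.scale fun i => if i ≤ m then 1 else 0

theorem trunc_of_le {m n : ℕ} (h : n ≤ m) {x : X} (hx : x ∈ X.gr n) : X.trunc m x = x := by
  simp [trunc, X.scale_of_mem _ hx, h]

theorem trunc_of_gt {m n : ℕ} (h : m < n) {x : X} (hx : x ∈ X.gr n) : X.trunc m x = 0 := by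
  simp [trunc, X.scale_of_mem _ hx, Nat.not_le.2 h]

theorem trunc_trunc {m n : ℕ} (h : m ≤ n) (x : X) : X.trunc n (X.trunc m x) = X.trunc m x := by
  have : X.trunc n ∘ₗ X.trunc m = X.trunc m := by
    refine X.lin_ext fun i x hx => ?_
    rw [LinearMap.comp_apply]
    rcases Nat.lt_or_ge m i with hi | hi
    · rw [trunc_of_gt hi hx, map_zero]
    · rw [trunc_of_le hi hx, trunc_of_le (hi.trans h) hx]
  exact LinearMap.congr_fun this x

theorem trunc_eq_mono {m n : ℕ} (h : m ≤ n) {x : X} (hx : X.trunc m x = x) : X.trunc n x = x := by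
  rw [← hx, trunc_trunc h]

theorem d_trunc (m : ℕ) (x : X) : X.d (X.trunc (m + 1) x) = X.trunc m (X.d x) := by
  have : X.d ∘ₗ X.trunc (m + 1) = X.trunc m ∘ₗ X.d := by
    refine X.lin_ext fun i x hx => ?_
    rw [LinearMap.comp_apply, LinearMap.comp_apply]
    cases i with
    | zero => rw [trunc_of_le (Nat.zero_le _) hx, X.d_zero x hx, map_zero]
    | succ i =>
      rcases Nat.lt_or_ge m i with hi | hi
      · rw [trunc_of_gt (by omega) hx, trunc_of_gt hi (X.d_mem i x hx), map_zero]
      · rw [trunc_of_le (by omega) hx, trunc_of_le hi (X.d_mem i x hx)]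
  exact LinearMap.congr_fun this x

theorem Hom.trunc_comm (f : Hom X Y) (m : ℕ) (x : X) :
    f.toLin (X.trunc m x) = Y.trunc m (f.toLin x) := f.scale_comm _ x

theorem exists_trunc_eq (x : X) : ∃ m, X.trunc m x = x := by
  induction x using X.induction_homogeneous with
  | h n x hx => exact ⟨n, trunc_of_le le_rfl hx⟩
  | h0 => exact ⟨0, map_zero _⟩
  | ha x y hx hy =>
    obtain ⟨m, hm⟩ := hx
    obtain ⟨n, hn⟩ := hy
    refine ⟨max m n, ?_⟩
    rw [map_add, trunc_eq_mono (le_max_left m n) hm, trunc_eq_mono (le_max_right m n) hn]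

theorem eq_zero_of_trunc {m : ℕ} {x : X} (hx : X.trunc m x = x)
    (h : ∀ i ≤ m, ∀ y ∈ X.gr i, y = 0) : x = 0 := by
  have : X.trunc m = 0 := by
    refine X.lin_ext fun i y hy => ?_
    rcases Nat.lt_or_ge m i with hi | hi
    · rw [trunc_of_gt hi hy, LinearMap.zero_apply]
    · rw [h i hi y hy, map_zero, map_zero]
  rw [← hx, this, LinearMap.zero_apply]

/-- Up to signs this is the acyclicity of the mapping cone. A relative cycle `(x, y)` gets a
relative primitive in one step, which is the form that induction over columns requires; the converse
is `isQuasiIso_of_exists_primitive`. -/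
theorem Hom.IsQuasiIso.exists_primitive {f : Hom X Y} (hf : f.IsQuasiIso) {x : X} {y : Y}
    (hx : X.d x = 0) (hy : f.toLin x = Y.d y) :
    ∃ w v, X.d w = x ∧ y = f.toLin w + Y.d v := by
  obtain ⟨h₁, h₂⟩ := (Hom.isQuasiIso_iff f).1 hf
  obtain ⟨w, hw⟩ := h₁ x y hx hy.symm
  obtain ⟨z, v, hz, hv⟩ := h₂ (y - f.toLin w) (by
    rw [map_sub, ← f.map_d_apply, hw, hy, sub_self])
  exact ⟨w + z, v, by rw [map_add, hw, hz, add_zero], by rw [map_add, add_assoc, hv]; abel⟩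

theorem Hom.isQuasiIso_of_exists_primitive (f : Hom X Y)
    (h : ∀ x y, X.d x = 0 → f.toLin x = Y.d y → ∃ w v, X.d w = x ∧ y = f.toLin w + Y.d v) :
    f.IsQuasiIso := by
  refine (Hom.isQuasiIso_iff f).2 ⟨fun x y hx hy => ?_, fun y hy => ?_⟩
  · obtain ⟨w, v, hw, -⟩ := h x y hx hy.symm
    exact ⟨w, hw⟩
  · obtain ⟨w, v, hw, hv⟩ := h 0 y (map_zero _) (by rw [map_zero, hy])
    exact ⟨w, v, hw, hv.symm⟩

/-- Truncating the primitives keeps the equations, as `d` lowers degrees by one. The bounds are what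
makes the induction over columns terminate. -/
theorem Hom.IsQuasiIso.exists_primitive_trunc {f : Hom X Y} (hf : f.IsQuasiIso) {x : X} {y : Y}
    {m : ℕ} (hxm : X.trunc m x = x) (hym : Y.trunc (m + 1) y = y)
    (hx : X.d x = 0) (hy : f.toLin x = Y.d y) :
    ∃ w v, X.trunc (m + 1) w = w ∧ Y.trunc (m + 2) v = v ∧ X.d w = x ∧
      y = f.toLin w + Y.d v := by
  obtain ⟨w, v, hw, hv⟩ := hf.exists_primitive hx hy
  refine ⟨X.trunc (m + 1) w, Y.trunc (m + 2) v, trunc_trunc le_rfl _, trunc_trunc le_rfl _, ?_, ?_⟩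
  · rw [d_trunc, hw, hxm]
  · rw [d_trunc, f.trunc_comm, ← map_add, ← hv, hym]

end DGModule

/-- A cochain complex of comodules, with the vanishing `(obj q)_m = 0` for `m < 2 q`. -/
structure CochainComodule {k : Type u} [CommRing k] (C : DGCoalgebra k) where
  obj : ℕ → DGComodule C
  δ : ∀ q, DGComodule.Hom (obj q) (obj (q + 1))
  δ_δ : ∀ q (x : (obj q).toDGModule), (δ (q + 1)).toLin ((δ q).toLin x) = 0
  eq_zero : ∀ q m (x : (obj q).toDGModule), m < 2 * q → x ∈ (obj q).gr m → x = 0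

/-! ### The total comodule of a cochain complex of comodules. -/

namespace CochainComodule

open DGModule DGComodule

variable {k : Type u} [CommRing k] {C : DGCoalgebra k} (N : CochainComodule C)

/-- The module `⨁ q, N^q`. -/
abbrev Sum : Type u := DirectSum ℕ fun q => (N.obj q).carrier

/-- The inclusion `N^q ⟶ ⨁ q, N^q`. -/
noncomputable abbrev incl (q : ℕ) : (N.obj q).toDGModule →ₗ[k] N.Sum :=
  DirectSum.lof k ℕ (fun q => (N.obj q).carrier) q

theorem incl_same (q : ℕ) (x : (N.obj q).toDGModule) : N.incl q x q = x :=
  DirectSum.component.lof_self k (M := fun q => (N.obj q).carrier) q x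

theorem incl_ne {p q : ℕ} (h : q ≠ p) (x : (N.obj q).toDGModule) : N.incl q x p = 0 := by
  have := DirectSum.component.of k (M := fun q => (N.obj q).carrier) p q x
  exact this.trans (dif_neg h)

theorem add_apply (x y : N.Sum) (q : ℕ) : (x + y) q = x q + y q := rfl

theorem sum_ext {x y : N.Sum} (h : ∀ q, x q = y q) : x = y := DFinsupp.ext h

theorem lin_ext {M : Type u} [AddCommGroup M] [Module k M] {f g : N.Sum →ₗ[k] M}
    (h : ∀ q x, f (N.incl q x) = g (N.incl q x)) : f = g :=
  DirectSum.linearMap_ext k fun q => LinearMap.ext fun x => h q x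

theorem mem_of_incl (S : Submodule k N.Sum) (x : N.Sum) (h : ∀ q, N.incl q (x q) ∈ S) :
    x ∈ S := by
  classical
  have : x = ∑ q ∈ DFinsupp.support x, N.incl q (x q) :=
    (DirectSum.sum_support_of x).symm
  rw [this]
  exact Submodule.sum_mem _ fun q _ => h q

/-- The part of total degree `n`: the sum of the `(N^q)_{n+q}`. -/
def totGr (n : ℕ) : Submodule k N.Sum where
  carrier := {x | ∀ q, x q ∈ (N.obj q).gr (n + q)}
  zero_mem' _ := zero_mem _
  add_mem' hx hy q := add_mem (hx q) (hy q)
  smul_mem' a _ hx q := Submodule.smul_mem _ a (hx q)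

theorem incl_mem {q m n : ℕ} (h : m = n + q) {x : (N.obj q).toDGModule} (hx : x ∈ (N.obj q).gr m) :
    N.incl q x ∈ N.totGr n := by
  intro p
  by_cases hp : q = p
  · subst hp; subst h; rwa [incl_same]
  · rw [N.incl_ne hp]; exact zero_mem _

/-- The vanishing below `2 q` excludes negative total degrees. It also bounds the columns of total
degree `n` by `q ≤ n`, so the direct sum is the right totalization. -/
theorem incl_mem_or {q m : ℕ} {x : (N.obj q).toDGModule} (hx : x ∈ (N.obj q).gr m) :
    x = 0 ∨ ∃ n, m = n + q := by
  rcases Nat.lt_or_ge m (2 * q) with h | h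
  · exact Or.inl (N.eq_zero q m x h hx)
  · exact Or.inr ⟨m - q, by omega⟩

/-- The projection onto total degree `n`. -/
noncomputable def totProj (n : ℕ) : N.Sum →ₗ[k] N.Sum :=
  DirectSum.toModule k ℕ _ fun q => N.incl q ∘ₗ (N.obj q).proj (n + q)

theorem totProj_incl (n q : ℕ) (x : (N.obj q).toDGModule) :
    N.totProj n (N.incl q x) = N.incl q ((N.obj q).proj (n + q) x) := by
  rw [totProj, DirectSum.toModule_lof]; rfl

theorem totProj_apply (n : ℕ) (x : N.Sum) (q : ℕ) :
    N.totProj n x q = (N.obj q).proj (n + q) (x q) := by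
  have : DirectSum.component k ℕ (fun q => (N.obj q).carrier) q ∘ₗ N.totProj n =
      (N.obj q).proj (n + q) ∘ₗ DirectSum.component k ℕ (fun q => (N.obj q).carrier) q := by
    refine N.lin_ext fun p x => ?_
    rw [LinearMap.comp_apply, LinearMap.comp_apply, totProj_incl]
    change N.incl p ((N.obj p).proj (n + p) x) q = (N.obj q).proj (n + q) (N.incl p x q)
    by_cases hp : p = q
    · subst hp; rw [incl_same, incl_same]
    · rw [N.incl_ne hp, N.incl_ne hp, map_zero]
  exact LinearMap.congr_fun this x

theorem totGr_isInternal : DirectSum.IsInternal N.totGr := by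
  refine isInternal_of_proj _ N.totProj ?_ ?_ ?_
  · intro n x hx
    refine N.sum_ext fun q => ?_
    rw [totProj_apply, (N.obj q).proj_self (hx q)]
  · intro m n hmn x hx
    refine N.sum_ext fun q => ?_
    rw [totProj_apply, (N.obj q).proj_ne (by omega) (hx q)]
    rfl
  · rw [eq_top_iff]
    rintro x -
    refine N.mem_of_incl _ x fun q => ?_
    induction x q using (N.obj q).induction_homogeneous with
    | h0 => rw [map_zero]; exact zero_mem _
    | ha x y hx hy => rw [map_add]; exact add_mem hx hy
    | h m x hx =>
      obtain rfl | ⟨n, rfl⟩ := N.incl_mem_or hx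
      · rw [map_zero]; exact zero_mem _
      · exact Submodule.mem_iSup_of_mem n (N.incl_mem rfl hx)

/-- The total differential: `D x = (-1)^q (d x + δ x)` for `x` in `N^q`. -/
noncomputable def totD : N.Sum →ₗ[k] N.Sum :=
  DirectSum.toModule k ℕ _ fun q =>
    (-1 : k) ^ q • (N.incl q ∘ₗ (N.obj q).d + N.incl (q + 1) ∘ₗ (N.δ q).toLin)

theorem totD_incl (q : ℕ) (x : (N.obj q).toDGModule) :
    N.totD (N.incl q x) =
      (-1 : k) ^ q • (N.incl q ((N.obj q).d x) + N.incl (q + 1) ((N.δ q).toLin x)) := by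
  rw [totD, DirectSum.toModule_lof]; rfl

theorem totD_totD : N.totD ∘ₗ N.totD = 0 := by
  refine N.lin_ext fun q x => ?_
  rw [LinearMap.comp_apply, totD_incl, map_smul, map_add, totD_incl, totD_incl, d_d_apply,
    map_zero, N.δ_δ, map_zero, (N.δ q).map_d_apply, zero_add, add_zero, pow_succ]
  simp

theorem totD_totD_apply (x : N.Sum) : N.totD (N.totD x) = 0 := LinearMap.congr_fun N.totD_totD x

theorem totD_incl_mem {q m n : ℕ} (h : m = n + 1 + q) {x : (N.obj q).toDGModule}
    (hx : x ∈ (N.obj q).gr m) : N.totD (N.incl q x) ∈ N.totGr n := by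
  rw [totD_incl]
  refine Submodule.smul_mem _ _ (add_mem (N.incl_mem (m := n + q) rfl ?_)
    (N.incl_mem (m := m) (by omega) ((N.δ q).map_mem m x hx)))
  refine (N.obj q).d_mem _ x ?_
  rwa [show n + q + 1 = m by omega]

/-- The total complex. -/
noncomputable abbrev totModule : DGModule k where
  carrier := N.Sum
  gr := N.totGr
  isInternal := N.totGr_isInternal
  d := N.totD
  d_mem n x hx := by
    have h : x ∈ (N.totGr n).comap N.totD :=
      N.mem_of_incl _ x fun q => N.totD_incl_mem (n := n) rfl (hx q)
    exact h
  d_zero x hx := by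
    -- In total degree `0` the column `q ≥ 1` would sit in degree `q < 2 q` and vanishes. On the
    -- column `q = 0` the cochain differential lands in `(N^1)_0 = 0`.
    have h : x ∈ LinearMap.ker N.totD := by
      refine N.mem_of_incl _ x fun q => ?_
      rw [LinearMap.mem_ker, totD_incl]
      have hq := hx q
      cases q with
      | zero =>
        rw [(N.obj 0).d_zero _ hq, N.eq_zero 1 _ _ (by omega) ((N.δ 0).map_mem _ _ hq)]
        simp
      | succ q =>
        rw [N.eq_zero (q + 1) _ _ (by omega) hq]
        simp
    exact h
  d_d := N.totD_totD

theorem totModule_sgn_incl (q : ℕ) (x : (N.obj q).toDGModule) :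
    N.totModule.sgn (N.incl q x) = (-1 : k) ^ q • N.incl q ((N.obj q).sgn x) := by
  have : N.totModule.sgn ∘ₗ N.incl q = (-1 : k) ^ q • (N.incl q ∘ₗ (N.obj q).sgn) := by
    refine (N.obj q).lin_ext fun m x hx => ?_
    rw [LinearMap.comp_apply, LinearMap.smul_apply, LinearMap.comp_apply,
      (N.obj q).sgn_of_mem hx, map_smul, smul_smul]
    obtain rfl | ⟨n, rfl⟩ := N.incl_mem_or hx
    · simp
    · rw [N.totModule.sgn_of_mem (N.incl_mem rfl hx), pow_add, mul_comm, mul_assoc, ← mul_pow]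
      simp
  exact LinearMap.congr_fun this x

/-- The inclusion of `N^q ⊗ C`. -/
noncomputable abbrev inclC (q : ℕ) (P : DGModule k) :
    (N.obj q).toDGModule ⊗[k] P →ₗ[k] N.Sum ⊗[k] P :=
  TensorProduct.map (N.incl q) LinearMap.id

/-- The total degree differs from the internal one by `q`, so a factor on the right sees the sign
`(-1)^q`. As `totD` carries this sign as a whole, the coactions of the columns assemble to a chain
map without further signs. -/
theorem tensor_d_inclC (q : ℕ) (P : DGModule k) (t : (N.obj q).toDGModule ⊗[k] P) :
    (tensor N.totModule P).d (N.inclC q P t) = (-1 : k) ^ q •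
      (N.inclC q P ((tensor (N.obj q).toDGModule P).d t) +
        N.inclC (q + 1) P (TensorProduct.map (N.δ q).toLin LinearMap.id t)) := by
  induction t using TensorProduct.induction_on with
  | zero => simp
  | add a b ha hb => simp only [map_add, ha, hb, smul_add]; abel
  | tmul x c =>
    rw [TensorProduct.map_tmul, TensorProduct.map_tmul, LinearMap.id_apply]
    erw [tensor_d_tmul, tensor_d_tmul]
    rw [totModule_sgn_incl]
    change N.totD (N.incl q x) ⊗ₜ[k] c + _ = _
    rw [totD_incl, map_add, TensorProduct.map_tmul, TensorProduct.map_tmul,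
      TensorProduct.map_tmul]
    simp only [LinearMap.id_apply, ← TensorProduct.smul_tmul', TensorProduct.add_tmul, smul_add]
    abel

theorem inclC_mem (P : DGModule k) {q n : ℕ} {t : (N.obj q).toDGModule ⊗[k] P}
    (ht : t ∈ (tensor (N.obj q).toDGModule P).gr (n + q)) :
    N.inclC q P t ∈ (tensor N.totModule P).gr n := by
  induction ht using Submodule.span_induction with
  | zero => rw [map_zero]; exact zero_mem _
  | add a b _ _ ha hb => rw [map_add]; exact add_mem ha hb
  | smul a t _ ht => rw [map_smul]; exact Submodule.smul_mem _ _ ht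
  | mem t ht =>
    obtain ⟨i, j, hij, x, hx, c, hc, rfl⟩ := ht
    rw [TensorProduct.map_tmul, LinearMap.id_apply]
    obtain rfl | ⟨m, rfl⟩ := N.incl_mem_or hx
    · rw [map_zero, TensorProduct.zero_tmul]; exact zero_mem _
    · exact tmul_mem (X := N.totModule) (i := m) (by omega) (N.incl_mem rfl hx) hc

/-- The coaction of the total complex. -/
noncomputable def totCoactLin : N.Sum →ₗ[k] N.Sum ⊗[k] C.toDGModule :=
  DirectSum.toModule k ℕ _ fun q => N.inclC q C.toDGModule ∘ₗ (N.obj q).coact.toLin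

theorem totCoactLin_incl (q : ℕ) (x : (N.obj q).toDGModule) :
    N.totCoactLin (N.incl q x) = N.inclC q C.toDGModule ((N.obj q).coact.toLin x) := by
  rw [totCoactLin, DirectSum.toModule_lof]; rfl

/-- The coaction of the total complex as a chain map. -/
noncomputable def totCoact : DGModule.Hom N.totModule (tensor N.totModule C.toDGModule) where
  toLin := N.totCoactLin
  map_mem n x hx := by
    have h : x ∈ ((tensor N.totModule C.toDGModule).gr n).comap N.totCoactLin := by
      refine N.mem_of_incl _ x fun q => ?_
      rw [Submodule.mem_comap, totCoactLin_incl]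
      exact N.inclC_mem _ ((N.obj q).coact.map_mem _ _ (hx q))
    exact h
  map_d := by
    refine N.lin_ext fun q x => ?_
    rw [LinearMap.comp_apply, LinearMap.comp_apply, totCoactLin_incl, tensor_d_inclC]
    change N.totCoactLin (N.totD _) = _
    rw [totD_incl, map_smul, map_add, totCoactLin_incl, totCoactLin_incl,
      (N.obj q).coact.map_d_apply, (N.δ q).coact_apply]

theorem idComul_inclC (q : ℕ) (t : (N.obj q).toDGModule ⊗[k] C.toDGModule) :
    (C.idComul N.totModule).toLin (N.inclC q C.toDGModule t) =
      TensorProduct.map (N.inclC q C.toDGModule) LinearMap.id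
        ((C.idComul (N.obj q).toDGModule).toLin t) := by
  induction t using TensorProduct.induction_on with
  | zero => simp
  | add a b ha hb => simp only [map_add, ha, hb]
  | tmul x c =>
    change (TensorProduct.assoc k N.Sum C.toDGModule C.toDGModule).symm
      (N.incl q x ⊗ₜ[k] C.comulHom.toLin c) = TensorProduct.map (N.inclC q C.toDGModule) LinearMap.id
        ((TensorProduct.assoc k (N.obj q).toDGModule C.toDGModule C.toDGModule).symm
          (x ⊗ₜ[k] C.comulHom.toLin c))
    induction C.comulHom.toLin c using TensorProduct.induction_on with
    | zero => simp
    | add a b ha hb => simp only [map_add, ha, hb, TensorProduct.tmul_add]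
    | tmul a b => rfl

/-- The total comodule of a cochain complex of comodules. -/
noncomputable abbrev tot : DGComodule C where
  toDGModule := N.totModule
  coact := N.totCoact
  coassoc := by
    ext1
    refine N.lin_ext fun q x => ?_
    change TensorProduct.map N.totCoactLin LinearMap.id (N.totCoactLin (N.incl q x)) =
      (C.idComul N.totModule).toLin (N.totCoactLin (N.incl q x))
    rw [totCoactLin_incl, idComul_inclC, ← (N.obj q).coact_coact]
    generalize (N.obj q).coact.toLin x = t
    induction t using TensorProduct.induction_on with
    | zero => simp
    | add a b ha hb => simp only [map_add, ha, hb]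
    | tmul x c =>
      rw [TensorProduct.map_tmul, TensorProduct.map_tmul, totCoactLin_incl]
      rfl
  counit := by
    ext1
    refine N.lin_ext fun q x => ?_
    change (C.idCounit N.totModule).toLin (N.totCoactLin (N.incl q x)) = N.incl q x
    rw [totCoactLin_incl]
    conv_rhs => rw [← (N.obj q).counit_coact x]
    generalize (N.obj q).coact.toLin x = t
    induction t using TensorProduct.induction_on with
    | zero => simp
    | add a b ha hb => simp only [map_add, ha, hb]
    | tmul x c => exact (map_smul (N.incl q) _ x).symm

theorem totD_apply_zero (x : N.Sum) : N.totD x 0 = (N.obj 0).d (x 0) := by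
  have : DirectSum.component k ℕ (fun q => (N.obj q).carrier) 0 ∘ₗ N.totD =
      (N.obj 0).d ∘ₗ DirectSum.component k ℕ (fun q => (N.obj q).carrier) 0 := by
    refine N.lin_ext fun q x => ?_
    rw [LinearMap.comp_apply, LinearMap.comp_apply, totD_incl]
    change (-1 : k) ^ q • (N.incl q ((N.obj q).d x) 0 + N.incl (q + 1) ((N.δ q).toLin x) 0) =
      (N.obj 0).d (N.incl q x 0)
    rw [N.incl_ne (Nat.succ_ne_zero q)]
    cases q with
    | zero => rw [incl_same, incl_same]; simp
    | succ q => rw [N.incl_ne (Nat.succ_ne_zero q), N.incl_ne (Nat.succ_ne_zero q)]; simp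
  exact LinearMap.congr_fun this x

theorem totD_apply_succ (x : N.Sum) (p : ℕ) : N.totD x (p + 1) =
    (-1 : k) ^ (p + 1) • (N.obj (p + 1)).d (x (p + 1)) + (-1 : k) ^ p • (N.δ p).toLin (x p) := by
  have : DirectSum.component k ℕ (fun q => (N.obj q).carrier) (p + 1) ∘ₗ N.totD =
      (-1 : k) ^ (p + 1) • (N.obj (p + 1)).d ∘ₗ
        DirectSum.component k ℕ (fun q => (N.obj q).carrier) (p + 1) +
      (-1 : k) ^ p • (N.δ p).toLin ∘ₗ DirectSum.component k ℕ (fun q => (N.obj q).carrier) p := by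
    refine N.lin_ext fun q x => ?_
    rw [LinearMap.comp_apply, LinearMap.add_apply, LinearMap.smul_apply, LinearMap.smul_apply,
      LinearMap.comp_apply, LinearMap.comp_apply, totD_incl]
    change (-1 : k) ^ q • (N.incl q ((N.obj q).d x) (p + 1) +
        N.incl (q + 1) ((N.δ q).toLin x) (p + 1)) =
      (-1 : k) ^ (p + 1) • (N.obj (p + 1)).d (N.incl q x (p + 1)) +
        (-1 : k) ^ p • (N.δ p).toLin (N.incl q x p)
    by_cases h : q = p
    · subst h
      rw [N.incl_ne (p := q + 1) (q := q) (by omega), N.incl_ne (p := q + 1) (q := q) (by omega),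
        incl_same, incl_same]
      simp
    · rw [N.incl_ne (p := p) (q := q) h, N.incl_ne (p := p + 1) (q := q + 1) (by omega)]
      by_cases h' : q = p + 1
      · subst h'
        rw [incl_same, incl_same]
        simp
      · rw [N.incl_ne h', N.incl_ne h']
        simp
  exact LinearMap.congr_fun this x

/-! ### Coaugmented exact cochain complexes. -/

section aug

variable {Z : DGComodule C} (ε : DGComodule.Hom Z (N.obj 0))
  (hε : ∀ z, (N.δ 0).toLin (ε.toLin z) = 0)

/-- The map to the total comodule given by a coaugmentation. -/
noncomputable def totAug : DGComodule.Hom Z N.tot where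
  toLin := N.incl 0 ∘ₗ ε.toLin
  map_mem n z hz := N.incl_mem (m := n) rfl (ε.map_mem n z hz)
  map_d := by
    refine LinearMap.ext fun z => ?_
    change N.incl 0 (ε.toLin (Z.d z)) = N.totD (N.incl 0 (ε.toLin z))
    rw [totD_incl, hε, ε.map_d_apply]
    simp
  colinear := by
    ext1
    refine LinearMap.ext fun z => ?_
    change N.totCoactLin (N.incl 0 (ε.toLin z)) =
      TensorProduct.map (N.incl 0 ∘ₗ ε.toLin) LinearMap.id (Z.coact.toLin z)
    rw [totCoactLin_incl, ε.coact_apply]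
    exact (LinearMap.congr_fun (TensorProduct.map_comp (N.incl 0) LinearMap.id ε.toLin
      LinearMap.id) _).symm

/-- The highest column of `y` is a cocycle for `δ`, hence a coboundary, and subtracting a total
boundary removes it. Descending to the column `0`, exactness at the coaugmentation finishes. -/
theorem exists_of_totD_eq (hex₀ : ∀ x, (N.δ 0).toLin x = 0 → ∃ z, ε.toLin z = x)
    (hex : ∀ q x, (N.δ (q + 1)).toLin x = 0 → ∃ y, (N.δ q).toLin y = x) (m : ℕ) (y : N.Sum)
    (hm : ∀ q, m < q → y q = 0) (hy : ∀ q, N.totD y (q + 1) = 0) :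
    ∃ z w, y = N.incl 0 (ε.toLin z) + N.totD w := by
  induction m generalizing y with
  | zero =>
    have h := hy 0
    rw [totD_apply_succ, hm (0 + 1) (by omega), map_zero, smul_zero, pow_zero, one_smul] at h
    obtain ⟨z, hz⟩ := hex₀ (y 0) ((zero_add _).symm.trans h)
    refine ⟨z, 0, N.sum_ext fun q => ?_⟩
    rw [map_zero, add_zero, hz]
    cases q with
    | zero => rw [incl_same]
    | succ q => rw [N.incl_ne (by omega), hm _ (by omega)]
  | succ m ih =>
    have h := hy (m + 1)
    rw [totD_apply_succ, hm (m + 1 + 1) (by omega), map_zero, smul_zero, zero_add] at h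
    have h' : (N.δ (m + 1)).toLin (y (m + 1)) = 0 := by
      have := congrArg ((-1 : k) ^ (m + 1) • ·) h
      simpa [smul_smul, ← mul_pow] using this
    obtain ⟨u, hu⟩ := hex m _ h'
    -- The sign cancels the one in `totD`; the correction alters only the columns `m` and `m + 1`,
    -- so the remainder is supported in columns at most `m`.
    have hyu : ∀ q, m < q → N.totD ((-1 : k) ^ m • N.incl m u) q = y q := by
      intro q hq
      rw [map_smul, totD_incl, smul_smul, ← mul_pow, neg_one_mul, neg_neg, one_pow, one_smul,
        add_apply, N.incl_ne (by omega), hu, zero_add]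
      by_cases h : m + 1 = q
      · subst h; rw [incl_same]
      · rw [N.incl_ne h, hm q (by omega)]
    obtain ⟨z, w, hzw⟩ := ih (y - N.totD ((-1 : k) ^ m • N.incl m u)) (fun q hq => by
      change y q - N.totD _ q = 0
      rw [hyu q hq, sub_self]) (fun q => by
        rw [map_sub, N.totD_totD_apply, sub_zero,
          hy q])
    refine ⟨z, w + (-1 : k) ^ m • N.incl m u, ?_⟩
    rw [map_add, ← add_assoc, ← hzw, sub_add_cancel]

/-- A relative cycle for the coaugmentation has vanishing positive columns after `totD`, so the
preceding zigzag applies. Column `0` then identifies the boundary in `Z` by injectivity. -/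
theorem totAug_isQuasiIso (hinj : Function.Injective ε.toLin)
    (hex₀ : ∀ x, (N.δ 0).toLin x = 0 → ∃ z, ε.toLin z = x)
    (hex : ∀ q x, (N.δ (q + 1)).toLin x = 0 → ∃ y, (N.δ q).toLin y = x) :
    (N.totAug ε hε).IsQuasiIso := by
  have key : ∀ (x : Z.toDGModule) (y : N.Sum), N.totD y = N.incl 0 (ε.toLin x) →
      ∃ z w, y = N.incl 0 (ε.toLin z) + N.totD w ∧ Z.d z = x := by
    intro x y hxy
    classical
    obtain ⟨m, hm⟩ := (DFinsupp.support y).bddAbove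
    obtain ⟨z, w, hzw⟩ := N.exists_of_totD_eq ε hex₀ hex m y (fun q hq => by
      by_contra h
      exact absurd (hm (DFinsupp.mem_support_iff.2 h)) (by simpa using hq)) (fun q => by
        rw [hxy, N.incl_ne (by omega)])
    refine ⟨z, w, hzw, hinj ?_⟩
    have h := congrArg (fun t => N.totD t 0) hzw
    simp only [map_add, add_apply] at h
    rw [hxy, N.totD_totD_apply, totD_apply_zero,
      incl_same, incl_same, ← ε.map_d_apply] at h
    exact (h.trans (add_zero _)).symm
  refine (DGModule.Hom.isQuasiIso_iff _).2 ⟨fun x y hx hy => ?_, fun y hy => ?_⟩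
  · obtain ⟨z, w, -, hz⟩ := key x y hy
    exact ⟨z, hz⟩
  · obtain ⟨z, w, hzw, hz⟩ := key 0 y (by rw [map_zero, map_zero]; exact hy)
    exact ⟨z, w, hz, hzw.symm⟩

end aug

/-- Maps of cochain complexes of comodules. -/
structure Hom (N N' : CochainComodule C) where
  app : ∀ q, DGComodule.Hom (N.obj q) (N'.obj q)
  app_δ : ∀ q x, (app (q + 1)).toLin ((N.δ q).toLin x) = (N'.δ q).toLin ((app q).toLin x)

variable {N} {N' : CochainComodule C}

/-- The linear map of total modules induced by a family of linear maps. -/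
noncomputable def totMapLin (f : ∀ q, (N.obj q).toDGModule →ₗ[k] (N'.obj q).toDGModule) :
    N.Sum →ₗ[k] N'.Sum :=
  DirectSum.toModule k ℕ _ fun q => N'.incl q ∘ₗ f q

theorem totMapLin_incl (f : ∀ q, (N.obj q).toDGModule →ₗ[k] (N'.obj q).toDGModule) (q : ℕ)
    (x : (N.obj q).toDGModule) : totMapLin f (N.incl q x) = N'.incl q (f q x) := by
  rw [totMapLin, DirectSum.toModule_lof]; rfl

theorem totMapLin_apply (f : ∀ q, (N.obj q).toDGModule →ₗ[k] (N'.obj q).toDGModule) (x : N.Sum)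
    (q : ℕ) : totMapLin f x q = f q (x q) := by
  have : DirectSum.component k ℕ (fun q => (N'.obj q).carrier) q ∘ₗ totMapLin f =
      f q ∘ₗ DirectSum.component k ℕ (fun q => (N.obj q).carrier) q := by
    refine N.lin_ext fun p x => ?_
    rw [LinearMap.comp_apply, LinearMap.comp_apply, totMapLin_incl]
    change N'.incl p (f p x) q = f q (N.incl p x q)
    by_cases hp : p = q
    · subst hp; rw [incl_same, incl_same]
    · rw [N.incl_ne hp, N'.incl_ne hp, map_zero]
  exact LinearMap.congr_fun this x

/-- The map of total comodules. -/
noncomputable def totMap (f : Hom N N') : DGComodule.Hom N.tot N'.tot where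
  toLin := totMapLin fun q => (f.app q).toLin
  map_mem n x hx q := by
    rw [totMapLin_apply]
    exact (f.app q).map_mem _ _ (hx q)
  map_d := by
    refine N.lin_ext fun q x => ?_
    rw [LinearMap.comp_apply, LinearMap.comp_apply, totMapLin_incl]
    change totMapLin _ (N.totD _) = N'.totD _
    rw [totD_incl, totD_incl, map_smul, map_add, totMapLin_incl, totMapLin_incl, f.app_δ,
      (f.app q).map_d_apply]
  colinear := by
    ext1
    refine N.lin_ext fun q x => ?_
    change N'.totCoactLin (totMapLin _ (N.incl q x)) =
      TensorProduct.map (totMapLin _) LinearMap.id (N.totCoactLin (N.incl q x))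
    rw [totMapLin_incl, totCoactLin_incl, totCoactLin_incl, (f.app q).coact_apply]
    generalize (N.obj q).coact.toLin x = t
    induction t using TensorProduct.induction_on with
    | zero => simp
    | add a b ha hb => simp only [map_add, ha, hb]
    | tmul x c => simp only [TensorProduct.map_tmul, totMapLin_incl]

theorem totMap_incl (f : Hom N N') (q : ℕ) (x : (N.obj q).toDGModule) :
    (totMap f).toLin (N.incl q x) = N'.incl q ((f.app q).toLin x) :=
  totMapLin_incl _ q x

/-- Here the columns are cleared from the left: `p` is the first column that may be nonzero and `j`
counts the remaining steps. A primitive in column `p` moves the error to column `p + 1` and respects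
the bounds on the degrees. -/
theorem totMap_exists_primitive (f : Hom N N') (hf : ∀ q, (f.app q).IsQuasiIso) (n j p : ℕ)
    (hj : n + 2 ≤ p + j) (x : N.Sum) (y : N'.Sum)
    (hxn : ∀ q, (N.obj q).trunc (n + q) (x q) = x q)
    (hyn : ∀ q, (N'.obj q).trunc (n + q + 1) (y q) = y q)
    (hxp : ∀ q, q < p → x q = 0) (hyp : ∀ q, q < p → y q = 0)
    (hx : N.totD x = 0) (hxy : (totMap f).toLin x = N'.totD y) :
    ∃ w v, N.totD w = x ∧ y = (totMap f).toLin w + N'.totD v := by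
  induction j generalizing p x y with
  | zero =>
    -- Now `p ≥ n + 2`. In a column `q ≥ p` the degrees of `x` and `y` are at most `n + q + 1 < 2
    -- q`, where the columns vanish.
    have hx0 : x = 0 := N.sum_ext fun q => by
      rcases Nat.lt_or_ge q p with h | h
      · exact hxp q h
      · exact eq_zero_of_trunc (hxn q) fun i hi z hz => N.eq_zero q i z (by omega) hz
    have hy0 : y = 0 := N'.sum_ext fun q => by
      rcases Nat.lt_or_ge q p with h | h
      · exact hyp q h
      · exact eq_zero_of_trunc (hyn q) fun i hi z hz => N'.eq_zero q i z (by omega) hz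
    exact ⟨0, 0, by rw [hx0, map_zero], by rw [hy0, map_zero, map_zero, add_zero]⟩
  | succ j ih =>
    have hd : ∀ (M : CochainComodule C) (z : M.Sum), (∀ q, q < p → z q = 0) →
        M.totD z p = (-1 : k) ^ p • (M.obj p).d (z p) := by
      intro M z hz
      cases p with
      | zero => rw [totD_apply_zero, pow_zero, one_smul]
      | succ p => rw [totD_apply_succ, hz p (by omega), map_zero, smul_zero, add_zero]
    have hs : ∀ {M : Type u} [AddCommGroup M] [Module k M] (z : M),
        (-1 : k) ^ p • (-1 : k) ^ p • z = z := by
      intro M _ _ z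
      rw [smul_smul, ← mul_pow, neg_one_mul, neg_neg, one_pow, one_smul]
    have h₁ : (N.obj p).d (x p) = 0 := by
      rw [← hs ((N.obj p).d (x p)), ← hd N x hxp, hx]
      exact smul_zero _
    have h₂ : (f.app p).toLin (x p) = (N'.obj p).d ((-1 : k) ^ p • y p) := by
      rw [map_smul, ← hd N' y hyp, ← hxy]
      exact (totMapLin_apply (fun q => (f.app q).toLin) x p).symm
    obtain ⟨w, v, hwn, hvn, hw, hv⟩ := (hf p).exists_primitive_trunc (hxn p)
      (by rw [map_smul, hyn p]) h₁ h₂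
    -- The correction reproduces `x` and `y` in column `p`; its only other terms are the images
    -- under `δ` in column `p + 1`, of degree within the same bounds.
    have e₁ : N.totD ((-1 : k) ^ p • N.incl p w) =
        N.incl p (x p) + N.incl (p + 1) ((N.δ p).toLin w) := by
      rw [map_smul, totD_incl, hs, hw]
    have e₂ : (totMap f).toLin ((-1 : k) ^ p • N.incl p w) + N'.totD (N'.incl p v) =
        N'.incl p (y p) + (-1 : k) ^ p • N'.incl (p + 1) ((N'.δ p).toLin v) := by
      have : (-1 : k) ^ p • (f.app p).toLin w + (-1 : k) ^ p • (N'.obj p).d v = y p := by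
        rw [← smul_add, ← hv, hs]
      rw [map_smul, totMap_incl, totD_incl, ← this, map_add, map_smul, map_smul, smul_add]
      abel
    have e₃ : N.totD (N.totD ((-1 : k) ^ p • N.incl p w)) = 0 := N.totD_totD_apply _
    have e₄ : N'.totD (N'.totD (N'.incl p v)) = 0 := N'.totD_totD_apply _
    suffices h : ∃ w' v', N.totD w' = x - N.totD ((-1 : k) ^ p • N.incl p w) ∧
        y - ((totMap f).toLin ((-1 : k) ^ p • N.incl p w) + N'.totD (N'.incl p v)) =
          (totMap f).toLin w' + N'.totD v' by
      obtain ⟨w', v', hw', hv'⟩ := h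
      refine ⟨w' + (-1 : k) ^ p • N.incl p w, v' + N'.incl p v, ?_, ?_⟩
      · rw [map_add, hw', sub_add_cancel]
      · have := eq_add_of_sub_eq hv'
        rw [this, map_add, map_add]
        abel
    refine ih (p + 1) (by omega) _ _ ?_ ?_ ?_ ?_ ?_ ?_
    · intro q
      rw [e₁]
      change (N.obj q).trunc (n + q) (x q - (N.incl p (x p) q + N.incl (p + 1) _ q)) = _
      rw [map_sub, hxn, map_add]
      congr 2
      · by_cases h : p = q
        · subst h; rw [incl_same, hxn]
        · rw [N.incl_ne h, map_zero]
      · by_cases h : p + 1 = q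
        · subst h
          rw [incl_same, ← (N.δ p).trunc_comm, show n + (p + 1) = n + p + 1 by omega, hwn]
        · rw [N.incl_ne h, map_zero]
    · intro q
      rw [e₂]
      change (N'.obj q).trunc (n + q + 1)
        (y q - (N'.incl p (y p) q + (-1 : k) ^ p • N'.incl (p + 1) _ q)) =
        y q - (N'.incl p (y p) q + (-1 : k) ^ p • N'.incl (p + 1) _ q)
      rw [map_sub, hyn, map_add, map_smul]
      refine congrArg₂ (fun a b => y q - (a + (-1 : k) ^ p • b)) ?_ ?_
      · by_cases h : p = q
        · subst h; rw [incl_same, hyn]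
        · rw [N'.incl_ne h, map_zero]
      · by_cases h : p + 1 = q
        · subst h
          rw [incl_same, ← (N'.δ p).trunc_comm, show n + (p + 1) + 1 = n + p + 2 by omega, hvn]
        · rw [N'.incl_ne h, map_zero]
    · intro q hq
      rw [e₁]
      change x q - (N.incl p (x p) q + N.incl (p + 1) _ q) = 0
      rw [N.incl_ne (p := q) (q := p + 1) (by omega), add_zero]
      by_cases h : p = q
      · subst h; rw [incl_same, sub_self]
      · rw [N.incl_ne h, sub_zero, hxp q (by omega)]
    · intro q hq
      rw [e₂]
      change y q - (N'.incl p (y p) q + (-1 : k) ^ p • N'.incl (p + 1) _ q) = 0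
      rw [N'.incl_ne (p := q) (q := p + 1) (by omega), smul_zero, add_zero]
      by_cases h : p = q
      · subst h; rw [incl_same, sub_self]
      · rw [N'.incl_ne h, sub_zero, hyp q (by omega)]
    · rw [map_sub, hx, e₃, sub_zero]
    · rw [map_sub, map_sub, map_add, e₄, add_zero, hxy]
      exact congrArg _ ((totMap f).map_d_apply _)

theorem exists_trunc_bound (x : N.Sum) : ∃ n, ∀ q, (N.obj q).trunc n (x q) = x q := by
  classical
  choose m hm using fun q => exists_trunc_eq (X := (N.obj q).toDGModule) (x q)
  refine ⟨(DFinsupp.support x).sup m, fun q => ?_⟩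
  by_cases hq : q ∈ DFinsupp.support x
  · exact trunc_eq_mono (Finset.le_sup hq) (hm q)
  · rw [DFinsupp.notMem_support_iff.1 hq, map_zero]

theorem totMap_isQuasiIso (f : Hom N N') (hf : ∀ q, (f.app q).IsQuasiIso) :
    (totMap f).IsQuasiIso := by
  refine DGModule.Hom.isQuasiIso_of_exists_primitive _ fun x y hx hxy => ?_
  obtain ⟨m, hm⟩ := exists_trunc_bound x
  obtain ⟨n, hn⟩ := exists_trunc_bound y
  exact totMap_exists_primitive f hf (m + n) (m + n + 2) 0 (by omega) x y
    (fun q => trunc_eq_mono (by omega) (hm q)) (fun q => trunc_eq_mono (by omega) (hn q))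
    (by omega) (by omega) hx hxy

end CochainComodule

namespace CosimplicialModule

variable {k : Type u} [CommRing k] {M M' : CosimplicialModule k}

theorem map_normalize (F : ∀ n, M.obj n →ₗ[k] M'.obj n)
    (hδ : ∀ {n : ℕ} (i : Fin (n + 2)) (x : M.obj n), F (n + 1) (M.δ i x) = M'.δ i (F n x))
    (hσ : ∀ {n : ℕ} (i : Fin (n + 1)) (x : M.obj (n + 1)), F n (M.σ i x) = M'.σ i (F (n + 1) x))
    {q : ℕ} (x : M.obj q) : F q (M.normalize q x) = M'.normalize q (F q x) := by
  cases q with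
  | zero => rfl
  | succ q =>
    have h : ∀ m ≤ q + 1,
        F (q + 1) (M.normalizeAux q m x) = M'.normalizeAux q m (F (q + 1) x) := by
      intro m
      induction m with
      | zero => intro _; rfl
      | succ m ih =>
        intro hm
        rw [M.normalizeAux_succ hm, M'.normalizeAux_succ hm, map_sub, hδ, hσ, ih (by omega)]
    exact h _ le_rfl

end CosimplicialModule

namespace DGComodule

open DGModule

variable {k : Type u} [CommRing k] {C : DGCoalgebra k} {X Y Z : DGComodule C}

/-- The module of maps of comodules. -/
def homs (X Y : DGComodule C) : Submodule k (X.toDGModule →ₗ[k] Y.toDGModule) where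
  carrier := {f | (∀ n, ∀ x ∈ X.gr n, f x ∈ Y.gr n) ∧ (∀ x, f (X.d x) = Y.d (f x)) ∧
    ∀ x, Y.coact.toLin (f x) = TensorProduct.map f LinearMap.id (X.coact.toLin x)}
  zero_mem' := ⟨fun _ _ _ => zero_mem _, fun _ => (map_zero _).symm, fun x => by
    rw [TensorProduct.map_zero_left]; simp⟩
  add_mem' {f g} hf hg := ⟨fun n x hx => add_mem (hf.1 n x hx) (hg.1 n x hx), fun x => by
    rw [LinearMap.add_apply, LinearMap.add_apply, map_add, hf.2.1, hg.2.1], fun x => by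
    rw [LinearMap.add_apply, map_add, hf.2.2, hg.2.2, TensorProduct.map_add_left]; rfl⟩
  smul_mem' a f hf := ⟨fun n x hx => Submodule.smul_mem _ a (hf.1 n x hx), fun x => by
    rw [LinearMap.smul_apply, LinearMap.smul_apply, map_smul, hf.2.1], fun x => by
    rw [LinearMap.smul_apply, map_smul, hf.2.2, TensorProduct.map_smul_left]; rfl⟩

/-- The map of comodules underlying an element of `homs`. -/
def homOfMem (f : X.toDGModule →ₗ[k] Y.toDGModule) (hf : f ∈ homs X Y) : Hom X Y where
  toLin := f
  map_mem := hf.1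
  map_d := LinearMap.ext hf.2.1
  colinear := DGModule.Hom.ext (LinearMap.ext hf.2.2)

theorem Hom.mem_homs (f : Hom X Y) : f.toLin ∈ homs X Y :=
  ⟨f.map_mem, f.map_d_apply, f.coact_apply⟩

theorem comp_mem_homs {g : Y.toDGModule →ₗ[k] Z.toDGModule} {f : X.toDGModule →ₗ[k] Y.toDGModule}
    (hg : g ∈ homs Y Z) (hf : f ∈ homs X Y) : g ∘ₗ f ∈ homs X Z :=
  ((homOfMem g hg).comp (homOfMem f hf)).mem_homs

end DGComodule

/-! ### The normalized cochain complex of a cosimplicial comodule. -/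

namespace CosimplicialComodule

open DGModule DGComodule

variable {k : Type u} [CommRing k] {C : DGCoalgebra k} (Φ : CosimplicialComodule C)

/-- The underlying cosimplicial module. -/
abbrev cosimplicial : CosimplicialModule k where
  obj n := (Φ.obj n).carrier
  δ i := (Φ.δ i).toLin
  σ i := (Φ.σ i).toLin
  δ_δ h x := DGModule.Hom.congr_toLin (congrArg DGComodule.Hom.toHom (Φ.δ_comp_δ h)) x
  σ_δ_of_le h x := DGModule.Hom.congr_toLin (congrArg DGComodule.Hom.toHom (Φ.δ_comp_σ_of_le h)) x
  σ_δ_self x := DGModule.Hom.congr_toLin (congrArg DGComodule.Hom.toHom Φ.δ_comp_σ_self) x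
  σ_δ_succ x := DGModule.Hom.congr_toLin (congrArg DGComodule.Hom.toHom Φ.δ_comp_σ_succ) x
  σ_δ_of_gt h x := DGModule.Hom.congr_toLin (congrArg DGComodule.Hom.toHom (Φ.δ_comp_σ_of_gt h)) x
  σ_σ h x := DGModule.Hom.congr_toLin (congrArg DGComodule.Hom.toHom (Φ.σ_comp_σ h)) x

theorem alt_mem_homs (q : ℕ) : Φ.cosimplicial.alt q ∈ homs (Φ.obj q) (Φ.obj (q + 1)) :=
  Submodule.sum_mem _ fun i _ => Submodule.smul_mem _ _ (Φ.δ i).mem_homs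

theorem normalize_mem_homs (q : ℕ) : Φ.cosimplicial.normalize q ∈ homs (Φ.obj q) (Φ.obj q) := by
  cases q with
  | zero => exact (DGComodule.Hom.id _).mem_homs
  | succ q =>
    have h : ∀ m, Φ.cosimplicial.normalizeAux q m ∈ homs (Φ.obj (q + 1)) (Φ.obj (q + 1)) := by
      intro m
      induction m with
      | zero => exact (DGComodule.Hom.id _).mem_homs
      | succ m ih =>
        by_cases hm : m < q + 1
        · rw [CosimplicialModule.normalizeAux, dif_pos hm]
          exact comp_mem_homs (sub_mem (DGComodule.Hom.id _).mem_homs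
            (comp_mem_homs (Φ.δ _).mem_homs (Φ.σ _).mem_homs)) ih
        · rw [CosimplicialModule.normalizeAux, dif_neg hm]
          exact ih
    exact h _

/-- The alternating sum of the cofaces. -/
def altHom (q : ℕ) : DGComodule.Hom (Φ.obj q) (Φ.obj (q + 1)) := homOfMem _ (Φ.alt_mem_homs q)

/-- The normalization. -/
def normalizeHom (q : ℕ) : DGComodule.Hom (Φ.obj q) (Φ.obj q) :=
  homOfMem _ (Φ.normalize_mem_homs q)

/-- The normalized part of `Φ^q` vanishes below degree `2 q`. -/
def IsConnective : Prop := ∀ q m, m < 2 * q → ∀ x ∈ (Φ.obj q).gr m, x ∈ Φ.cosimplicial.normal q →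
  x = 0

variable [IsFiniteProductOfFields k]

/-- The comodule of normalized cochains. -/
noncomputable abbrev normalObj (q : ℕ) : DGComodule C :=
  DGComodule.ker ((DGComodule.Hom.id (Φ.obj q)).sub (Φ.normalizeHom q))

/-- The inclusion of the normalized cochains. -/
noncomputable abbrev normalIncl (q : ℕ) : DGComodule.Hom (Φ.normalObj q) (Φ.obj q) := kerIncl _

theorem val_mem_normal {q : ℕ} (x : (Φ.normalObj q).toDGModule) :
    x.1 ∈ Φ.cosimplicial.normal q := by
  have h : x.1 - Φ.cosimplicial.normalize q x.1 = 0 := x.2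
  rw [sub_eq_zero.1 h]
  exact Φ.cosimplicial.normalize_mem _

theorem sub_normalize_eq_zero {q : ℕ} {x : (Φ.obj q).toDGModule}
    (hx : x ∈ Φ.cosimplicial.normal q) :
    ((DGComodule.Hom.id (Φ.obj q)).sub (Φ.normalizeHom q)).toLin x = 0 :=
  sub_eq_zero.2 (Φ.cosimplicial.normalize_of_mem hx).symm

/-- A map of comodules with normalized values. -/
noncomputable def normalLift {q : ℕ} {Z : DGComodule C} (f : DGComodule.Hom Z (Φ.obj q))
    (hf : ∀ z, f.toLin z ∈ Φ.cosimplicial.normal q) : DGComodule.Hom Z (Φ.normalObj q) :=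
  kerDesc _ f fun z => Φ.sub_normalize_eq_zero (hf z)

/-- An element of the normalized cochains. -/
noncomputable abbrev normalMk {q : ℕ} (x : (Φ.obj q).toDGModule)
    (hx : x ∈ Φ.cosimplicial.normal q) : (Φ.normalObj q).toDGModule :=
  ⟨x, Φ.sub_normalize_eq_zero hx⟩

/-- The projection onto the normalized cochains. -/
noncomputable def normalProj (q : ℕ) : DGComodule.Hom (Φ.obj q) (Φ.normalObj q) :=
  Φ.normalLift (Φ.normalizeHom q) fun _ => Φ.cosimplicial.normalize_mem _

theorem normalProj_val {q : ℕ} (x : (Φ.normalObj q).toDGModule) :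
    (Φ.normalProj q).toLin x.1 = x :=
  Subtype.ext (Φ.cosimplicial.normalize_of_mem (Φ.val_mem_normal x))

/-- The normalized cochain complex. -/
noncomputable abbrev normalized (hΦ : Φ.IsConnective) : CochainComodule C where
  obj := Φ.normalObj
  δ q := Φ.normalLift ((Φ.altHom q).comp (Φ.normalIncl q)) fun x =>
    Φ.cosimplicial.alt_mem_normal (Φ.val_mem_normal x)
  δ_δ _ x := Subtype.ext (Φ.cosimplicial.alt_alt x.1)
  eq_zero q m x hm hx := Subtype.ext (hΦ q m hm x.1 hx (Φ.val_mem_normal x))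

variable {Φ} {Ψ : CosimplicialComodule C}

theorem Hom.apply_δ (F : Hom Φ Ψ) {n : ℕ} (i : Fin (n + 2)) (x : (Φ.obj n).toDGModule) :
    (F.app (n + 1)).toLin ((Φ.δ i).toLin x) = (Ψ.δ i).toLin ((F.app n).toLin x) :=
  DGModule.Hom.congr_toLin (congrArg DGComodule.Hom.toHom (F.app_δ i)) x

theorem Hom.apply_σ (F : Hom Φ Ψ) {n : ℕ} (i : Fin (n + 1)) (x : (Φ.obj (n + 1)).toDGModule) :
    (F.app n).toLin ((Φ.σ i).toLin x) = (Ψ.σ i).toLin ((F.app (n + 1)).toLin x) :=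
  DGModule.Hom.congr_toLin (congrArg DGComodule.Hom.toHom (F.app_σ i)) x

/-- The map of normalized cochain complexes. -/
noncomputable def normalizedMap (F : Hom Φ Ψ) (hΦ : Φ.IsConnective) (hΨ : Ψ.IsConnective) :
    CochainComodule.Hom (Φ.normalized hΦ) (Ψ.normalized hΨ) where
  app q := Ψ.normalLift ((F.app q).comp (Φ.normalIncl q)) fun x =>
    CosimplicialModule.map_mem_normal (M := Φ.cosimplicial) (M' := Ψ.cosimplicial)
      (fun n => (F.app n).toLin) F.apply_σ (Φ.val_mem_normal x)
  app_δ _ x := Subtype.ext (CosimplicialModule.map_alt (M := Φ.cosimplicial) (M' := Ψ.cosimplicial)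
    (fun n => (F.app n).toLin) F.apply_δ x.1)

/-- Normalization is a natural projection, so the normalized map is a retract of the given one. -/
theorem normalizedMap_app_isQuasiIso (F : Hom Φ Ψ) (hΦ : Φ.IsConnective) (hΨ : Ψ.IsConnective)
    (hF : ∀ q, (F.app q).IsQuasiIso) (q : ℕ) : ((normalizedMap F hΦ hΨ).app q).IsQuasiIso := by
  refine DGModule.Hom.IsQuasiIso.of_retract (hF q) (Φ.normalIncl q).toHom (Φ.normalProj q).toHom
    (Ψ.normalIncl q).toHom (Ψ.normalProj q).toHom ?_ ?_ rfl ?_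
  · exact DGModule.Hom.ext (LinearMap.ext fun x => Φ.normalProj_val x)
  · exact DGModule.Hom.ext (LinearMap.ext fun x => Ψ.normalProj_val x)
  · exact DGModule.Hom.ext (LinearMap.ext fun x => Subtype.ext
      (CosimplicialModule.map_normalize (M := Φ.cosimplicial) (M' := Ψ.cosimplicial)
        (fun n => (F.app n).toLin) F.apply_δ F.apply_σ x))

theorem totMap_normalizedMap_isQuasiIso (F : Hom Φ Ψ) (hΦ : Φ.IsConnective) (hΨ : Ψ.IsConnective)
    (hF : ∀ q, (F.app q).IsQuasiIso) : (CochainComodule.totMap (normalizedMap F hΦ hΨ)).IsQuasiIso :=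
  CochainComodule.totMap_isQuasiIso _ (normalizedMap_app_isQuasiIso F hΦ hΨ hF)

end CosimplicialComodule

namespace DGModule

variable {k : Type u} [CommRing k] {X Y Z : DGModule k}

/-- If `g ∘ f` is a quasi-isomorphism and `g` is injective on homology, then `f` is a
quasi-isomorphism. -/
theorem Hom.IsQuasiIso.of_comp_of_reflects {g : Hom Y Z} {f : Hom X Y}
    (hg : ∀ y z, Y.d y = 0 → Z.d z = g.toLin y → ∃ w, Y.d w = y) (h : (g.comp f).IsQuasiIso) :
    f.IsQuasiIso := by
  obtain ⟨h₁, h₂⟩ := (Hom.isQuasiIso_iff _).1 h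
  refine (Hom.isQuasiIso_iff f).2 ⟨fun x y hx hy => ?_, fun y hy => ?_⟩
  · exact h₁ x (g.toLin y) hx (by rw [← g.map_d_apply, hy]; rfl)
  · obtain ⟨x, w, hx, hw⟩ := h₂ (g.toLin y) (by rw [← g.map_d_apply, hy, map_zero])
    obtain ⟨v, hv⟩ := hg (y - f.toLin x) w (by rw [map_sub, hy, ← f.map_d_apply, hx, map_zero,
      sub_zero]) (by rw [map_sub, ← hw]; exact (add_sub_cancel_left _ _).symm)
    exact ⟨x, v, hx, by rw [hv, add_sub_cancel]⟩

end DGModule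

/-! ### Maps into the total comodule. -/

namespace CochainComodule

open DGModule DGComodule

variable {k : Type u} [CommRing k] {C : DGCoalgebra k} (N : CochainComodule C)

/-- The projection of the total module onto `N^q`. -/
noncomputable abbrev comp (q : ℕ) : N.Sum →ₗ[k] (N.obj q).toDGModule :=
  DirectSum.component k ℕ (fun q => (N.obj q).carrier) q

theorem comp_apply (q : ℕ) (x : N.Sum) : N.comp q x = x q := rfl

/-- Each element of the tensor product involves only finitely many columns, so it is the sum of its
components. -/
theorem tensor_sum_ext {P : Type u} [AddCommGroup P] [Module k P] {t t' : N.Sum ⊗[k] P}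
    (h : ∀ q, TensorProduct.map (N.comp q) LinearMap.id t =
      TensorProduct.map (N.comp q) LinearMap.id t') : t = t' := by
  have key : ∀ t : N.Sum ⊗[k] P, ∃ s : Finset ℕ, ∀ s', s ⊆ s' → t = ∑ q ∈ s',
      TensorProduct.map (N.incl q) LinearMap.id (TensorProduct.map (N.comp q) LinearMap.id t) := by
    intro t
    induction t using TensorProduct.induction_on with
    | zero => exact ⟨∅, fun s' _ => by simp⟩
    | add a b ha hb =>
      obtain ⟨s, hs⟩ := ha
      obtain ⟨s', hs'⟩ := hb
      refine ⟨s ∪ s', fun r hr => ?_⟩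
      simp only [map_add, Finset.sum_add_distrib]
      rw [← hs r (Finset.union_subset_left hr), ← hs' r (Finset.union_subset_right hr)]
    | tmul x p =>
      classical
      refine ⟨DFinsupp.support x, fun s' hs' => ?_⟩
      simp only [TensorProduct.map_tmul, LinearMap.id_apply]
      rw [← TensorProduct.sum_tmul]
      congr 1
      refine (DirectSum.sum_support_of x).symm.trans (Finset.sum_subset hs' fun q _ hq => ?_)
      change N.incl q (x q) = 0
      rw [DFinsupp.notMem_support_iff.1 hq, map_zero]
  obtain ⟨s, hs⟩ := key t
  obtain ⟨s', hs'⟩ := key t'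
  rw [hs (s ∪ s') Finset.subset_union_left, hs' (s ∪ s') Finset.subset_union_right]
  exact Finset.sum_congr rfl fun q _ => by rw [h]

theorem map_comp_inclC_same (q : ℕ) {P : DGModule k} (t : (N.obj q).toDGModule ⊗[k] P) :
    TensorProduct.map (N.comp q) LinearMap.id (N.inclC q P t) = t := by
  induction t using TensorProduct.induction_on with
  | zero => simp
  | add a b ha hb => simp only [map_add, ha, hb]
  | tmul x c =>
    rw [TensorProduct.map_tmul, TensorProduct.map_tmul, comp_apply, incl_same]
    rfl

theorem map_comp_inclC_ne {p q : ℕ} (h : p ≠ q) {P : DGModule k}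
    (t : (N.obj p).toDGModule ⊗[k] P) :
    TensorProduct.map (N.comp q) LinearMap.id (N.inclC p P t) = 0 := by
  induction t using TensorProduct.induction_on with
  | zero => simp
  | add a b ha hb => simp only [map_add, ha, hb, add_zero]
  | tmul x c =>
    rw [TensorProduct.map_tmul, TensorProduct.map_tmul, comp_apply, N.incl_ne h,
      TensorProduct.zero_tmul]

theorem map_comp_totCoactLin (q : ℕ) (x : N.Sum) :
    TensorProduct.map (N.comp q) LinearMap.id (N.totCoactLin x) = (N.obj q).coact.toLin (x q) := by
  refine LinearMap.congr_fun (f := TensorProduct.map (N.comp q) LinearMap.id ∘ₗ N.totCoactLin)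
    (g := (N.obj q).coact.toLin ∘ₗ N.comp q) (N.lin_ext fun p x => ?_) x
  rw [LinearMap.comp_apply, LinearMap.comp_apply, totCoactLin_incl, comp_apply]
  by_cases h : p = q
  · subst h; rw [map_comp_inclC_same, incl_same]
  · rw [N.map_comp_inclC_ne h, N.incl_ne h, map_zero]

section lift

variable {Z : DGComodule C} (b : ∀ q, Z.toDGModule →ₗ[k] (N.obj q).toDGModule)

/-- The linear map to the total module with components `b q`. -/
noncomputable def totLiftLin : Z.toDGModule →ₗ[k] N.Sum :=
  -- On degree `n` the component `b q` has degree `n + q`, which lies below `2 q` for `q > n`; these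
  -- components vanish and the finite sum loses nothing.
  Z.glue fun n => ∑ q ∈ Finset.range (n + 1), N.incl q ∘ₗ b q

theorem totLiftLin_apply (hb : ∀ q n, ∀ z ∈ Z.gr n, b q z ∈ (N.obj q).gr (n + q))
    (z : Z.toDGModule) (q : ℕ) : N.totLiftLin b z q = b q z := by
  refine LinearMap.congr_fun (f := N.comp q ∘ₗ N.totLiftLin b) (Z.lin_ext fun n z hz => ?_) z
  rw [LinearMap.comp_apply, totLiftLin, glue_of_mem _ hz, LinearMap.sum_apply, map_sum]
  simp only [LinearMap.comp_apply, comp_apply]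
  by_cases hq : q ∈ Finset.range (n + 1)
  · rw [Finset.sum_eq_single_of_mem q hq fun p _ hp => N.incl_ne hp _, incl_same]
  · rw [Finset.sum_eq_zero fun p hp => N.incl_ne (p := q) (q := p) (by rintro rfl; exact hq hp) _,
      N.eq_zero q (n + q) _ (by rw [Finset.mem_range] at hq; omega) (hb q n z hz)]

/-- The map of comodules to the total comodule with components `b q`. -/
noncomputable def totLift (hb : ∀ q n, ∀ z ∈ Z.gr n, b q z ∈ (N.obj q).gr (n + q))
    (hb₀ : ∀ z, (N.obj 0).d (b 0 z) = b 0 (Z.d z))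
    (hb₁ : ∀ q z, (N.obj (q + 1)).d (b (q + 1) z) =
      (N.δ q).toLin (b q z) + (-1 : k) ^ (q + 1) • b (q + 1) (Z.d z))
    (hco : ∀ q z, (N.obj q).coact.toLin (b q z) =
      TensorProduct.map (b q) LinearMap.id (Z.coact.toLin z)) : DGComodule.Hom Z N.tot where
  toLin := N.totLiftLin b
  map_mem n z hz q := by
    rw [N.totLiftLin_apply b hb]
    exact hb q n z hz
  map_d := by
    refine LinearMap.ext fun z => N.sum_ext fun q => ?_
    change N.totLiftLin b (Z.d z) q = N.totD (N.totLiftLin b z) q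
    cases q with
    | zero => rw [totD_apply_zero, N.totLiftLin_apply b hb, N.totLiftLin_apply b hb, hb₀]
    | succ q =>
      rw [totD_apply_succ, N.totLiftLin_apply b hb, N.totLiftLin_apply b hb,
        N.totLiftLin_apply b hb, hb₁, smul_add, smul_smul, ← mul_pow, pow_succ]
      simp
  colinear := by
    ext1
    refine LinearMap.ext fun z => N.tensor_sum_ext fun q => ?_
    change TensorProduct.map (N.comp q) LinearMap.id (N.totCoactLin (N.totLiftLin b z)) =
      TensorProduct.map (N.comp q) LinearMap.id
        (TensorProduct.map (N.totLiftLin b) LinearMap.id (Z.coact.toLin z))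
    rw [map_comp_totCoactLin, N.totLiftLin_apply b hb, hco]
    have h : N.comp q ∘ₗ N.totLiftLin b = b q :=
      LinearMap.ext fun z => N.totLiftLin_apply b hb z q
    rw [← h]
    exact LinearMap.congr_fun (TensorProduct.map_comp (N.comp q) LinearMap.id (N.totLiftLin b)
      LinearMap.id) (Z.coact.toLin z)

end lift

end CochainComodule

/-! ### The comparison from a cone to the total comodule. -/

namespace HolimCone

open DGModule DGComodule

variable {k : Type u} [CommRing k] {C : DGCoalgebra k} {Φ : CosimplicialComodule C}

theorem θ_δ_apply (S : HolimCone Φ) {n : ℕ} (i : Fin (n + 2)) (κ : weight k n)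
    (s : S.pt.toDGModule) : (S.θ (n + 1)).toLin ((weightδ k i).toLin κ ⊗ₜ[k] s) =
      (Φ.δ i).toLin ((S.θ n).toLin (κ ⊗ₜ[k] s)) :=
  DGModule.Hom.congr_toLin (congrArg DGComodule.Hom.toHom (S.θ_δ i)) (κ ⊗ₜ[k] s)

theorem θ_σ_apply (S : HolimCone Φ) {n : ℕ} (i : Fin (n + 1)) (κ : weight k (n + 1))
    (s : S.pt.toDGModule) : (S.θ n).toLin ((weightσ k i).toLin κ ⊗ₜ[k] s) =
      (Φ.σ i).toLin ((S.θ (n + 1)).toLin (κ ⊗ₜ[k] s)) :=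
  DGModule.Hom.congr_toLin (congrArg DGComodule.Hom.toHom (S.θ_σ i)) (κ ⊗ₜ[k] s)

/-- The pullback of a cone along a map of comodules. -/
noncomputable def precomp (S : HolimCone Φ) {Z : DGComodule C} (f : DGComodule.Hom Z S.pt) :
    HolimCone Φ where
  pt := Z
  θ n := (S.θ n).comp (tensorLeftMap (DGModule.Hom.id (weight k n)) f)
  θ_δ {n} i := by
    ext1
    refine TensorProduct.ext' fun κ z => ?_
    exact S.θ_δ_apply i κ (f.toLin z)
  θ_σ {n} i := by
    ext1
    refine TensorProduct.ext' fun κ z => ?_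
    exact S.θ_σ_apply i κ (f.toLin z)

theorem IsHolim.hom_ext {S : HolimCone Φ} (hS : S.IsHolim) {Z : DGComodule C}
    {f g : DGComodule.Hom Z S.pt}
    (h : ∀ n κ z, (S.θ n).toLin (κ ⊗ₜ[k] f.toLin z) = (S.θ n).toLin (κ ⊗ₜ[k] g.toLin z)) :
    f = g := by
  refine (hS (S.precomp f)).unique (fun n => rfl) fun n => ?_
  ext1
  exact TensorProduct.ext' fun κ z => (h n κ z).symm

theorem IsHolim.lift_spec {S : HolimCone Φ} (hS : S.IsHolim) (T : HolimCone Φ) (n : ℕ) :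
    (S.θ n).comp (tensorLeftMap (DGModule.Hom.id (weight k n)) (hS.lift T)) = T.θ n :=
  (hS T).choose_spec.1 n

theorem IsHolim.θ_lift {S : HolimCone Φ} (hS : S.IsHolim) (T : HolimCone Φ) (n : ℕ)
    (κ : weight k n) (t : T.pt.toDGModule) :
    (S.θ n).toLin (κ ⊗ₜ[k] (hS.lift T).toLin t) = (T.θ n).toLin (κ ⊗ₜ[k] t) :=
  DGModule.Hom.congr_toLin (congrArg DGComodule.Hom.toHom (hS.lift_spec T n)) (κ ⊗ₜ[k] t)

theorem coact_θ (S : HolimCone Φ) (n : ℕ) (κ : weight k n) (s : S.pt.toDGModule) :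
    (Φ.obj n).coact.toLin ((S.θ n).toLin (κ ⊗ₜ[k] s)) =
      TensorProduct.map ((S.θ n).toLin ∘ₗ TensorProduct.mk k _ _ κ) LinearMap.id
        (S.pt.coact.toLin s) := by
  refine ((S.θ n).coact_apply (κ ⊗ₜ[k] s)).trans ?_
  change TensorProduct.map (S.θ n).toLin LinearMap.id
    ((TensorProduct.assoc k (weight k n) S.pt.toDGModule C.toDGModule).symm
      (κ ⊗ₜ[k] S.pt.coact.toLin s)) = _
  induction S.pt.coact.toLin s using TensorProduct.induction_on with
  | zero => simp
  | add a b ha hb => simp only [map_add, ha, hb, TensorProduct.tmul_add]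
  | tmul a b => rfl

section tot

variable [IsFiniteProductOfFields k] (hΦ : Φ.IsConnective) (S : HolimCone Φ)
  {ι : ∀ q, weight k q} (hι : IsFundamental k ι)

/-- Naturality of the cone moves a codegeneracy from the value to `ι_q`, which is normalized. -/
theorem θ_fundamental_mem_normal (hι : IsFundamental k ι) (q : ℕ) (s : S.pt.toDGModule) :
    (S.θ q).toLin (ι q ⊗ₜ[k] s) ∈ Φ.cosimplicial.normal q := by
  cases q with
  | zero => trivial
  | succ q =>
    refine (CosimplicialModule.mem_normal_succ _).2 fun j => ?_
    refine (S.θ_σ_apply j (ι (q + 1)) s).symm.trans ?_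
    have h : (weightσ k j).toLin (ι (q + 1)) = 0 :=
      (CosimplicialModule.mem_normal_succ _).1 (hι.normal (q + 1)) j
    rw [h, TensorProduct.zero_tmul, map_zero]

/-- The components of the comparison map from a cone to the total comodule. -/
noncomputable def toTotComponent (q : ℕ) :
    S.pt.toDGModule →ₗ[k] (Φ.normalObj q).toDGModule :=
  ((S.θ q).toLin ∘ₗ TensorProduct.mk k _ _ (ι q)).codRestrict _ fun s =>
    Φ.sub_normalize_eq_zero (S.θ_fundamental_mem_normal hι q s)

theorem toTotComponent_val (q : ℕ) (s : S.pt.toDGModule) :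
    (S.toTotComponent hι q s).1 = (S.θ q).toLin (ι q ⊗ₜ[k] s) := rfl

theorem θ_alt (q : ℕ) (κ : weight k q) (s : S.pt.toDGModule) :
    (S.θ (q + 1)).toLin ((weightCosimplicial k).alt q κ ⊗ₜ[k] s) =
      Φ.cosimplicial.alt q ((S.θ q).toLin (κ ⊗ₜ[k] s)) := by
  rw [weightCosimplicial_alt, TensorProduct.sum_tmul, map_sum, CosimplicialModule.alt_apply]
  refine Finset.sum_congr rfl fun i _ => ?_
  rw [← TensorProduct.smul_tmul', map_smul, S.θ_δ_apply]

theorem d_θ (q : ℕ) {κ : weight k q} {m : ℕ} (hκ : κ ∈ (weight k q).gr m) (s : S.pt.toDGModule) :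
    (Φ.obj q).d ((S.θ q).toLin (κ ⊗ₜ[k] s)) = (S.θ q).toLin ((weight k q).d κ ⊗ₜ[k] s) +
      (-1 : k) ^ m • (S.θ q).toLin (κ ⊗ₜ[k] S.pt.d s) := by
  refine ((S.θ q).map_d_apply (κ ⊗ₜ[k] s)).symm.trans ?_
  rw [tensor_d_tmul, map_add, sgn_of_mem _ hκ, ← TensorProduct.smul_tmul', map_smul]

/-- The comparison map from a cone to the total comodule. -/
noncomputable def toTot : DGComodule.Hom S.pt (Φ.normalized hΦ).tot :=
  (Φ.normalized hΦ).totLift (S.toTotComponent hι)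
    (fun q n s hs => (S.θ q).map_mem (n + q) _ (tmul_mem (add_comm q n) (hι.mem q) hs))
    (fun s => Subtype.ext (by
      have h : (weight k 0).d (ι 0) = 0 := (weight k 0).d_zero _ (hι.mem 0)
      refine (S.d_θ 0 (hι.mem 0) s).trans ?_
      rw [h, TensorProduct.zero_tmul, map_zero, zero_add, pow_zero, one_smul]
      rfl))
    -- The Leibniz rule gives a term with `d ι_{q+1}`. By the defining relation of the fundamental
    -- chains it is the alternating sum of the cofaces of `ι_q`, which naturality turns into the
    -- cochain differential.
    (fun q s => Subtype.ext (by
      refine (S.d_θ (q + 1) (hι.mem (q + 1)) s).trans ?_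
      rw [hι.d_succ, S.θ_alt]
      rfl))
    (fun q s => by
      apply tensorHom_injective (Φ.normalIncl q).toHom (kerι_injective _) C.toDGModule
      refine ((Φ.normalIncl q).coact_apply _).symm.trans ((S.coact_θ q (ι q) s).trans ?_)
      exact LinearMap.congr_fun (TensorProduct.map_comp (Φ.normalIncl q).toLin LinearMap.id
        (S.toTotComponent hι q) LinearMap.id) (S.pt.coact.toLin s))

theorem toTot_apply (q : ℕ) (s : S.pt.toDGModule) :
    (((S.toTot hΦ hι).toLin s : (Φ.normalized hΦ).Sum) q).1 =
      (S.θ q).toLin (ι q ⊗ₜ[k] s) := by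
  refine (congrArg Subtype.val ((Φ.normalized hΦ).totLiftLin_apply (S.toTotComponent hι)
    (fun q n s hs => (S.θ q).map_mem (n + q) _ (tmul_mem (add_comm q n) (hι.mem q) hs)) s q)).trans
    (S.toTotComponent_val hι q s)

end tot

end HolimCone

/-! ### The total comodule as a cone, through last-vertex maps. -/

namespace CosimplicialComodule

open DGModule DGComodule CategoryTheory

variable {k : Type u} [CommRing k] {C : DGCoalgebra k} (Φ : CosimplicialComodule C)

theorem act_mem_homs {q n : ℕ} (α : SimplexCategory.mk q ⟶ SimplexCategory.mk n) :
    Φ.cosimplicial.act α ∈ homs (Φ.obj q) (Φ.obj n) := by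
  by_cases h : Mono α
  · have hw := CosimplicialModule.isCofaceWord_act (M := Φ.cosimplicial) α
    generalize Φ.cosimplicial.act α = g at hw ⊢
    induction hw with
    | id => exact (DGComodule.Hom.id _).mem_homs
    | δ i hg ih => exact comp_mem_homs (Φ.δ i).mem_homs (ih hg.mono)
  · rw [CosimplicialModule.act_of_not_mono h]
    exact zero_mem _

variable [IsFiniteProductOfFields k] (hΦ : Φ.IsConnective)

/-- The action of a simplex on the total comodule. -/
noncomputable def simplexAct {q n : ℕ} (x : OverSimplex (SimplexCategory.mk n) q) :
    (Φ.normalized hΦ).Sum →ₗ[k] (Φ.obj n).toDGModule :=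
  Φ.cosimplicial.act x.lastVertex ∘ₗ (Φ.normalIncl q).toLin ∘ₗ (Φ.normalized hΦ).comp q

/-- The action of the chains on the total comodule. -/
noncomputable def mooreAct (n : ℕ) : overMoore k (SimplexCategory.mk n) →ₗ[k]
    (Φ.normalized hΦ).Sum →ₗ[k] (Φ.obj n).toDGModule :=
  overMooreLift k fun _ x => Φ.simplexAct hΦ x

theorem mooreAct_simplex {q n : ℕ} (x : OverSimplex (SimplexCategory.mk n) q)
    (r : (Φ.normalized hΦ).Sum) :
    Φ.mooreAct hΦ n (simplex k x) r = Φ.cosimplicial.act x.lastVertex (r q).1 := by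
  rw [mooreAct, overMooreLift_simplex]
  rfl

theorem mooreAct_mem (n i j : ℕ) (μ : overMoore k (SimplexCategory.mk n))
    (hμ : μ ∈ (overMoore k (SimplexCategory.mk n)).gr i) (r : (Φ.normalized hΦ).Sum)
    (hr : r ∈ (Φ.normalized hΦ).totGr j) : Φ.mooreAct hΦ n μ r ∈ (Φ.obj n).gr (i + j) := by
  refine overMoore_induction k (P := fun μ => Φ.mooreAct hΦ n μ r ∈ (Φ.obj n).gr (i + j)) hμ
    (fun x => ?_) ?_ ?_ ?_
  · rw [mooreAct_simplex]
    refine (Φ.act_mem_homs _).1 _ _ ?_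
    rw [add_comm]
    exact hr i
  · rw [map_zero]; exact zero_mem _
  · intro x y hx hy; rw [map_add]; exact add_mem hx hy
  · intro a x hx; rw [map_smul]; exact Submodule.smul_mem _ _ hx

/-- The Leibniz rule for the action. Faces of a simplex produce the cochain differential of a column
by `act_alt`, and this cancels the `δ`-part of the total differential; what remains is the internal
differential. -/
theorem mooreAct_d (n : ℕ) (μ : overMoore k (SimplexCategory.mk n)) (r : (Φ.normalized hΦ).Sum) :
    (Φ.obj n).d (Φ.mooreAct hΦ n μ r) =
      Φ.mooreAct hΦ n ((overMoore k (SimplexCategory.mk n)).d μ) r +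
      Φ.mooreAct hΦ n ((overMoore k (SimplexCategory.mk n)).sgn μ) ((Φ.normalized hΦ).totD r) := by
  refine LinearMap.congr_fun (f := (Φ.obj n).d ∘ₗ (Φ.mooreAct hΦ n).flip r)
    (g := (Φ.mooreAct hΦ n).flip r ∘ₗ (overMoore k (SimplexCategory.mk n)).d +
      (Φ.mooreAct hΦ n).flip ((Φ.normalized hΦ).totD r) ∘ₗ
        (overMoore k (SimplexCategory.mk n)).sgn) ?_ μ
  refine overMoore_ext k fun q x => ?_
  change (Φ.obj n).d (Φ.mooreAct hΦ n (simplex k x) r) =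
    Φ.mooreAct hΦ n ((overMoore k (SimplexCategory.mk n)).d (simplex k x)) r +
      Φ.mooreAct hΦ n ((overMoore k (SimplexCategory.mk n)).sgn (simplex k x))
        ((Φ.normalized hΦ).totD r)
  rw [sgn_of_mem _ (simplex_mem k x), map_smul, LinearMap.smul_apply, mooreAct_simplex,
    mooreAct_simplex, ← (Φ.act_mem_homs x.lastVertex).2.1]
  cases q with
  | zero =>
    have h : (overMoore k (SimplexCategory.mk n)).d (simplex k x) = 0 :=
      (overMoore k (SimplexCategory.mk n)).d_zero _ (simplex_mem k x)
    rw [h, map_zero, LinearMap.zero_apply, zero_add, CochainComodule.totD_apply_zero, pow_zero,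
      one_smul]
    rfl
  | succ q =>
    rw [d_simplex, map_sum, LinearMap.sum_apply, CochainComodule.totD_apply_succ]
    have e : ∀ i : Fin (q + 2), Φ.mooreAct hΦ n ((-1 : k) ^ (i : ℕ) • simplex k (x.face i)) r =
        (-1 : k) ^ (i : ℕ) • Φ.cosimplicial.act (SimplexCategory.δ i ≫ x.lastVertex) (r q).1 := by
      intro i
      rw [map_smul, LinearMap.smul_apply, mooreAct_simplex, OverSimplex.lastVertex_face]
    rw [Finset.sum_congr rfl fun i _ => e i, ← CosimplicialModule.act_alt]
    change Φ.cosimplicial.act x.lastVertex ((Φ.obj (q + 1)).d (r (q + 1)).1) =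
      Φ.cosimplicial.act x.lastVertex (Φ.cosimplicial.alt q (r q).1) +
        (-1 : k) ^ (q + 1) • Φ.cosimplicial.act x.lastVertex
          ((-1 : k) ^ (q + 1) • (Φ.obj (q + 1)).d (r (q + 1)).1 +
            (-1 : k) ^ q • Φ.cosimplicial.alt q (r q).1)
    -- The first product keeps the internal differential, the second makes the two terms with `alt`
    -- cancel.
    have h₁ : (-1 : k) ^ (q + 1) * (-1) ^ (q + 1) = 1 := by rw [← mul_pow]; simp
    have h₂ : (-1 : k) ^ (q + 1) * (-1) ^ q = -1 := by
      rw [pow_succ, mul_right_comm, ← mul_pow]; simp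
    rw [map_add, map_smul, map_smul, smul_add, smul_smul, smul_smul, h₁, h₂]
    simp

theorem mooreAct_coact (n : ℕ) (μ : overMoore k (SimplexCategory.mk n))
    (r : (Φ.normalized hΦ).Sum) : (Φ.obj n).coact.toLin (Φ.mooreAct hΦ n μ r) =
      TensorProduct.map (Φ.mooreAct hΦ n μ) LinearMap.id ((Φ.normalized hΦ).totCoactLin r) := by
  induction μ using (overMoore k (SimplexCategory.mk n)).induction_homogeneous with
  | h0 => rw [map_zero, TensorProduct.map_zero_left]; simp
  | ha μ ν hμ hν =>
    rw [map_add, TensorProduct.map_add_left, LinearMap.add_apply, LinearMap.add_apply, map_add, hμ,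
      hν]
  | h q μ hμ =>
    refine overMoore_induction k (P := fun μ => (Φ.obj n).coact.toLin (Φ.mooreAct hΦ n μ r) =
      TensorProduct.map (Φ.mooreAct hΦ n μ) LinearMap.id ((Φ.normalized hΦ).totCoactLin r)) hμ
      (fun x => ?_) ?_ ?_ ?_
    · have h : Φ.mooreAct hΦ n (simplex k x) = Φ.simplexAct hΦ x := overMooreLift_simplex k _ x
      rw [h, simplexAct, LinearMap.comp_apply, (Φ.act_mem_homs x.lastVertex).2.2,
        LinearMap.comp_apply, (Φ.normalIncl q).coact_apply, CochainComodule.comp_apply,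
        ← (Φ.normalized hΦ).map_comp_totCoactLin]
      generalize (Φ.normalized hΦ).totCoactLin r = t
      induction t using TensorProduct.induction_on with
      | zero => simp
      | add a b ha hb => simp only [map_add, ha, hb]
      | tmul a b => rfl
    · rw [map_zero, TensorProduct.map_zero_left]; simp
    · intro x y hx hy
      rw [map_add, TensorProduct.map_add_left, LinearMap.add_apply, LinearMap.add_apply, map_add,
        hx, hy]
    · intro a x hx
      rw [map_smul, TensorProduct.map_smul_left, LinearMap.smul_apply, LinearMap.smul_apply,
        map_smul, hx]

theorem mooreAct_δ (n : ℕ) (i : Fin (n + 2)) (μ : overMoore k (SimplexCategory.mk n))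
    (r : (Φ.normalized hΦ).Sum) :
    Φ.mooreAct hΦ (n + 1) ((overMooreMap k (SimplexCategory.δ i)).toLin μ) r =
      (Φ.δ i).toLin (Φ.mooreAct hΦ n μ r) := by
  refine LinearMap.congr_fun (f := (Φ.mooreAct hΦ (n + 1)).flip r ∘ₗ
    (overMooreMap k (SimplexCategory.δ i)).toLin)
    (g := (Φ.δ i).toLin ∘ₗ (Φ.mooreAct hΦ n).flip r) ?_ μ
  refine overMoore_ext k fun q x => ?_
  change Φ.mooreAct hΦ (n + 1) ((overMooreMap k (SimplexCategory.δ i)).toLin (simplex k x)) r =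
    (Φ.δ i).toLin (Φ.mooreAct hΦ n (simplex k x) r)
  rw [simplex_map, mooreAct_simplex, mooreAct_simplex]
  exact (CosimplicialModule.δ_act (M := Φ.cosimplicial) x.lastVertex i (r q).1).symm

/-- Compatibility with codegeneracies needs normalized columns: it fails for `act` on general
cochains. -/
theorem mooreAct_σ (n : ℕ) (i : Fin (n + 1)) (μ : overMoore k (SimplexCategory.mk (n + 1)))
    (r : (Φ.normalized hΦ).Sum) :
    Φ.mooreAct hΦ n ((overMooreMap k (SimplexCategory.σ i)).toLin μ) r =
      (Φ.σ i).toLin (Φ.mooreAct hΦ (n + 1) μ r) := by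
  refine LinearMap.congr_fun (f := (Φ.mooreAct hΦ n).flip r ∘ₗ
    (overMooreMap k (SimplexCategory.σ i)).toLin)
    (g := (Φ.σ i).toLin ∘ₗ (Φ.mooreAct hΦ (n + 1)).flip r) ?_ μ
  refine overMoore_ext k fun q x => ?_
  change Φ.mooreAct hΦ n ((overMooreMap k (SimplexCategory.σ i)).toLin (simplex k x)) r =
    (Φ.σ i).toLin (Φ.mooreAct hΦ (n + 1) (simplex k x) r)
  rw [simplex_map, mooreAct_simplex, mooreAct_simplex]
  exact (CosimplicialModule.σ_act (M := Φ.cosimplicial) x.lastVertex i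
    (Φ.val_mem_normal (r q))).symm

/-- The structure maps of the total comodule as a cone. -/
noncomputable def totConeθ (n : ℕ) :
    DGComodule.Hom (tensorLeft (weight k n) (Φ.normalized hΦ).tot) (Φ.obj n) where
  toLin := TensorProduct.lift
    (Φ.mooreAct hΦ n ∘ₗ (overIncl k (SimplexCategory.mk n)).toLin)
  map_mem := map_mem_of_tmul (X := weight k n) (Y := (Φ.normalized hΦ).totModule) _ _
    fun i j κ hκ r hr => Φ.mooreAct_mem hΦ n i j _
      ((overIncl k (SimplexCategory.mk n)).map_mem i κ hκ) r hr
  map_d := by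
    refine TensorProduct.ext' fun κ r => ?_
    rw [LinearMap.comp_apply, LinearMap.comp_apply, TensorProduct.lift.tmul]
    refine Eq.trans (congrArg _ (tensor_d_tmul (X := weight k n)
      (Y := (Φ.normalized hΦ).totModule) κ r)) ?_
    rw [map_add, TensorProduct.lift.tmul, TensorProduct.lift.tmul]
    refine Eq.trans ?_ (Φ.mooreAct_d hΦ n _ r).symm
    have h₁ := (overIncl k (SimplexCategory.mk n)).map_d_apply κ
    have h₂ : (overIncl k (SimplexCategory.mk n)).toLin ((weight k n).sgn κ) =
      (overMoore k (SimplexCategory.mk n)).sgn ((overIncl k (SimplexCategory.mk n)).toLin κ) :=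
      (overIncl k (SimplexCategory.mk n)).scale_comm _ κ
    rw [← h₁, ← h₂]
    rfl
  colinear := by
    ext1
    refine TensorProduct.ext' fun κ r => ?_
    change (Φ.obj n).coact.toLin (Φ.mooreAct hΦ n ((overIncl k (SimplexCategory.mk n)).toLin κ) r) =
      TensorProduct.map (TensorProduct.lift
        (Φ.mooreAct hΦ n ∘ₗ (overIncl k (SimplexCategory.mk n)).toLin)) LinearMap.id
        ((TensorProduct.assoc k (weight k n) (Φ.normalized hΦ).Sum C.toDGModule).symm
          (κ ⊗ₜ[k] (Φ.normalized hΦ).totCoactLin r))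
    rw [mooreAct_coact]
    induction (Φ.normalized hΦ).totCoactLin r using TensorProduct.induction_on with
    | zero => simp
    | add a b ha hb => simp only [map_add, ha, hb, TensorProduct.tmul_add]
    | tmul a b => rfl

/-- The total comodule as a cone. -/
noncomputable def totCone : HolimCone Φ where
  pt := (Φ.normalized hΦ).tot
  θ := Φ.totConeθ hΦ
  θ_δ {n} i := by
    ext1
    refine TensorProduct.ext' fun κ r => ?_
    refine Eq.trans (congrArg (fun μ => Φ.mooreAct hΦ (n + 1) μ r) ?_) (Φ.mooreAct_δ hΦ n i _ r)
    exact DGModule.Hom.congr_toLin (overIncl_naturality k (SimplexCategory.δ i)) κ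
  θ_σ {n} i := by
    ext1
    refine TensorProduct.ext' fun κ r => ?_
    refine Eq.trans (congrArg (fun μ => Φ.mooreAct hΦ n μ r) ?_) (Φ.mooreAct_σ hΦ n i _ r)
    exact DGModule.Hom.congr_toLin (overIncl_naturality k (SimplexCategory.σ i)) κ

variable {Φ} (S : HolimCone Φ) {ι : ∀ q, weight k q} (hι : IsFundamental k ι)

/-- For injective `α` this is naturality along a coface word. Otherwise both sides vanish, the right
one because `ι_q` is normalized. -/
theorem act_θ {q n : ℕ} (α : SimplexCategory.mk q ⟶ SimplexCategory.mk n)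
    (hι : IsFundamental k ι) (s : S.pt.toDGModule) :
    Φ.cosimplicial.act α ((S.θ q).toLin (ι q ⊗ₜ[k] s)) =
      (S.θ n).toLin ((overWeightMap k α).toLin (ι q) ⊗ₜ[k] s) := by
  by_cases h : Mono α
  · have hw := CosimplicialModule.isCofaceWord_act (M := Φ.cosimplicial) α
    generalize Φ.cosimplicial.act α = g at hw ⊢
    induction hw with
    | id =>
      have e : (overWeightMap k (𝟙 (SimplexCategory.mk q))).toLin (ι q) = ι q :=
        DGModule.Hom.congr_toLin (overWeightMap_id k (SimplexCategory.mk q)) (ι q)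
      rw [e]
      rfl
    | δ i hg ih =>
      rw [overWeightMap_comp_apply]
      refine (congrArg (Φ.δ i).toLin (ih hg.mono)).trans ?_
      exact (S.θ_δ_apply i _ s).symm
  · rw [CosimplicialModule.act_of_not_mono h, hι.map_eq_zero h, TensorProduct.zero_tmul, map_zero]
    rfl

/-- Passing from a cone to the total comodule and acting there amounts to applying the last-vertex
map to the weights; the homotopy on the weights thus becomes usable. -/
theorem mooreAct_toTot (n : ℕ) (μ : overMoore k (SimplexCategory.mk n)) (s : S.pt.toDGModule) :
    Φ.mooreAct hΦ n μ ((S.toTot hΦ hι).toLin s) =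
      (S.θ n).toLin (lastVertexLin ι (SimplexCategory.mk n) μ ⊗ₜ[k] s) := by
  refine LinearMap.congr_fun (f := (Φ.mooreAct hΦ n).flip ((S.toTot hΦ hι).toLin s))
    (g := (S.θ n).toLin ∘ₗ (TensorProduct.mk k _ _).flip s ∘ₗ
      lastVertexLin ι (SimplexCategory.mk n)) ?_ μ
  refine overMoore_ext k fun q x => ?_
  change Φ.mooreAct hΦ n (simplex k x) ((S.toTot hΦ hι).toLin s) =
    (S.θ n).toLin (lastVertexLin ι (SimplexCategory.mk n) (simplex k x) ⊗ₜ[k] s)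
  rw [mooreAct_simplex, S.toTot_apply, act_θ S _ hι, lastVertexLin_simplex]

end CosimplicialComodule

/-! ### Null homotopies as maps out of a disk. -/

namespace DGModule

variable (k : Type u) [CommRing k]

/-- The projections of `k × k`. -/
def diskProj : ℕ → k × k →ₗ[k] k × k
  | 0 => LinearMap.prod (LinearMap.fst k k k) 0
  | 1 => LinearMap.prod 0 (LinearMap.snd k k k)
  | _ + 2 => 0

/-- The acyclic complex `k ⟵ k` in degrees `0` and `1`. -/
def disk : DGModule k where
  carrier := k × k
  gr n := LinearMap.range (diskProj k n)
  isInternal := by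
    refine isInternal_of_proj _ (diskProj k) ?_ ?_ ?_
    · rintro (_ | _ | n) _ ⟨x, rfl⟩ <;> rfl
    · rintro (_ | _ | m) (_ | _ | n) h _ ⟨x, rfl⟩ <;> first | rfl | exact absurd rfl h
    · rw [eq_top_iff]
      rintro ⟨a, b⟩ -
      have : ((a, b) : k × k) = diskProj k 0 (a, b) + diskProj k 1 (a, b) := by
        simp [diskProj]
      rw [this]
      exact add_mem (Submodule.mem_iSup_of_mem 0 ⟨_, rfl⟩) (Submodule.mem_iSup_of_mem 1 ⟨_, rfl⟩)
  d := LinearMap.prod (LinearMap.snd k k k) 0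
  d_mem := by
    rintro (_ | n) _ ⟨x, rfl⟩
    · exact ⟨(x.2, 0), rfl⟩
    · exact zero_mem _
  d_zero := by
    rintro _ ⟨x, rfl⟩
    rfl
  d_d := rfl

/-- The generator of degree `0`. -/
def diskZero : disk k := ((1, 0) : k × k)

/-- The generator of degree `1`. -/
def diskOne : disk k := ((0, 1) : k × k)

theorem diskZero_mem : diskZero k ∈ (disk k).gr 0 := ⟨diskZero k, rfl⟩

theorem disk_d_diskOne : (disk k).d (diskOne k) = diskZero k := rfl

theorem disk_d_diskZero : (disk k).d (diskZero k) = 0 := rfl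

variable {k}

theorem disk_tensor_ext {X : DGModule k} {M : Type u} [AddCommGroup M] [Module k M]
    {f g : X ⊗[k] disk k →ₗ[k] M}
    (h₀ : ∀ x, f (x ⊗ₜ[k] diskZero k) = g (x ⊗ₜ[k] diskZero k))
    (h₁ : ∀ x, f (x ⊗ₜ[k] diskOne k) = g (x ⊗ₜ[k] diskOne k)) : f = g := by
  refine TensorProduct.ext' fun x v => ?_
  have hv : v = v.1 • diskZero k + v.2 • diskOne k := by
    refine Prod.ext ?_ ?_
    · change v.1 = v.1 * 1 + v.2 * 0
      ring
    · change v.2 = v.1 * 0 + v.2 * 1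
      ring
  rw [hv, TensorProduct.tmul_add, map_add, map_add, TensorProduct.tmul_smul,
    TensorProduct.tmul_smul, map_smul, map_smul, map_smul, map_smul, h₀, h₁]

section homotopy

variable {X : DGModule k} (f : Hom X X) (h : X →ₗ[k] X)
  (hh : ∀ n, ∀ x ∈ X.gr n, h x ∈ X.gr (n + 1))
  (hd : ∀ x, X.d (h x) + h (X.d x) = f.toLin x)

/-- The linear map on `X ⊗ disk` encoding a nullhomotopy. -/
noncomputable def nullHomotopyLin : X ⊗[k] disk k →ₗ[k] X :=
  TensorProduct.lift ((LinearMap.lsmul k X).flip ∘ₗ f.toLin) ∘ₗ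
    TensorProduct.map LinearMap.id (LinearMap.fst k k k) +
  TensorProduct.lift ((LinearMap.lsmul k X).flip ∘ₗ h ∘ₗ X.sgn) ∘ₗ
    TensorProduct.map LinearMap.id (LinearMap.snd k k k)

theorem nullHomotopyLin_tmul (x : X) (v : disk k) :
    nullHomotopyLin f h (x ⊗ₜ[k] v) = v.1 • f.toLin x + v.2 • h (X.sgn x) := rfl

theorem nullHomotopyLin_zero (x : X) : nullHomotopyLin f h (x ⊗ₜ[k] diskZero k) = f.toLin x := by
  rw [nullHomotopyLin_tmul]
  simp [diskZero]

theorem nullHomotopyLin_one (x : X) : nullHomotopyLin f h (x ⊗ₜ[k] diskOne k) = h (X.sgn x) := by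
  rw [nullHomotopyLin_tmul]
  simp [diskOne]

/-- A nullhomotopy as a chain map `X ⊗ disk ⟶ X`. -/
noncomputable def nullHomotopy (hh : ∀ n, ∀ x ∈ X.gr n, h x ∈ X.gr (n + 1))
    (hd : ∀ x, X.d (h x) + h (X.d x) = f.toLin x) : Hom (tensor X (disk k)) X where
  toLin := nullHomotopyLin f h
  map_mem := map_mem_of_tmul _ _ fun i j x hx v hv => by
    rw [nullHomotopyLin_tmul]
    obtain ⟨w, rfl⟩ := hv
    rcases j with _ | _ | j
    · refine add_mem (Submodule.smul_mem _ _ (f.map_mem _ _ hx)) ?_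
      change (0 : k) • _ ∈ _
      rw [zero_smul]; exact zero_mem _
    · refine add_mem ?_ (Submodule.smul_mem _ _ (hh _ _ ?_))
      · change (0 : k) • _ ∈ _
        rw [zero_smul]; exact zero_mem _
      · rw [X.sgn_of_mem hx]; exact Submodule.smul_mem _ _ hx
    · refine add_mem ?_ ?_
      · change (0 : k) • _ ∈ _
        rw [zero_smul]; exact zero_mem _
      · change (0 : k) • _ ∈ _
        rw [zero_smul]; exact zero_mem _
  map_d := by
    refine disk_tensor_ext (fun x => ?_) fun x => ?_
    · rw [LinearMap.comp_apply, LinearMap.comp_apply, tensor_d_tmul, disk_d_diskZero,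
        TensorProduct.tmul_zero, add_zero, nullHomotopyLin_zero, nullHomotopyLin_zero,
        f.map_d_apply]
    · rw [LinearMap.comp_apply, LinearMap.comp_apply, tensor_d_tmul, disk_d_diskOne, map_add,
        nullHomotopyLin_zero, nullHomotopyLin_one, nullHomotopyLin_one, sgn_d, ← hd (X.sgn x),
        map_neg]
      abel

end homotopy

end DGModule

/-! ### Homotopies on the weights and injectivity of `toTot` on homology. -/

namespace HolimCone

open DGModule DGComodule CosimplicialComodule

variable {k : Type u} [CommRing k] {C : DGCoalgebra k} {Φ : CosimplicialComodule C}

/-- The tensor product of a cone with a complex `V` that acts on the weights. -/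
noncomputable def weightAct (S : HolimCone Φ) {V : DGModule k}
    (A : ∀ n, DGModule.Hom (tensor (weight k n) V) (weight k n))
    (hδ : ∀ {n : ℕ} (i : Fin (n + 2)) κ v, (A (n + 1)).toLin ((weightδ k i).toLin κ ⊗ₜ[k] v) =
      (weightδ k i).toLin ((A n).toLin (κ ⊗ₜ[k] v)))
    (hσ : ∀ {n : ℕ} (i : Fin (n + 1)) κ v, (A n).toLin ((weightσ k i).toLin κ ⊗ₜ[k] v) =
      (weightσ k i).toLin ((A (n + 1)).toLin (κ ⊗ₜ[k] v))) : HolimCone Φ where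
  pt := tensorLeft V S.pt
  θ n := ((S.θ n).comp (tensorLeftMap (A n) (DGComodule.Hom.id S.pt))).comp
    (tensorLeftAssocInv (weight k n) V S.pt)
  θ_δ {n} i := by
    ext1
    refine TensorProduct.ext_threefold' fun κ v s => ?_
    refine Eq.trans ?_ (S.θ_δ_apply i ((A n).toLin (κ ⊗ₜ[k] v)) s)
    rw [← hδ]
    rfl
  θ_σ {n} i := by
    ext1
    refine TensorProduct.ext_threefold' fun κ v s => ?_
    refine Eq.trans ?_ (S.θ_σ_apply i ((A (n + 1)).toLin (κ ⊗ₜ[k] v)) s)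
    rw [← hσ]
    rfl

section homotopy

variable {ι : ∀ q, weight k q} (hι : IsFundamental k ι)

/-- The difference of the last-vertex map and the identity of the weight. -/
noncomputable def lastVertexSub (n : ℕ) : DGModule.Hom (weight k n) (weight k n) :=
  ((lastVertexHom hι (SimplexCategory.mk n)).comp (overIncl k (SimplexCategory.mk n))).sub
    (DGModule.Hom.id _)

theorem lastVertexSub_apply (n : ℕ) (κ : weight k n) : (lastVertexSub hι n).toLin κ =
    lastVertexLin ι (SimplexCategory.mk n) ((overIncl k (SimplexCategory.mk n)).toLin κ) - κ := rfl

/-- The natural homotopy on the weights. -/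
noncomputable def weightNullHomotopy (n : ℕ) :
    DGModule.Hom (tensor (weight k n) (disk k)) (weight k n) :=
  nullHomotopy (lastVertexSub hι n) (weightHomotopy hι (SimplexCategory.mk n))
    (weightHomotopy_mem hι) (weightHomotopy_spec hι)

theorem weightNullHomotopy_naturality {m n : ℕ}
    (α : SimplexCategory.mk m ⟶ SimplexCategory.mk n) (κ : weight k m) (v : disk k) :
    (weightNullHomotopy hι n).toLin ((overWeightMap k α).toLin κ ⊗ₜ[k] v) =
      (overWeightMap k α).toLin ((weightNullHomotopy hι m).toLin (κ ⊗ₜ[k] v)) := by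
  have h₁ : (overIncl k (SimplexCategory.mk n)).toLin ((overWeightMap k α).toLin κ) =
      (overMooreMap k α).toLin ((overIncl k (SimplexCategory.mk m)).toLin κ) :=
    DGModule.Hom.congr_toLin (overIncl_naturality k α) κ
  have h₂ : (weight k n).sgn ((overWeightMap k α).toLin κ) =
      (overWeightMap k α).toLin ((weight k m).sgn κ) := ((overWeightMap k α).scale_comm _ κ).symm
  have h₃ : (lastVertexSub hι n).toLin ((overWeightMap k α).toLin κ) =
      (overWeightMap k α).toLin ((lastVertexSub hι m).toLin κ) := by
    rw [lastVertexSub_apply, lastVertexSub_apply, map_sub, h₁, lastVertexLin_naturality]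
  change v.1 • (lastVertexSub hι n).toLin ((overWeightMap k α).toLin κ) +
    v.2 • weightHomotopy hι (SimplexCategory.mk n) ((weight k n).sgn ((overWeightMap k α).toLin κ)) =
    (overWeightMap k α).toLin (v.1 • (lastVertexSub hι m).toLin κ +
      v.2 • weightHomotopy hι (SimplexCategory.mk m) ((weight k m).sgn κ))
  rw [h₂, h₃, weightHomotopy_naturality, map_add, map_smul, map_smul]

/-- The cone over the cylinder of a homotopy limit. -/
noncomputable def diskCone (S : HolimCone Φ) : HolimCone Φ :=
  S.weightAct (weightNullHomotopy hι) (fun _ => weightNullHomotopy_naturality hι _)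
    (fun _ => weightNullHomotopy_naturality hι _)

theorem diskCone_θ (S : HolimCone Φ) (n : ℕ) (κ : weight k n) (v : disk k) (s : S.pt.toDGModule) :
    ((S.diskCone hι).θ n).toLin (κ ⊗ₜ[k] (v ⊗ₜ[k] s)) =
      (S.θ n).toLin ((weightNullHomotopy hι n).toLin (κ ⊗ₜ[k] v) ⊗ₜ[k] s) := rfl

/-- The inclusion of `S.pt` as the degree zero end of `disk ⊗ S.pt`. -/
noncomputable def diskIncl (Z : DGComodule C) : DGComodule.Hom Z (tensorLeft (disk k) Z) where
  toLin := TensorProduct.mk k _ _ (diskZero k)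
  map_mem n z hz := tmul_mem (Nat.zero_add n) (diskZero_mem k) hz
  map_d := by
    refine LinearMap.ext fun z => ?_
    rw [LinearMap.comp_apply, LinearMap.comp_apply, TensorProduct.mk_apply, TensorProduct.mk_apply]
    refine Eq.trans ?_ (tensor_d_tmul (X := disk k) (Y := Z.toDGModule) _ _).symm
    rw [disk_d_diskZero, sgn_of_mem _ (diskZero_mem k), TensorProduct.zero_tmul, zero_add, pow_zero,
      one_smul]
  colinear := by
    ext1
    refine LinearMap.ext fun z => ?_
    change (TensorProduct.assoc k (disk k) Z.toDGModule C.toDGModule).symm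
      (diskZero k ⊗ₜ[k] Z.coact.toLin z) = TensorProduct.map (TensorProduct.mk k _ _ (diskZero k))
        LinearMap.id (Z.coact.toLin z)
    induction Z.coact.toLin z using TensorProduct.induction_on with
    | zero => simp
    | add a b ha hb => simp only [map_add, ha, hb, TensorProduct.tmul_add]
    | tmul a b => rfl

variable [IsFiniteProductOfFields k] (hΦ : Φ.IsConnective)

/-- The universal property only produces maps of comodules of degree `0`, so the homotopy is encoded
by a map out of `disk ⊗ S.pt`. On the generator of degree `0` it must be the map that the homotopy
trivializes, and this is checked on the universal families. -/
theorem IsHolim.lift_diskCone {S : HolimCone Φ} (hS : S.IsHolim) (s : S.pt.toDGModule) :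
    (hS.lift (S.diskCone hι)).toLin (diskZero k ⊗ₜ[k] s) =
      (hS.lift (Φ.totCone hΦ)).toLin ((S.toTot hΦ hι).toLin s) - s := by
  have h : (hS.lift (S.diskCone hι)).comp (diskIncl S.pt) =
      ((hS.lift (Φ.totCone hΦ)).comp (S.toTot hΦ hι)).sub (DGComodule.Hom.id S.pt) := by
    refine hS.hom_ext fun n κ s => ?_
    refine (hS.θ_lift (S.diskCone hι) n κ (diskZero k ⊗ₜ[k] s)).trans ?_
    rw [diskCone_θ]
    change (S.θ n).toLin (nullHomotopyLin _ _ (κ ⊗ₜ[k] diskZero k) ⊗ₜ[k] s) =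
      (S.θ n).toLin (κ ⊗ₜ[k] ((hS.lift (Φ.totCone hΦ)).toLin ((S.toTot hΦ hι).toLin s) - s))
    rw [nullHomotopyLin_zero, lastVertexSub_apply, TensorProduct.sub_tmul, map_sub,
      TensorProduct.tmul_sub, map_sub]
    congr 1
    refine Eq.trans ?_ (hS.θ_lift (Φ.totCone hΦ) n κ _).symm
    exact (mooreAct_toTot hΦ S hι n _ s).symm
  exact DGModule.Hom.congr_toLin (congrArg DGComodule.Hom.toHom h) s

/-- The comparison map from a homotopy limit to the total comodule reflects boundaries. -/
theorem IsHolim.toTot_reflects {S : HolimCone Φ} (hS : S.IsHolim) (s : S.pt.toDGModule)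
    (r : (Φ.normalized hΦ).tot.toDGModule) (hs : S.pt.d s = 0)
    (hr : (Φ.normalized hΦ).tot.d r = (S.toTot hΦ hι).toLin s) : ∃ w, S.pt.d w = s := by
  -- If `j` is the map from the total comodule to the homotopy limit, then `j r` has boundary `j
  -- (toTot s)`, and the homotopy has boundary `j (toTot s) - s`.
  refine ⟨(hS.lift (Φ.totCone hΦ)).toLin r -
    (hS.lift (S.diskCone hι)).toLin (diskOne k ⊗ₜ[k] s), ?_⟩
  have h₁ : (tensor (disk k) S.pt.toDGModule).d (diskOne k ⊗ₜ[k] s) = diskZero k ⊗ₜ[k] s := by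
    rw [tensor_d_tmul, disk_d_diskOne, hs, TensorProduct.tmul_zero, add_zero]
  have h₂ := (hS.lift (S.diskCone hι)).map_d_apply (diskOne k ⊗ₜ[k] s)
  have h₃ := (hS.lift (Φ.totCone hΦ)).map_d_apply r
  rw [map_sub, ← h₂, ← h₃]
  refine (congrArg₂ (· - ·) (congrArg _ hr) (congrArg _ h₁)).trans ?_
  rw [hS.lift_diskCone hι hΦ, sub_sub_cancel]

end homotopy

/-! ### Coaugmentations of homotopy limits. -/

section coaugmentation

variable {Z : DGComodule C} (ε : ∀ n, DGComodule.Hom Z (Φ.obj n))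
  (hδ : ∀ {n : ℕ} (i : Fin (n + 2)) z, (Φ.δ i).toLin ((ε n).toLin z) = (ε (n + 1)).toLin z)
  (hσ : ∀ {n : ℕ} (i : Fin (n + 1)) z, (Φ.σ i).toLin ((ε (n + 1)).toLin z) = (ε n).toLin z)

theorem weightAug_d (n : ℕ) (κ : weight k n) : weightAug k n ((weight k n).d κ) = 0 := by
  rw [weightAug_eq]; exact overWeightAug_d k κ

theorem weightAug_of_pos (n : ℕ) {q : ℕ} {κ : weight k n} (hκ : κ ∈ (weight k n).gr (q + 1)) :
    weightAug k n κ = 0 := by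
  rw [weightAug_eq]; exact overWeightAug_of_pos k hκ

theorem weightAug_sgn (n : ℕ) (κ : weight k n) :
    weightAug k n ((weight k n).sgn κ) = weightAug k n κ := by
  refine LinearMap.congr_fun (f := weightAug k n ∘ₗ (weight k n).sgn)
    ((weight k n).lin_ext fun q κ hκ => ?_) κ
  rw [LinearMap.comp_apply, sgn_of_mem _ hκ, map_smul]
  cases q with
  | zero => rw [pow_zero, one_smul]
  | succ q => rw [weightAug_of_pos n hκ, smul_zero]

theorem weightAug_map {m n : ℕ} (α : SimplexCategory.mk m ⟶ SimplexCategory.mk n)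
    (κ : weight k m) : weightAug k n ((overWeightMap k α).toLin κ) = weightAug k m κ := by
  rw [weightAug_eq, weightAug_eq]; exact overWeightAug_map k α κ

/-- The structure maps of the cone of a coaugmentation. -/
noncomputable def coaugθ (n : ℕ) : DGComodule.Hom (tensorLeft (weight k n) Z) (Φ.obj n) where
  toLin := (ε n).toLin ∘ₗ TensorProduct.lift (LinearMap.lsmul k Z.toDGModule ∘ₗ weightAug k n)
  map_mem := map_mem_of_tmul (X := weight k n) _ _ fun i j κ hκ z hz => by
    change (ε n).toLin (weightAug k n κ • z) ∈ _
    cases i with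
    | zero =>
      rw [Nat.zero_add]
      exact (ε n).map_mem _ _ (Submodule.smul_mem _ _ hz)
    | succ i => rw [weightAug_of_pos n hκ, zero_smul, map_zero]; exact zero_mem _
  map_d := by
    refine TensorProduct.ext' fun κ z => ?_
    rw [LinearMap.comp_apply]
    refine Eq.trans (congrArg _ (tensor_d_tmul (X := weight k n) κ z)) ?_
    rw [map_add]
    change (ε n).toLin (weightAug k n ((weight k n).d κ) • z) +
      (ε n).toLin (weightAug k n ((weight k n).sgn κ) • Z.d z) =
        (Φ.obj n).d ((ε n).toLin (weightAug k n κ • z))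
    rw [weightAug_d, weightAug_sgn, zero_smul, map_zero, zero_add, ← map_smul Z.d,
      (ε n).map_d_apply]
  colinear := by
    ext1
    refine TensorProduct.ext' fun κ z => ?_
    refine ((ε n).coact_apply (weightAug k n κ • z)).trans ?_
    rw [map_smul, map_smul]
    change _ = TensorProduct.map ((ε n).toLin ∘ₗ
      TensorProduct.lift (LinearMap.lsmul k Z.toDGModule ∘ₗ weightAug k n)) LinearMap.id
      ((TensorProduct.assoc k (weight k n) Z.toDGModule C.toDGModule).symm
        (κ ⊗ₜ[k] Z.coact.toLin z))
    induction Z.coact.toLin z using TensorProduct.induction_on with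
    | zero => simp
    | add a b ha hb => simp only [map_add, smul_add, ha, hb, TensorProduct.tmul_add]
    | tmul a b =>
      change weightAug k n κ • ((ε n).toLin a ⊗ₜ[k] b) =
        (ε n).toLin (weightAug k n κ • a) ⊗ₜ[k] b
      rw [map_smul, TensorProduct.smul_tmul']

theorem coaugθ_tmul (n : ℕ) (κ : weight k n) (z : Z.toDGModule) :
    (coaugθ ε n).toLin (κ ⊗ₜ[k] z) = weightAug k n κ • (ε n).toLin z :=
  map_smul (ε n).toLin _ z

/-- The cone of a coaugmentation. -/
noncomputable def coaugCone
    (hδ : ∀ {n : ℕ} (i : Fin (n + 2)) z, (Φ.δ i).toLin ((ε n).toLin z) = (ε (n + 1)).toLin z)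
    (hσ : ∀ {n : ℕ} (i : Fin (n + 1)) z, (Φ.σ i).toLin ((ε (n + 1)).toLin z) = (ε n).toLin z) :
    HolimCone Φ where
  pt := Z
  θ := coaugθ ε
  θ_δ {n} i := by
    ext1
    refine TensorProduct.ext' fun κ z => ?_
    refine (coaugθ_tmul ε (n + 1) ((weightδ k i).toLin κ) z).trans ?_
    refine Eq.trans ?_ (congrArg (Φ.δ i).toLin (coaugθ_tmul ε n κ z)).symm
    have h : weightAug k (n + 1) ((weightδ k i).toLin κ) = weightAug k n κ := weightAug_map _ κ
    rw [map_smul, hδ, h]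
  θ_σ {n} i := by
    ext1
    refine TensorProduct.ext' fun κ z => ?_
    refine (coaugθ_tmul ε n ((weightσ k i).toLin κ) z).trans ?_
    refine Eq.trans ?_ (congrArg (Φ.σ i).toLin (coaugθ_tmul ε (n + 1) κ z)).symm
    have h : weightAug k n ((weightσ k i).toLin κ) = weightAug k (n + 1) κ := weightAug_map _ κ
    rw [map_smul, hσ, h]

variable [IsFiniteProductOfFields k]

/-- The coaugmentation of the normalized cochain complex. -/
noncomputable def normalCoaug (ε₀ : DGComodule.Hom Z (Φ.obj 0)) :
    DGComodule.Hom Z (Φ.normalObj 0) :=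
  Φ.normalLift ε₀ fun _ => trivial

theorem δ_normalCoaug (hΦ : Φ.IsConnective)
    (hδ : ∀ {n : ℕ} (i : Fin (n + 2)) z, (Φ.δ i).toLin ((ε n).toLin z) = (ε (n + 1)).toLin z)
    (z : Z.toDGModule) :
    ((Φ.normalized hΦ).δ 0).toLin ((normalCoaug (ε 0)).toLin z) = 0 := by
  refine Subtype.ext ?_
  change Φ.cosimplicial.alt 0 ((ε 0).toLin z) = 0
  rw [CosimplicialModule.alt_apply, Fin.sum_univ_two]
  change (-1 : k) ^ 0 • (Φ.δ 0).toLin ((ε 0).toLin z) +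
    (-1 : k) ^ 1 • (Φ.δ 1).toLin ((ε 0).toLin z) = 0
  rw [hδ, hδ]
  simp

/-- If the coaugmented total complex of a connective cosimplicial comodule is a
quasi-isomorphism, then so is the coaugmentation of the homotopy limit. -/
theorem IsHolim.isQuasiIso_of_coaug (hΦ : Φ.IsConnective)
    (hδ : ∀ {n : ℕ} (i : Fin (n + 2)) z, (Φ.δ i).toLin ((ε n).toLin z) = (ε (n + 1)).toLin z)
    (htot : ((Φ.normalized hΦ).totAug (normalCoaug (ε 0)) (δ_normalCoaug ε hΦ hδ)).IsQuasiIso)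
    {S : HolimCone Φ} (hS : S.IsHolim) (p : DGComodule.Hom Z S.pt)
    (hp : ∀ n κ z, (S.θ n).toLin (κ ⊗ₜ[k] p.toLin z) = weightAug k n κ • (ε n).toLin z) :
    p.IsQuasiIso := by
  obtain ⟨ι, hι⟩ := exists_fundamental k
  refine DGModule.Hom.IsQuasiIso.of_comp_of_reflects (g := (S.toTot hΦ hι).toHom)
    (fun s r hs hr => hS.toTot_reflects hι hΦ s r hs hr) ?_
  -- The composite is concentrated in column `0`: in positive degrees the augmentation kills `ι_q`,
  -- and on `ι_0` it is `1`. It is thus the coaugmentation of the total comodule, and `toTot` is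
  -- injective on homology.
  have h : (S.toTot hΦ hι).comp p =
      (Φ.normalized hΦ).totAug (normalCoaug (ε 0)) (δ_normalCoaug ε hΦ hδ) := by
    ext1
    refine LinearMap.ext fun z => (Φ.normalized hΦ).sum_ext fun q => Subtype.ext ?_
    refine (S.toTot_apply hΦ hι q (p.toLin z)).trans ?_
    rw [hp]
    change _ = (((Φ.normalized hΦ).incl 0 ((normalCoaug (ε 0)).toLin z)) q).1
    cases q with
    | zero =>
      have h1 : weightAug k 0 (ι 0) = 1 := by rw [weightAug_eq]; exact hι.aug
      rw [CochainComodule.incl_same, h1, one_smul]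
      rfl
    | succ q =>
      rw [(Φ.normalized hΦ).incl_ne (Nat.succ_ne_zero q).symm,
        weightAug_of_pos (q + 1) (hι.mem (q + 1)), zero_smul]
      rfl
  have := htot
  rw [← h] at this
  exact this

end coaugmentation

end HolimCone

/-! ### Connectivity of the cobar construction over a simply connected coalgebra. -/

namespace DGCoalgebra

open DGModule

variable {k : Type u} [CommRing k] (C : DGCoalgebra k)

theorem comul_eq_of_gr_zero {g : C.toDGModule} (hg : ∀ c ∈ C.gr 0, ∃ a : k, c = a • g)
    {c : C.toDGModule} (hc : c ∈ C.gr 0) :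
    ∃ a : k, Coalgebra.comul (R := k) c = a • (g ⊗ₜ[k] g) := by
  have h := C.comul_mem 0 c hc
  generalize Coalgebra.comul (R := k) c = w at h ⊢
  induction h using Submodule.span_induction with
  | zero => exact ⟨0, (zero_smul _ _).symm⟩
  | add x y _ _ hx hy =>
    obtain ⟨a, rfl⟩ := hx
    obtain ⟨b, rfl⟩ := hy
    exact ⟨a + b, (add_smul _ _ _).symm⟩
  | smul r x _ hx =>
    obtain ⟨a, rfl⟩ := hx
    exact ⟨r * a, (mul_smul _ _ _).symm⟩
  | mem x hx =>
    obtain ⟨i, j, hij, y, hy, z, hz, rfl⟩ := hx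
    obtain ⟨rfl, rfl⟩ : i = 0 ∧ j = 0 := by omega
    obtain ⟨a, rfl⟩ := hg y hy
    obtain ⟨b, rfl⟩ := hg z hz
    exact ⟨a * b, by rw [TensorProduct.smul_tmul_smul]⟩

/-- In a simply connected coalgebra, the counit identifies the degree zero part with `k`. -/
theorem exists_unit [h : C.IsSimplyConnected] :
    ∃ η : C.toDGModule, ∀ c, C.proj 0 c = Coalgebra.counit (R := k) c • η := by
  obtain ⟨e⟩ := h.gr_zero
  let g : C.toDGModule := (e.symm 1).1
  have hg0 : g ∈ C.gr 0 := (e.symm 1).2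
  have hg : ∀ c ∈ C.gr 0, ∃ a : k, c = a • g := by
    intro c hc
    refine ⟨e ⟨c, hc⟩, ?_⟩
    have : (⟨c, hc⟩ : C.gr 0) = e ⟨c, hc⟩ • e.symm 1 := by
      rw [← map_smul, smul_eq_mul, mul_one, e.symm_apply_apply]
    exact congrArg Subtype.val this
  obtain ⟨a, ha⟩ := C.comul_eq_of_gr_zero hg hg0
  -- The generator `g` of `C_0` need not have counit `1`. Since `Δ g = a (g ⊗ g)`, the counit axiom
  -- says that `a g` is the correctly scaled generator.
  have hε : (a * Coalgebra.counit (R := k) g) • g = g := by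
    have h₁ := Coalgebra.rTensor_counit_comul (R := k) g
    rw [ha, map_smul, LinearMap.rTensor_tmul] at h₁
    have h₂ := congrArg (TensorProduct.lid k C.toDGModule) h₁
    rw [map_smul, TensorProduct.lid_tmul, TensorProduct.lid_tmul, one_smul, smul_smul] at h₂
    exact h₂
  refine ⟨a • g, fun c => ?_⟩
  have key : C.proj 0 = (LinearMap.lsmul k C.toDGModule).flip (a • g) ∘ₗ
      Coalgebra.counit (R := k) := by
    refine C.lin_ext fun n c hc => ?_
    change C.proj 0 c = Coalgebra.counit (R := k) c • a • g
    cases n with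
    | zero =>
      rw [C.proj_self hc]
      obtain ⟨b, rfl⟩ := hg c hc
      rw [map_smul, smul_smul, smul_eq_mul, mul_assoc, mul_comm _ a, mul_smul, hε]
    | succ n => rw [C.proj_ne (Nat.succ_ne_zero n).symm hc, C.counit_mem n c hc, zero_smul]
  exact LinearMap.congr_fun key c

end DGCoalgebra

namespace DGComodule

open DGModule

variable {k : Type u} [CommRing k] {C : DGCoalgebra k} (X : DGComodule C)

/-- The projection of `X ⊗ C^{⊗ n}` onto the part where no factor `C` has degree `0`. -/
noncomputable def powReduce : ∀ n, X.pow n →ₗ[k] X.pow n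
  | 0 => LinearMap.id
  | n + 1 => TensorProduct.map (powReduce n) (LinearMap.id - C.proj 0)

/-- After the degree `0` parts are removed, each of the `n` factors `C` has degree at least `2`,
because `C_1 = 0`. -/
theorem powReduce_eq_zero [h : C.IsSimplyConnected] (n m : ℕ) (hm : m < 2 * n) (t : X.pow n)
    (ht : t ∈ (X.pow n).gr m) : X.powReduce n t = 0 := by
  induction n generalizing m with
  | zero => omega
  | succ n ih =>
    -- Vanishing in a range of degrees is phrased as membership in submodules that are `⊥` in that
    -- range and `⊤` outside, so that it can be checked on pure tensors.
    refine (Submodule.mem_bot k).1 (map_mem_of_tmul (X := X.pow n) (Y := C.toDGModule)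
      (fun i => if i < 2 * (n + 1) then (⊥ : Submodule k (X.pow (n + 1))) else ⊤)
      (X.powReduce (n + 1)) (fun i j x hx c hc => ?_) m t ht |> fun h => by rwa [if_pos hm] at h)
    split_ifs with hij
    · rw [Submodule.mem_bot]
      change X.powReduce n x ⊗ₜ[k] (c - C.proj 0 c) = 0
      rcases j with _ | _ | j
      · rw [C.proj_self hc, sub_self, TensorProduct.tmul_zero]
      · rw [h.gr_one, Submodule.mem_bot] at hc
        rw [hc, map_zero, sub_zero, TensorProduct.tmul_zero]
      · rw [ih i (by omega) x hx, TensorProduct.zero_tmul]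
    · trivial

/-- The projection onto `C_0` factors through the counit, so an element killed by the counit of a
factor has no part of degree `0` there. The extra factor `M` carries the factors to the right. -/
theorem reduce_last [C.IsSimplyConnected] {P M : Type u} [AddCommGroup P] [Module k P]
    [AddCommGroup M] [Module k M] (t : (P ⊗[k] C.toDGModule) ⊗[k] M)
    (h : TensorProduct.map ((TensorProduct.rid k P).toLinearMap ∘ₗ
      TensorProduct.map LinearMap.id (Coalgebra.counit (R := k))) LinearMap.id t = (0 : P ⊗[k] M)) :
    TensorProduct.map (TensorProduct.map LinearMap.id (LinearMap.id - C.proj 0))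
      LinearMap.id t = t := by
  obtain ⟨η, hη⟩ := C.exists_unit
  have key : TensorProduct.map (TensorProduct.map LinearMap.id (LinearMap.id - C.proj 0))
      LinearMap.id t = t - TensorProduct.map ((TensorProduct.mk k P C.toDGModule).flip η)
        LinearMap.id (TensorProduct.map ((TensorProduct.rid k P).toLinearMap ∘ₗ
          TensorProduct.map LinearMap.id (Coalgebra.counit (R := k))) LinearMap.id t) := by
    clear h
    induction t using TensorProduct.induction_on with
    | zero => simp
    | add a b ha hb => simp only [map_add, ha, hb]; abel
    | tmul u m =>
      induction u using TensorProduct.induction_on with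
      | zero => simp
      | add a b ha hb => simp only [map_add, TensorProduct.add_tmul, ha, hb]; abel
      | tmul p c =>
        simp only [TensorProduct.map_tmul, LinearMap.id_apply, LinearMap.sub_apply,
          LinearMap.comp_apply, LinearEquiv.coe_coe, TensorProduct.rid_tmul, LinearMap.flip_apply,
          TensorProduct.mk_apply, hη]
        rw [TensorProduct.tmul_sub, TensorProduct.sub_tmul, TensorProduct.tmul_smul,
          TensorProduct.smul_tmul' _ p η]
  rw [key, h, map_zero, sub_zero]

theorem map_map_assoc {P P' Q M : Type u} [AddCommGroup P] [Module k P] [AddCommGroup P']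
    [Module k P'] [AddCommGroup Q] [Module k Q] [AddCommGroup M] [Module k M] (f : P →ₗ[k] P')
    (t : (P ⊗[k] Q) ⊗[k] M) :
    TensorProduct.map f LinearMap.id (TensorProduct.assoc k P Q M t) =
      TensorProduct.assoc k P' Q M
        (TensorProduct.map (TensorProduct.map f LinearMap.id) LinearMap.id t) := by
  induction t using TensorProduct.induction_on with
  | zero => simp
  | add a b ha hb => simp only [map_add, ha, hb]
  | tmul u m =>
    induction u using TensorProduct.induction_on with
    | zero => simp
    | add a b ha hb => simp only [map_add, TensorProduct.add_tmul, ha, hb]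
    | tmul p c => rfl

/-- Induction over the factors `C` from the right: a factor already treated is absorbed into `M`,
which is why `M` is arbitrary. -/
theorem powReduce_of_codegeneracy [C.IsSimplyConnected] (n : ℕ) {M : Type u} [AddCommGroup M]
    [Module k M] (t : X.pow (n + 1) ⊗[k] M)
    (h : ∀ j ≤ n, TensorProduct.map (X.codegeneracy n j).toLin LinearMap.id t = 0) :
    TensorProduct.map (X.powReduce (n + 1)) LinearMap.id t = t := by
  induction n generalizing M with
  | zero => exact reduce_last (P := X.toDGModule) t (h 0 le_rfl)
  | succ n ih =>
    let s : (X.pow (n + 1) ⊗[k] C.toDGModule) ⊗[k] M := t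
    have h₁ : TensorProduct.map (TensorProduct.map LinearMap.id (LinearMap.id - C.proj 0))
        LinearMap.id s = s := by
      refine reduce_last (P := X.pow (n + 1)) s ?_
      have := h (n + 1) le_rfl
      rw [X.codegeneracy_self] at this
      exact this
    have h₂ : TensorProduct.map (TensorProduct.map (X.powReduce (n + 1)) LinearMap.id)
        LinearMap.id s = s := by
      have h' := ih (M := C.toDGModule ⊗[k] M) (TensorProduct.assoc k _ _ _ s) fun j hj => by
        rw [map_map_assoc]
        have := h j (by omega)
        rw [X.codegeneracy_succ_of_le hj] at this
        refine (congrArg _ ?_).trans (map_zero _)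
        exact this
      rw [map_map_assoc] at h'
      exact (TensorProduct.assoc k _ _ _).injective h'
    change TensorProduct.map (TensorProduct.map (X.powReduce (n + 1)) (LinearMap.id - C.proj 0))
      LinearMap.id s = s
    conv_rhs => rw [← h₂, ← h₁]
    rw [← LinearMap.comp_apply, ← TensorProduct.map_comp, ← TensorProduct.map_comp]
    rfl

theorem eq_zero_of_codegeneracy [C.IsSimplyConnected] (n m : ℕ) (hm : m < 2 * (n + 1))
    {M : DGModule k} (t : X.pow (n + 1) ⊗[k] M) (ht : t ∈ (tensor (X.pow (n + 1)) M).gr m)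
    (h : ∀ j ≤ n, TensorProduct.map (X.codegeneracy n j).toLin LinearMap.id t = 0) : t = 0 := by
  rw [← X.powReduce_of_codegeneracy n t h]
  have h' := map_mem_of_tmul (X := X.pow (n + 1)) (Y := M)
    (fun i => if i < 2 * (n + 1) then (⊥ : Submodule k (X.pow (n + 1) ⊗[k] M)) else ⊤)
    (TensorProduct.map (X.powReduce (n + 1)) LinearMap.id) (fun i j x hx y hy => by
      split_ifs with hij
      · rw [Submodule.mem_bot, TensorProduct.map_tmul,
          X.powReduce_eq_zero (n + 1) i (by omega) x hx, TensorProduct.zero_tmul]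
      · trivial) m t ht
  rwa [if_pos hm] at h'

theorem cobar_isConnective [C.IsSimplyConnected] : X.cobar.IsConnective := by
  rintro (_ | q) m hm x hx hn
  · omega
  · refine X.eq_zero_of_codegeneracy q m hm (M := C.toDGModule) x hx fun j hj => ?_
    have h : (X.codegeneracy (q + 1) j).toLin x = 0 :=
      (CosimplicialModule.mem_normal_succ _).1 hn ⟨j, by omega⟩
    rw [X.codegeneracy_succ_of_le hj] at h
    exact h

theorem cobar_cotensor_isConnective [C.IsSimplyConnected] [C.IsCocommutative]
    [IsFiniteProductOfFields k] (Y : DGComodule C) : (X.cobar.cotensor Y).IsConnective := by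
  rintro (_ | q) m hm x hx hn
  · omega
  · have hx' : x.1 ∈ (tensor (tensor (X.pow (q + 1)) C.toDGModule) Y.toDGModule).gr m := hx
    refine Subtype.ext ((TensorProduct.assoc k (X.pow (q + 1)) C.toDGModule
      Y.toDGModule).injective ?_)
    refine (X.eq_zero_of_codegeneracy q m hm (M := tensor C.toDGModule Y.toDGModule) _
      ((assocHom _ _ _).map_mem m _ hx') fun j hj => ?_).trans (map_zero _).symm
    have h : TensorProduct.map (X.codegeneracy (q + 1) j).toLin LinearMap.id x.1 = 0 :=
      congrArg Subtype.val ((CosimplicialModule.mem_normal_succ _).1 hn ⟨j, by omega⟩)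
    rw [X.codegeneracy_succ_of_le hj] at h
    refine (map_map_assoc (X.codegeneracy q j).toLin _).trans ?_
    exact (congrArg _ h).trans (map_zero _)

end DGComodule

/-! ### Resolutions and their cotensor products with coflat comodules. -/

namespace CosimplicialComodule

open DGModule DGComodule

variable {k : Type u} [CommRing k] {C : DGCoalgebra k} (Φ : CosimplicialComodule C)

/-- The coaugmented normalized cochain complex is exact. -/
structure IsResolution {Z : DGComodule C} (ε : DGComodule.Hom Z (Φ.obj 0)) : Prop where
  injective : Function.Injective ε.toLin
  alt_coaug : ∀ z, Φ.cosimplicial.alt 0 (ε.toLin z) = 0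
  exact_zero : ∀ x, Φ.cosimplicial.alt 0 x = 0 → ∃ z, ε.toLin z = x
  exact_succ : ∀ q, ∀ x ∈ Φ.cosimplicial.normal (q + 1), Φ.cosimplicial.alt (q + 1) x = 0 →
    ∃ y ∈ Φ.cosimplicial.normal q, Φ.cosimplicial.alt q y = x

variable {Φ} [IsFiniteProductOfFields k]

theorem IsResolution.totAug_isQuasiIso {Z : DGComodule C} {ε : DGComodule.Hom Z (Φ.obj 0)}
    (h : Φ.IsResolution ε) (hΦ : Φ.IsConnective) (hε) :
    ((Φ.normalized hΦ).totAug (HolimCone.normalCoaug ε) hε).IsQuasiIso := by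
  refine (Φ.normalized hΦ).totAug_isQuasiIso _ _ (fun x y hxy => ?_) (fun x hx => ?_)
    fun q x hx => ?_
  · exact h.injective (congrArg Subtype.val hxy)
  · obtain ⟨z, hz⟩ := h.exact_zero x.1 (congrArg Subtype.val hx)
    exact ⟨z, Subtype.ext hz⟩
  · obtain ⟨y, hy, hyx⟩ := h.exact_succ q x.1 (Φ.val_mem_normal x) (congrArg Subtype.val hx)
    exact ⟨Φ.normalMk y hy, Subtype.ext hyx⟩

section cotensor

variable [C.IsCocommutative] (Y : DGComodule C)

theorem cotensor_alt_val {q : ℕ} (z : ((Φ.cotensor Y).obj q).toDGModule) :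
    ((Φ.cotensor Y).cosimplicial.alt q z).1 =
      TensorProduct.map (Φ.cosimplicial.alt q) LinearMap.id z.1 := by
  refine (congrArg Subtype.val (CosimplicialModule.alt_apply
    (Φ.cotensor Y).cosimplicial (q := q) z)).trans ?_
  have h : TensorProduct.map (Φ.cosimplicial.alt q) LinearMap.id =
      ∑ i : Fin (q + 2), (-1 : k) ^ (i : ℕ) •
        TensorProduct.map (Φ.δ i).toLin (LinearMap.id (M := Y.toDGModule)) := by
    refine (map_sum (LinearMap.rTensorHom Y.toDGModule) _ _).trans
      (Finset.sum_congr rfl fun i _ => ?_)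
    exact map_smul (LinearMap.rTensorHom Y.toDGModule) _ _
  rw [h, LinearMap.sum_apply]
  exact map_sum (cotensorIncl (Φ.obj (q + 1)) Y).toLin _ _

theorem cotensor_normalize_val {q : ℕ} (z : ((Φ.cotensor Y).obj q).toDGModule) :
    ((Φ.cotensor Y).cosimplicial.normalize q z).1 =
      TensorProduct.map (Φ.cosimplicial.normalize q) LinearMap.id z.1 := by
  cases q with
  | zero => exact (LinearMap.congr_fun TensorProduct.map_id z.1).symm
  | succ q =>
    have h : ∀ m ≤ q + 1, ((Φ.cotensor Y).cosimplicial.normalizeAux q m z).1 =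
        TensorProduct.map (Φ.cosimplicial.normalizeAux q m) LinearMap.id z.1 := by
      intro m
      induction m with
      | zero => intro _; exact (LinearMap.congr_fun TensorProduct.map_id z.1).symm
      | succ m ih =>
        intro hm
        rw [CosimplicialModule.normalizeAux_succ _ hm]
        have e : Φ.cosimplicial.normalizeAux q (m + 1) = Φ.cosimplicial.normalizeAux q m -
            ((Φ.δ (Fin.succ ⟨m, hm⟩)).toLin ∘ₗ (Φ.σ ⟨m, hm⟩).toLin) ∘ₗ
              Φ.cosimplicial.normalizeAux q m :=
          LinearMap.ext fun x => CosimplicialModule.normalizeAux_succ _ hm x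
        have e' : TensorProduct.map (Φ.cosimplicial.normalizeAux q (m + 1))
            (LinearMap.id (M := Y.toDGModule)) =
            TensorProduct.map (Φ.cosimplicial.normalizeAux q m) LinearMap.id -
            (TensorProduct.map (Φ.δ (Fin.succ ⟨m, hm⟩)).toLin LinearMap.id ∘ₗ
              TensorProduct.map (Φ.σ ⟨m, hm⟩).toLin LinearMap.id) ∘ₗ
              TensorProduct.map (Φ.cosimplicial.normalizeAux q m) LinearMap.id := by
          rw [e]
          refine (LinearMap.rTensor_sub _ _).trans ?_
          refine congrArg (_ - ·) ?_
          exact (LinearMap.rTensor_comp _ _ _).trans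
            (congrArg (· ∘ₗ _) (LinearMap.rTensor_comp _ _ _))
        rw [e', LinearMap.sub_apply, LinearMap.comp_apply, LinearMap.comp_apply, ← ih (by omega)]
        rfl
    exact h _ le_rfl

/-- Normalization is a natural projection made of cofaces and codegeneracies, so it commutes with `-
□_C Y`: normalized cochains of `Φ □_C Y` are the cotensor product of those of `Φ` with `Y`. The
reverse inclusion is `cotensor_normal_mem`. -/
theorem cotensor_normal_exists {q : ℕ} {z : ((Φ.cotensor Y).obj q).toDGModule}
    (hz : z ∈ (Φ.cotensor Y).cosimplicial.normal q) :
    ∃ w : (DGComodule.cotensor (Φ.normalObj q) Y).toDGModule,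
      (cotensorMap (Φ.normalIncl q) (DGComodule.Hom.id Y)).toLin w = z := by
  refine ⟨(cotensorMap (Φ.normalProj q) (DGComodule.Hom.id Y)).toLin z, Subtype.ext ?_⟩
  conv_rhs => rw [← CosimplicialModule.normalize_of_mem _ hz, cotensor_normalize_val]
  exact (LinearMap.congr_fun (TensorProduct.map_comp (Φ.normalIncl q).toLin LinearMap.id
    (Φ.normalProj q).toLin LinearMap.id) z.1).symm

theorem cotensor_normal_mem {q : ℕ}
    (w : (DGComodule.cotensor (Φ.normalObj q) Y).toDGModule) :
    ((cotensorMap (Φ.normalIncl q) (DGComodule.Hom.id Y)).toLin w :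
      ((Φ.cotensor Y).obj q).toDGModule) ∈ (Φ.cotensor Y).cosimplicial.normal q := by
  have h : (Φ.cotensor Y).cosimplicial.normalize q
      ((cotensorMap (Φ.normalIncl q) (DGComodule.Hom.id Y)).toLin w) =
      (cotensorMap (Φ.normalIncl q) (DGComodule.Hom.id Y)).toLin w := by
    refine Subtype.ext ((cotensor_normalize_val Y _).trans ?_)
    have e : Φ.cosimplicial.normalize q ∘ₗ (Φ.normalIncl q).toLin = (Φ.normalIncl q).toLin :=
      LinearMap.ext fun x => Φ.cosimplicial.normalize_of_mem (Φ.val_mem_normal x)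
    refine (LinearMap.congr_fun (TensorProduct.map_comp (Φ.cosimplicial.normalize q) LinearMap.id
      (Φ.normalIncl q).toLin LinearMap.id) w.1).symm.trans ?_
    rw [e]
    rfl
  rw [← h]
  exact CosimplicialModule.normalize_mem _ _

/-- Factor `f` as a surjection onto the kernel of `g` followed by the inclusion. Coflatness
preserves the surjection, and left exactness handles the kernel. -/
theorem cotensor_exact_of_exact {Y : DGComodule C} (hY : Y.IsCoflat) {A B D : DGComodule C}
    (f : DGComodule.Hom A B) (g : DGComodule.Hom B D) (hfg : ∀ a, g.toLin (f.toLin a) = 0)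
    (hex : ∀ b, g.toLin b = 0 → ∃ a, f.toLin a = b)
    (z : (DGComodule.cotensor B Y).toDGModule)
    (hz : (cotensorMap g (DGComodule.Hom.id Y)).toLin z = 0) :
    ∃ w, (cotensorMap f (DGComodule.Hom.id Y)).toLin w = z := by
  obtain ⟨v, rfl⟩ := exists_of_cotensorMap_left_eq_zero g z hz
  obtain ⟨w, rfl⟩ := hY.cotensorMap_surjective (kerDesc g f hfg) (fun b => by
    obtain ⟨a, ha⟩ := hex b.1 b.2
    exact ⟨a, Subtype.ext ha⟩) v
  refine ⟨w, ?_⟩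
  exact (DGModule.Hom.congr_toLin (congrArg DGComodule.Hom.toHom
    (cotensorMap_comp (kerDesc g f hfg) (kerIncl g) (DGComodule.Hom.id Y)
      (DGComodule.Hom.id Y))) w).symm

/-- The exact sequence of normalized cochains consists of comodule maps, so coflatness applies to
each of its spots, after normalized cochains of `Φ □_C Y` have been identified with `N^q □_C Y`. -/
theorem IsResolution.cotensor {Y : DGComodule C} (hY : Y.IsCoflat) {Z : DGComodule C}
    {ε : DGComodule.Hom Z (Φ.obj 0)} (h : Φ.IsResolution ε) (hΦ : Φ.IsConnective) :
    (Φ.cotensor Y).IsResolution (cotensorMap ε (DGComodule.Hom.id Y)) := by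
  have hδ : ∀ q (w : (DGComodule.cotensor (Φ.normalObj q) Y).toDGModule),
      (Φ.cotensor Y).cosimplicial.alt q
        ((cotensorMap (Φ.normalIncl q) (DGComodule.Hom.id Y)).toLin w) =
      (cotensorMap (Φ.normalIncl (q + 1)) (DGComodule.Hom.id Y)).toLin
        ((cotensorMap ((Φ.normalized hΦ).δ q) (DGComodule.Hom.id Y)).toLin w) := by
    intro q w
    refine Subtype.ext ((cotensor_alt_val Y _).trans ?_)
    refine (LinearMap.congr_fun (TensorProduct.map_comp (Φ.cosimplicial.alt q) LinearMap.id
      (Φ.normalIncl q).toLin LinearMap.id) w.1).symm.trans ?_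
    exact LinearMap.congr_fun (TensorProduct.map_comp (Φ.normalIncl (q + 1)).toLin LinearMap.id
      ((Φ.normalized hΦ).δ q).toLin LinearMap.id) w.1
  have hinj : ∀ q, Function.Injective
      (cotensorMap (Φ.normalIncl q) (DGComodule.Hom.id Y)).toLin := fun q =>
    cotensorMap_injective _ _ (kerι_injective _) Function.injective_id
  refine ⟨cotensorMap_injective _ _ h.injective Function.injective_id, fun z => ?_, fun x hx => ?_,
    fun q x hx hx' => ?_⟩
  · refine Subtype.ext ((cotensor_alt_val Y _).trans ?_)
    have e : Φ.cosimplicial.alt 0 ∘ₗ ε.toLin = 0 := LinearMap.ext h.alt_coaug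
    refine (LinearMap.congr_fun (TensorProduct.map_comp (Φ.cosimplicial.alt 0) LinearMap.id
      ε.toLin LinearMap.id) z.1).symm.trans ?_
    rw [e, TensorProduct.map_zero_left]
    rfl
  · refine cotensor_exact_of_exact hY ε (Φ.altHom 0) h.alt_coaug h.exact_zero x (Subtype.ext ?_)
    exact (cotensor_alt_val Y x).symm.trans (congrArg Subtype.val hx)
  · obtain ⟨w, rfl⟩ := cotensor_normal_exists Y hx
    rw [hδ] at hx'
    obtain ⟨v, rfl⟩ := cotensor_exact_of_exact hY ((Φ.normalized hΦ).δ q)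
      ((Φ.normalized hΦ).δ (q + 1)) ((Φ.normalized hΦ).δ_δ q) (fun b hb => by
        obtain ⟨y, hy, hyb⟩ := h.exact_succ q b.1 (Φ.val_mem_normal b) (congrArg Subtype.val hb)
        exact ⟨Φ.normalMk y hy, Subtype.ext hyb⟩) w (hinj _ (hx'.trans (map_zero _).symm))
    exact ⟨_, cotensor_normal_mem Y v, hδ q v⟩

end cotensor

end CosimplicialComodule

/-! ### The cobar construction is a resolution. -/

namespace DGComodule

open DGModule

variable {k : Type u} [CommRing k] {C : DGCoalgebra k} (X : DGComodule C)

/-- The extra codegeneracy of the cobar construction, the counit of the last factor. -/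
noncomputable def lastCounit (n : ℕ) : X.pow (n + 1) →ₗ[k] X.pow n := (X.codegeneracy n n).toLin

theorem lastCounit_coface_of_le {n i : ℕ} (hi : i ≤ n) (x : X.pow (n + 1)) :
    X.lastCounit (n + 1) ((X.coface (n + 1) i).toLin x) = (X.coface n i).toLin (X.lastCounit n x) :=
  DGModule.Hom.congr_toLin (X.codegeneracy_coface_of_le hi le_rfl) x

theorem lastCounit_coface_self (n : ℕ) (x : X.pow n) :
    X.lastCounit n ((X.coface n n).toLin x) = x :=
  DGModule.Hom.congr_toLin (X.codegeneracy_coface_self le_rfl) x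

theorem cobar_alt_apply {q : ℕ} (x : X.pow (q + 1)) : X.cobar.cosimplicial.alt q x =
    ∑ i : Fin (q + 2), (-1 : k) ^ (i : ℕ) • (X.coface (q + 1) i).toLin x :=
  CosimplicialModule.alt_apply X.cobar.cosimplicial (q := q) x

/-- The counit of the last factor commutes with all cofaces but the last and undoes the last one. Up
to sign this is a contraction of the cochain complex; it need not be a map of comodules. -/
theorem lastCounit_alt {q : ℕ} (x : X.pow (q + 1)) :
    X.lastCounit (q + 1) (X.cobar.cosimplicial.alt q x) =
      ∑ i : Fin (q + 1), (-1 : k) ^ (i : ℕ) • (X.coface q i).toLin (X.lastCounit q x) +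
        (-1 : k) ^ (q + 1) • x := by
  rw [cobar_alt_apply, map_sum, Fin.sum_univ_castSucc]
  congr 1
  · refine Finset.sum_congr rfl fun i _ => ?_
    rw [map_smul]
    exact congrArg _ (X.lastCounit_coface_of_le (Nat.lt_succ_iff.1 i.isLt) x)
  · rw [map_smul]
    exact congrArg _ (X.lastCounit_coface_self (q + 1) x)

/-- On a cocycle the extra codegeneracy exhibits `x`, up to sign, as the coboundary of its image. It
commutes with the other codegeneracies, so primitives of normalized cocycles are normalized. -/
theorem cobar_isResolution : X.cobar.IsResolution X.cobarCoaugZero where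
  injective := X.coact_injective
  alt_coaug z := by
    refine (X.cobar_alt_apply (q := 0) _).trans ?_
    rw [Fin.sum_univ_two]
    have h : (X.coface 1 1).toLin (X.coact.toLin z) = (X.coface 1 0).toLin (X.coact.toLin z) :=
      DGModule.Hom.congr_toLin (X.coface_coface (n := 0) (i := 0) (j := 0) le_rfl le_rfl) z
    change (-1 : k) ^ 0 • (X.coface 1 0).toLin (X.coact.toLin z) +
      (-1 : k) ^ 1 • (X.coface 1 1).toLin (X.coact.toLin z) = 0
    rw [h]
    simp
  exact_zero x hx := by
    have h := (X.lastCounit_alt (q := 0) x).symm.trans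
      ((congrArg (X.lastCounit (0 + 1)) hx).trans (map_zero _))
    rw [Fin.sum_univ_one] at h
    refine ⟨X.lastCounit 0 x, ?_⟩
    have h' : (-1 : k) ^ 0 • X.coact.toLin (X.lastCounit 0 x) +
      (-1 : k) ^ 1 • (show X.toDGModule ⊗[k] C.toDGModule from x) = 0 := h
    rw [pow_zero, one_smul, pow_one, neg_one_smul] at h'
    exact add_neg_eq_zero.1 h'
  exact_succ q x hx hx' := by
    have h := (X.lastCounit_alt (q := q + 1) x).symm.trans
      ((congrArg (X.lastCounit (q + 1 + 1)) hx').trans (map_zero _))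
    have h' : X.cobar.cosimplicial.alt q (X.lastCounit (q + 1) x) + (-1 : k) ^ (q + 2) • x = 0 :=
      (congrArg (· + _) (X.cobar_alt_apply _)).trans h
    -- For a cocycle, `lastCounit_alt` says that `x` with the sign `(-1)^(q+2)` is minus the
    -- coboundary of its image, hence the sign `(-1)^(q+1)` here.
    refine ⟨(-1 : k) ^ (q + 1) • (X.lastCounit (q + 1) x : X.pow (q + 1)),
      Submodule.smul_mem _ _ ?_, ?_⟩
    · cases q with
      | zero => trivial
      | succ q =>
        refine (CosimplicialModule.mem_normal_succ _).2 fun j => ?_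
        have e : (X.codegeneracy (q + 1) j).toLin (X.lastCounit (q + 2) x) =
            X.lastCounit (q + 1) ((X.codegeneracy (q + 2) j).toLin x) :=
          (DGModule.Hom.congr_toLin (X.codegeneracy_codegeneracy (n := q + 1) (i := j)
            (j := q + 1) (by omega) le_rfl) x).symm
        have e' : (X.codegeneracy (q + 2) j).toLin x = 0 :=
          (CosimplicialModule.mem_normal_succ _).1 hx j.castSucc
        exact e.trans ((congrArg _ e').trans (map_zero _))
    · refine (map_smul (X.cobar.cosimplicial.alt q) _ _).trans ?_
      have e : X.cobar.cosimplicial.alt q (X.lastCounit (q + 1) x) = -((-1 : k) ^ (q + 2) • x) :=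
        eq_neg_of_add_eq_zero_left h'
      refine (congrArg _ e).trans ?_
      rw [pow_succ _ (q + 1), mul_neg_one, neg_smul, neg_neg, smul_smul, ← mul_pow]
      simp

theorem δ_cobarCoaug {n : ℕ} (i : Fin (n + 2)) (z : X.toDGModule) :
    (X.cobar.δ i).toLin ((X.cobarCoaug n).toLin z) = (X.cobarCoaug (n + 1)).toLin z := by
  induction n with
  | zero =>
    have h : (X.coface 1 1).toLin (X.coact.toLin z) = (X.coface 1 0).toLin (X.coact.toLin z) :=
      DGModule.Hom.congr_toLin (X.coface_coface (n := 0) (i := 0) (j := 0) le_rfl le_rfl) z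
    rcases i with ⟨_ | _ | i, hi⟩
    · rfl
    · exact h
    · omega
  | succ n ih =>
    induction i using Fin.cases with
    | zero => rfl
    | succ i =>
      refine (X.cobar.cosimplicial.δ_δ (i := 0) (j := i) (Fin.zero_le _) _).trans ?_
      exact congrArg (X.cobar.δ (0 : Fin (n + 1 + 2))).toLin (ih i)

theorem σ_cobarCoaug {n : ℕ} (i : Fin (n + 1)) (z : X.toDGModule) :
    (X.cobar.σ i).toLin ((X.cobarCoaug (n + 1)).toLin z) = (X.cobarCoaug n).toLin z := by
  rw [← X.δ_cobarCoaug i.castSucc]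
  exact X.cobar.cosimplicial.σ_δ_self _

end DGComodule

/-! ### Relatively injective comodules. -/

namespace DGComodule

open DGModule

variable {k : Type u} [CommRing k] {C : DGCoalgebra k}

/-- `Y` is relatively injective: the coaction `Y ⟶ Y ⊗ C` has a retraction of graded comodules
(which need not commute with the differentials). -/
def IsRelInjective (Y : DGComodule C) : Prop :=
  ∃ e : Y.toDGModule ⊗[k] C.toDGModule →ₗ[k] Y.toDGModule,
    (∀ n, ∀ t ∈ (tensor Y.toDGModule C.toDGModule).gr n, e t ∈ Y.gr n) ∧
    (∀ t, Y.coact.toLin (e t) =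
      TensorProduct.map e LinearMap.id ((C.idComul Y.toDGModule).toLin t)) ∧
    ∀ y, e (Y.coact.toLin y) = y

theorem idComul_map {M N : Type u} [AddCommGroup M] [Module k M] [AddCommGroup N] [Module k N]
    (φ : M →ₗ[k] N) (t : M ⊗[k] (C.toDGModule ⊗[k] C.toDGModule)) :
    (TensorProduct.assoc k N C.toDGModule C.toDGModule).symm
        (TensorProduct.map φ LinearMap.id t) =
      TensorProduct.map (TensorProduct.map φ LinearMap.id) LinearMap.id
        ((TensorProduct.assoc k M C.toDGModule C.toDGModule).symm t) := by
  have h : (TensorProduct.assoc k N C.toDGModule C.toDGModule).symm.toLinearMap ∘ₗ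
      TensorProduct.map φ LinearMap.id =
      TensorProduct.map (TensorProduct.map φ LinearMap.id) LinearMap.id ∘ₗ
        (TensorProduct.assoc k M C.toDGModule C.toDGModule).symm.toLinearMap :=
    TensorProduct.ext_threefold' fun _ _ _ => rfl
  exact LinearMap.congr_fun h t

/-- `id ⊗ Δ` is natural with respect to all linear maps. -/
theorem idComul_map_apply {M N : DGModule k} (φ : M →ₗ[k] N) (t : M ⊗[k] C.toDGModule) :
    (C.idComul N).toLin (TensorProduct.map φ LinearMap.id t) =
      TensorProduct.map (TensorProduct.map φ LinearMap.id) LinearMap.id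
        ((C.idComul M).toLin t) := by
  refine Eq.trans ?_ (idComul_map φ (TensorProduct.map LinearMap.id C.comulHom.toLin t))
  refine congrArg (TensorProduct.assoc k N C.toDGModule C.toDGModule).symm ?_
  change TensorProduct.map LinearMap.id C.comulHom.toLin (TensorProduct.map φ LinearMap.id t) = _
  rw [← LinearMap.comp_apply, ← LinearMap.comp_apply, ← TensorProduct.map_comp,
    ← TensorProduct.map_comp]
  rfl

/-- The retraction applies the counit to the inner factor of `(V ⊗ C) ⊗ C`. -/
theorem cofree_isRelInjective (V : DGModule k) : (tensorLeft V (regular C)).IsRelInjective := by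
  refine ⟨(tensorHom (C.idCounit V) (DGModule.Hom.id C.toDGModule)).toLin,
    (tensorHom (C.idCounit V) (DGModule.Hom.id C.toDGModule)).map_mem, fun t => ?_, fun y => ?_⟩
  · exact DGModule.Hom.congr_toLin (DGCoalgebra.idComul_naturality (C := C) (C.idCounit V)) t
  · exact DGModule.Hom.congr_toLin (DGCoalgebra.idCounit_tensor_idComul (C := C) V) y

theorem IsRelInjective.of_retract {X Y : DGComodule C} (hY : Y.IsRelInjective) (i : Hom X Y)
    (r : Hom Y X) (hri : ∀ x, r.toLin (i.toLin x) = x) : X.IsRelInjective := by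
  obtain ⟨e, he, hcol, hret⟩ := hY
  refine ⟨r.toLin ∘ₗ e ∘ₗ TensorProduct.map i.toLin LinearMap.id, fun n t ht => ?_, fun t => ?_,
    fun x => ?_⟩
  · exact r.map_mem n _ (he n _
      ((tensorHom i.toHom (DGModule.Hom.id C.toDGModule)).map_mem n t ht))
  · rw [LinearMap.comp_apply, LinearMap.comp_apply, r.coact_apply, hcol, idComul_map_apply,
      ← LinearMap.comp_apply, ← LinearMap.comp_apply, ← TensorProduct.map_comp,
      ← TensorProduct.map_comp]
    rfl
  · rw [LinearMap.comp_apply, LinearMap.comp_apply, ← i.coact_apply, hret, hri]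

end DGComodule

namespace CochainComodule

open DGModule DGComodule

variable {k : Type u} [CommRing k] {C : DGCoalgebra k} (N : CochainComodule C)

/-- Only graded retractions are demanded, so those of the columns can be added up regardless of the
total differential. -/
theorem tot_isRelInjective (h : ∀ q, (N.obj q).IsRelInjective) : N.tot.IsRelInjective := by
  choose e he hcol hret using h
  let E : N.Sum ⊗[k] C.toDGModule →ₗ[k] N.Sum := TensorProduct.lift
    (DirectSum.toModule k ℕ _ fun q => TensorProduct.curry (N.incl q ∘ₗ e q))
  have hE : ∀ q t, E (N.inclC q C.toDGModule t) = N.incl q (e q t) := by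
    intro q t
    induction t using TensorProduct.induction_on with
    | zero => simp
    | add a b ha hb => simp only [map_add, ha, hb]
    | tmul x c =>
      change DirectSum.toModule k ℕ (C.toDGModule →ₗ[k] N.Sum)
        (fun q => TensorProduct.curry (N.incl q ∘ₗ e q)) (N.incl q x) c = _
      rw [DirectSum.toModule_lof]
      rfl
  refine ⟨E, map_mem_of_tmul (X := N.totModule) N.totGr E fun i j x hx c hc => ?_, fun t => ?_,
    fun y => ?_⟩
  · have : x ∈ (N.totGr (i + j)).comap (E ∘ₗ (TensorProduct.mk k N.Sum C.toDGModule).flip c) := by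
      refine N.mem_of_incl _ x fun q => ?_
      change E (N.inclC q C.toDGModule (x q ⊗ₜ[k] c)) ∈ N.totGr (i + j)
      rw [hE]
      exact N.incl_mem (m := i + q + j) (by omega) (he q _ _ (tmul_mem rfl (hx q) hc))
    exact this
  · have key : N.totCoactLin ∘ₗ E = TensorProduct.map E LinearMap.id ∘ₗ
        (C.idComul N.totModule).toLin := by
      refine TensorProduct.ext (DirectSum.linearMap_ext k fun q => LinearMap.ext fun x =>
        LinearMap.ext fun c => ?_)
      change N.totCoactLin (E (N.inclC q C.toDGModule (x ⊗ₜ[k] c))) =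
        TensorProduct.map E LinearMap.id
          ((C.idComul N.totModule).toLin (N.inclC q C.toDGModule (x ⊗ₜ[k] c)))
      rw [hE, totCoactLin_incl, hcol, idComul_inclC]
      refine (LinearMap.congr_fun (TensorProduct.map_comp (N.incl q) LinearMap.id (e q)
        LinearMap.id) _).symm.trans (Eq.trans ?_ (LinearMap.congr_fun
          (TensorProduct.map_comp E LinearMap.id (N.inclC q C.toDGModule) LinearMap.id) _))
      rw [show E ∘ₗ N.inclC q C.toDGModule = N.incl q ∘ₗ e q from LinearMap.ext (hE q)]
    exact LinearMap.congr_fun key t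
  · have key : E ∘ₗ N.totCoactLin = LinearMap.id := by
      refine N.lin_ext fun q x => ?_
      rw [LinearMap.comp_apply, totCoactLin_incl, hE, hret]
      rfl
    exact LinearMap.congr_fun key y

end CochainComodule

namespace CosimplicialComodule

open DGModule DGComodule

variable {k : Type u} [CommRing k] [IsFiniteProductOfFields k] {C : DGCoalgebra k}
  {Φ : CosimplicialComodule C}

theorem tot_normalized_isRelInjective (hΦ : Φ.IsConnective) (h : ∀ q, (Φ.obj q).IsRelInjective) :
    (Φ.normalized hΦ).tot.IsRelInjective :=
  (Φ.normalized hΦ).tot_isRelInjective fun q =>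
    (h q).of_retract (Φ.normalIncl q) (Φ.normalProj q) fun x => Φ.normalProj_val x

end CosimplicialComodule

/-! ### Relatively injective comodules are fibrant. -/

namespace DGComodule

open DGModule

variable {k : Type u} [CommRing k] {C : DGCoalgebra k}

section extension

variable {B Y : DGComodule C}

/-- The commutator `d φ - φ d`. -/
noncomputable def commD {M N : DGModule k} (φ : M →ₗ[k] N) : M →ₗ[k] N := N.d ∘ₗ φ - φ ∘ₗ M.d

theorem commD_apply {M N : DGModule k} (φ : M →ₗ[k] N) (x : M) :
    commD φ x = N.d (φ x) - φ (M.d x) := rfl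

theorem commD_add {M N : DGModule k} (φ ψ : M →ₗ[k] N) : commD (φ + ψ) = commD φ + commD ψ := by
  refine LinearMap.ext fun x => ?_
  simp only [commD_apply, LinearMap.add_apply, map_add]
  abel

theorem d_commD {M N : DGModule k} (φ : M →ₗ[k] N) (x : M) :
    N.d (commD φ x) = - commD φ (M.d x) := by
  rw [commD_apply, commD_apply, map_sub, d_d_apply, d_d_apply, map_zero]
  abel

theorem scale_comm_of_graded {M N : DGModule k} (φ : M →ₗ[k] N)
    (hφ : ∀ n, ∀ x ∈ M.gr n, φ x ∈ N.gr n) (a : ℕ → k) (x : M) :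
    φ (M.scale a x) = N.scale a (φ x) := by
  have : φ ∘ₗ M.scale a = N.scale a ∘ₗ φ := by
    refine M.lin_ext fun n x hx => ?_
    simp [M.scale_of_mem a hx, N.scale_of_mem a (hφ n x hx)]
  exact LinearMap.congr_fun this x

theorem tensor_d_map {M N : DGModule k} (P : DGModule k) (φ : M →ₗ[k] N)
    (hφ : ∀ n, ∀ x ∈ M.gr n, φ x ∈ N.gr n) (t : M ⊗[k] P) :
    (tensor N P).d (TensorProduct.map φ LinearMap.id t) =
      TensorProduct.map φ LinearMap.id ((tensor M P).d t) +
        TensorProduct.map (commD φ) LinearMap.id t := by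
  induction t using TensorProduct.induction_on with
  | zero => simp
  | add a b ha hb => simp only [map_add, ha, hb]; abel
  | tmul x c =>
    rw [TensorProduct.map_tmul, LinearMap.id_apply, tensor_d_tmul, tensor_d_tmul, map_add,
      TensorProduct.map_tmul, TensorProduct.map_tmul, TensorProduct.map_tmul, commD_apply,
      TensorProduct.sub_tmul]
    have : φ (M.sgn x) = N.sgn (φ x) := scale_comm_of_graded φ hφ _ x
    rw [this]
    simp only [LinearMap.id_apply]
    abel

/-- Linear maps that commute with the coactions. -/
def IsColinear (φ : B.toDGModule →ₗ[k] Y.toDGModule) : Prop :=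
  ∀ b, Y.coact.toLin (φ b) = TensorProduct.map φ LinearMap.id (B.coact.toLin b)

theorem IsColinear.commD {φ : B.toDGModule →ₗ[k] Y.toDGModule} (h : IsColinear φ)
    (hφ : ∀ n, ∀ x ∈ B.gr n, φ x ∈ Y.gr n) : IsColinear (commD φ) := by
  intro b
  rw [commD_apply, map_sub, Y.coact.map_d_apply, h, h, B.coact.map_d_apply,
    tensor_d_map _ φ hφ, add_sub_cancel_left]

theorem IsColinear.add {φ ψ : B.toDGModule →ₗ[k] Y.toDGModule} (h : IsColinear φ)
    (h' : IsColinear ψ) : IsColinear (φ + ψ) := by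
  intro b
  rw [LinearMap.add_apply, map_add, h, h', TensorProduct.map_add_left, LinearMap.add_apply]

variable (e : Y.toDGModule ⊗[k] C.toDGModule →ₗ[k] Y.toDGModule)

/-- The colinear map associated with a linear map and a retraction of the coaction. -/
noncomputable def colinearize (φ : B.toDGModule →ₗ[k] Y.toDGModule) :
    B.toDGModule →ₗ[k] Y.toDGModule :=
  e ∘ₗ TensorProduct.map φ LinearMap.id ∘ₗ B.coact.toLin

theorem colinearize_apply (φ : B.toDGModule →ₗ[k] Y.toDGModule) (b : B.toDGModule) :
    colinearize e φ b = e (TensorProduct.map φ LinearMap.id (B.coact.toLin b)) := rfl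

theorem colinearize_isColinear (hcol : ∀ t, Y.coact.toLin (e t) =
      TensorProduct.map e LinearMap.id ((C.idComul Y.toDGModule).toLin t))
    (φ : B.toDGModule →ₗ[k] Y.toDGModule) : IsColinear (colinearize e φ) := by
  intro b
  rw [colinearize_apply, hcol, idComul_map_apply, ← coact_coact, ← LinearMap.comp_apply,
    ← LinearMap.comp_apply, ← TensorProduct.map_comp, ← TensorProduct.map_comp]
  rfl

theorem colinearize_mem (he : ∀ n, ∀ t ∈ (tensor Y.toDGModule C.toDGModule).gr n, e t ∈ Y.gr n)
    {φ : B.toDGModule →ₗ[k] Y.toDGModule} (hφ : ∀ n, ∀ x ∈ B.gr n, φ x ∈ Y.gr n) (n : ℕ)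
    (b : B.toDGModule) (hb : b ∈ B.gr n) : colinearize e φ b ∈ Y.gr n :=
  he n _ (map_mem_of_tmul (tensor Y.toDGModule C.toDGModule).gr (TensorProduct.map φ LinearMap.id)
    (fun i _ x hx _ hc => tmul_mem rfl (hφ i x hx) hc) n _ (B.coact.map_mem n b hb))

/-- The failure of `colinearize e φ` to be a chain map has two sources: the retraction `e` and `φ`
itself. -/
theorem commD_colinearize {φ : B.toDGModule →ₗ[k] Y.toDGModule}
    (hφ : ∀ n, ∀ x ∈ B.gr n, φ x ∈ Y.gr n) (b : B.toDGModule) :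
    commD (colinearize e φ) b =
      commD (M := tensor Y.toDGModule C.toDGModule) e
          (TensorProduct.map φ LinearMap.id (B.coact.toLin b)) +
        colinearize e (commD φ) b := by
  rw [commD_apply, commD_apply, colinearize_apply, colinearize_apply, colinearize_apply,
    B.coact.map_d_apply, tensor_d_map _ φ hφ, map_add]
  abel

end extension

/-- As `C_1 = 0`, the coaction of `b` has components `x ⊗ c` only with `|c| = 0` or `|x| ≤ n - 2`.
The latter are killed by `φ`, and the counit axiom evaluates the former. Simple connectedness gains
one degree here, which drives the induction in `IsRelInjective.isFibrant`. -/
theorem map_coact_eq_tmul [hC : C.IsSimplyConnected] {B : DGComodule C} {η : C.toDGModule}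
    (hη : ∀ c, C.proj 0 c = Coalgebra.counit (R := k) c • η) {M : Type u} [AddCommGroup M]
    [Module k M] (φ : B.toDGModule →ₗ[k] M) {n : ℕ}
    (hφ : ∀ i, i + 2 ≤ n → ∀ x ∈ B.gr i, φ x = 0) {b : B.toDGModule} (hb : b ∈ B.gr n) :
    TensorProduct.map φ LinearMap.id (B.coact.toLin b) = φ b ⊗ₜ[k] η := by
  have h : ∀ w ∈ (tensor B.toDGModule C.toDGModule).gr n,
      TensorProduct.map φ LinearMap.id w = φ ((C.idCounit B.toDGModule).toLin w) ⊗ₜ[k] η := by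
    intro w hw
    induction hw using Submodule.span_induction with
    | zero => simp
    | add x y _ _ hx hy => simp only [map_add, hx, hy, TensorProduct.add_tmul]
    | smul r x _ hx => simp only [map_smul, hx, TensorProduct.smul_tmul']
    | mem x hx =>
      obtain ⟨i, j, hij, x, hx, c, hc, rfl⟩ := hx
      have e : (C.idCounit B.toDGModule).toLin (x ⊗ₜ[k] c) =
        Coalgebra.counit (R := k) (A := C.toDGModule) c • x := rfl
      rw [e, TensorProduct.map_tmul, LinearMap.id_apply, map_smul, TensorProduct.smul_tmul]
      match j, hc with
      | 0, hc => rw [← hη, C.proj_self hc]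
      | 1, hc =>
        rw [hC.gr_one, Submodule.mem_bot] at hc
        rw [hc, map_zero, zero_smul]
      | j + 2, hc =>
        rw [hφ i (by omega) x hx, TensorProduct.zero_tmul, TensorProduct.zero_tmul]
  rw [h _ (B.coact.map_mem n b hb), counit_coact]

theorem map_coact_congr {B : DGComodule C} {M : Type u} [AddCommGroup M] [Module k M]
    (φ ψ : B.toDGModule →ₗ[k] M) {n : ℕ} (h : ∀ i ≤ n, ∀ x ∈ B.gr i, φ x = ψ x)
    {b : B.toDGModule} (hb : b ∈ B.gr n) :
    TensorProduct.map φ LinearMap.id (B.coact.toLin b) =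
      TensorProduct.map ψ LinearMap.id (B.coact.toLin b) := by
  have hw := B.coact.map_mem n b hb
  generalize B.coact.toLin b = w at hw ⊢
  induction hw using Submodule.span_induction with
  | zero => simp
  | add x y _ _ hx hy => simp only [map_add, hx, hy]
  | smul r x _ hx => simp only [map_smul, hx]
  | mem x hx =>
    obtain ⟨i, j, hij, x, hx, c, hc, rfl⟩ := hx
    rw [TensorProduct.map_tmul, TensorProduct.map_tmul, h i (by omega) x hx]

/-- An injective quasi-isomorphism is the inclusion of a deformation retract of complexes. -/
theorem _root_.DGModule.Hom.IsQuasiIso.exists_deformationRetraction [IsSemisimpleRing k]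
    {A B : DGModule k} {i : DGModule.Hom A B} (hi : i.IsQuasiIso)
    (hinj : Function.Injective i.toLin) :
    ∃ (r : DGModule.Hom B A) (h : B →ₗ[k] B), (∀ n, ∀ x ∈ B.gr n, h x ∈ B.gr (n + 1)) ∧
      (∀ a, r.toLin (i.toLin a) = a) ∧ (∀ a, h (i.toLin a) = 0) ∧
      ∀ b, B.d (h b) + h (B.d b) = b - i.toLin (r.toLin b) := by
  obtain ⟨g, s, t, hs, ht, es, et⟩ := hi.exists_homotopyInverse
  obtain ⟨ρ, hρ, hρi⟩ := i.exists_graded_retraction hinj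
  -- A homotopy inverse `g` only satisfies `g i ≃ 1`. Extending the homotopy `s` along the graded
  -- retraction `ρ` and adding its boundary makes `r i = 1` strictly.
  let r : DGModule.Hom B A :=
    { toLin := g.toLin + A.d ∘ₗ s ∘ₗ ρ + s ∘ₗ ρ ∘ₗ B.d
      map_mem := fun n x hx => by
        refine add_mem (add_mem (g.map_mem n x hx) ?_) ?_
        · exact A.d_mem n _ (hs n _ (hρ n x hx))
        · cases n with
          | zero =>
            change s (ρ (B.d x)) ∈ _
            rw [B.d_zero x hx, map_zero, map_zero]; exact zero_mem _
          | succ n => exact hs n _ (hρ n _ (B.d_mem n x hx))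
      map_d := by
        refine LinearMap.ext fun x => ?_
        change g.toLin (B.d x) + A.d (s (ρ (B.d x))) + s (ρ (B.d (B.d x))) =
          A.d (g.toLin x + A.d (s (ρ x)) + s (ρ (B.d x)))
        rw [map_add, map_add, d_d_apply, d_d_apply, g.map_d_apply]
        simp }
  have hr : ∀ b, r.toLin b = g.toLin b + A.d (s (ρ b)) + s (ρ (B.d b)) := fun _ => rfl
  have hri : ∀ a, r.toLin (i.toLin a) = a := by
    intro a
    rw [hr, ← i.map_d_apply, hρi, hρi, add_assoc, es]
    abel
  -- The homotopy on `B` is corrected accordingly, from `i g` to `i r`.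
  let t' : B →ₗ[k] B := t - i.toLin ∘ₗ s ∘ₗ ρ
  have ht' : ∀ b, t' b = t b - i.toLin (s (ρ b)) := fun _ => rfl
  have et' : ∀ b, B.d (t' b) + t' (B.d b) = b - i.toLin (r.toLin b) := by
    intro b
    rw [ht', ht', map_sub, hr, map_add, map_add, ← i.map_d_apply]
    have := et b
    rw [show b - (i.toLin (g.toLin b) + i.toLin (A.d (s (ρ b))) + i.toLin (s (ρ (B.d b)))) =
      (b - i.toLin (g.toLin b)) - i.toLin (A.d (s (ρ b))) - i.toLin (s (ρ (B.d b))) by abel,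
      ← this]
    abel
  -- Precomposition with the projection `1 - i r` makes the homotopy vanish on the image of `i`; it
  -- stays a homotopy to `1 - i r` because this is idempotent.
  refine ⟨r, t' ∘ₗ (LinearMap.id - i.toLin ∘ₗ r.toLin), fun n x hx => ?_, hri, fun a => ?_,
    fun b => ?_⟩
  · have hx' : x - i.toLin (r.toLin x) ∈ B.gr n :=
      sub_mem hx (i.map_mem n _ (r.map_mem n _ hx))
    exact sub_mem (ht n _ hx') (i.map_mem _ _ (hs n _ (hρ n _ hx')))
  · change t' (i.toLin a - i.toLin (r.toLin (i.toLin a))) = 0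
    rw [hri, sub_self, map_zero]
  · change B.d (t' (b - i.toLin (r.toLin b))) + t' (B.d b - i.toLin (r.toLin (B.d b))) = _
    rw [r.map_d_apply, i.map_d_apply, ← map_sub B.d, et', map_sub, hri, sub_self, map_zero,
      sub_zero]

/-- Start with the colinear map obtained from `f r`. It extends `f` but need not commute with `d`.
Adding the colinear map obtained from `[d, G] h` keeps it colinear and unchanged on `A`, and
improves `[d, G] = 0` by one degree at each step. In a fixed degree the process becomes stationary,
so the limit is an extension of `f` by a map of comodules. -/
theorem IsRelInjective.isFibrant [IsSemisimpleRing k] [C.IsSimplyConnected] {Y : DGComodule C}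
    (hY : Y.IsRelInjective) : Y.IsFibrant := by
  obtain ⟨e, he, hcol, hret⟩ := hY
  obtain ⟨η, hη⟩ := C.exists_unit
  intro A B i hinj hi f
  obtain ⟨r, h, hh, hri, hhi, ehr⟩ :=
    DGModule.Hom.IsQuasiIso.exists_deformationRetraction hi hinj
  obtain ⟨G, hG₀, hG⟩ : ∃ G : ℕ → (B.toDGModule →ₗ[k] Y.toDGModule),
      G 0 = colinearize e (f.toLin ∘ₗ r.toLin) ∧
      ∀ j, G (j + 1) = G j + colinearize e (commD (G j) ∘ₗ h) :=
    ⟨fun j => Nat.rec (colinearize e (f.toLin ∘ₗ r.toLin))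
      (fun _ φ => φ + colinearize e (commD φ ∘ₗ h)) j, rfl, fun _ => rfl⟩
  have commD_h_mem : ∀ {φ : B.toDGModule →ₗ[k] Y.toDGModule},
      (∀ n, ∀ x ∈ B.gr n, φ x ∈ Y.gr n) →
      ∀ n, ∀ x ∈ B.gr n, (commD φ ∘ₗ h) x ∈ Y.gr n := fun {φ} hφ n x hx =>
    sub_mem (Y.d_mem n _ (hφ _ _ (hh n x hx))) (hφ n _ (B.d_mem n _ (hh n x hx)))
  have hmem : ∀ j n, ∀ x ∈ B.gr n, G j x ∈ Y.gr n := by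
    intro j
    induction j with
    | zero =>
      rw [hG₀]
      exact colinearize_mem e he fun n x hx => f.map_mem n _ (r.map_mem n x hx)
    | succ j ih =>
      intro n x hx
      rw [hG]
      exact add_mem (ih n x hx) (colinearize_mem e he (commD_h_mem ih) n x hx)
  have hco : ∀ j, IsColinear (G j) := by
    intro j
    induction j with
    | zero => rw [hG₀]; exact colinearize_isColinear e hcol _
    | succ j ih => rw [hG]; exact ih.add (colinearize_isColinear e hcol _)
  have hi' : ∀ j a, G j (i.toLin a) = f.toLin a := by
    intro j
    have aux : ∀ (φ : B.toDGModule →ₗ[k] Y.toDGModule) a, colinearize e φ (i.toLin a) =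
        e (TensorProduct.map (φ ∘ₗ i.toLin) LinearMap.id (A.coact.toLin a)) := by
      intro φ a
      rw [colinearize_apply, i.coact_apply]
      exact congrArg e (LinearMap.congr_fun
        (TensorProduct.map_comp φ LinearMap.id i.toLin LinearMap.id) _).symm
    induction j with
    | zero =>
      intro a
      rw [hG₀, aux]
      have : (f.toLin ∘ₗ r.toLin) ∘ₗ i.toLin = f.toLin :=
        LinearMap.ext fun a => congrArg f.toLin (hri a)
      rw [this, ← f.coact_apply, hret]
    | succ j ih =>
      intro a
      rw [hG, LinearMap.add_apply, ih, aux]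
      have : (commD (G j) ∘ₗ h) ∘ₗ i.toLin = 0 := LinearMap.ext fun a => by
        change commD (G j) (h (i.toLin a)) = 0
        rw [hhi, map_zero]
      rw [this, TensorProduct.map_zero_left, LinearMap.zero_apply, map_zero, add_zero]
  -- One correction cancels the old error `[d, G_j]`: the commutator of `[d, G_j] h` is `-[d, G_j]`,
  -- because `[d, G_j]` vanishes on `i r`. What is left is caused only by the failure of `e` to be a
  -- chain map.
  have hcomm : ∀ j b, commD (G (j + 1)) b = commD (M := tensor Y.toDGModule C.toDGModule) e
      (TensorProduct.map (commD (G j) ∘ₗ h) LinearMap.id (B.coact.toLin b)) := by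
    intro j b
    have e₁ : commD (commD (G j) ∘ₗ h) = - commD (G j) := by
      refine LinearMap.ext fun b => ?_
      rw [commD_apply, LinearMap.comp_apply, LinearMap.comp_apply, d_commD, LinearMap.neg_apply,
        ← neg_add', ← map_add, ehr, map_sub, commD_apply _ (i.toLin _), hi', ← i.map_d_apply, hi',
        f.map_d_apply, sub_self, sub_zero]
    have e₂ : colinearize e (- commD (G j)) b = - commD (G j) b := by
      have : colinearize e (- commD (G j)) b = - colinearize e (commD (G j)) b := by
        rw [colinearize_apply, colinearize_apply, ← map_neg]
        exact congrArg e (LinearMap.congr_fun (LinearMap.rTensor_neg _) _)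
      rw [this, colinearize_apply, ← (hco j).commD (hmem j) b, hret]
    rw [hG, commD_add, LinearMap.add_apply, commD_colinearize e (commD_h_mem (hmem j)), e₁, e₂]
    abel
  -- By induction the argument of `[d, e]` reduces to `y ⊗ η` with `y = [d, G_j] (h b)`, and this is
  -- the coaction of `y`. There `[d, e]` vanishes, since `e` retracts the coaction and the coaction
  -- is a chain map.
  have hkill : ∀ j n, n ≤ j → ∀ b ∈ B.gr n, commD (G j) b = 0 := by
    intro j
    induction j with
    | zero =>
      intro n hn b hb
      obtain rfl : n = 0 := by omega
      rw [commD_apply, Y.d_zero _ (hmem 0 0 b hb), B.d_zero b hb, map_zero, sub_zero]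
    | succ j ih =>
      intro n hn b hb
      have e₁ : TensorProduct.map (commD (G j) ∘ₗ h) LinearMap.id (B.coact.toLin b) =
          (commD (G j) ∘ₗ h) b ⊗ₜ[k] η :=
        map_coact_eq_tmul hη _ (fun i hi x hx => ih (i + 1) (by omega) (h x) (hh i x hx)) hb
      have e₂ : Y.coact.toLin (commD (G j) (h b)) = commD (G j) (h b) ⊗ₜ[k] η := by
        rw [(hco j).commD (hmem j)]
        exact map_coact_eq_tmul hη _ (fun i hi x hx => ih i (by omega) x hx) (hh n b hb)
      rw [hcomm, e₁, LinearMap.comp_apply, ← e₂, commD_apply, hret, ← Y.coact.map_d_apply, hret,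
        sub_self]
  -- On degrees at most `n` the correction involves `[d, G_j]` in degrees at most `n + 1`, since `h`
  -- raises degrees by one. It is therefore zero once `j ≥ n + 1`.
  have hstable : ∀ n j, n + 1 ≤ j → ∀ b ∈ B.gr n, G j b = G (n + 1) b := by
    intro n j hj b hb
    induction j, hj using Nat.le_induction with
    | base => rfl
    | succ j hj ih =>
      rw [hG, LinearMap.add_apply, ih, colinearize_apply,
        map_coact_congr (commD (G j) ∘ₗ h) 0 (fun i hi x hx =>
          hkill j (i + 1) (by omega) (h x) (hh i x hx)) hb,
        TensorProduct.map_zero_left, LinearMap.zero_apply, map_zero, add_zero]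
  let g : B.toDGModule →ₗ[k] Y.toDGModule := B.toDGModule.glue fun n => G (n + 1)
  have hg : ∀ n j, n + 1 ≤ j → ∀ b ∈ B.gr n, g b = G j b := fun n j hj b hb =>
    (glue_of_mem _ hb).trans (hstable n j hj b hb).symm
  refine ⟨{ toLin := g, map_mem := fun n b hb => ?_, map_d := ?_, colinear := ?_ }, ?_⟩
  · rw [hg n _ le_rfl b hb]
    exact hmem (n + 1) n b hb
  · refine B.lin_ext fun n b hb => ?_
    rw [LinearMap.comp_apply, LinearMap.comp_apply, hg n (n + 1) le_rfl b hb]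
    have h₀ := hkill (n + 1) n (by omega) b hb
    rw [commD_apply, sub_eq_zero] at h₀
    rw [h₀]
    cases n with
    | zero => rw [B.d_zero b hb, map_zero, map_zero]
    | succ n => exact hg n (n + 1 + 1) (by omega) _ (B.d_mem n b hb)
  · ext1
    refine B.lin_ext fun n b hb => ?_
    change Y.coact.toLin (g b) = TensorProduct.map g LinearMap.id (B.coact.toLin b)
    rw [hg n (n + 1) le_rfl b hb, hco, map_coact_congr g (G (n + 1)) (fun i hi x hx =>
      hg i (n + 1) (by omega) x hx) hb]
  · ext1
    refine A.lin_ext fun n a ha => ?_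
    change g (i.toLin a) = f.toLin a
    rw [hg n (n + 1) le_rfl _ (i.map_mem n a ha), hi']

end DGComodule

/-! ### Fibrant replacements, and coflatness of fibrant comodules. -/

namespace DGComodule

open DGModule

variable {k : Type u} [CommRing k] [IsFiniteProductOfFields k] {C : DGCoalgebra k}

section replacement

variable [C.IsSimplyConnected] (X : DGComodule C)

/-- The total complex of the normalized cobar construction, a fibrant replacement of `X`. -/
noncomputable def fibrantReplacement : DGComodule C := (X.cobar.normalized X.cobar_isConnective).tot

/-- The map to the fibrant replacement. -/
noncomputable def toFibrantReplacement : Hom X X.fibrantReplacement :=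
  (X.cobar.normalized X.cobar_isConnective).totAug (HolimCone.normalCoaug X.cobarCoaugZero)
    (HolimCone.δ_normalCoaug X.cobarCoaug X.cobar_isConnective X.δ_cobarCoaug)

theorem toFibrantReplacement_isQuasiIso : X.toFibrantReplacement.IsQuasiIso :=
  X.cobar_isResolution.totAug_isQuasiIso X.cobar_isConnective _

theorem toFibrantReplacement_injective : Function.Injective X.toFibrantReplacement.toLin := by
  intro x y h
  have h' : (X.cobar.normalized X.cobar_isConnective).incl 0
      ((HolimCone.normalCoaug X.cobarCoaugZero).toLin x) =
      (X.cobar.normalized X.cobar_isConnective).incl 0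
      ((HolimCone.normalCoaug X.cobarCoaugZero).toLin y) := h
  have h₀ := congrArg (fun z : (X.cobar.normalized X.cobar_isConnective).Sum => z 0) h'
  have h₁ := (CochainComodule.incl_same _ _ _).symm.trans
    (h₀.trans (CochainComodule.incl_same _ _ _))
  exact X.coact_injective (congrArg Subtype.val h₁)

theorem fibrantReplacement_isRelInjective : X.fibrantReplacement.IsRelInjective :=
  CosimplicialComodule.tot_normalized_isRelInjective X.cobar_isConnective fun q =>
    cofree_isRelInjective (X.pow q)

theorem fibrantReplacement_isFibrant : X.fibrantReplacement.IsFibrant :=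
  X.fibrantReplacement_isRelInjective.isFibrant

variable {X}

/-- The map to the replacement is an injective quasi-isomorphism, so a fibrant `X` is a retract of
it. -/
theorem IsFibrant.isRelInjective (hX : X.IsFibrant) : X.IsRelInjective := by
  obtain ⟨r, hr⟩ := hX X X.fibrantReplacement X.toFibrantReplacement
    X.toFibrantReplacement_injective X.toFibrantReplacement_isQuasiIso (Hom.id X)
  exact X.fibrantReplacement_isRelInjective.of_retract X.toFibrantReplacement r fun x =>
    DGModule.Hom.congr_toLin (congrArg Hom.toHom hr) x

end replacement

section coflat

variable [C.IsCocommutative] {Y : DGComodule C}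

/-- The projection of `Y ⊗ Z` onto `Y □_C Z` given by a retraction of the coaction of `Y`. -/
noncomputable def cotensorProj (e : Y.toDGModule ⊗[k] C.toDGModule →ₗ[k] Y.toDGModule)
    (Z : DGComodule C) :
    Y.toDGModule ⊗[k] Z.toDGModule →ₗ[k] Y.toDGModule ⊗[k] Z.toDGModule :=
  TensorProduct.map e LinearMap.id ∘ₗ
    (TensorProduct.assoc k Y.toDGModule C.toDGModule Z.toDGModule).symm.toLinearMap ∘ₗ
      TensorProduct.map LinearMap.id Z.leftCoact.toLin

theorem cotensorProj_tmul (e : Y.toDGModule ⊗[k] C.toDGModule →ₗ[k] Y.toDGModule)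
    (Z : DGComodule C) (y : Y.toDGModule) (z : Z.toDGModule) :
    cotensorProj e Z (y ⊗ₜ[k] z) = TensorProduct.map e LinearMap.id
      ((TensorProduct.assoc k Y.toDGModule C.toDGModule Z.toDGModule).symm
        (y ⊗ₜ[k] Z.leftCoact.toLin z)) := rfl

/-- Colinearity of `e` turns the left coaction equation into coassociativity of the left coaction of
`Z`. With `cotensorProj_of_condition`, `cotensorProj e Z` is a projection of `Y ⊗ Z` onto the
cotensor product. -/
theorem cotensorProj_condition {e : Y.toDGModule ⊗[k] C.toDGModule →ₗ[k] Y.toDGModule}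
    (hcol : ∀ t, Y.coact.toLin (e t) =
      TensorProduct.map e LinearMap.id ((C.idComul Y.toDGModule).toLin t))
    (Z : DGComodule C) (w : Y.toDGModule ⊗[k] Z.toDGModule) :
    (coactLeft Y Z).toLin (cotensorProj e Z w) = (coactRight Y Z).toLin (cotensorProj e Z w) := by
  have h₁ : ∀ (y : Y.toDGModule) (v : C.toDGModule ⊗[k] Z.toDGModule),
      (coactLeft Y Z).toLin (TensorProduct.map e LinearMap.id
        ((TensorProduct.assoc k Y.toDGModule C.toDGModule Z.toDGModule).symm (y ⊗ₜ[k] v))) =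
      TensorProduct.map e LinearMap.id
        ((TensorProduct.assoc k Y.toDGModule C.toDGModule (C.toDGModule ⊗[k] Z.toDGModule)).symm
          (y ⊗ₜ[k] TensorProduct.assoc k C.toDGModule C.toDGModule Z.toDGModule
            (TensorProduct.map C.comulHom.toLin LinearMap.id v))) := by
    intro y v
    induction v using TensorProduct.induction_on with
    | zero => simp
    | add a b ha hb => simp only [TensorProduct.tmul_add, map_add, ha, hb]
    | tmul c z =>
      change TensorProduct.assoc k Y.toDGModule C.toDGModule Z.toDGModule
        (Y.coact.toLin (e (y ⊗ₜ[k] c)) ⊗ₜ[k] z) = _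
      rw [hcol]
      change TensorProduct.assoc k Y.toDGModule C.toDGModule Z.toDGModule
        (TensorProduct.map e LinearMap.id
          ((TensorProduct.assoc k Y.toDGModule C.toDGModule C.toDGModule).symm
            (y ⊗ₜ[k] C.comulHom.toLin c)) ⊗ₜ[k] z) =
        TensorProduct.map e LinearMap.id
        ((TensorProduct.assoc k Y.toDGModule C.toDGModule (C.toDGModule ⊗[k] Z.toDGModule)).symm
          (y ⊗ₜ[k] TensorProduct.assoc k C.toDGModule C.toDGModule Z.toDGModule
            (C.comulHom.toLin c ⊗ₜ[k] z)))
      induction C.comulHom.toLin c using TensorProduct.induction_on with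
      | zero => simp
      | add a b ha hb => simp only [TensorProduct.tmul_add, TensorProduct.add_tmul, map_add, ha, hb]
      | tmul a b => rfl
  have h₂ : ∀ (y : Y.toDGModule) (v : C.toDGModule ⊗[k] Z.toDGModule),
      (coactRight Y Z).toLin (TensorProduct.map e LinearMap.id
        ((TensorProduct.assoc k Y.toDGModule C.toDGModule Z.toDGModule).symm (y ⊗ₜ[k] v))) =
      TensorProduct.map e LinearMap.id
        ((TensorProduct.assoc k Y.toDGModule C.toDGModule (C.toDGModule ⊗[k] Z.toDGModule)).symm
          (y ⊗ₜ[k] TensorProduct.map LinearMap.id Z.leftCoact.toLin v)) := by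
    intro y v
    induction v using TensorProduct.induction_on with
    | zero => simp
    | add a b ha hb => simp only [TensorProduct.tmul_add, map_add, ha, hb]
    | tmul c z => rfl
  induction w using TensorProduct.induction_on with
  | zero => simp
  | add a b ha hb => simp only [map_add, ha, hb]
  | tmul y z =>
    rw [cotensorProj_tmul, h₁, h₂]
    exact congrArg (fun v => TensorProduct.map e LinearMap.id
      ((TensorProduct.assoc k Y.toDGModule C.toDGModule (C.toDGModule ⊗[k] Z.toDGModule)).symm
        (y ⊗ₜ[k] v))) (DGModule.Hom.congr_toLin (leftCoact_coassoc Z) z).symm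

theorem cotensorProj_of_condition {e : Y.toDGModule ⊗[k] C.toDGModule →ₗ[k] Y.toDGModule}
    (hret : ∀ y, e (Y.coact.toLin y) = y) {Z : DGComodule C}
    (w : Y.toDGModule ⊗[k] Z.toDGModule)
    (hw : (coactLeft Y Z).toLin w = (coactRight Y Z).toLin w) : cotensorProj e Z w = w := by
  have h : cotensorProj e Z w = TensorProduct.map e LinearMap.id
      ((TensorProduct.assoc k Y.toDGModule C.toDGModule Z.toDGModule).symm
        ((coactLeft Y Z).toLin w)) :=
    congrArg (fun v => TensorProduct.map e LinearMap.id
      ((TensorProduct.assoc k Y.toDGModule C.toDGModule Z.toDGModule).symm v)) hw.symm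
  rw [h]
  change TensorProduct.map e LinearMap.id
      ((TensorProduct.assoc k Y.toDGModule C.toDGModule Z.toDGModule).symm
        (TensorProduct.assoc k Y.toDGModule C.toDGModule Z.toDGModule
          (TensorProduct.map Y.coact.toLin LinearMap.id w))) = w
  rw [LinearEquiv.symm_apply_apply]
  refine (LinearMap.congr_fun (TensorProduct.map_comp e LinearMap.id Y.coact.toLin
    LinearMap.id) w).symm.trans ?_
  rw [show e ∘ₗ Y.coact.toLin = LinearMap.id from LinearMap.ext hret]
  exact LinearMap.congr_fun TensorProduct.map_id w

theorem cotensorProj_map (e : Y.toDGModule ⊗[k] C.toDGModule →ₗ[k] Y.toDGModule)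
    {Z Z' : DGComodule C} (g : Hom Z Z') (w : Y.toDGModule ⊗[k] Z.toDGModule) :
    cotensorProj e Z' (TensorProduct.map LinearMap.id g.toLin w) =
      TensorProduct.map LinearMap.id g.toLin (cotensorProj e Z w) := by
  induction w using TensorProduct.induction_on with
  | zero => simp
  | add a b ha hb => simp only [map_add, ha, hb]
  | tmul y z =>
    have h : Z'.leftCoact.toLin (g.toLin z) =
        TensorProduct.map LinearMap.id g.toLin (Z.leftCoact.toLin z) :=
      DGModule.Hom.congr_toLin (leftCoact_naturality g) z
    rw [TensorProduct.map_tmul, LinearMap.id_apply, cotensorProj_tmul, cotensorProj_tmul, h]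
    generalize Z.leftCoact.toLin z = v
    change C.toDGModule ⊗[k] Z.toDGModule at v
    induction v using TensorProduct.induction_on with
    | zero => simp
    | add a b ha hb => simp only [TensorProduct.tmul_add, map_add, ha, hb]
    | tmul a b => rfl

/-- Left exactness is automatic. For surjectivity, lift along `Y ⊗ Z ⟶ Y ⊗ Z''` and project the lift
to the cotensor product; the projection is natural in `Z` and fixes the given element. It need not
respect differentials, as exactness concerns only the underlying modules. -/
theorem IsRelInjective.isCoflat (hY : Y.IsRelInjective) : Y.IsCoflat := by
  obtain ⟨e, -, hcol, hret⟩ := hY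
  intro Z' Z Z'' f g hf hfg hg
  refine ⟨cotensorMap_injective _ _ Function.injective_id hf, cotensorMap_right_exact f g hf hfg,
    fun v => ?_⟩
  obtain ⟨w, hw⟩ := LinearMap.lTensor_surjective Y.toDGModule hg v.1
  refine ⟨⟨cotensorProj e Z w, (mem_cotensor_iff _).2 (cotensorProj_condition hcol Z w)⟩,
    Subtype.ext ?_⟩
  refine (cotensorProj_map e g w).symm.trans ((congrArg _ hw).trans ?_)
  exact cotensorProj_of_condition hret v.1 (cotensor_condition v)

theorem isCoflat_of_isFibrant_or_isCoflat [C.IsSimplyConnected]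
    (hY : Y.IsFibrant ∨ Y.IsCoflat) : Y.IsCoflat :=
  hY.elim (fun h => h.isRelInjective.isCoflat) id

end coflat

/-! ### Homotopy invariance of the cotensor product. -/

section invariance

variable [C.IsCocommutative] [C.IsSimplyConnected] {X X' Y Y' : DGComodule C}

theorem powMap_isQuasiIso {i : Hom X X'} (hi : i.IsQuasiIso) (n : ℕ) :
    (powMap i n).IsQuasiIso := by
  induction n with
  | zero => exact hi
  | succ n ih =>
    exact ih.tensor (DGModule.Hom.isQuasiIso_of_bijective _ Function.bijective_id)

variable (X Y) in
/-- The coaugmentation `X □_C Y ⟶ Ω^n(X, C, Y)`. -/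
noncomputable def cobarCotensorCoaug (n : ℕ) : Hom (cotensor X Y) ((X.cobar.cotensor Y).obj n) :=
  cotensorMap (X.cobarCoaug n) (Hom.id Y)

theorem δ_cobarCotensorCoaug {n : ℕ} (i : Fin (n + 2)) (z : (cotensor X Y).toDGModule) :
    ((X.cobar.cotensor Y).δ i).toLin ((cobarCotensorCoaug X Y n).toLin z) =
      (cobarCotensorCoaug X Y (n + 1)).toLin z := by
  have h : (X.cobar.δ i).comp (X.cobarCoaug n) = X.cobarCoaug (n + 1) :=
    Hom.ext (LinearMap.ext fun z => X.δ_cobarCoaug i z)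
  refine (DGModule.Hom.congr_toLin (congrArg Hom.toHom (cotensorMap_comp (X.cobarCoaug n)
    (X.cobar.δ i) (Hom.id Y) (Hom.id Y))) z).trans ?_
  rw [h]
  rfl

theorem σ_cobarCotensorCoaug {n : ℕ} (i : Fin (n + 1)) (z : (cotensor X Y).toDGModule) :
    ((X.cobar.cotensor Y).σ i).toLin ((cobarCotensorCoaug X Y (n + 1)).toLin z) =
      (cobarCotensorCoaug X Y n).toLin z := by
  have h : (X.cobar.σ i).comp (X.cobarCoaug (n + 1)) = X.cobarCoaug n :=
    Hom.ext (LinearMap.ext fun z => X.σ_cobarCoaug i z)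
  refine (DGModule.Hom.congr_toLin (congrArg Hom.toHom (cotensorMap_comp (X.cobarCoaug (n + 1))
    (X.cobar.σ i) (Hom.id Y) (Hom.id Y))) z).trans ?_
  rw [h]
  rfl

variable (X Y) in
/-- The coaugmentation of the total complex of `Ω^•(X, C, Y)`. -/
noncomputable def cobarTotAug : Hom (cotensor X Y)
    ((X.cobar.cotensor Y).normalized (X.cobar_cotensor_isConnective Y)).tot :=
  ((X.cobar.cotensor Y).normalized (X.cobar_cotensor_isConnective Y)).totAug
    (HolimCone.normalCoaug (cobarCotensorCoaug X Y 0))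
    (HolimCone.δ_normalCoaug (cobarCotensorCoaug X Y) (X.cobar_cotensor_isConnective Y)
      δ_cobarCotensorCoaug)

/-- The only use of coflatness in the comparison: it keeps the cobar resolution exact after `- □_C
Y`. -/
theorem cobarTotAug_isQuasiIso (hY : Y.IsCoflat) : (cobarTotAug X Y).IsQuasiIso :=
  (X.cobar_isResolution.cotensor hY X.cobar_isConnective).totAug_isQuasiIso
    (X.cobar_cotensor_isConnective Y) _

theorem cobarCoaugZero_naturality (i : Hom X X') :
    ((cobarMap i).app 0).comp X.cobarCoaugZero = X'.cobarCoaugZero.comp i :=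
  Hom.ext_toHom i.colinear.symm

/-- Cotensor products of coflat comodules with arbitrary comodules are homotopy invariant. -/
theorem cotensorMap_isQuasiIso (hY : Y.IsCoflat) (hY' : Y'.IsCoflat) {i : Hom X X'} {j : Hom Y Y'}
    (hi : i.IsQuasiIso) (hj : j.IsQuasiIso) : (cotensorMap i j).IsQuasiIso := by
  -- The cotensor products are replaced by the total complexes of `Ω^•(X, C, Y)` and `Ω^•(X', C,
  -- Y')`, whose levels are cotensor products with cofree comodules and hence homotopy invariant.
  let F := CosimplicialComodule.normalizedMap
    (CosimplicialComodule.cotensorHom (cobarMap i) j)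
    (X.cobar_cotensor_isConnective Y) (X'.cobar_cotensor_isConnective Y')
  have hF : (CochainComodule.totMap F).IsQuasiIso :=
    CosimplicialComodule.totMap_normalizedMap_isQuasiIso _ _ _ fun q =>
      cotensorMap_cofree_isQuasiIso (powMap_isQuasiIso hi q) hj
  have hcomm : (cobarTotAug X' Y').comp (cotensorMap i j) =
      (CochainComodule.totMap F).comp (cobarTotAug X Y) := by
    ext1
    refine LinearMap.ext fun z => ?_
    refine Eq.trans ?_ (CochainComodule.totMapLin_incl (fun q => (F.app q).toLin) 0
      ((HolimCone.normalCoaug (cobarCotensorCoaug X Y 0)).toLin z)).symm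
    refine congrArg (((X'.cobar.cotensor Y').normalized
      (X'.cobar_cotensor_isConnective Y')).incl 0) (Subtype.ext ?_)
    have h := (cotensorMap_comp i (X'.cobarCoaug 0) j (Hom.id Y')).trans
      ((congrArg (fun f => cotensorMap f j) (cobarCoaugZero_naturality i)).symm.trans
        (cotensorMap_comp (X.cobarCoaug 0) ((cobarMap i).app 0) (Hom.id Y) j).symm)
    exact DGModule.Hom.congr_toLin (congrArg Hom.toHom h) z
  refine DGModule.Hom.IsQuasiIso.of_comp_left (g := (cobarTotAug X' Y').toHom)
    (cobarTotAug_isQuasiIso hY') ?_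
  exact (congrArg Hom.IsQuasiIso hcomm).mpr
    (DGModule.Hom.IsQuasiIso.comp hF (cobarTotAug_isQuasiIso hY))

end invariance

end DGComodule

/-! ### The comparison map: naturality and quasi-isomorphism. -/

namespace HolimCone

open DGModule DGComodule

variable {k : Type u} [CommRing k] [IsFiniteProductOfFields k] {C : DGCoalgebra k}
  [C.IsCocommutative]

section naturality

variable {Φ Ψ : CosimplicialComodule C} {Y Y' : DGComodule C}

theorem θ_comparison (T : HolimCone Φ) {S : HolimCone (Φ.cotensor Y)} (hS : S.IsHolim) (n : ℕ)
    (κ : weight k n) (z : (DGComodule.cotensor T.pt Y).toDGModule) :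
    (S.θ n).toLin (κ ⊗ₜ[k] (T.comparison hS).toLin z) =
      (tensorCotensorMap (T.θ n) Y).toLin (κ ⊗ₜ[k] z) :=
  hS.θ_lift (T.cotensor Y) n κ z

theorem tensorCotensorMap_tmul_val {K : DGModule k} {T Z : DGComodule C}
    (θ : DGComodule.Hom (tensorLeft K T) Z) (Y : DGComodule C) (κ : K)
    (z : (DGComodule.cotensor T Y).toDGModule) :
    ((tensorCotensorMap θ Y).toLin (κ ⊗ₜ[k] z)).1 =
      TensorProduct.map (θ.toLin ∘ₗ TensorProduct.mk k K T.toDGModule κ) LinearMap.id z.1 := by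
  change TensorProduct.map θ.toLin LinearMap.id
    ((assocInvHom K T.toDGModule Y.toDGModule).toLin (κ ⊗ₜ[k] z.1)) = _
  generalize z.1 = w
  induction w using TensorProduct.induction_on with
  | zero => simp
  | add a b ha hb => simp only [TensorProduct.tmul_add, map_add, ha, hb]
  | tmul t y => rfl

/-- Maps into a homotopy limit are determined by their families, and both composites induce the same
family on pure tensors. -/
theorem comparison_naturality (T : HolimCone Φ) {T' : HolimCone Ψ} (hT' : T'.IsHolim)
    {S : HolimCone (Φ.cotensor Y)} (hS : S.IsHolim) {S' : HolimCone (Ψ.cotensor Y')}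
    (hS' : S'.IsHolim) (f : CosimplicialComodule.Hom Φ Ψ) (g : DGComodule.Hom Y Y') :
    (T'.comparison hS').comp (cotensorMap (T.holimMap hT' f) g) =
      (S.holimMap hS' (CosimplicialComodule.cotensorHom f g)).comp (T.comparison hS) := by
  refine hS'.hom_ext fun n κ z => ?_
  refine (T'.θ_comparison hS' n κ _).trans (Eq.trans ?_ (hS'.θ_lift
    (S.postcomp (CosimplicialComodule.cotensorHom f g)) n κ ((T.comparison hS).toLin z)).symm)
  refine Eq.trans ?_ (congrArg (cotensorMap (f.app n) g).toLin (T.θ_comparison hS n κ z)).symm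
  refine Subtype.ext ((tensorCotensorMap_tmul_val _ _ _ _).trans (Eq.trans ?_
    (congrArg (TensorProduct.map (f.app n).toLin g.toLin)
      (tensorCotensorMap_tmul_val (T.θ n) Y κ z)).symm))
  refine (LinearMap.congr_fun (TensorProduct.map_comp _ _ (T.holimMap hT' f).toLin g.toLin)
    z.1).symm.trans (Eq.trans ?_ (LinearMap.congr_fun
      (TensorProduct.map_comp (f.app n).toLin g.toLin _ _) z.1))
  congr 2
  exact LinearMap.ext fun t => hT'.θ_lift (T.postcomp f) n κ t

end naturality

variable [C.IsSimplyConnected] {X Y : DGComodule C}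

/-- The map `X □_C Y ⟶ Ω(X, C, Y)` induced by the coaugmentation. -/
theorem exists_coaug {S : HolimCone (X.cobar.cotensor Y)} (hS : S.IsHolim) (hY : Y.IsCoflat) :
    ∃ q : DGComodule.Hom (DGComodule.cotensor X Y) S.pt,
      (∀ (n : ℕ) (κ : weight k n) (z : (DGComodule.cotensor X Y).toDGModule),
        (S.θ n).toLin (κ ⊗ₜ[k] q.toLin z) = weightAug k n κ •
          (cotensorMap (X.cobarCoaug n) (DGComodule.Hom.id Y)).toLin z) ∧ q.IsQuasiIso := by
  let K : HolimCone (X.cobar.cotensor Y) :=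
    coaugCone (cobarCotensorCoaug X Y) δ_cobarCotensorCoaug σ_cobarCotensorCoaug
  have hq : ∀ (n : ℕ) (κ : weight k n) (z : (DGComodule.cotensor X Y).toDGModule),
      (S.θ n).toLin (κ ⊗ₜ[k] (hS.lift K).toLin z) =
        weightAug k n κ • (cobarCotensorCoaug X Y n).toLin z := fun n κ z =>
    (hS.θ_lift K n κ z).trans (coaugθ_tmul _ n κ z)
  exact ⟨hS.lift K, hq, hS.isQuasiIso_of_coaug (cobarCotensorCoaug X Y)
    (X.cobar_cotensor_isConnective Y) δ_cobarCotensorCoaug (cobarTotAug_isQuasiIso hY) _ hq⟩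

/-- Precompose with `p □_C Y`, where `p : X ⟶ Ω(X, C, C)` is the coaugmentation. It is a
quasi-isomorphism because `p` is one and `Y` is coflat, and the composite is the coaugmentation of
`Ω(X, C, Y)`, which is a quasi-isomorphism too. -/
theorem comparison_isQuasiIso {T : HolimCone X.cobar} (hT : T.IsHolim)
    {S : HolimCone (X.cobar.cotensor Y)} (hS : S.IsHolim) (hY : Y.IsCoflat) :
    (T.comparison hS).IsQuasiIso := by
  let K : HolimCone X.cobar := coaugCone X.cobarCoaug X.δ_cobarCoaug X.σ_cobarCoaug
  let p : DGComodule.Hom X T.pt := hT.lift K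
  have hp : ∀ n (κ : weight k n) z, (T.θ n).toLin (κ ⊗ₜ[k] p.toLin z) =
      weightAug k n κ • (X.cobarCoaug n).toLin z := fun n κ z =>
    (hT.θ_lift K n κ z).trans (coaugθ_tmul _ n κ z)
  have hK : p.IsQuasiIso :=
    hT.isQuasiIso_of_coaug X.cobarCoaug X.cobar_isConnective X.δ_cobarCoaug
      (X.cobar_isResolution.totAug_isQuasiIso X.cobar_isConnective _) p hp
  have hid : (DGComodule.Hom.id Y).IsQuasiIso :=
    DGModule.Hom.isQuasiIso_of_bijective _ Function.bijective_id
  refine DGModule.Hom.IsQuasiIso.of_comp_right (cotensorMap_isQuasiIso hY hY hK hid) ?_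
  refine hS.isQuasiIso_of_coaug (cobarCotensorCoaug X Y)
    (X.cobar_cotensor_isConnective Y) δ_cobarCotensorCoaug (cobarTotAug_isQuasiIso hY)
    ((T.comparison hS).comp (cotensorMap p (DGComodule.Hom.id Y))) fun n κ z => ?_
  refine (T.θ_comparison hS n κ _).trans (Subtype.ext ?_)
  refine (tensorCotensorMap_tmul_val _ _ _ _).trans ?_
  refine (LinearMap.congr_fun (TensorProduct.map_comp _ _ p.toLin LinearMap.id)
    z.1).symm.trans ?_
  have h : ((T.θ n).toLin ∘ₗ TensorProduct.mk k (weight k n) T.pt.toDGModule κ) ∘ₗ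
      p.toLin = weightAug k n κ • (X.cobarCoaug n).toLin :=
    LinearMap.ext fun z => hp n κ z
  refine (congrArg (fun φ => TensorProduct.map φ LinearMap.id z.1) h).trans ?_
  exact LinearMap.congr_fun (TensorProduct.map_smul_left _ _ _) z.1

end HolimCone

theorem theorem4 {k : Type u} [CommRing k] [IsFiniteProductOfFields k] (C : DGCoalgebra k)
    [C.IsCocommutative] [C.IsSimplyConnected] :
    -- the homotopy limits `Ω(X, C, C)` and `Ω(X, C, Y)` exist
    (∀ X : DGComodule C, ∃ T : HolimCone X.cobar, T.IsHolim) ∧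
    (∀ X Y : DGComodule C, ∃ S : HolimCone (X.cobar.cotensor Y), S.IsHolim) ∧
    -- the canonical map `Ω(X, C, C) □_C Y ⟶ Ω(X, C, Y)` is a quasi-isomorphism
    (∀ X Y : DGComodule C, Y.IsFibrant ∨ Y.IsCoflat →
      ∀ (T : HolimCone X.cobar) (_ : T.IsHolim)
        (S : HolimCone (X.cobar.cotensor Y)) (hS : S.IsHolim),
        (T.comparison hS).IsQuasiIso) ∧
    -- and it is natural in `X` and `Y`
    (∀ (X X' Y Y' : DGComodule C) (f : DGComodule.Hom X X') (g : DGComodule.Hom Y Y')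
      (T : HolimCone X.cobar) (_ : T.IsHolim) (T' : HolimCone X'.cobar) (hT' : T'.IsHolim)
      (S : HolimCone (X.cobar.cotensor Y)) (hS : S.IsHolim)
      (S' : HolimCone (X'.cobar.cotensor Y')) (hS' : S'.IsHolim),
      (T'.comparison hS').comp
          (DGComodule.cotensorMap (T.holimMap hT' (DGComodule.cobarMap f)) g) =
        (S.holimMap hS' (CosimplicialComodule.cotensorHom (DGComodule.cobarMap f) g)).comp
          (T.comparison hS)) ∧
    -- fibrant replacements exist, and the derived cotensor product, i.e. the cotensor product
    -- of fibrant replacements, is computed by `Ω(X, C, Y)`: both maps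
    -- `X' □_C Y' ⟵ X □_C Y ⟶ Ω(X, C, Y)` are quasi-isomorphisms
    (∀ X : DGComodule C, ∃ (X' : DGComodule C) (i : DGComodule.Hom X X'),
      X'.IsFibrant ∧ i.IsQuasiIso) ∧
    (∀ X Y : DGComodule C, Y.IsFibrant ∨ Y.IsCoflat →
      (∀ (X' Y' : DGComodule C) (i : DGComodule.Hom X X') (j : DGComodule.Hom Y Y'),
        X'.IsFibrant → Y'.IsFibrant → i.IsQuasiIso → j.IsQuasiIso →
          (DGComodule.cotensorMap i j).IsQuasiIso) ∧
      ∀ (S : HolimCone (X.cobar.cotensor Y)) (_ : S.IsHolim),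
        ∃ q : DGComodule.Hom (DGComodule.cotensor X Y) S.pt,
          (∀ (n : ℕ) (κ : DGModule.weight k n) (z : (DGComodule.cotensor X Y).toDGModule),
            (S.θ n).toLin (κ ⊗ₜ[k] q.toLin z) =
              DGModule.weightAug k n κ •
                (DGComodule.cotensorMap (X.cobarCoaug n) (DGComodule.Hom.id Y)).toLin z) ∧
          q.IsQuasiIso) := by
  -- Both hypotheses on `Y` are reduced to coflatness.
  have hcoflat : ∀ Y : DGComodule C, Y.IsFibrant ∨ Y.IsCoflat → Y.IsCoflat :=
    fun _ => DGComodule.isCoflat_of_isFibrant_or_isCoflat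
  refine ⟨fun X => ⟨_, X.cobar.holimCone_isHolim⟩,
    fun X Y => ⟨_, (X.cobar.cotensor Y).holimCone_isHolim⟩,
    fun X Y hY T hT S hS => HolimCone.comparison_isQuasiIso hT hS (hcoflat Y hY),
    fun X X' Y Y' f g T _ T' hT' S hS S' hS' =>
      T.comparison_naturality hT' hS hS' (DGComodule.cobarMap f) g,
    fun X => ⟨_, X.toFibrantReplacement, X.fibrantReplacement_isFibrant,
      X.toFibrantReplacement_isQuasiIso⟩,
    fun X Y hY => ⟨fun X' Y' i j _ hY' hi hj =>
      DGComodule.cotensorMap_isQuasiIso (hcoflat Y hY) (hcoflat Y' (Or.inl hY')) hi hj,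
      fun S hS => HolimCone.exists_coaug hS (hcoflat Y hY)⟩⟩
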